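/- **Setting.** Let $V\subseteq\mathbb R^3$ be open, let $f=f(x,y,p)$ and $h=h(x,y)$ be smooth on $V$, and let $M\subseteq\mathbb R^5$ be open, with coordinates $(x,y,z,p,q)$, such that $(x,y,p)\in V$ at every point of $M$. Let $\mathcal D_{f,h}$ be the generic rank 2 distribution on $M$ spanned by $\partial_q$ and $\partial_x+p\,\partial_y+q\,\partial_p+F\,\partial_z$ with $F=q^2+f(x,y,p)+h(x,y)z$. Put $g_{\mathcal D_{f,h}}=2\theta^1\theta^5-2\theta^2\theta^4+(\theta^3)^2$ with $$\theta^1=dy-p\,dx,\quad \theta^2=dz-(q^2+f+hz)dx-\tfrac{\sqrt2}{2}q\,\theta^3,\quad \theta^3=2\sqrt2(dp-q\,dx),\quad \theta^4=3\,dx,$$ $$\theta^5=\tfrac{\sqrt2 h}{2}\theta^3-6\,dq+3(2hq+f_p)dx+\tfrac1{10}\big(9f_{pp}+4h^2-6(ph_y+h_x)\big)\theta^1 .$$ The conformal class $[g_{\mathcal D}]$ of a generic rank 2 distribution $\mathcal D$ is the class of $2\tau^1\tau^5-2\tau^2\tau^4+\tfrac43(\tau^3)^2$, where $(\tau^i)$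 is a coframe with $\mathcal D=\ker\tau^1\cap\ker\tau^2\cap\ker\tau^3$ for which there are 1-forms $\Omega_1,\dots,\Omega_7$ satisfying Cartan's structure equations $$\begin{aligned}d\tau^1&=\tau^1\wedge(2\Omega_1+\Omega_4)+\tau^2\wedge\Omega_2+\tau^3\wedge\tau^4,\\ d\tau^2&=\tau^1\wedge\Omega_3+\tau^2\wedge(\Omega_1+2\Omega_4)+\tau^3\wedge\tau^5,\\ d\tau^3&=\tau^1\wedge\Omega_5+\tau^2\wedge\Omega_6+\tau^3\wedge(\Omega_1+\Omega_4)+\tau^4\wedge\tau^5,\\ d\tau^4&=\tau^1\wedge\Omega_7+\tfrac43\tau^3\wedge\Omega_6+\tau^4\wedge\Omega_1+\tau^5\wedge\Omega_2,\\ d\tau^5&=\tau^2\wedge\Omega_7-\tfrac43\tau^3\wedge\Omega_5+\tau^4\wedge\Omega_3+\tau^5\wedge\Omega_4.\end{aligned}$$ For a metric $g_0$ on $M$ and an interval $I\ni0$, a *twice differentiable ambient metric* for $g_0$ on $(0,\infty)\times M\times I$, with coordinates $(t,\cdot,\varrho)$, is a twice differentiable Ricci-flat metric of the form $2\,dt\,d(\varrho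 t)+t^2g(\cdot,\varrho)$, where the $g(\cdot,\varrho)$ are semi-Riemannian metrics on $M$ with $g(\cdot,0)=g_0$. It is called an *ambient metric* if it is smooth and $I=(-\varepsilon,\varepsilon)$ for some $\varepsilon>0$. For functions $A,B,C$ of $(x,y,p,\varrho)$ consider the first order system $$\begin{aligned} B_p&=\tfrac59A-\tfrac29\varrho A_\varrho,\\ B_\varrho&=-\tfrac1{72}A_p-\tfrac1{40}f_{ppp}-\tfrac3{20}h_y,\\ C_\varrho&=\tfrac1{648}A-\tfrac1{72}B_p-\tfrac1{90}f_{pp}+\tfrac2{45}h^2-\tfrac1{15}(ph_y+h_x),\\ C_p&=\tfrac1{324}\varrho A_p+\tfrac23B+\tfrac1{180}\varrho f_{ppp}+\tfrac1{30}\varrho h_y, \end{aligned}\tag{1}$$ the 1-forms $$\begin{gathered}\omega^1=9\sqrt2\,dt+\sqrt2\,t\,h\,\theta^4,\quad \omega^2=\theta^1,\quad \omega^3=-\tfrac19t\,h(\varrho\,dt+t\,d\varrho)-t^2\theta^2+\tfrac12t^2C\,\theta^4,\quad \omega^4=t\,\theta^3,\\ \omega^5=\theta^4,\quad \omega^6=\tfrac12t^2A\,\theta^1+t^2B\,\theta^4+t^2\theta^5,\quad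 \omega^7=\tfrac{\sqrt2}{18}(\varrho\,dt+t\,d\varrho),\end{gathered}$$ and $$\tilde g=2\omega^1\omega^7+2\omega^2\omega^6+2\omega^3\omega^5+(\omega^4)^2,\qquad \Upsilon=2\omega^{123}-\omega^{147}-\omega^{246}-\omega^{345}+\omega^{567},$$ where $\omega^{ijk}=\omega^i\wedge\omega^j\wedge\omega^k$. **Theorem.** The metric $g_{\mathcal D_{f,h}}$ belongs to the conformal class $[g_{\mathcal D_{f,h}}]$ of the distribution $\mathcal D_{f,h}$ on $M$. Moreover: 1. Let $\varepsilon>0$, let $I=(-\varepsilon,\varepsilon)$ or $I=[0,\varepsilon)$, and let $A,B,C$ be twice differentiable solutions of (1) on $V\times I$ that vanish at $\varrho=0$. Then $\tilde g$ is a twice differentiable ambient metric for $g_{\mathcal D_{f,h}}$ on $(0,\infty)\times M\times I$, and an ambient metric if $I=(-\varepsilon,\varepsilon)$ and $A,B,C$ are smooth. The 3-form $\Upsilon$ is parallel for the Levi-Civita connection of $\tilde g$, and the holonomy of $\tilde g$ is contained in the split real form of $\mathbf G_2$: at each point the tangent space can be identified with the imaginary split octonions, so that $v^2=\tilde g(v,v)1$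 and so that each element of the holonomy group is the restriction of an automorphism of the split octonions. 2. Let $f$ be analytic on $V$. Consider the series $$\begin{aligned} A&=\tfrac35\sum_{k\ge1}\tfrac{(2k-1)(2k-3)}{2^{2k}(2k)!}\,\partial_p^{2k+2}f\;\varrho^k,\\ B&=-\tfrac3{20}\varrho h_y-\tfrac1{15}\sum_{k\ge1}\tfrac{(2k-1)(2k-3)(2k-5)}{2^{2k}(2k)!}\,\partial_p^{2k+1}f\;\varrho^k,\\ C&=\tfrac2{45}\varrho h^2-\tfrac1{15}\varrho(ph_y+h_x)+\tfrac2{135}\sum_{k\ge1}\tfrac{(k-3)(2k-1)(2k-3)(2k-5)}{2^{2k}(2k)!}\,\partial_p^{2k}f\;\varrho^k . \end{aligned}$$ (a) Every point of $V$ has an open neighbourhood $V_0\subseteq V$ such that for some $\varepsilon>0$ the series converge on $V_0\times(-\varepsilon,\varepsilon)$ to smooth functions. (b) If, for some $\varepsilon>0$, the series converge on $V\times(-\varepsilon,\varepsilon)$ to smooth functions $A,B,C$, then $A,B,C$ solve (1) and vanish at $\varrho=0$, and $\tilde g$ is the unique ambient metric for $g_{\mathcal D_{f,h}}$ that is analytic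 in $\varrho$: it is an ambient metric on $(0,\infty)\times M\times(-\varepsilon,\varepsilon)$ and analytic in $\varrho$, and every ambient metric for $g_{\mathcal D_{f,h}}$ on some $(0,\infty)\times M\times(-\delta,\delta)$ that is analytic in $\varrho$ coincides with it where both are defined. -/

import Mathlib

open scoped ContDiff

noncomputable section

namespace AmbientG2

/-! ### Tensor calculus in coordinates on a subset `S` of `ℝⁿ`

Derivatives are taken within `S`, so that `S` may contain a part of its boundary. -/

/-- `∂F/∂xⁱ` at `u`, within `S`. -/
def pd {n : ℕ} (S : Set (Fin n → ℝ)) (i : Fin n) (F : (Fin n → ℝ) → ℝ) (u : Fin n → ℝ) : ℝ :=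
  fderivWithin ℝ F S u (Pi.single i 1)

/-- `F` is twice (Fréchet) differentiable on `S`. -/
def TwiceDiffOn {E : Type*} [NormedAddCommGroup E] [NormedSpace ℝ E] (F : E → ℝ) (S : Set E) :
    Prop :=
  DifferentiableOn ℝ F S ∧ DifferentiableOn ℝ (fderivWithin ℝ F S) S

/-- `F` is smooth on `S`. -/
def SmoothOn {E : Type*} [NormedAddCommGroup E] [NormedSpace ℝ E] (F : E → ℝ) (S : Set E) :
    Prop :=
  ContDiffOn ℝ ∞ F S

/-- Christoffel symbols `Γᵏᵢⱼ` of the Levi-Civita connection of the metric `g`. -/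
def christoffel {n : ℕ} (S : Set (Fin n → ℝ)) (g : (Fin n → ℝ) → Matrix (Fin n) (Fin n) ℝ)
    (k i j : Fin n) (u : Fin n → ℝ) : ℝ :=
  (1 / 2) * ∑ l, (g u)⁻¹ k l *
    (pd S i (fun v => g v j l) u + pd S j (fun v => g v i l) u - pd S l (fun v => g v i j) u)

/-- Ricci tensor `Rᵢⱼ` of `g`. -/
def ricci {n : ℕ} (S : Set (Fin n → ℝ)) (g : (Fin n → ℝ) → Matrix (Fin n) (Fin n) ℝ)
    (i j : Fin n) (u : Fin n → ℝ) : ℝ :=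
  ∑ k, (pd S k (christoffel S g k i j) u - pd S j (christoffel S g k i k) u
    + ∑ l, (christoffel S g k k l u * christoffel S g l i j u
      - christoffel S g k j l u * christoffel S g l i k u))

/-- The components `(∇ₗΥ)ᵢⱼₖ` of the covariant derivative of a 3-form. -/
def covDeriv {n : ℕ} (S : Set (Fin n → ℝ)) (g : (Fin n → ℝ) → Matrix (Fin n) (Fin n) ℝ)
    (U : (Fin n → ℝ) → Fin n → Fin n → Fin n → ℝ) (l i j k : Fin n) (u : Fin n → ℝ) : ℝ :=
  pd S l (fun v => U v i j k) u - ∑ m, (christoffel S g m l i u * U u m j k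
    + christoffel S g m l j u * U u i m k + christoffel S g m l k u * U u i j m)

/-- `∇Υ = 0` on `S`. -/
def IsParallelForm {n : ℕ} (S : Set (Fin n → ℝ)) (g : (Fin n → ℝ) → Matrix (Fin n) (Fin n) ℝ)
    (U : (Fin n → ℝ) → Fin n → Fin n → Fin n → ℝ) : Prop :=
  (∀ i j k, DifferentiableOn ℝ (fun v => U v i j k) S) ∧
    ∀ u ∈ S, ∀ l i j k, covDeriv S g U l i j k u = 0

/-- The vector field `W` along the curve `γ : [0,1] → S` is parallel:
`dWᵏ/ds + Γᵏᵢⱼ(γ) (dγⁱ/ds) Wʲ = 0`. -/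
def IsParallelAlong {n : ℕ} (S : Set (Fin n → ℝ))
    (g : (Fin n → ℝ) → Matrix (Fin n) (Fin n) ℝ) (γ W : ℝ → Fin n → ℝ) : Prop :=
  ∀ s ∈ Set.Icc (0 : ℝ) 1, HasDerivWithinAt W
    (fun k => -∑ i, ∑ j, christoffel S g k i j (γ s) *
      derivWithin γ (Set.Icc 0 1) s i * W s j) (Set.Icc 0 1) s

/-- `T` is the parallel transport from `a` to `b` along some piecewise `C¹` curve in `S`. -/
inductive IsTransport {n : ℕ} (S : Set (Fin n → ℝ))
    (g : (Fin n → ℝ) → Matrix (Fin n) (Fin n) ℝ) :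
    (Fin n → ℝ) → (Fin n → ℝ) → ((Fin n → ℝ) →ₗ[ℝ] (Fin n → ℝ)) → Prop
  | segment (γ : ℝ → Fin n → ℝ) (T : (Fin n → ℝ) →ₗ[ℝ] (Fin n → ℝ))
      (hγ : ContDiffOn ℝ 1 γ (Set.Icc 0 1)) (hS : ∀ s ∈ Set.Icc (0 : ℝ) 1, γ s ∈ S)
      (hT : ∀ v, ∃ W, IsParallelAlong S g γ W ∧ W 0 = v ∧ W 1 = T v) :
      IsTransport S g (γ 0) (γ 1) T
  | concat (a b c : Fin n → ℝ) (T T' : (Fin n → ℝ) →ₗ[ℝ] (Fin n → ℝ))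
      (h : IsTransport S g a b T) (h' : IsTransport S g b c T') :
      IsTransport S g a c (T' ∘ₗ T)

/-- The holonomy group of `(S, g)` at `a`: the parallel transports along loops based at `a`. -/
def holonomy {n : ℕ} (S : Set (Fin n → ℝ)) (g : (Fin n → ℝ) → Matrix (Fin n) (Fin n) ℝ)
    (a : Fin n → ℝ) : Set ((Fin n → ℝ) →ₗ[ℝ] (Fin n → ℝ)) :=
  {T | IsTransport S g a a T}

/-! ### Algebra of forms at a point (a covector is its list of components) -/

/-- The matrix of `2αβ = α ⊗ β + β ⊗ α`. -/
def twoSym {n : ℕ} (α β : Fin n → ℝ) : Matrix (Fin n) (Fin n) ℝ :=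
  Matrix.vecMulVec α β + Matrix.vecMulVec β α

/-- The matrix of `α² = α ⊗ α`. -/
def symSq {n : ℕ} (α : Fin n → ℝ) : Matrix (Fin n) (Fin n) ℝ :=
  Matrix.vecMulVec α α

/-- The components of `α ∧ β`. -/
def wedge {n : ℕ} (α β : Fin n → ℝ) : Fin n → Fin n → ℝ :=
  fun i j => α i * β j - α j * β i

/-- The components of `α ∧ β ∧ γ`. -/
def wedge₃ {n : ℕ} (α β γ : Fin n → ℝ) : Fin n → Fin n → Fin n → ℝ :=
  fun i j k => Matrix.det !![α i, α j, α k; β i, β j, β k; γ i, γ j, γ k]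

/-- The components of the exterior derivative of a 1-form. -/
def extD {n : ℕ} (S : Set (Fin n → ℝ)) (α : (Fin n → ℝ) → Fin n → ℝ) (u : Fin n → ℝ) :
    Fin n → Fin n → ℝ :=
  fun i j => pd S i (fun v => α v j) u - pd S j (fun v => α v i) u

/-! ### Split octonions and the split real form of `G₂` -/

/-- The split octonions, as the Cayley-Dickson double of the real `2 × 2` matrices. -/
abbrev SplitOct : Type := Matrix (Fin 2) (Fin 2) ℝ × Matrix (Fin 2) (Fin 2) ℝ

/-- The octonion product `(a, b)(c, d) = (ac + d̄b, da + bc̄)`, the bar being the adjugate. -/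
def omul (u v : SplitOct) : SplitOct :=
  (u.1 * v.1 + v.2.adjugate * u.2, v.2 * u.1 + u.2 * v.1.adjugate)

/-- The unit of the split octonions. -/
def oone : SplitOct := (1, 0)

/-- The imaginary split octonions. -/
def imSplitOct : Submodule ℝ SplitOct where
  carrier := {u | u.1.trace = 0}
  add_mem' := by
    intro u v hu hv
    simp only [Set.mem_ofPred_eq] at *
    simp [hu, hv]
  zero_mem' := by simp
  smul_mem' := by
    intro c u hu
    simp only [Set.mem_ofPred_eq] at *
    simp [hu]

/-- The split real form of the Lie group `G₂`: the automorphisms of the split octonions. -/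
def splitG2 : Subgroup (SplitOct ≃ₗ[ℝ] SplitOct) where
  carrier := {φ | ∀ u v, φ (omul u v) = omul (φ u) (φ v)}
  mul_mem' := by
    intro φ ψ hφ hψ u v
    simp only [Set.mem_ofPred_eq] at hφ hψ
    simp [LinearEquiv.mul_apply, hφ, hψ]
  one_mem' := by
    intro u v
    simp
  inv_mem' := by
    intro φ hφ u v
    simp only [Set.mem_ofPred_eq] at hφ
    apply φ.injective
    have h : ∀ w, φ (φ⁻¹ w) = w := fun w => φ.apply_symm_apply w
    rw [hφ, h, h, h]

/-- The holonomy of `(S, g)` is contained in split `G₂`: at each point `u` the tangent space can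
be identified with the imaginary split octonions, with `v² = g(v, v) 1`, so that each element of
the holonomy group at `u` is the restriction of an automorphism of the split octonions. -/
def HolonomyInSplitG2 (S : Set (Fin 7 → ℝ)) (g : (Fin 7 → ℝ) → Matrix (Fin 7) (Fin 7) ℝ) :
    Prop :=
  ∀ u ∈ S, ∃ L : (Fin 7 → ℝ) →ₗ[ℝ] SplitOct,
    Function.Injective L ∧ LinearMap.range L = imSplitOct ∧
    (∀ v, omul (L v) (L v) = (∑ i, ∑ j, g u i j * v i * v j) • oone) ∧
    ∀ T ∈ holonomy S g u, ∃ φ ∈ splitG2, ∀ v, φ (L v) = L (T v)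

/-! ### Generic rank 2 distributions in dimension 5 and their conformal classes -/

/-- `g₀` is on `M ⊆ ℝ⁵` a metric of the conformal class of the generic rank 2 distribution `D`
(Cartan, Nurowski): up to a positive factor it is `2τ¹τ⁵ - 2τ²τ⁴ + (4/3)(τ³)²`, for a coframe
`τ¹, …, τ⁵` with `D = ker τ¹ ∩ ker τ² ∩ ker τ³` that satisfies, with some 1-forms `Ω₁, …, Ω₇`,
Cartan's structure equations for `dτ¹, …, dτ⁵`. The indices in the code start at `0`. -/
def InConformalClass (M : Set (Fin 5 → ℝ)) (D : (Fin 5 → ℝ) → Submodule ℝ (Fin 5 → ℝ))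
    (g₀ : (Fin 5 → ℝ) → Matrix (Fin 5) (Fin 5) ℝ) : Prop :=
  ∃ (τ : Fin 5 → (Fin 5 → ℝ) → Fin 5 → ℝ) (Ω : Fin 7 → (Fin 5 → ℝ) → Fin 5 → ℝ)
    (φ : (Fin 5 → ℝ) → ℝ),
    (∀ a i, SmoothOn (fun m => τ a m i) M) ∧ (∀ a i, SmoothOn (fun m => Ω a m i) M) ∧
    SmoothOn φ M ∧
    ∀ m ∈ M,
      LinearIndependent ℝ (fun a => τ a m) ∧
      (∀ v, v ∈ D m ↔ τ 0 m ⬝ᵥ v = 0 ∧ τ 1 m ⬝ᵥ v = 0 ∧ τ 2 m ⬝ᵥ v = 0) ∧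
      extD M (τ 0) m = wedge (τ 0 m) ((2 : ℝ) • Ω 0 m + Ω 3 m) + wedge (τ 1 m) (Ω 1 m)
        + wedge (τ 2 m) (τ 3 m) ∧
      extD M (τ 1) m = wedge (τ 0 m) (Ω 2 m) + wedge (τ 1 m) (Ω 0 m + (2 : ℝ) • Ω 3 m)
        + wedge (τ 2 m) (τ 4 m) ∧
      extD M (τ 2) m = wedge (τ 0 m) (Ω 4 m) + wedge (τ 1 m) (Ω 5 m)
        + wedge (τ 2 m) (Ω 0 m + Ω 3 m) + wedge (τ 3 m) (τ 4 m) ∧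
      extD M (τ 3) m = wedge (τ 0 m) (Ω 6 m) + (4 / 3 : ℝ) • wedge (τ 2 m) (Ω 5 m)
        + wedge (τ 3 m) (Ω 0 m) + wedge (τ 4 m) (Ω 1 m) ∧
      extD M (τ 4) m = wedge (τ 1 m) (Ω 6 m) - (4 / 3 : ℝ) • wedge (τ 2 m) (Ω 4 m)
        + wedge (τ 3 m) (Ω 2 m) + wedge (τ 4 m) (Ω 3 m) ∧
      g₀ m = Real.exp (2 * φ m) •
        (twoSym (τ 0 m) (τ 4 m) - twoSym (τ 1 m) (τ 3 m) + (4 / 3 : ℝ) • symSq (τ 2 m))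

/-- The distribution `D_{f,h}` spanned by `∂_q` and `∂_x + p ∂_y + q ∂_p + F ∂_z`, with
`F = q² + f(x,y,p) + h(x,y) z`, on `ℝ⁵` with coordinates `m = (x, y, z, p, q)`. -/
def distr (f : ℝ → ℝ → ℝ → ℝ) (h : ℝ → ℝ → ℝ) (m : Fin 5 → ℝ) : Submodule ℝ (Fin 5 → ℝ) :=
  Submodule.span ℝ {![0, 0, 0, 0, 1],
    ![1, m 3, (m 4) ^ 2 + f (m 0) (m 1) (m 3) + h (m 0) (m 1) * m 2, m 4, 0]}

/-- `h_x`. -/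
def dX (h : ℝ → ℝ → ℝ) (x y : ℝ) : ℝ := deriv (fun s => h s y) x

/-- `h_y`. -/
def dY (h : ℝ → ℝ → ℝ) (x y : ℝ) : ℝ := deriv (fun s => h x s) y

/-- `∂ᵏf/∂pᵏ`. -/
def dP (k : ℕ) (f : ℝ → ℝ → ℝ → ℝ) (x y p : ℝ) : ℝ := iteratedDeriv k (fun s => f x y s) p

/-- `dx, dy, dz, dp, dq` on `ℝ⁵`. -/
def d₅ (i : Fin 5) : Fin 5 → ℝ := Pi.single i 1

/-- `θ¹ = dy - p dx`. -/
def θ₁ (m : Fin 5 → ℝ) : Fin 5 → ℝ := d₅ 1 - m 3 • d₅ 0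

/-- `θ³ = 2√2 (dp - q dx)`. -/
def θ₃ (m : Fin 5 → ℝ) : Fin 5 → ℝ := (2 * √2) • (d₅ 3 - m 4 • d₅ 0)

/-- `θ² = dz - (q² + f + hz) dx - (√2/2) q θ³`. -/
def θ₂ (f : ℝ → ℝ → ℝ → ℝ) (h : ℝ → ℝ → ℝ) (m : Fin 5 → ℝ) : Fin 5 → ℝ :=
  d₅ 2 - ((m 4) ^ 2 + f (m 0) (m 1) (m 3) + h (m 0) (m 1) * m 2) • d₅ 0
    - (√2 / 2 * m 4) • θ₃ m

/-- `θ⁴ = 3 dx`. -/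
def θ₄ : Fin 5 → ℝ := (3 : ℝ) • d₅ 0

/-- `θ⁵ = (√2 h/2) θ³ - 6 dq + 3(2hq + f_p) dx + (1/10)(9 f_pp + 4h² - 6(p h_y + h_x)) θ¹`. -/
def θ₅ (f : ℝ → ℝ → ℝ → ℝ) (h : ℝ → ℝ → ℝ) (m : Fin 5 → ℝ) : Fin 5 → ℝ :=
  (√2 * h (m 0) (m 1) / 2) • θ₃ m - (6 : ℝ) • d₅ 4
    + (3 * (2 * h (m 0) (m 1) * m 4 + dP 1 f (m 0) (m 1) (m 3))) • d₅ 0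
    + ((1 / 10) * (9 * dP 2 f (m 0) (m 1) (m 3) + 4 * h (m 0) (m 1) ^ 2
      - 6 * (m 3 * dY h (m 0) (m 1) + dX h (m 0) (m 1)))) • θ₁ m

/-- The metric `g_{D_{f,h}} = 2θ¹θ⁵ - 2θ²θ⁴ + (θ³)²`. -/
def gD (f : ℝ → ℝ → ℝ → ℝ) (h : ℝ → ℝ → ℝ) (m : Fin 5 → ℝ) : Matrix (Fin 5) (Fin 5) ℝ :=
  twoSym (θ₁ m) (θ₅ f h m) - twoSym (θ₂ f h m) θ₄ + symSq (θ₃ m)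

/-! ### Ambient metrics on the ambient space, with coordinates `u = (t, x, y, z, p, q, ϱ)` -/

/-- The point with coordinates `(t, m, ϱ)`. -/
def pt (t : ℝ) (m : Fin 5 → ℝ) (r : ℝ) : Fin 7 → ℝ := ![t, m 0, m 1, m 2, m 3, m 4, r]

/-- The projection to `ℝ⁵`. -/
def base (u : Fin 7 → ℝ) : Fin 5 → ℝ := ![u 1, u 2, u 3, u 4, u 5]

/-- The ambient space `(0, ∞) × M × I`. -/
def ambientSpace (M : Set (Fin 5 → ℝ)) (I : Set ℝ) : Set (Fin 7 → ℝ) :=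
  {u | 0 < u 0 ∧ base u ∈ M ∧ u 6 ∈ I}

/-- Pull-back of covectors from `ℝ⁵` to the ambient space. -/
def pull (α : Fin 5 → ℝ) : Fin 7 → ℝ := ![0, α 0, α 1, α 2, α 3, α 4, 0]

/-- `dt`. -/
def dt : Fin 7 → ℝ := Pi.single 0 1

/-- `d(ϱt) = ϱ dt + t dϱ`. -/
def dϱt (t r : ℝ) : Fin 7 → ℝ := r • dt + t • Pi.single 6 1

/-- `2 dt d(ϱt) + t² G`. -/
def ambientForm (t r : ℝ) (G : Matrix (Fin 5) (Fin 5) ℝ) : Matrix (Fin 7) (Fin 7) ℝ :=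
  twoSym dt (dϱt t r)
    + t ^ 2 • ∑ i, ∑ j, G i j • Matrix.vecMulVec (pull (d₅ i)) (pull (d₅ j))

/-- `gt` has on `(0, ∞) × M × I` the form `2 dt d(ϱt) + t² g(x,ϱ)`, with a family of
semi-Riemannian metrics `g(x,ϱ)` on `M`, `ϱ ∈ I`, such that `g(x,0) = g₀(x)`. -/
def HasAmbientForm (M : Set (Fin 5 → ℝ)) (I : Set ℝ)
    (g₀ : (Fin 5 → ℝ) → Matrix (Fin 5) (Fin 5) ℝ)
    (gt : (Fin 7 → ℝ) → Matrix (Fin 7) (Fin 7) ℝ) : Prop :=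
  ∃ g : (Fin 5 → ℝ) → ℝ → Matrix (Fin 5) (Fin 5) ℝ,
    (∀ m ∈ M, g m 0 = g₀ m) ∧ (∀ m ∈ M, ∀ r ∈ I, (g m r).IsSymm ∧ (g m r).det ≠ 0) ∧
    ∀ m ∈ M, ∀ r ∈ I, ∀ t : ℝ, 0 < t → gt (pt t m r) = ambientForm t r (g m r)

/-- `gt` is Ricci-flat on `S`. -/
def IsRicciFlat (S : Set (Fin 7 → ℝ)) (gt : (Fin 7 → ℝ) → Matrix (Fin 7) (Fin 7) ℝ) : Prop :=
  ∀ u ∈ S, ∀ i j, ricci S gt i j u = 0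

/-- `gt` is a (smooth) ambient metric for `g₀` on `(0, ∞) × M × (-ε, ε)`. -/
def IsAmbientMetric (M : Set (Fin 5 → ℝ)) (ε : ℝ)
    (g₀ : (Fin 5 → ℝ) → Matrix (Fin 5) (Fin 5) ℝ)
    (gt : (Fin 7 → ℝ) → Matrix (Fin 7) (Fin 7) ℝ) : Prop :=
  HasAmbientForm M (Set.Ioo (-ε) ε) g₀ gt ∧
    (∀ i j, SmoothOn (fun u => gt u i j) (ambientSpace M (Set.Ioo (-ε) ε))) ∧
    IsRicciFlat (ambientSpace M (Set.Ioo (-ε) ε)) gt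

/-- `gt` is a twice differentiable, possibly non-smooth, ambient metric for `g₀` on
`(0, ∞) × M × I`. -/
def IsTwiceDiffAmbientMetric (M : Set (Fin 5 → ℝ)) (I : Set ℝ)
    (g₀ : (Fin 5 → ℝ) → Matrix (Fin 5) (Fin 5) ℝ)
    (gt : (Fin 7 → ℝ) → Matrix (Fin 7) (Fin 7) ℝ) : Prop :=
  HasAmbientForm M I g₀ gt ∧
    (∀ i j, TwiceDiffOn (fun u => gt u i j) (ambientSpace M I)) ∧
    IsRicciFlat (ambientSpace M I) gt

/-- `gt` is analytic in `ϱ ∈ (-ε, ε)`. -/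
def IsAnalyticInRho (M : Set (Fin 5 → ℝ)) (ε : ℝ)
    (gt : (Fin 7 → ℝ) → Matrix (Fin 7) (Fin 7) ℝ) : Prop :=
  ∀ m ∈ M, ∀ t : ℝ, 0 < t → ∀ i j,
    AnalyticOnNhd ℝ (fun r => gt (pt t m r) i j) (Set.Ioo (-ε) ε)

/-! ### The first order system -/

/-- A function of `(x, y, p)` as a function on `ℝ × ℝ × ℝ`. -/
def unc₃ (f : ℝ → ℝ → ℝ → ℝ) : ℝ × ℝ × ℝ → ℝ := fun v => f v.1 v.2.1 v.2.2

/-- A function of `(x, y, p, ϱ)` as a function on `(ℝ × ℝ × ℝ) × ℝ`. -/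
def unc₄ (A : ℝ → ℝ → ℝ → ℝ → ℝ) : (ℝ × ℝ × ℝ) × ℝ → ℝ :=
  fun w => A w.1.1 w.1.2.1 w.1.2.2 w.2

/-- `A_p`. -/
def derP (A : ℝ → ℝ → ℝ → ℝ → ℝ) (x y p r : ℝ) : ℝ := deriv (fun s => A x y s r) p

/-- `A_ϱ`, for `ϱ` in the interval `I` (one-sided at an end point that belongs to `I`). -/
def derRho (I : Set ℝ) (A : ℝ → ℝ → ℝ → ℝ → ℝ) (x y p r : ℝ) : ℝ :=
  derivWithin (fun s => A x y p s) I r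

/-- `A, B, C` satisfy the first order system on `V × I`. -/
def SolvesSystem (V : Set (ℝ × ℝ × ℝ)) (I : Set ℝ) (f : ℝ → ℝ → ℝ → ℝ) (h : ℝ → ℝ → ℝ)
    (A B C : ℝ → ℝ → ℝ → ℝ → ℝ) : Prop :=
  ∀ x y p r : ℝ, (x, y, p) ∈ V → r ∈ I →
    derP B x y p r = 5 / 9 * A x y p r - 2 / 9 * r * derRho I A x y p r ∧
    derRho I B x y p r
      = -(1 / 72) * derP A x y p r - 1 / 40 * dP 3 f x y p - 3 / 20 * dY h x y ∧
    derRho I C x y p r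
      = 1 / 648 * A x y p r - 1 / 72 * derP B x y p r - 1 / 90 * dP 2 f x y p
        + 2 / 45 * h x y ^ 2 - 1 / 15 * (p * dY h x y + dX h x y) ∧
    derP C x y p r
      = 1 / 324 * r * derP A x y p r + 2 / 3 * B x y p r + 1 / 180 * r * dP 3 f x y p
        + 1 / 30 * r * dY h x y

/-- `A, B, C` vanish at `ϱ = 0`. -/
def VanishAtZero (V : Set (ℝ × ℝ × ℝ)) (A B C : ℝ → ℝ → ℝ → ℝ → ℝ) : Prop :=
  ∀ x y p : ℝ, (x, y, p) ∈ V → A x y p 0 = 0 ∧ B x y p 0 = 0 ∧ C x y p 0 = 0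

/-- The number `(2k-1)(2k-3) / (2^{2k} (2k)!)`. -/
def cf (k : ℕ) : ℝ :=
  (2 * (k : ℝ) - 1) * (2 * (k : ℝ) - 3) / (2 ^ (2 * k) * (Nat.factorial (2 * k) : ℝ))

/-- On `V × (-ε, ε)` the functions `A, B, C` are the sums of the convergent series
`A = (3/5) ∑_{k≥1} (2k-1)(2k-3)/(2^{2k}(2k)!) (∂_p^{2k+2} f) ϱᵏ`,
`B = -(3/20) ϱ h_y - (1/15) ∑_{k≥1} (2k-1)(2k-3)(2k-5)/(2^{2k}(2k)!) (∂_p^{2k+1} f) ϱᵏ`,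
`C = (2/45) ϱ h² - (1/15) ϱ (p h_y + h_x)
  + (2/135) ∑_{k≥1} (k-3)(2k-1)(2k-3)(2k-5)/(2^{2k}(2k)!) (∂_p^{2k} f) ϱᵏ`.
The summation index in the code is `k - 1`. -/
def IsSeriesSolution (V : Set (ℝ × ℝ × ℝ)) (ε : ℝ) (f : ℝ → ℝ → ℝ → ℝ) (h : ℝ → ℝ → ℝ)
    (A B C : ℝ → ℝ → ℝ → ℝ → ℝ) : Prop :=
  ∀ x y p r : ℝ, (x, y, p) ∈ V → r ∈ Set.Ioo (-ε) ε →
    ∃ a b c : ℝ,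
      HasSum (fun j : ℕ => cf (j + 1) * dP (2 * (j + 1) + 2) f x y p * r ^ (j + 1)) a ∧
      HasSum (fun j : ℕ => cf (j + 1) * (2 * ((j : ℝ) + 1) - 5)
        * dP (2 * (j + 1) + 1) f x y p * r ^ (j + 1)) b ∧
      HasSum (fun j : ℕ => (((j : ℝ) + 1) - 3) * cf (j + 1) * (2 * ((j : ℝ) + 1) - 5)
        * dP (2 * (j + 1)) f x y p * r ^ (j + 1)) c ∧
      A x y p r = 3 / 5 * a ∧
      B x y p r = -(3 / 20) * r * dY h x y - 1 / 15 * b ∧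
      C x y p r = 2 / 45 * r * h x y ^ 2 - 1 / 15 * r * (p * dY h x y + dX h x y)
        + 2 / 135 * c

/-! ### The null coframe, the metric and the 3-form -/

/-- `A(x, y, p, ϱ)` at the point `u` of the ambient space. -/
def at₄ (A : ℝ → ℝ → ℝ → ℝ → ℝ) (u : Fin 7 → ℝ) : ℝ := A (u 1) (u 2) (u 4) (u 6)

/-- `ω¹ = 9√2 dt + √2 t h θ⁴`. -/
def ω₁ (h : ℝ → ℝ → ℝ) (u : Fin 7 → ℝ) : Fin 7 → ℝ :=
  (9 * √2) • dt + (u 0 * √2 * h (u 1) (u 2)) • pull θ₄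

/-- `ω² = θ¹`. -/
def ω₂ (u : Fin 7 → ℝ) : Fin 7 → ℝ := pull (θ₁ (base u))

/-- `ω³ = -(1/9) t h (ϱ dt + t dϱ) - t² θ² + (1/2) t² C θ⁴`. -/
def ω₃ (f : ℝ → ℝ → ℝ → ℝ) (h : ℝ → ℝ → ℝ) (C : ℝ → ℝ → ℝ → ℝ → ℝ) (u : Fin 7 → ℝ) :
    Fin 7 → ℝ :=
  (-(1 / 9) * u 0 * h (u 1) (u 2)) • dϱt (u 0) (u 6) - (u 0) ^ 2 • pull (θ₂ f h (base u))
    + ((1 / 2) * (u 0) ^ 2 * at₄ C u) • pull θ₄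

/-- `ω⁴ = t θ³`. -/
def ω₄ (u : Fin 7 → ℝ) : Fin 7 → ℝ := u 0 • pull (θ₃ (base u))

/-- `ω⁵ = θ⁴`. -/
def ω₅ : Fin 7 → ℝ := pull θ₄

/-- `ω⁶ = (1/2) t² A θ¹ + t² B θ⁴ + t² θ⁵`. -/
def ω₆ (f : ℝ → ℝ → ℝ → ℝ) (h : ℝ → ℝ → ℝ) (A B : ℝ → ℝ → ℝ → ℝ → ℝ) (u : Fin 7 → ℝ) :
    Fin 7 → ℝ :=
  ((1 / 2) * (u 0) ^ 2 * at₄ A u) • pull (θ₁ (base u)) + ((u 0) ^ 2 * at₄ B u) • pull θ₄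
    + (u 0) ^ 2 • pull (θ₅ f h (base u))

/-- `ω⁷ = (√2/18) (ϱ dt + t dϱ)`. -/
def ω₇ (u : Fin 7 → ℝ) : Fin 7 → ℝ := (√2 / 18) • dϱt (u 0) (u 6)

/-- The metric `2ω¹ω⁷ + 2ω²ω⁶ + 2ω³ω⁵ + (ω⁴)²`. -/
def gTilde (f : ℝ → ℝ → ℝ → ℝ) (h : ℝ → ℝ → ℝ) (A B C : ℝ → ℝ → ℝ → ℝ → ℝ)
    (u : Fin 7 → ℝ) : Matrix (Fin 7) (Fin 7) ℝ :=
  twoSym (ω₁ h u) (ω₇ u) + twoSym (ω₂ u) (ω₆ f h A B u) + twoSym (ω₃ f h C u) ω₅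
    + symSq (ω₄ u)

/-- The 3-form `Υ = 2ω¹²³ - ω¹⁴⁷ - ω²⁴⁶ - ω³⁴⁵ + ω⁵⁶⁷`. -/
def upsilon (f : ℝ → ℝ → ℝ → ℝ) (h : ℝ → ℝ → ℝ) (A B C : ℝ → ℝ → ℝ → ℝ → ℝ)
    (u : Fin 7 → ℝ) : Fin 7 → Fin 7 → Fin 7 → ℝ :=
  (2 : ℝ) • wedge₃ (ω₁ h u) (ω₂ u) (ω₃ f h C u) - wedge₃ (ω₁ h u) (ω₄ u) (ω₇ u)
    - wedge₃ (ω₂ u) (ω₄ u) (ω₆ f h A B u) - wedge₃ (ω₃ f h C u) (ω₄ u) ω₅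
    + wedge₃ ω₅ (ω₆ f h A B u) (ω₇ u)

end AmbientG2

end

open scoped ContDiff
open AmbientG2

/-!
# The ambient metrics of the distributions `D_{f,h}`

**Parallel 3-form, Ricci-flatness, holonomy.** Up to constant factors, the forms `ω¹, …, ω⁷` are a
coframe in which `gTilde` and `upsilon` have constant components, and the common stabilizer of
these components in `𝔤𝔩(7)` is the Lie algebra of split `G₂` (`lieG2`). The first order system is
what makes a torsion-free connection form with values in this Lie algebra exist; it is written
down explicitly (`Jet.conn`, `Jet.torsion`). Being metric and torsion-free, it is the Levi-Civita
connection (`IsConnectionForm.frame_mul_chrM`), so that `upsilon` is parallel. Its curvature takes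
values in `𝔤₂`, and an algebraic curvature tensor with values in `𝔤₂` is Ricci-flat
(`sum_eq_zero_of_mem_lieG2`). Parallel transport preserves the scalar product and the 3-form,
hence the vector product which they determine, and this vector product is that of the imaginary
split octonions (`exists_splitG2`). As `A, B, C` are only twice differentiable, the commutation of
second derivatives is used without their continuity, and everything is done on domains that may
contain boundary points (`RegularDomain`).

**The conformal class.** The explicit coframe `Jet.tau`, which consists of constant multiples of
`θ¹, …, θ⁵`, satisfies Cartan's structure equations with explicit forms `Ω₁, …, Ω₇`
(`Jet.structure_equations`).

**The series.** The coefficients of the series satisfy a two-term recursion (`cf_succ`), by which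
the term-by-term derivatives satisfy the first order system. If `f` is analytic, Cauchy estimates
bound `∂_p^{2k+j} f` and its derivatives by `(2k+j)!` times a power, and the denominators `(2k)!`
make the series converge to smooth functions on a neighbourhood of any given point
(`exists_isSeriesSolution`). If conversely the series are only assumed to converge pointwise to
smooth functions, the term-by-term differentiation in `p` needs an argument: by Baire's theorem
the convergence is dominated near the points of a dense set, and the resulting identity extends by
continuity (`deriv_eq_of_hasSum`).

**Uniqueness.** For a metric `2 dt d(ϱt) + t² g(ϱ)` on a space over `ℝ⁵`, Ricci-flatness amounts
to an equation of the form `ϱ g'' - (3/2) g' = ⋯`, where the right hand side also contains the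
trace of `g'`, which is controlled by the trace of the same equation and by the Ricci component
along `∂_ϱ`. The indicial root `3/2` for `g'` is not an integer, so that two such metrics that
agree at `ϱ = 0` agree there to infinite order (`mem_contactAlg`). For metrics that are analytic
in `ϱ` this means that they coincide (`IsAmbientMetric.eq_of_isAnalyticInRho`). The comparison is
organized by the algebra `contactAlg` of pairs of functions that agree to a given order at
`ϱ = 0`.
-/

set_option linter.unusedSimpArgs false
set_option linter.unusedVariables false


/-! ### Gradients within a set -/

namespace AmbientG2

variable {n : ℕ}

/-- The linear form with the list of components `G`. -/
def covec (G : Fin n → ℝ) : (Fin n → ℝ) →L[ℝ] ℝ :=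
  ∑ i, G i • ContinuousLinearMap.proj (R := ℝ) (φ := fun _ : Fin n => ℝ) i

@[simp] lemma covec_apply (G v : Fin n → ℝ) : covec G v = ∑ i, G i * v i := by
  simp [covec]

/-- `G` lists the partial derivatives, within `S`, of `F` at `u`. -/
def HasGrad (S : Set (Fin n → ℝ)) (F : (Fin n → ℝ) → ℝ) (G : Fin n → ℝ) (u : Fin n → ℝ) : Prop :=
  HasFDerivWithinAt F (covec G) S u

variable {S : Set (Fin n → ℝ)} {F F' : (Fin n → ℝ) → ℝ} {G G' u : Fin n → ℝ}

lemma covec_eq (L : (Fin n → ℝ) →L[ℝ] ℝ) : covec (fun i => L (Pi.single i 1)) = L := by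
  ext v
  conv_rhs => rw [← Finset.univ_sum_single v]
  rw [covec_apply, map_sum]
  refine Finset.sum_congr rfl fun i _ => ?_
  rw [show (Pi.single i (v i) : Fin n → ℝ) = v i • Pi.single i 1 by
    rw [← Pi.single_smul, smul_eq_mul, mul_one], map_smul, smul_eq_mul, mul_comm]

lemma HasGrad.pd_eq (hF : HasGrad S F G u) (hS : UniqueDiffWithinAt ℝ S u) (i : Fin n) :
    pd S i F u = G i := by
  rw [pd, HasFDerivWithinAt.fderivWithin hF hS, covec_apply]
  simp [Pi.single_apply]

lemma HasGrad.differentiableWithinAt (hF : HasGrad S F G u) : DifferentiableWithinAt ℝ F S u :=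
  HasFDerivWithinAt.differentiableWithinAt hF

lemma hasGrad_pd (hF : DifferentiableWithinAt ℝ F S u) :
    HasGrad S F (fun i => pd S i F u) u := by
  have := hF.hasFDerivWithinAt
  rw [← covec_eq (fderivWithin ℝ F S u)] at this
  exact this

lemma HasGrad.congr_grad (hF : HasGrad S F G u) (h : ∀ i, G' i = G i) : HasGrad S F G' u := by
  rwa [show G' = G from funext h]

lemma HasGrad.congr (hF : HasGrad S F G u) (hu : u ∈ S) (h : ∀ v ∈ S, F' v = F v) :
    HasGrad S F' G u :=
  HasFDerivWithinAt.congr hF h (h u hu)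

lemma HasGrad.unique (hF : HasGrad S F G u) (hF' : HasGrad S F G' u)
    (hS : UniqueDiffWithinAt ℝ S u) : G = G' :=
  funext fun i => (hF.pd_eq hS i).symm.trans (hF'.pd_eq hS i)

lemma hasGrad_const (c : ℝ) : HasGrad S (fun _ => c) 0 u := by
  have : covec (0 : Fin n → ℝ) = 0 := by ext v; simp
  rw [HasGrad, this]
  exact hasFDerivWithinAt_const c u S

lemma hasGrad_coord (i : Fin n) : HasGrad S (fun v => v i) (Pi.single i 1) u := by
  have : covec (Pi.single i 1 : Fin n → ℝ) = ContinuousLinearMap.proj i := by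
    ext v; simp [Pi.single_apply]
  rw [HasGrad, this]
  exact (ContinuousLinearMap.proj (R := ℝ) (φ := fun _ : Fin n => ℝ) i).hasFDerivWithinAt

lemma HasGrad.add (hF : HasGrad S F G u) (hF' : HasGrad S F' G' u) :
    HasGrad S (fun v => F v + F' v) (fun i => G i + G' i) u := by
  have : covec (fun i => G i + G' i) = covec G + covec G' := by
    ext v; simp [add_mul, Finset.sum_add_distrib]
  rw [HasGrad, this]
  exact HasFDerivWithinAt.add hF hF'

lemma HasGrad.neg (hF : HasGrad S F G u) : HasGrad S (fun v => -F v) (fun i => -G i) u := by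
  have : covec (fun i => -G i) = -covec G := by ext v; simp
  rw [HasGrad, this]
  exact HasFDerivWithinAt.neg hF

lemma HasGrad.sub (hF : HasGrad S F G u) (hF' : HasGrad S F' G' u) :
    HasGrad S (fun v => F v - F' v) (fun i => G i - G' i) u := by
  simpa only [sub_eq_add_neg] using hF.add hF'.neg

lemma HasGrad.mul (hF : HasGrad S F G u) (hF' : HasGrad S F' G' u) :
    HasGrad S (fun v => F v * F' v) (fun i => G i * F' u + F u * G' i) u := by
  have : covec (fun i => G i * F' u + F u * G' i) = F u • covec G' + F' u • covec G := by
    ext v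
    simp only [covec_apply, add_apply, smul_apply,
      smul_eq_mul, Finset.mul_sum, ← Finset.sum_add_distrib]
    exact Finset.sum_congr rfl fun i _ => by ring
  rw [HasGrad, this]
  exact HasFDerivWithinAt.mul hF hF'

lemma HasGrad.const_mul (c : ℝ) (hF : HasGrad S F G u) :
    HasGrad S (fun v => c * F v) (fun i => c * G i) u :=
  ((hasGrad_const c).mul hF).congr_grad fun i => by simp

lemma HasGrad.sum {ι : Type*} (s : Finset ι) {F : ι → (Fin n → ℝ) → ℝ} {G : ι → Fin n → ℝ}
    (hF : ∀ a ∈ s, HasGrad S (F a) (G a) u) :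
    HasGrad S (fun v => ∑ a ∈ s, F a v) (fun i => ∑ a ∈ s, G a i) u := by
  classical
  induction s using Finset.induction_on with
  | empty =>
    simp only [Finset.sum_empty]
    exact hasGrad_const 0
  | insert a s ha ih =>
    simp only [Finset.sum_insert ha]
    exact (hF a (Finset.mem_insert_self a s)).add
      (ih fun b hb => hF b (Finset.mem_insert_of_mem hb))

lemma pd_congr (hu : u ∈ S) (h : ∀ v ∈ S, F v = F' v) (i : Fin n) : pd S i F u = pd S i F' u := by
  rw [pd, pd, fderivWithin_congr h (h u hu)]

/-! ### Twice differentiable functions -/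

/-- A set on which the calculus of derivatives within the set works up to the second order: near
each of its points it contains a relative neighbourhood that is convex with nonempty interior. -/
def RegularDomain (S : Set (Fin n → ℝ)) : Prop :=
  ∀ u ∈ S, ∃ s ⊆ S, u ∈ s ∧ Convex ℝ s ∧ (interior s).Nonempty

lemma RegularDomain.uniqueDiffOn (hS : RegularDomain S) : UniqueDiffOn ℝ S := fun u hu => by
  obtain ⟨s, hs, hus, hc, hi⟩ := hS u hu
  exact (uniqueDiffWithinAt_convex hc hi (subset_closure hus)).mono hs

lemma TwiceDiffOn.pd_differentiableOn {E : Type*} [NormedAddCommGroup E] [NormedSpace ℝ E]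
    {S : Set E} {F : E → ℝ} (hF : TwiceDiffOn F S) (e : E) :
    DifferentiableOn ℝ (fun v => fderivWithin ℝ F S v e) S :=
  fun u hu => (hF.2 u hu).clm_apply (differentiableWithinAt_const e)

/-- Second derivatives within a regular domain commute; no continuity of them is needed. -/
lemma TwiceDiffOn.pd_comm (hS : RegularDomain S) (hF : TwiceDiffOn F S) (hu : u ∈ S)
    (i j : Fin n) : pd S i (pd S j F) u = pd S j (pd S i F) u := by
  obtain ⟨s, hs, hus, hc, hi⟩ := hS u hu
  have hU := hS.uniqueDiffOn u hu
  have key : ∀ k l : Fin n, pd S k (pd S l F) u =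
      fderivWithin ℝ (fderivWithin ℝ F S) S u (Pi.single k 1) (Pi.single l 1) := by
    intro k l
    have h1 : HasFDerivWithinAt (fun v => fderivWithin ℝ F S v (Pi.single l 1)) _ S u :=
      (hF.2 u hu).hasFDerivWithinAt.clm_apply
        (hasFDerivWithinAt_const (Pi.single l (1 : ℝ) : Fin n → ℝ) u S)
    rw [pd, show pd S l F = fun v => fderivWithin ℝ F S v (Pi.single l 1) from rfl,
      h1.fderivWithin hU]
    simp
  rw [key, key]
  refine hc.second_derivative_within_at_symmetric hi (f := F) (f' := fderivWithin ℝ F S)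
    (fun x hx => ?_) hus ((hF.2 u hu).hasFDerivWithinAt.mono (interior_subset.trans hs)) _ _
  have hx' : S ∈ nhds x := Filter.mem_of_superset (mem_interior_iff_mem_nhds.1 hx) hs
  exact (hF.1 x (mem_of_mem_nhds hx')).hasFDerivWithinAt.hasFDerivAt hx'

section TwiceDiff

variable {E : Type*} [NormedAddCommGroup E] [NormedSpace ℝ E] {S : Set E} {F F' : E → ℝ}

lemma SmoothOn.twiceDiffOn (hS : UniqueDiffOn ℝ S) (hF : SmoothOn F S) : TwiceDiffOn F S :=
  ⟨hF.differentiableOn (by simp),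
    (hF.fderivWithin (m := 1) hS (WithTop.coe_le_coe.2 (le_top : (1 + 1 : ℕ∞) ≤ ⊤))).differentiableOn
      (by simp)⟩

lemma TwiceDiffOn.add (hS : UniqueDiffOn ℝ S) (hF : TwiceDiffOn F S) (hF' : TwiceDiffOn F' S) :
    TwiceDiffOn (F + F') S :=
  ⟨hF.1.add hF'.1, (hF.2.add hF'.2).congr fun u hu =>
    fderivWithin_add (hS u hu) (hF.1 u hu) (hF'.1 u hu)⟩

lemma TwiceDiffOn.mul (hS : UniqueDiffOn ℝ S) (hF : TwiceDiffOn F S) (hF' : TwiceDiffOn F' S) :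
    TwiceDiffOn (F * F') S :=
  ⟨hF.1.mul hF'.1, ((hF.1.smul hF'.2).add (hF'.1.smul hF.2)).congr fun u hu =>
    fderivWithin_mul (hS u hu) (hF.1 u hu) (hF'.1 u hu)⟩

/-- The twice differentiable functions on `S` form an algebra. -/
def twiceDiffAlg (S : Set E) (hS : UniqueDiffOn ℝ S) : Subalgebra ℝ (E → ℝ) where
  carrier := {F | TwiceDiffOn F S}
  mul_mem' hF hF' := TwiceDiffOn.mul hS hF hF'
  add_mem' hF hF' := TwiceDiffOn.add hS hF hF'
  algebraMap_mem' c := SmoothOn.twiceDiffOn hS (contDiffOn_const (c := c))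

/-- The smooth functions on `S` form an algebra. -/
def smoothAlg (S : Set E) : Subalgebra ℝ (E → ℝ) where
  carrier := {F | SmoothOn F S}
  mul_mem' hF hF' := ContDiffOn.mul hF hF'
  add_mem' hF hF' := ContDiffOn.add hF hF'
  algebraMap_mem' c := contDiffOn_const (c := c)

/-- The composition of a twice differentiable function with a linear map. -/
lemma TwiceDiffOn.comp_clm {E' : Type*} [NormedAddCommGroup E'] [NormedSpace ℝ E'] {S' : Set E'}
    (hF : TwiceDiffOn F S) (L : E' →L[ℝ] E) (hL : Set.MapsTo L S' S) (hS' : UniqueDiffOn ℝ S') :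
    TwiceDiffOn (F ∘ L) S' := by
  have h1 : ∀ u ∈ S', HasFDerivWithinAt (F ∘ L) ((fderivWithin ℝ F S (L u)).comp L) S' u :=
    fun u hu => (hF.1 _ (hL hu)).hasFDerivWithinAt.comp u L.hasFDerivWithinAt hL
  refine ⟨fun u hu => (h1 u hu).differentiableWithinAt, ?_⟩
  have h2 : DifferentiableOn ℝ (fun u => (fderivWithin ℝ F S (L u)).comp L) S' := fun u hu =>
    ((hF.2 _ (hL hu)).comp u L.differentiableAt.differentiableWithinAt hL).clm_comp
      (differentiableWithinAt_const L)
  exact h2.congr fun u hu => (h1 u hu).fderivWithin (hS' u hu)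

end TwiceDiff

end AmbientG2

/-! ### Matrix valued functions -/

noncomputable section

namespace AmbientG2

open Matrix

variable {n : ℕ} {S : Set (Fin n → ℝ)} {u : Fin n → ℝ}

section Algebra

variable {X ι : Type*} [Fintype ι] [DecidableEq ι] (𝒜 : Subalgebra ℝ (X → ℝ))
  {W : X → Matrix ι ι ℝ}

lemma det_mem_subalgebra (hW : ∀ a b, (fun x => W x a b) ∈ 𝒜) : (fun x => (W x).det) ∈ 𝒜 := by
  have : (fun x => (W x).det) =
      ∑ π : Equiv.Perm ι, (((Equiv.Perm.sign π : ℤ) : ℝ)) • ∏ i, fun x => W x (π i) i := by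
    ext x
    simp only [det_apply', Finset.sum_apply, Pi.smul_apply, Finset.prod_apply, smul_eq_mul]
  rw [this]
  exact 𝒜.sum_mem fun π _ => 𝒜.smul_mem (𝒜.prod_mem fun i _ => hW _ _) _

lemma adjugate_mem_subalgebra (hW : ∀ a b, (fun x => W x a b) ∈ 𝒜) (a b : ι) :
    (fun x => (W x).adjugate a b) ∈ 𝒜 := by
  simp only [adjugate_apply]
  refine det_mem_subalgebra 𝒜 fun i j => ?_
  by_cases hi : i = b
  · subst hi
    simp only [updateRow_self]
    exact 𝒜.algebraMap_mem _
  · simp only [updateRow_ne hi]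
    exact hW i j

lemma inv_mem_subalgebra (hW : ∀ a b, (fun x => W x a b) ∈ 𝒜)
    (hdet : (fun x => (W x).det⁻¹) ∈ 𝒜) (a b : ι) : (fun x => (W x)⁻¹ a b) ∈ 𝒜 := by
  have : (fun x => (W x)⁻¹ a b) = (fun x => (W x).det⁻¹) * fun x => (W x).adjugate a b := by
    ext x
    simp [inv_def]
  rw [this]
  exact 𝒜.mul_mem hdet (adjugate_mem_subalgebra 𝒜 hW a b)

end Algebra

/-- The differentiable functions on `S` form an algebra. -/
def diffAlg (S : Set (Fin n → ℝ)) : Subalgebra ℝ ((Fin n → ℝ) → ℝ) where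
  carrier := {F | DifferentiableOn ℝ F S}
  mul_mem' hF hF' := DifferentiableOn.mul hF hF'
  add_mem' hF hF' := DifferentiableOn.add hF hF'
  algebraMap_mem' c := differentiableOn_const c

lemma differentiableOn_inv_entry {W : (Fin n → ℝ) → Matrix (Fin n) (Fin n) ℝ}
    (hW : ∀ a b, DifferentiableOn ℝ (fun v => W v a b) S) (hd : ∀ v ∈ S, (W v).det ≠ 0)
    (a b : Fin n) : DifferentiableOn ℝ (fun v => (W v)⁻¹ a b) S :=
  inv_mem_subalgebra (diffAlg S) hW
    (DifferentiableOn.inv (det_mem_subalgebra (diffAlg S) hW) hd) a b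

/-- The matrix of the `l`-th partial derivatives of the entries of `W`. -/
def pdM (S : Set (Fin n → ℝ)) (l : Fin n) (W : (Fin n → ℝ) → Matrix (Fin n) (Fin n) ℝ)
    (u : Fin n → ℝ) : Matrix (Fin n) (Fin n) ℝ :=
  Matrix.of fun a b => pd S l (fun v => W v a b) u

/-- The entries of `W` are differentiable on `S`. -/
def DiffM (S : Set (Fin n → ℝ)) (W : (Fin n → ℝ) → Matrix (Fin n) (Fin n) ℝ) : Prop :=
  ∀ a b, DifferentiableOn ℝ (fun v => W v a b) S

variable {W W' : (Fin n → ℝ) → Matrix (Fin n) (Fin n) ℝ}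

lemma DiffM.mul (hW : DiffM S W) (hW' : DiffM S W') : DiffM S (fun v => W v * W' v) := by
  intro a b
  simp only [Matrix.mul_apply]
  exact DifferentiableOn.fun_sum fun c _ => (hW a c).mul (hW' c b)

lemma DiffM.sub (hW : DiffM S W) (hW' : DiffM S W') : DiffM S (fun v => W v - W' v) :=
  fun a b => (hW a b).sub (hW' a b)

lemma DiffM.transpose (hW : DiffM S W) : DiffM S (fun v => (W v)ᵀ) := fun a b => hW b a

lemma DiffM.inv (hW : DiffM S W) (hd : ∀ v ∈ S, (W v).det ≠ 0) : DiffM S (fun v => (W v)⁻¹) :=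
  differentiableOn_inv_entry hW hd

lemma DiffM.const (A : Matrix (Fin n) (Fin n) ℝ) : DiffM S (fun _ => A) :=
  fun _ _ => differentiableOn_const _

lemma DiffM.congr (hW : DiffM S W) (h : ∀ v ∈ S, W' v = W v) : DiffM S W' :=
  fun a b => (hW a b).congr fun v hv => by rw [h v hv]

lemma pdM_congr (hu : u ∈ S) (h : ∀ v ∈ S, W v = W' v) (l : Fin n) :
    pdM S l W u = pdM S l W' u := by
  ext a b
  exact pd_congr hu (fun v hv => by rw [h v hv]) l

lemma pdM_mul (hU : UniqueDiffOn ℝ S) (hu : u ∈ S) (hW : DiffM S W) (hW' : DiffM S W')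
    (l : Fin n) :
    pdM S l (fun v => W v * W' v) u = pdM S l W u * W' u + W u * pdM S l W' u := by
  ext a b
  simp only [pdM, of_apply, Matrix.add_apply, Matrix.mul_apply]
  rw [(HasGrad.sum Finset.univ fun c _ => (hasGrad_pd (hW a c u hu)).mul
    (hasGrad_pd (hW' c b u hu))).pd_eq (hU u hu), Finset.sum_add_distrib]

lemma pdM_sub (hU : UniqueDiffOn ℝ S) (hu : u ∈ S) (hW : DiffM S W) (hW' : DiffM S W')
    (l : Fin n) : pdM S l (fun v => W v - W' v) u = pdM S l W u - pdM S l W' u := by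
  ext a b
  exact ((hasGrad_pd (hW a b u hu)).sub (hasGrad_pd (hW' a b u hu))).pd_eq (hU u hu) l

lemma pdM_transpose (l : Fin n) : pdM S l (fun v => (W v)ᵀ) u = (pdM S l W u)ᵀ := rfl

lemma pdM_const (hU : UniqueDiffOn ℝ S) (hu : u ∈ S) (A : Matrix (Fin n) (Fin n) ℝ) (l : Fin n) :
    pdM S l (fun _ => A) u = 0 := by
  ext a b
  exact (hasGrad_const (S := S) (u := u) (A a b)).pd_eq (hU u hu) l

/-- The derivatives of a function with values in a subspace belong to the subspace. -/
lemma pdM_mem (hU : UniqueDiffOn ℝ S) (hu : u ∈ S) (hW : DiffM S W)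
    (𝔤 : Submodule ℝ (Matrix (Fin n) (Fin n) ℝ)) (h : ∀ v ∈ S, W v ∈ 𝔤) (l : Fin n) :
    pdM S l W u ∈ 𝔤 := by
  by_contra hx
  -- a linear form that vanishes on `𝔤` but not at the derivative
  obtain ⟨φ, hφ, hle⟩ := Submodule.exists_le_ker_of_notMem hx
  apply hφ
  have hexp : ∀ A : Matrix (Fin n) (Fin n) ℝ,
      φ A = ∑ a, ∑ b, φ (Matrix.single a b 1) * A a b := by
    intro A
    conv_lhs => rw [matrix_eq_sum_single A]
    simp only [map_sum]
    refine Finset.sum_congr rfl fun a _ => Finset.sum_congr rfl fun b _ => ?_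
    rw [show Matrix.single a b (A a b) = A a b • Matrix.single a b (1 : ℝ) by
      rw [Matrix.smul_single, smul_eq_mul, mul_one], map_smul, smul_eq_mul, mul_comm]
  have h1 : HasGrad S (fun v => φ (W v)) (fun i => φ (pdM S i W u)) u := by
    rw [show (fun v => φ (W v)) = fun v => ∑ a, ∑ b, φ (Matrix.single a b 1) * W v a b from
      funext fun v => hexp _, show (fun i => φ (pdM S i W u)) =
      fun i => ∑ a, ∑ b, φ (Matrix.single a b 1) * pd S i (fun v => W v a b) u from
      funext fun i => hexp _]
    exact HasGrad.sum _ fun a _ => HasGrad.sum _ fun b _ =>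
      (hasGrad_pd (hW a b u hu)).const_mul _
  have h2 : HasGrad S (fun v => φ (W v)) 0 u :=
    (hasGrad_const 0).congr hu fun v hv => hle (h v hv)
  exact congrFun (h1.unique h2 (hU u hu)) l

/-! ### The Levi-Civita connection in a coframe -/

/-- The metric with constant components `η` in the coframe given by the rows of `σ`. -/
def frameMetric (η : Matrix (Fin n) (Fin n) ℝ) (σ : (Fin n → ℝ) → Matrix (Fin n) (Fin n) ℝ)
    (u : Fin n → ℝ) : Matrix (Fin n) (Fin n) ℝ :=
  (σ u)ᵀ * η * σ u

/-- `κ = κ₀ dx⁰ + ⋯` is a torsion-free `𝔤`-valued connection form in the twice differentiable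
coframe `σ` on the regular domain `S`, where `𝔤` is a Lie algebra of matrices that are skew for the
nondegenerate symmetric form `η`. The torsion-freeness is the equation `dσ + κ ∧ σ = 0`. -/
structure IsConnectionForm (S : Set (Fin n → ℝ)) (η : Matrix (Fin n) (Fin n) ℝ)
    (𝔤 : Submodule ℝ (Matrix (Fin n) (Fin n) ℝ))
    (σ : (Fin n → ℝ) → Matrix (Fin n) (Fin n) ℝ)
    (κ : Fin n → (Fin n → ℝ) → Matrix (Fin n) (Fin n) ℝ) : Prop where
  regular : RegularDomain S
  symm : ηᵀ = η
  η_det : η.det ≠ 0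
  skew : ∀ X ∈ 𝔤, η * X + Xᵀ * η = 0
  bracket : ∀ X ∈ 𝔤, ∀ Y ∈ 𝔤, X * Y - Y * X ∈ 𝔤
  twiceDiff : ∀ a j, TwiceDiffOn (fun v => σ v a j) S
  det_ne_zero : ∀ u ∈ S, (σ u).det ≠ 0
  mem : ∀ u ∈ S, ∀ l, κ l u ∈ 𝔤
  torsion : ∀ u ∈ S, ∀ i j a, pd S i (fun v => σ v a j) u + (κ i u * σ u) a j =
    pd S j (fun v => σ v a i) u + (κ j u * σ u) a i

/-- The matrices `(Γₗ)ᵏᵢ = Γᵏₗᵢ` of Christoffel symbols. -/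
def chrM (S : Set (Fin n → ℝ)) (g : (Fin n → ℝ) → Matrix (Fin n) (Fin n) ℝ) (l : Fin n)
    (u : Fin n → ℝ) : Matrix (Fin n) (Fin n) ℝ :=
  Matrix.of fun k i => christoffel S g k l i u

/-- The matrices `Rₖⱼ = ∂ₖΓⱼ - ∂ⱼΓₖ + [Γₖ, Γⱼ]` of the curvature of a connection. -/
def curvM (S : Set (Fin n → ℝ)) (Γ : Fin n → (Fin n → ℝ) → Matrix (Fin n) (Fin n) ℝ)
    (k j : Fin n) (u : Fin n → ℝ) : Matrix (Fin n) (Fin n) ℝ :=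
  pdM S k (Γ j) u - pdM S j (Γ k) u + (Γ k u * Γ j u - Γ j u * Γ k u)

lemma ricci_eq_sum_curvM (g : (Fin n → ℝ) → Matrix (Fin n) (Fin n) ℝ)
    (hsymm : ∀ k i j, christoffel S g k i j = christoffel S g k j i) (i j : Fin n) :
    ricci S g i j u = ∑ k, curvM S (chrM S g) k j u k i := by
  refine Finset.sum_congr rfl fun k _ => ?_
  simp only [curvM, pdM, chrM, Matrix.sub_apply, Matrix.add_apply, Matrix.mul_apply, of_apply,
    Finset.sum_sub_distrib]
  rw [hsymm k i j, hsymm k i k]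
  congr 2 <;> exact Finset.sum_congr rfl fun l _ => by rw [hsymm l i]

lemma christoffel_comm {g : (Fin n → ℝ) → Matrix (Fin n) (Fin n) ℝ} (hg : ∀ v, (g v)ᵀ = g v)
    (k i j : Fin n) : christoffel S g k i j = christoffel S g k j i := by
  have h : ∀ a b, (fun v => g v a b) = fun v => g v b a := fun a b =>
    funext fun v => congrFun (congrFun (hg v) b) a
  ext u
  simp only [christoffel]
  congr 1
  refine Finset.sum_congr rfl fun l _ => ?_
  rw [h i j]
  ring

namespace IsConnectionForm

variable {η : Matrix (Fin n) (Fin n) ℝ} {𝔤 : Submodule ℝ (Matrix (Fin n) (Fin n) ℝ)}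
  {σ : (Fin n → ℝ) → Matrix (Fin n) (Fin n) ℝ}
  {κ : Fin n → (Fin n → ℝ) → Matrix (Fin n) (Fin n) ℝ}

lemma diffM (H : IsConnectionForm S η 𝔤 σ κ) : DiffM S σ := fun a j => (H.twiceDiff a j).1

lemma diffM_pdM (H : IsConnectionForm S η 𝔤 σ κ) (l : Fin n) : DiffM S (pdM S l σ) :=
  fun a j => (H.twiceDiff a j).pd_differentiableOn _

lemma transpose_frameMetric (H : IsConnectionForm S η 𝔤 σ κ) (v : Fin n → ℝ) :
    (frameMetric η σ v)ᵀ = frameMetric η σ v := by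
  simp [frameMetric, H.symm, Matrix.mul_assoc]

lemma frameMetric_det (H : IsConnectionForm S η 𝔤 σ κ) (hu : u ∈ S) :
    (frameMetric η σ u).det ≠ 0 := by
  simp [frameMetric, H.η_det, H.det_ne_zero u hu]

lemma diffM_frameMetric (H : IsConnectionForm S η 𝔤 σ κ) : DiffM S (frameMetric η σ) :=
  (H.diffM.transpose.mul (DiffM.const η)).mul H.diffM

lemma inv_mul_frame (H : IsConnectionForm S η 𝔤 σ κ) (hu : u ∈ S) : (σ u)⁻¹ * σ u = 1 :=
  nonsing_inv_mul _ (isUnit_iff_ne_zero.2 (H.det_ne_zero u hu))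

lemma frame_mul_inv (H : IsConnectionForm S η 𝔤 σ κ) (hu : u ∈ S) : σ u * (σ u)⁻¹ = 1 :=
  mul_nonsing_inv _ (isUnit_iff_ne_zero.2 (H.det_ne_zero u hu))

/-- A torsion-free metric connection is the Levi-Civita connection: `∂ₗσ = σΓₗ - κₗσ`. -/
lemma frame_mul_chrM (H : IsConnectionForm S η 𝔤 σ κ) (hu : u ∈ S) (l : Fin n) :
    σ u * chrM S (frameMetric η σ) l u = pdM S l σ u + κ l u * σ u := by
  have hU := H.regular.uniqueDiffOn
  set g := frameMetric η σ with hg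
  set Γ : Fin n → Matrix (Fin n) (Fin n) ℝ :=
    fun l => (σ u)⁻¹ * (pdM S l σ u + κ l u * σ u) with hΓ
  have hσΓ : ∀ l, σ u * Γ l = pdM S l σ u + κ l u * σ u := fun l => by
    rw [hΓ, ← Matrix.mul_assoc, H.frame_mul_inv hu, Matrix.one_mul]
  -- the connection `Γ` is torsion-free
  have hsym : ∀ l i k, Γ l k i = Γ i k l := fun l i k => by
    simp only [hΓ, Matrix.mul_apply (M := (σ u)⁻¹)]
    exact Finset.sum_congr rfl fun a _ => congrArg _ (H.torsion u hu l i a)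
  -- the connection `Γ` is compatible with the metric
  have hpd : ∀ l, pdM S l g u = g u * Γ l + (g u * Γ l)ᵀ := fun l => by
    have h1 : pdM S l g u = (pdM S l σ u)ᵀ * η * σ u + (σ u)ᵀ * η * pdM S l σ u := by
      rw [hg, show frameMetric η σ = fun v => (σ v)ᵀ * η * σ v from rfl,
        pdM_mul hU hu (H.diffM.transpose.mul (DiffM.const η)) H.diffM,
        pdM_mul hU hu H.diffM.transpose (DiffM.const η), pdM_const hU hu, pdM_transpose,
        Matrix.mul_zero, add_zero]
    have h2 : g u * Γ l = (σ u)ᵀ * η * (pdM S l σ u + κ l u * σ u) := by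
      rw [hg, frameMetric, Matrix.mul_assoc _ (σ u), hσΓ]
    have h3 := H.skew _ (H.mem u hu l)
    rw [h1, h2, transpose_mul, transpose_add, transpose_mul, transpose_mul, transpose_transpose,
      H.symm]
    have h4 : (σ u)ᵀ * (η * κ l u + (κ l u)ᵀ * η) * σ u = 0 := by rw [h3]; simp
    simp only [Matrix.mul_add, Matrix.add_mul, Matrix.mul_assoc] at h4 ⊢
    rw [← sub_eq_zero, ← neg_eq_zero, ← h4]
    abel
  have hP : ∀ i l j, pd S i (fun v => g v l j) u = (g u * Γ i) l j + (g u * Γ i) j l :=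
    fun i l j => congrFun (congrFun (hpd i) l) j
  have hPs : ∀ i l j, (g u * Γ i) l j = (g u * Γ j) l i := fun i l j => by
    simp only [Matrix.mul_apply]
    exact Finset.sum_congr rfl fun a _ => by rw [hsym]
  -- the Koszul formula
  have hchr : chrM S g l u = Γ l := by
    have hdet : IsUnit (g u).det := isUnit_iff_ne_zero.2 (H.frameMetric_det hu)
    rw [show Γ l = (g u)⁻¹ * (g u * Γ l) by
      rw [← Matrix.mul_assoc, nonsing_inv_mul _ hdet, Matrix.one_mul]]
    ext k j
    rw [Matrix.mul_apply, chrM, of_apply, christoffel, Finset.mul_sum]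
    refine Finset.sum_congr rfl fun m _ => ?_
    rw [hP, hP, hP, hPs j m l, hPs m l j, hPs m j l, hPs j l m]
    ring
  rw [hchr, hσΓ]

lemma diffM_chrM (H : IsConnectionForm S η 𝔤 σ κ) (h2 : ∀ i j,
    TwiceDiffOn (fun v => frameMetric η σ v i j) S) (l : Fin n) :
    DiffM S (chrM S (frameMetric η σ) l) := by
  intro k i
  have hp : ∀ a b c, DifferentiableOn ℝ (pd S a fun v => frameMetric η σ v b c) S :=
    fun a b c => (h2 b c).pd_differentiableOn _
  refine (DifferentiableOn.fun_sum fun m _ => ?_).const_mul (1 / 2 : ℝ)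
  exact (H.diffM_frameMetric.inv (fun v hv => H.frameMetric_det hv) k m).mul
    (((hp l i m).add (hp i l m)).sub (hp m l i))

lemma twiceDiff_frameMetric (H : IsConnectionForm S η 𝔤 σ κ) (i j : Fin n) :
    TwiceDiffOn (fun v => frameMetric η σ v i j) S := by
  have : (fun v => frameMetric η σ v i j) =
      ∑ b, ∑ a, (fun v => σ v a i) * (fun _ => η a b) * fun v => σ v b j := by
    ext v
    simp only [frameMetric, Matrix.mul_apply, transpose_apply, Finset.sum_apply, Pi.mul_apply,
      Finset.sum_mul]
  rw [this]
  set 𝒜 := twiceDiffAlg S H.regular.uniqueDiffOn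
  exact 𝒜.sum_mem fun b _ => 𝒜.sum_mem fun a _ => 𝒜.mul_mem
    (𝒜.mul_mem (H.twiceDiff a i) (𝒜.algebraMap_mem _)) (H.twiceDiff b j)

lemma diffM_conn (H : IsConnectionForm S η 𝔤 σ κ) (l : Fin n) : DiffM S (κ l) := by
  refine DiffM.congr (((H.diffM.mul (H.diffM_chrM H.twiceDiff_frameMetric l)).sub
    (H.diffM_pdM l)).mul (H.diffM.inv H.det_ne_zero)) fun v hv => ?_
  rw [H.frame_mul_chrM hv, add_sub_cancel_left, Matrix.mul_assoc, H.frame_mul_inv hv,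
    Matrix.mul_one]

/-- In the coframe, the curvature of the Levi-Civita connection is that of `κ`. -/
lemma frame_mul_curvM (H : IsConnectionForm S η 𝔤 σ κ) (hu : u ∈ S) (k j : Fin n) :
    σ u * curvM S (chrM S (frameMetric η σ)) k j u = curvM S κ k j u * σ u := by
  have hU := H.regular.uniqueDiffOn
  set Γ := chrM S (frameMetric η σ) with hΓ
  have hdΓ : ∀ l, DiffM S (Γ l) := H.diffM_chrM H.twiceDiff_frameMetric
  have hd : ∀ l, ∀ v ∈ S, pdM S l σ v = σ v * Γ l v - κ l v * σ v := fun l v hv => by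
    rw [H.frame_mul_chrM hv, add_sub_cancel_right]
  have hdd : ∀ k j, pdM S k (pdM S j σ) u = (σ u * Γ k u - κ k u * σ u) * Γ j u
      + σ u * pdM S k (Γ j) u - (pdM S k (κ j) u * σ u
      + κ j u * (σ u * Γ k u - κ k u * σ u)) := fun k j => by
    rw [pdM_congr hu (hd j), pdM_sub hU hu (H.diffM.mul (hdΓ j)) ((H.diffM_conn j).mul H.diffM),
      pdM_mul hU hu H.diffM (hdΓ j), pdM_mul hU hu (H.diffM_conn j) H.diffM, hd k u hu]
  -- the second derivatives of the coframe commute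
  have hcomm : pdM S k (pdM S j σ) u = pdM S j (pdM S k σ) u := by
    ext a i
    exact (H.twiceDiff a i).pd_comm H.regular hu k j
  rw [hdd, hdd] at hcomm
  rw [curvM, curvM, ← sub_eq_zero]
  rw [← sub_eq_zero] at hcomm
  rw [← hcomm]
  noncomm_ring

lemma curvM_mem (H : IsConnectionForm S η 𝔤 σ κ) (hu : u ∈ S) (k j : Fin n) :
    curvM S κ k j u ∈ 𝔤 := by
  have hU := H.regular.uniqueDiffOn
  refine 𝔤.add_mem (𝔤.sub_mem ?_ ?_) ?_
  · exact pdM_mem hU hu (H.diffM_conn j) 𝔤 (fun v hv => H.mem v hv j) k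
  · exact pdM_mem hU hu (H.diffM_conn k) 𝔤 (fun v hv => H.mem v hv k) j
  · exact H.bracket _ (H.mem u hu k) _ (H.mem u hu j)

/-- The components of the curvature form in the coframe. -/
def frameCurv (S : Set (Fin n → ℝ)) (σ : (Fin n → ℝ) → Matrix (Fin n) (Fin n) ℝ)
    (κ : Fin n → (Fin n → ℝ) → Matrix (Fin n) (Fin n) ℝ) (c d : Fin n) (u : Fin n → ℝ) :
    Matrix (Fin n) (Fin n) ℝ :=
  ∑ k, ∑ j, ((σ u)⁻¹ k c * (σ u)⁻¹ j d) • curvM S κ k j u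

lemma frameCurv_mem (H : IsConnectionForm S η 𝔤 σ κ) (hu : u ∈ S) (c d : Fin n) :
    frameCurv S σ κ c d u ∈ 𝔤 :=
  sum_mem fun k _ => sum_mem fun j _ => 𝔤.smul_mem _ (H.curvM_mem hu k j)

lemma frameCurv_antisymm (c d : Fin n) : frameCurv S σ κ c d u = -frameCurv S σ κ d c u := by
  rw [frameCurv, frameCurv, Finset.sum_comm, ← Finset.sum_neg_distrib]
  refine Finset.sum_congr rfl fun j _ => ?_
  rw [← Finset.sum_neg_distrib]
  refine Finset.sum_congr rfl fun k _ => ?_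
  rw [← smul_neg, mul_comm]
  congr 1
  simp only [curvM]
  abel

/-- The first Bianchi identity, which expresses the symmetry of the Christoffel symbols. -/
lemma frameCurv_bianchi (H : IsConnectionForm S η 𝔤 σ κ) (hu : u ∈ S) (a b c d : Fin n) :
    frameCurv S σ κ c d u a b + frameCurv S σ κ d b u a c + frameCurv S σ κ b c u a d = 0 := by
  set g := frameMetric η σ with hg
  have hs : ∀ k i j, christoffel S g k i j = christoffel S g k j i :=
    christoffel_comm H.transpose_frameMetric
  -- the Bianchi identity in coordinates, which is transferred to the coframe below
  have hR : ∀ k j i m, curvM S (chrM S g) k j u m i + curvM S (chrM S g) j i u m k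
      + curvM S (chrM S g) i k u m j = 0 := fun k j i m => by
    have e : ∀ p q r, pdM S p (chrM S g q) u m r = pdM S p (chrM S g r) u m q :=
      fun p q r => by simp only [pdM, chrM, of_apply, hs m q r]
    have e' : ∀ p q r, (chrM S g p u * chrM S g q u) m r = (chrM S g p u * chrM S g r u) m q :=
      fun p q r => by
        simp only [Matrix.mul_apply]
        exact Finset.sum_congr rfl fun l _ => by simp only [chrM, of_apply, hs l q r]
    simp only [curvM, Matrix.add_apply, Matrix.sub_apply]
    rw [e k j i, e j i k, e i k j, e' k j i, e' j i k, e' i k j]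
    ring
  have hK : ∀ k j i, (curvM S κ k j u * σ u) a i + (curvM S κ j i u * σ u) a k
      + (curvM S κ i k u * σ u) a j = 0 := fun k j i => by
    simp only [← H.frame_mul_curvM hu, Matrix.mul_apply (M := σ u), ← Finset.sum_add_distrib,
      ← mul_add, ← hg, hR, mul_zero, Finset.sum_const_zero]
  have hx : ∀ k j, curvM S κ k j u a = fun b => ∑ i, (curvM S κ k j u * σ u) a i * (σ u)⁻¹ i b :=
    fun k j => by
      have : curvM S κ k j u = curvM S κ k j u * σ u * (σ u)⁻¹ := by
        rw [Matrix.mul_assoc, H.frame_mul_inv hu, Matrix.mul_one]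
      conv_lhs => rw [this]
      ext b
      rw [Matrix.mul_apply (M := curvM S κ k j u * σ u)]
  set e := (σ u)⁻¹
  set T : Fin n → Fin n → Fin n → ℝ := fun k j i => (curvM S κ k j u * σ u) a i with hT
  have hf : ∀ c d b, frameCurv S σ κ c d u a b = ∑ k, ∑ j, ∑ i, e k c * e j d * e i b * T k j i :=
    fun c d b => by
      simp only [frameCurv, Matrix.sum_apply, Matrix.smul_apply, smul_eq_mul]
      refine Finset.sum_congr rfl fun k _ => Finset.sum_congr rfl fun j _ => ?_
      rw [hx, Finset.mul_sum]
      exact Finset.sum_congr rfl fun i _ => by ring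
  have h2 : frameCurv S σ κ d b u a c = ∑ k, ∑ j, ∑ i, e k c * e j d * e i b * T j i k := by
    rw [hf, Finset.sum_comm_cycle]
    exact Finset.sum_congr rfl fun k _ => Finset.sum_congr rfl fun j _ =>
      Finset.sum_congr rfl fun i _ => by ring
  have h3 : frameCurv S σ κ b c u a d = ∑ k, ∑ j, ∑ i, e k c * e j d * e i b * T i k j := by
    rw [hf, ← Finset.sum_comm_cycle]
    exact Finset.sum_congr rfl fun k _ => Finset.sum_congr rfl fun j _ =>
      Finset.sum_congr rfl fun i _ => by ring
  rw [hf, h2, h3]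
  simp only [← Finset.sum_add_distrib, ← mul_add]
  exact Finset.sum_eq_zero fun k _ => Finset.sum_eq_zero fun j _ => Finset.sum_eq_zero fun i _ => by
    rw [hT, hK, mul_zero]

/-- The Ricci tensor vanishes if its components in the coframe vanish. -/
lemma ricci_eq_zero (H : IsConnectionForm S η 𝔤 σ κ) (hu : u ∈ S)
    (h0 : ∀ d b, ∑ a, frameCurv S σ κ a d u a b = 0) (i j : Fin n) :
    ricci S (frameMetric η σ) i j u = 0 := by
  rw [ricci_eq_sum_curvM _ (christoffel_comm H.transpose_frameMetric)]
  set e := (σ u)⁻¹ with he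
  have h1 : ∀ k, curvM S (chrM S (frameMetric η σ)) k j u = e * curvM S κ k j u * σ u :=
    fun k => by
      rw [Matrix.mul_assoc, ← H.frame_mul_curvM hu, ← Matrix.mul_assoc, H.inv_mul_frame hu,
        Matrix.one_mul]
  have h2 : ∀ a b, ∑ d, σ u d j * frameCurv S σ κ a d u a b = ∑ k, e k a * curvM S κ k j u a b :=
    fun a b => by
      have hδ : ∀ l, ∑ d, e l d * σ u d j = if l = j then 1 else 0 := fun l => by
        rw [← Matrix.mul_apply, H.inv_mul_frame hu, one_apply]
      simp only [frameCurv, Matrix.sum_apply, Matrix.smul_apply, smul_eq_mul, Finset.mul_sum]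
      rw [Finset.sum_comm]
      refine Finset.sum_congr rfl fun k _ => ?_
      rw [Finset.sum_comm]
      have : ∀ l, ∑ d, σ u d j * (e k a * e l d * curvM S κ k l u a b) =
          (e k a * curvM S κ k l u a b) * ∑ d, e l d * σ u d j := fun l => by
        rw [Finset.mul_sum]
        exact Finset.sum_congr rfl fun d _ => by ring
      simp [← he, this, hδ]
  have h3 : ∑ k, curvM S (chrM S (frameMetric η σ)) k j u k i =
      ∑ b, σ u b i * ∑ a, ∑ k, e k a * curvM S κ k j u a b := by
    simp only [h1, Matrix.mul_apply, Finset.mul_sum, Finset.sum_mul]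
    rw [Finset.sum_comm]
    refine Finset.sum_congr rfl fun b _ => ?_
    rw [Finset.sum_comm]
    exact Finset.sum_congr rfl fun a _ => Finset.sum_congr rfl fun k _ => by ring
  rw [h3]
  refine Finset.sum_eq_zero fun b _ => ?_
  have : ∑ a, ∑ k, e k a * curvM S κ k j u a b =
      ∑ d, σ u d j * ∑ a, frameCurv S σ κ a d u a b := by
    simp only [← h2, Finset.mul_sum]
    exact Finset.sum_comm
  rw [this]
  simp [h0]

end IsConnectionForm

end AmbientG2

end

noncomputable section

namespace AmbientG2

open Matrix

/-! ### Constant 3-forms and parallel forms -/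

section Trilinear

variable {n : ℕ} {S : Set (Fin n → ℝ)} {u : Fin n → ℝ}

/-- The trilinear form with the components `U`. -/
def tri (U : Fin n → Fin n → Fin n → ℝ) (x y z : Fin n → ℝ) : ℝ :=
  ∑ a, ∑ b, ∑ c, U a b c * x a * y b * z c

variable (U U' : Fin n → Fin n → Fin n → ℝ) (x x' y y' z z' : Fin n → ℝ)

lemma tri_add_left : tri U (x + x') y z = tri U x y z + tri U x' y z := by
  simp only [tri, Pi.add_apply, mul_add, add_mul, Finset.sum_add_distrib]

lemma tri_add_mid : tri U x (y + y') z = tri U x y z + tri U x y' z := by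
  simp only [tri, Pi.add_apply, mul_add, add_mul, Finset.sum_add_distrib]

lemma tri_add_right : tri U x y (z + z') = tri U x y z + tri U x y z' := by
  simp only [tri, Pi.add_apply, mul_add, Finset.sum_add_distrib]

lemma tri_smul_left (c : ℝ) : tri U (c • x) y z = c * tri U x y z := by
  simp only [tri, Pi.smul_apply, smul_eq_mul, Finset.mul_sum]
  exact Finset.sum_congr rfl fun _ _ => Finset.sum_congr rfl fun _ _ =>
    Finset.sum_congr rfl fun _ _ => by ring

lemma tri_smul_mid (c : ℝ) : tri U x (c • y) z = c * tri U x y z := by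
  simp only [tri, Pi.smul_apply, smul_eq_mul, Finset.mul_sum]
  exact Finset.sum_congr rfl fun _ _ => Finset.sum_congr rfl fun _ _ =>
    Finset.sum_congr rfl fun _ _ => by ring

lemma tri_smul_right (c : ℝ) : tri U x y (c • z) = c * tri U x y z := by
  simp only [tri, Pi.smul_apply, smul_eq_mul, Finset.mul_sum]
  exact Finset.sum_congr rfl fun _ _ => Finset.sum_congr rfl fun _ _ =>
    Finset.sum_congr rfl fun _ _ => by ring

lemma tri_add_form : tri (U + U') x y z = tri U x y z + tri U' x y z := by
  simp only [tri, Pi.add_apply, add_mul, Finset.sum_add_distrib]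

lemma tri_smul_form (c : ℝ) : tri (c • U) x y z = c * tri U x y z := by
  simp only [tri, Pi.smul_apply, smul_eq_mul, Finset.mul_sum]
  exact Finset.sum_congr rfl fun _ _ => Finset.sum_congr rfl fun _ _ =>
    Finset.sum_congr rfl fun _ _ => by ring

lemma tri_wedge₃ (α β γ : Fin n → ℝ) : tri (wedge₃ α β γ) x y z =
    Matrix.det !![α ⬝ᵥ x, α ⬝ᵥ y, α ⬝ᵥ z; β ⬝ᵥ x, β ⬝ᵥ y, β ⬝ᵥ z; γ ⬝ᵥ x, γ ⬝ᵥ y, γ ⬝ᵥ z] := by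
  have key : ∀ p q r : Fin n → ℝ, (p ⬝ᵥ x) * (q ⬝ᵥ y) * (r ⬝ᵥ z) =
      ∑ a, ∑ b, ∑ c, (p a * q b * r c) * x a * y b * z c := fun p q r => by
    simp only [dotProduct]
    rw [Finset.sum_mul_sum, Finset.sum_mul]
    refine Finset.sum_congr rfl fun a _ => ?_
    rw [Finset.sum_mul_sum]
    exact Finset.sum_congr rfl fun b _ => Finset.sum_congr rfl fun c _ => by ring
  have hd : Matrix.det !![α ⬝ᵥ x, α ⬝ᵥ y, α ⬝ᵥ z; β ⬝ᵥ x, β ⬝ᵥ y, β ⬝ᵥ z;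
      γ ⬝ᵥ x, γ ⬝ᵥ y, γ ⬝ᵥ z] =
      (α ⬝ᵥ x) * (β ⬝ᵥ y) * (γ ⬝ᵥ z) - (α ⬝ᵥ x) * (γ ⬝ᵥ y) * (β ⬝ᵥ z)
      - (β ⬝ᵥ x) * (α ⬝ᵥ y) * (γ ⬝ᵥ z) + (γ ⬝ᵥ x) * (α ⬝ᵥ y) * (β ⬝ᵥ z)
      + (β ⬝ᵥ x) * (γ ⬝ᵥ y) * (α ⬝ᵥ z) - (γ ⬝ᵥ x) * (β ⬝ᵥ y) * (α ⬝ᵥ z) := by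
    rw [det_fin_three]
    simp
    ring
  rw [hd]
  simp only [key, ← Finset.sum_add_distrib, ← Finset.sum_sub_distrib]
  refine Finset.sum_congr rfl fun a _ => Finset.sum_congr rfl fun b _ =>
    Finset.sum_congr rfl fun c _ => ?_
  simp only [wedge₃, det_fin_three]
  simp
  ring

lemma hasGrad_tri {X Y Z : (Fin n → ℝ) → Fin n → ℝ} {X' Y' Z' : Fin n → Fin n → ℝ}
    (hX : ∀ a, HasGrad S (fun v => X v a) (fun l => X' l a) u)
    (hY : ∀ a, HasGrad S (fun v => Y v a) (fun l => Y' l a) u)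
    (hZ : ∀ a, HasGrad S (fun v => Z v a) (fun l => Z' l a) u) :
    HasGrad S (fun v => tri U (X v) (Y v) (Z v)) (fun l => tri U (X' l) (Y u) (Z u)
      + tri U (X u) (Y' l) (Z u) + tri U (X u) (Y u) (Z' l)) u := by
  refine (HasGrad.sum _ fun a _ => HasGrad.sum _ fun b _ => HasGrad.sum _ fun c _ =>
    (((hX a).const_mul (U a b c)).mul (hY b)).mul (hZ c)).congr_grad fun l => ?_
  simp only [tri, ← Finset.sum_add_distrib]
  exact Finset.sum_congr rfl fun _ _ => Finset.sum_congr rfl fun _ _ =>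
    Finset.sum_congr rfl fun _ _ => by ring

/-- The infinitesimal invariance of a trilinear form under the matrix `X`. -/
def TriInvariant (U : Fin n → Fin n → Fin n → ℝ) (X : Matrix (Fin n) (Fin n) ℝ) : Prop :=
  ∀ x y z, tri U (X *ᵥ x) y z + tri U x (X *ᵥ y) z + tri U x y (X *ᵥ z) = 0

lemma tri_sum_left {ι : Type*} (s : Finset ι) (c : ι → ℝ) (X : ι → Fin n → ℝ) :
    ∑ m ∈ s, c m * tri U (X m) y z = tri U (∑ m ∈ s, c m • X m) y z := by
  classical
  induction s using Finset.induction_on with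
  | empty => simp [tri]
  | insert a s ha ih =>
    rw [Finset.sum_insert ha, Finset.sum_insert ha, tri_add_left, tri_smul_left, ih]

lemma tri_sum_mid {ι : Type*} (s : Finset ι) (c : ι → ℝ) (Y : ι → Fin n → ℝ) :
    ∑ m ∈ s, c m * tri U x (Y m) z = tri U x (∑ m ∈ s, c m • Y m) z := by
  classical
  induction s using Finset.induction_on with
  | empty => simp [tri]
  | insert a s ha ih =>
    rw [Finset.sum_insert ha, Finset.sum_insert ha, tri_add_mid, tri_smul_mid, ih]

lemma tri_sum_right {ι : Type*} (s : Finset ι) (c : ι → ℝ) (Z : ι → Fin n → ℝ) :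
    ∑ m ∈ s, c m * tri U x y (Z m) = tri U x y (∑ m ∈ s, c m • Z m) := by
  classical
  induction s using Finset.induction_on with
  | empty => simp [tri]
  | insert a s ha ih =>
    rw [Finset.sum_insert ha, Finset.sum_insert ha, tri_add_right, tri_smul_right, ih]

variable {η : Matrix (Fin n) (Fin n) ℝ} {𝔤 : Submodule ℝ (Matrix (Fin n) (Fin n) ℝ)}
  {σ : (Fin n → ℝ) → Matrix (Fin n) (Fin n) ℝ}
  {κ : Fin n → (Fin n → ℝ) → Matrix (Fin n) (Fin n) ℝ}

/-- A 3-form whose components in the coframe are constant and invariant under the Lie algebra of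
the connection form is parallel. -/
lemma IsConnectionForm.isParallelForm (H : IsConnectionForm S η 𝔤 σ κ)
    (hinv : ∀ X ∈ 𝔤, TriInvariant U X) :
    IsParallelForm S (frameMetric η σ)
      fun v i j k => tri U ((σ v).col i) ((σ v).col j) ((σ v).col k) := by
  have hg : ∀ u ∈ S, ∀ i a, HasGrad S (fun v => (σ v).col i a)
      (fun l => (pdM S l σ u).col i a) u :=
    fun u hu i a => hasGrad_pd (H.diffM a i u hu)
  refine ⟨fun i j k u hu => (hasGrad_tri U (hg u hu i) (hg u hu j)
    (hg u hu k)).differentiableWithinAt, fun u hu l i j k => ?_⟩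
  rw [covDeriv, (hasGrad_tri U (hg u hu i) (hg u hu j) (hg u hu k)).pd_eq
    (H.regular.uniqueDiffOn u hu)]
  simp only [Finset.sum_add_distrib]
  rw [tri_sum_left, tri_sum_mid, tri_sum_right]
  have hs : ∀ i, ∑ m, christoffel S (frameMetric η σ) m l i u • (σ u).col m =
      (pdM S l σ u).col i + κ l u *ᵥ (σ u).col i := fun i => by
    ext a
    have := congrFun (congrFun (H.frame_mul_chrM hu l) a) i
    rw [Matrix.mul_apply, Matrix.add_apply, Matrix.mul_apply] at this
    simp only [Finset.sum_apply, Pi.smul_apply, smul_eq_mul, col_apply, Pi.add_apply,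
      mulVec, dotProduct]
    rw [← this]
    exact Finset.sum_congr rfl fun m _ => mul_comm _ _
  rw [hs, hs, hs, tri_add_left, tri_add_mid, tri_add_right]
  linear_combination -hinv _ (H.mem u hu l) ((σ u).col i) ((σ u).col j) ((σ u).col k)

end Trilinear

/-! ### The Lie algebra of split `G₂` -/

/-- The scalar product `2 w¹w⁷ + 2 w²w⁶ + 2 w³w⁵ + 2 (w⁴)²`. -/
def etaG2 : Matrix (Fin 7) (Fin 7) ℝ :=
  !![0, 0, 0, 0, 0, 0, 1; 0, 0, 0, 0, 0, 1, 0; 0, 0, 0, 0, 1, 0, 0; 0, 0, 0, 2, 0, 0, 0;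
    0, 0, 1, 0, 0, 0, 0; 0, 1, 0, 0, 0, 0, 0; 1, 0, 0, 0, 0, 0, 0]

/-- The 3-form `2 e¹²³ - e¹⁴⁷ - e²⁴⁶ - e³⁴⁵ + (1/2) e⁵⁶⁷` in the coframe given by the rows of
`σ`. -/
def upsForm {n : ℕ} (σ : Matrix (Fin 7) (Fin n) ℝ) : Fin n → Fin n → Fin n → ℝ :=
  (2 : ℝ) • wedge₃ (σ.row 0) (σ.row 1) (σ.row 2) + (-1 : ℝ) • wedge₃ (σ.row 0) (σ.row 3) (σ.row 6)
    + (-1 : ℝ) • wedge₃ (σ.row 1) (σ.row 3) (σ.row 5)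
    + (-1 : ℝ) • wedge₃ (σ.row 2) (σ.row 3) (σ.row 4)
    + (1 / 2 : ℝ) • wedge₃ (σ.row 4) (σ.row 5) (σ.row 6)

/-- The components of the 3-form that defines split `G₂` together with `etaG2`. -/
def upsG2 : Fin 7 → Fin 7 → Fin 7 → ℝ := upsForm 1

lemma tri_upsForm {n : ℕ} (σ : Matrix (Fin 7) (Fin n) ℝ) (x y z : Fin n → ℝ) :
    tri (upsForm σ) x y z =
      upsForm (Matrix.of fun a => ![σ.row a ⬝ᵥ x, σ.row a ⬝ᵥ y, σ.row a ⬝ᵥ z]) 0 1 2 := by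
  simp only [upsForm, tri_add_form, tri_smul_form, tri_wedge₃]
  rfl

lemma tri_upsG2 (x y z : Fin 7 → ℝ) :
    tri upsG2 x y z = upsForm (Matrix.of fun a => ![x a, y a, z a]) 0 1 2 := by
  rw [upsG2, tri_upsForm]
  congr! 6 <;> simp [one_apply, dotProduct]

lemma tri_upsG2_col {n : ℕ} (σ : Matrix (Fin 7) (Fin n) ℝ) (i j k : Fin n) :
    tri upsG2 (σ.col i) (σ.col j) (σ.col k) = upsForm σ i j k := by
  rw [tri_upsG2]
  rfl

/-- The explicit form of `tri upsG2`. -/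
lemma tri_upsG2_expand (x y z : Fin 7 → ℝ) :
    tri upsG2 x y z =
      2 * (x 0 * (y 1 * z 2 - y 2 * z 1) - x 1 * (y 0 * z 2 - y 2 * z 0)
        + x 2 * (y 0 * z 1 - y 1 * z 0))
      - (x 0 * (y 3 * z 6 - y 6 * z 3) - x 3 * (y 0 * z 6 - y 6 * z 0)
        + x 6 * (y 0 * z 3 - y 3 * z 0))
      - (x 1 * (y 3 * z 5 - y 5 * z 3) - x 3 * (y 1 * z 5 - y 5 * z 1)
        + x 5 * (y 1 * z 3 - y 3 * z 1))
      - (x 2 * (y 3 * z 4 - y 4 * z 3) - x 3 * (y 2 * z 4 - y 4 * z 2)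
        + x 4 * (y 2 * z 3 - y 3 * z 2))
      + 1 / 2 * (x 4 * (y 5 * z 6 - y 6 * z 5) - x 5 * (y 4 * z 6 - y 6 * z 4)
        + x 6 * (y 4 * z 5 - y 5 * z 4)) := by
  rw [tri_upsG2]
  simp [upsForm, wedge₃, det_fin_three]
  ring

/-- The Lie algebra of split `G₂`, as the stabilizer of `etaG2` and `upsG2`. -/
def lieG2 : Submodule ℝ (Matrix (Fin 7) (Fin 7) ℝ) where
  carrier := {X | etaG2 * X + Xᵀ * etaG2 = 0 ∧ TriInvariant upsG2 X}
  zero_mem' := ⟨by simp, fun x y z => by simp [tri]⟩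
  add_mem' := by
    rintro X Y ⟨hX, hX'⟩ ⟨hY, hY'⟩
    refine ⟨?_, fun x y z => ?_⟩
    · rw [transpose_add, Matrix.mul_add, Matrix.add_mul, ← add_zero (0 : Matrix _ _ ℝ)]
      nth_rewrite 1 [← hX]
      rw [← hY]
      abel
    · simp only [Matrix.add_mulVec, tri_add_left, tri_add_mid, tri_add_right]
      linear_combination hX' x y z + hY' x y z
  smul_mem' := by
    rintro c X ⟨hX, hX'⟩
    refine ⟨?_, fun x y z => ?_⟩
    · rw [transpose_smul, Matrix.mul_smul, Matrix.smul_mul, ← smul_add, hX, smul_zero]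
    · simp only [Matrix.smul_mulVec, tri_smul_left, tri_smul_mid, tri_smul_right]
      linear_combination c * hX' x y z

lemma lieG2_bracket (X : Matrix (Fin 7) (Fin 7) ℝ) (hX : X ∈ lieG2)
    (Y : Matrix (Fin 7) (Fin 7) ℝ) (hY : Y ∈ lieG2) : X * Y - Y * X ∈ lieG2 := by
  obtain ⟨hX, hX'⟩ := hX
  obtain ⟨hY, hY'⟩ := hY
  refine ⟨?_, fun x y z => ?_⟩
  · have e1 : etaG2 * X = -(Xᵀ * etaG2) := eq_neg_of_add_eq_zero_left hX
    have e2 : etaG2 * Y = -(Yᵀ * etaG2) := eq_neg_of_add_eq_zero_left hY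
    rw [transpose_sub, transpose_mul, transpose_mul, Matrix.mul_sub, ← Matrix.mul_assoc, e1,
      ← Matrix.mul_assoc, e2, Matrix.sub_mul, Matrix.neg_mul, Matrix.neg_mul, Matrix.mul_assoc,
      e2, Matrix.mul_assoc, e1]
    noncomm_ring
  · have h : ∀ w, (X * Y - Y * X) *ᵥ w = X *ᵥ (Y *ᵥ w) + (-1 : ℝ) • (Y *ᵥ (X *ᵥ w)) := fun w => by
      rw [Matrix.sub_mulVec, mulVec_mulVec, mulVec_mulVec]
      simp [sub_eq_add_neg]
    simp only [h, tri_add_left, tri_add_mid, tri_add_right, tri_smul_left, tri_smul_mid,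
      tri_smul_right]
    linear_combination hX' (Y *ᵥ x) y z + hX' x (Y *ᵥ y) z + hX' x y (Y *ᵥ z)
      - hY' (X *ᵥ x) y z - hY' x (X *ᵥ y) z - hY' x y (X *ᵥ z)

/-- The general element of the Lie algebra of split `G₂`; `kᵢⱼ` is its `(i, j)` component with the
first index lowered by `etaG2`. -/
def g2mat (k₁₂ k₁₃ k₁₅ k₁₆ k₁₇ k₂₃ k₂₅ k₂₆ k₂₇ k₃₆ k₃₇ k₅₆ k₅₇ k₆₇ : ℝ) :
    Matrix (Fin 7) (Fin 7) ℝ :=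
  !![-k₁₇, -k₂₇, -k₃₇, -k₂₃, -k₅₇, -k₆₇, 0;
    -k₁₆, -k₂₆, -k₃₆, k₁₃, -k₅₆, 0, k₆₇;
    -k₁₅, -k₂₅, k₁₇ + k₂₆, -k₁₂, 0, k₅₆, k₅₇;
    -2 * k₅₆, 2 * k₅₇, -2 * k₆₇, 0, k₁₂ / 2, -k₁₃ / 2, k₂₃ / 2;
    -k₁₃, -k₂₃, 0, 4 * k₆₇, -(k₁₇ + k₂₆), k₃₆, k₃₇;
    -k₁₂, 0, k₂₃, -4 * k₅₇, k₂₅, k₂₆, k₂₇;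
    0, k₁₂, k₁₃, 4 * k₅₆, k₁₅, k₁₆, k₁₇]

lemma g2mat_mem (k₁₂ k₁₃ k₁₅ k₁₆ k₁₇ k₂₃ k₂₅ k₂₆ k₂₇ k₃₆ k₃₇ k₅₆ k₅₇ k₆₇ : ℝ) :
    g2mat k₁₂ k₁₃ k₁₅ k₁₆ k₁₇ k₂₃ k₂₅ k₂₆ k₂₇ k₃₆ k₃₇ k₅₆ k₅₇ k₆₇ ∈ lieG2 := by
  refine ⟨?_, fun x y z => ?_⟩
  · ext i j
    fin_cases i <;> fin_cases j <;>
      simp [g2mat, etaG2, Matrix.mul_apply, Fin.sum_univ_succ] <;> ring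
  · simp only [tri_upsG2_expand]
    simp [g2mat, mulVec, dotProduct, Fin.sum_univ_succ]
    ring

end AmbientG2

end

noncomputable section

namespace AmbientG2

open Matrix

/-! ### Curvature tensors with values in the Lie algebra of split `G₂` -/

set_option maxHeartbeats 1000000 in
/-- Every element of the Lie algebra of split `G₂` is of the form `g2mat`. -/
lemma exists_eq_g2mat {X : Matrix (Fin 7) (Fin 7) ℝ} (hX : X ∈ lieG2) :
    ∃ k₁₂ k₁₃ k₁₅ k₁₆ k₁₇ k₂₃ k₂₅ k₂₆ k₂₇ k₃₆ k₃₇ k₅₆ k₅₇ k₆₇ : ℝ,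
      X = g2mat k₁₂ k₁₃ k₁₅ k₁₆ k₁₇ k₂₃ k₂₅ k₂₆ k₂₇ k₃₆ k₃₇ k₅₆ k₅₇ k₆₇ := by
  obtain ⟨h, ht⟩ := hX
  have hs : ∀ i j, (etaG2 * X) i j + (etaG2 * X) j i = 0 := fun i j => by
    have h' : Xᵀ * etaG2 = (etaG2 * X)ᵀ := by
      rw [transpose_mul]
      congr 1
      ext i j
      fin_cases i <;> fin_cases j <;> rfl
    rw [h'] at h
    exact congrFun (congrFun h i) j
  have hb : ∀ i j k : Fin 7, tri upsG2 (X.col i) (Pi.single j 1) (Pi.single k 1)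
      + tri upsG2 (Pi.single i 1) (X.col j) (Pi.single k 1)
      + tri upsG2 (Pi.single i 1) (Pi.single j 1) (X.col k) = 0 := fun i j k => by
    have := ht (Pi.single i 1) (Pi.single j 1) (Pi.single k 1)
    simpa only [mulVec_single_one] using this
  simp only [tri_upsG2_expand] at hb
  -- the seven relations that single out the Lie algebra among the skew matrices
  have r1 := hb 0 1 2
  have r2 := hb 0 1 3
  have r3 := hb 0 1 5
  have r4 := hb 0 1 6
  have r5 := hb 0 2 3
  have r6 := hb 0 2 6
  have r7 := hb 1 2 3
  simp at r1 r2 r3 r4 r5 r6 r7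
  clear hb
  obtain ⟨e0, e1, e2, e3, e4, e5, e6⟩ : (∀ b, (etaG2 * X) 0 b = X 6 b) ∧
      (∀ b, (etaG2 * X) 1 b = X 5 b) ∧ (∀ b, (etaG2 * X) 2 b = X 4 b) ∧
      (∀ b, (etaG2 * X) 3 b = 2 * X 3 b) ∧ (∀ b, (etaG2 * X) 4 b = X 2 b) ∧
      (∀ b, (etaG2 * X) 5 b = X 1 b) ∧ (∀ b, (etaG2 * X) 6 b = X 0 b) := by
    refine ⟨?_, ?_, ?_, ?_, ?_, ?_, ?_⟩ <;> intro b <;>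
      simp [etaG2, Matrix.mul_apply, Fin.sum_univ_succ]
  have d0 := hs 0 6
  have d1 := hs 1 5
  have d2 := hs 2 4
  have b0 := hs 0 1
  have b1 := hs 0 2
  have b2 := hs 1 2
  have c0 := hs 0 3
  have c1 := hs 1 3
  have c2 := hs 2 3
  have c4 := hs 4 3
  have c5 := hs 5 3
  have c6 := hs 6 3
  simp only [e0, e1, e2, e3, e4, e5, e6] at d0 d1 d2 b0 b1 b2 c0 c1 c2 c4 c5 c6
  refine ⟨X 6 1, X 6 2, X 6 4, X 6 5, X 6 6, X 5 2, X 5 4, X 5 5, X 5 6, X 4 5, X 4 6, X 2 5, X 2 6,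
    X 1 6, ?_⟩
  ext i j
  have s := hs (6 - i) j
  fin_cases i <;> fin_cases j <;> simp [g2mat] <;>
    simp [e0, e1, e2, e3, e4, e5, e6] at s <;> linarith

/-- A curvature tensor with values in the Lie algebra of split `G₂` that satisfies the first Bianchi
identity is Ricci-flat. By the pair symmetry of such a tensor `R`, the Bianchi identity also applies
to the last three indices; the Ricci components are then combinations of three instances of it. -/
lemma sum_eq_zero_of_mem_lieG2 (K : Fin 7 → Fin 7 → Matrix (Fin 7) (Fin 7) ℝ)
    (hK : ∀ c d, K c d ∈ lieG2) (hs : ∀ c d, K c d = -K d c)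
    (hB : ∀ a b c d, K c d a b + K d b a c + K b c a d = 0) (d b : Fin 7) :
    ∑ a, K a d a b = 0 := by
  set R : Fin 7 → Fin 7 → Fin 7 → Fin 7 → ℝ := fun c d e f => (etaG2 * K c d) e f with hR
  have R1 : ∀ c d e f, R c d e f = -R d c e f := fun c d e f => by
    simp only [hR]
    rw [hs c d, Matrix.mul_neg, Matrix.neg_apply]
  have R2 : ∀ c d e f, R c d e f = -R c d f e := fun c d e f => by
    have h := (hK c d).1
    have h' : (K c d)ᵀ * etaG2 = (etaG2 * K c d)ᵀ := by
      rw [transpose_mul]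
      congr 1
      ext i j
      fin_cases i <;> fin_cases j <;> rfl
    rw [h'] at h
    exact eq_neg_of_add_eq_zero_left (congrFun (congrFun h e) f)
  have R3 : ∀ c d e f, R c d e f + R d f e c + R f c e d = 0 := fun c d e f => by
    simp only [hR, Matrix.mul_apply, ← Finset.sum_add_distrib, ← mul_add, hB, mul_zero,
      Finset.sum_const_zero]
  have R4 : ∀ c d e f, R c d e f = R e f c d := fun c d e f => by
    linarith [R3 c d e f, R3 d e c f, R3 c e d f, R3 c d f e, R1 c d e f, R2 c d e f, R1 d f e c,
      R2 d f e c, R1 f c e d, R2 f c e d, R1 d e c f, R2 d e c f, R1 e f c d, R2 e f c d,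
      R1 f d c e, R2 f d c e, R1 c e d f, R2 c e d f, R1 e f d c, R2 e f d c, R1 f c d e,
      R2 f c d e, R1 c d f e, R2 c d f e, R1 d e f c, R2 d e f c, R1 e c f d, R2 e c f d]
  have R5 : ∀ a e f, R d a e f + R d e f a + R d f a e = 0 := fun a e f => by
    linarith [R3 e f d a, R4 d a e f, R4 d e f a, R4 d f a e, R2 a e d f, R2 f a d e, R2 e f d a,
      R1 e f d a, R1 f a d e, R1 a e d f]
  choose k₁₂ k₁₃ k₁₅ k₁₆ k₁₇ k₂₃ k₂₅ k₂₆ k₂₇ k₃₆ k₃₇ k₅₆ k₅₇ k₆₇ hk using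
    fun a => exists_eq_g2mat (hK d a)
  have hsum : ∑ a, K a d a b = -∑ a, K d a a b := by
    rw [← Finset.sum_neg_distrib]
    exact Finset.sum_congr rfl fun a _ => by rw [hs a d, Matrix.neg_apply]
  rw [hsum, neg_eq_zero]
  simp only [hR, hk] at R5
  simp only [hk]
  simp only [etaG2, g2mat, Matrix.mul_apply, Fin.sum_univ_succ] at R5 ⊢
  -- for each `b`, the instances of `R5` that combine to the Ricci component
  fin_cases b
  · have a1 := R5 0 2 4
    have a2 := R5 0 1 5
    have a3 := R5 3 4 5
    simp at a1 a2 a3 ⊢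
    linarith
  · have a1 := R5 0 1 6
    have a2 := R5 1 2 4
    have a3 := R5 3 4 6
    simp at a1 a2 a3 ⊢
    linarith
  · have a1 := R5 0 2 6
    have a2 := R5 1 2 5
    have a3 := R5 3 5 6
    simp at a1 a2 a3 ⊢
    linarith
  · have a1 := R5 0 1 2
    have a2 := R5 2 3 4
    have a3 := R5 1 3 5
    have a4 := R5 0 3 6
    simp at a1 a2 a3 a4 ⊢
    linarith
  · have a1 := R5 0 4 6
    have a2 := R5 1 4 5
    have a3 := R5 0 1 3
    simp at a1 a2 a3 ⊢
    linarith
  · have a1 := R5 0 5 6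
    have a2 := R5 2 4 5
    have a3 := R5 0 2 3
    simp at a1 a2 a3 ⊢
    linarith
  · have a1 := R5 1 5 6
    have a2 := R5 2 4 6
    have a3 := R5 1 2 3
    simp at a1 a2 a3 ⊢
    linarith

variable {S : Set (Fin 7 → ℝ)} {σ : (Fin 7 → ℝ) → Matrix (Fin 7) (Fin 7) ℝ}
  {κ : Fin 7 → (Fin 7 → ℝ) → Matrix (Fin 7) (Fin 7) ℝ}

lemma IsConnectionForm.isRicciFlat (H : IsConnectionForm S etaG2 lieG2 σ κ) :
    IsRicciFlat S (frameMetric etaG2 σ) := fun _ hu i j =>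
  H.ricci_eq_zero hu (sum_eq_zero_of_mem_lieG2 _ (H.frameCurv_mem hu)
    (fun c d => IsConnectionForm.frameCurv_antisymm c d) fun a b c d =>
      H.frameCurv_bianchi hu a b c d) i j

end AmbientG2

end

noncomputable section

namespace AmbientG2

open Matrix

/-! ### Parallel transport preserves the invariants -/

section Transport

variable {n : ℕ} {S : Set (Fin n → ℝ)} {η : Matrix (Fin n) (Fin n) ℝ}
  {𝔤 : Submodule ℝ (Matrix (Fin n) (Fin n) ℝ)}
  {σ : (Fin n → ℝ) → Matrix (Fin n) (Fin n) ℝ}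
  {κ : Fin n → (Fin n → ℝ) → Matrix (Fin n) (Fin n) ℝ}

/-- The coframe components `w = σV` of a parallel vector field `V` satisfy `w' = -κ(γ') w`. -/
lemma IsConnectionForm.hasDerivWithinAt_frame (H : IsConnectionForm S η 𝔤 σ κ)
    {γ : ℝ → Fin n → ℝ} (hγ : ContDiffOn ℝ 1 γ (Set.Icc 0 1))
    (hS : ∀ s ∈ Set.Icc (0 : ℝ) 1, γ s ∈ S)
    {s : ℝ} (hs : s ∈ Set.Icc (0 : ℝ) 1) :
    ∃ X ∈ 𝔤, ∀ V, IsParallelAlong S (frameMetric η σ) γ V → ∀ a,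
      HasDerivWithinAt (fun s => (σ (γ s) *ᵥ V s) a) (-(X *ᵥ (σ (γ s) *ᵥ V s)) a)
        (Set.Icc 0 1) s := by
  have hu := hS s hs
  set γ' : Fin n → ℝ := derivWithin γ (Set.Icc 0 1) s with hγ'
  have hd : HasDerivWithinAt γ γ' (Set.Icc 0 1) s :=
    (hγ.differentiableOn one_ne_zero s hs).hasDerivWithinAt
  refine ⟨∑ l, γ' l • κ l (γ s), 𝔤.sum_mem fun l _ => 𝔤.smul_mem _ (H.mem _ hu l),
    fun V hV a => ?_⟩
  have h1 : ∀ i, HasDerivWithinAt (fun s => σ (γ s) a i)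
      (∑ l, pdM S l σ (γ s) a i * γ' l) (Set.Icc 0 1) s := fun i => by
    have := HasFDerivWithinAt.comp_hasDerivWithinAt s (hasGrad_pd (H.diffM a i (γ s) hu)) hd hS
    exact HasDerivWithinAt.congr_deriv this (covec_apply _ _)
  have h2 : ∀ i, HasDerivWithinAt (fun s => V s i)
      (-∑ l, ∑ j, christoffel S (frameMetric η σ) i l j (γ s) * γ' l * V s j) (Set.Icc 0 1) s :=
    hasDerivWithinAt_pi.1 (hV s hs)
  have h3 := HasDerivWithinAt.fun_sum (u := Finset.univ) fun i _ => (h1 i).mul (h2 i)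
  refine h3.congr_deriv ?_
  have h4 : ∀ l j, ∑ i, σ (γ s) a i * christoffel S (frameMetric η σ) i l j (γ s) =
      pdM S l σ (γ s) a j + (κ l (γ s) * σ (γ s)) a j := fun l j => by
    have := congrFun (congrFun (H.frame_mul_chrM hu l) a) j
    rwa [Matrix.mul_apply] at this
  have h5 : ∑ i, σ (γ s) a i * (-∑ l, ∑ j, christoffel S (frameMetric η σ) i l j (γ s) *
      γ' l * V s j) = -∑ l, ∑ j, γ' l * V s j * (pdM S l σ (γ s) a j
        + (κ l (γ s) * σ (γ s)) a j) := by
    simp only [← h4, mul_neg, Finset.sum_neg_distrib, Finset.mul_sum]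
    rw [Finset.sum_comm]
    congr 1
    refine Finset.sum_congr rfl fun l _ => ?_
    rw [Finset.sum_comm]
    exact Finset.sum_congr rfl fun j _ => Finset.sum_congr rfl fun i _ => by ring
  have h6 : ((∑ l, γ' l • κ l (γ s)) *ᵥ (σ (γ s) *ᵥ V s)) a =
      ∑ l, ∑ j, γ' l * V s j * (κ l (γ s) * σ (γ s)) a j := by
    rw [Matrix.sum_mulVec, Finset.sum_apply]
    refine Finset.sum_congr rfl fun l _ => ?_
    rw [Matrix.smul_mulVec, mulVec_mulVec, Pi.smul_apply, smul_eq_mul, mulVec, dotProduct,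
      Finset.mul_sum]
    exact Finset.sum_congr rfl fun j _ => by ring
  have h7 : ∑ i, (∑ l, pdM S l σ (γ s) a i * γ' l) * V s i =
      ∑ l, ∑ j, γ' l * V s j * pdM S l σ (γ s) a j := by
    simp only [Finset.sum_mul]
    rw [Finset.sum_comm]
    exact Finset.sum_congr rfl fun l _ => Finset.sum_congr rfl fun j _ => by ring
  rw [Finset.sum_add_distrib, h5, h6, h7]
  simp only [mul_add, Finset.sum_add_distrib]
  ring

lemma const_of_hasDerivWithinAt_zero {F : ℝ → ℝ}
    (h : ∀ s ∈ Set.Icc (0 : ℝ) 1, HasDerivWithinAt F 0 (Set.Icc 0 1) s) : F 1 = F 0 :=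
  constant_of_derivWithin_zero (fun s hs => (h s hs).differentiableWithinAt)
    (fun s hs => (h s (Set.Ico_subset_Icc_self hs)).derivWithin
      (uniqueDiffOn_Icc_zero_one s (Set.Ico_subset_Icc_self hs))) 1 (by simp)

/-- Parallel transport preserves the metric. -/
lemma IsTransport.metric (H : IsConnectionForm S η 𝔤 σ κ) {a b : Fin n → ℝ}
    {T : (Fin n → ℝ) →ₗ[ℝ] (Fin n → ℝ)} (hT : IsTransport S (frameMetric η σ) a b T)
    (x y : Fin n → ℝ) :
    (σ b *ᵥ T x) ⬝ᵥ (η *ᵥ (σ b *ᵥ T y)) = (σ a *ᵥ x) ⬝ᵥ (η *ᵥ (σ a *ᵥ y)) := by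
  induction hT generalizing x y with
  | segment γ T hγ hS hT =>
    obtain ⟨X, hX, hX0, hX1⟩ := hT x
    obtain ⟨Y, hY, hY0, hY1⟩ := hT y
    rw [← hX1, ← hY1, ← hX0, ← hY0]
    refine const_of_hasDerivWithinAt_zero
      (F := fun s => (σ (γ s) *ᵥ X s) ⬝ᵥ (η *ᵥ (σ (γ s) *ᵥ Y s))) fun s hs => ?_
    obtain ⟨A, hA, hA'⟩ := H.hasDerivWithinAt_frame hγ hS hs
    set v := σ (γ s) *ᵥ X s
    set w := σ (γ s) *ᵥ Y s
    have h1 := HasDerivWithinAt.fun_sum (u := Finset.univ) fun i _ => (hA' X hX i).mul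
      (HasDerivWithinAt.fun_sum (u := Finset.univ) fun j _ => (hA' Y hY j).const_mul (η i j))
    refine h1.congr_deriv ?_
    have h2 : v ⬝ᵥ ((η * A + Aᵀ * η) *ᵥ w) = 0 := by rw [H.skew A hA]; simp
    rw [Matrix.add_mulVec, dotProduct_add, ← mulVec_mulVec, ← mulVec_mulVec,
      dotProduct_mulVec v Aᵀ, vecMul_transpose] at h2
    have h3 : ∀ p q : Fin n → ℝ, p ⬝ᵥ (η *ᵥ q) = ∑ i, p i * ∑ j, η i j * q j := fun p q => rfl
    rw [h3, h3] at h2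
    rw [← neg_zero, ← h2, add_comm, neg_add, ← Finset.sum_neg_distrib, ← Finset.sum_neg_distrib,
      ← Finset.sum_add_distrib]
    refine Finset.sum_congr rfl fun i _ => ?_
    simp only [mul_neg, Finset.sum_neg_distrib, neg_mul, v, w]
  | concat a b c T T' h h' ih ih' =>
    simp only [LinearMap.comp_apply]
    rw [ih', ih]

/-- Parallel transport preserves the 3-forms with constant invariant components. -/
lemma IsTransport.tri (H : IsConnectionForm S η 𝔤 σ κ) {U : Fin n → Fin n → Fin n → ℝ}
    (hinv : ∀ X ∈ 𝔤, TriInvariant U X) {a b : Fin n → ℝ}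
    {T : (Fin n → ℝ) →ₗ[ℝ] (Fin n → ℝ)} (hT : IsTransport S (frameMetric η σ) a b T)
    (x y z : Fin n → ℝ) :
    tri U (σ b *ᵥ T x) (σ b *ᵥ T y) (σ b *ᵥ T z) = tri U (σ a *ᵥ x) (σ a *ᵥ y) (σ a *ᵥ z) := by
  induction hT generalizing x y z with
  | segment γ T hγ hS hT =>
    obtain ⟨X, hX, hX0, hX1⟩ := hT x
    obtain ⟨Y, hY, hY0, hY1⟩ := hT y
    obtain ⟨Z, hZ, hZ0, hZ1⟩ := hT z
    rw [← hX1, ← hY1, ← hZ1, ← hX0, ← hY0, ← hZ0]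
    refine const_of_hasDerivWithinAt_zero (F := fun s => AmbientG2.tri U (σ (γ s) *ᵥ X s)
      (σ (γ s) *ᵥ Y s) (σ (γ s) *ᵥ Z s)) fun s hs => ?_
    obtain ⟨A, hA, hA'⟩ := H.hasDerivWithinAt_frame hγ hS hs
    have h1 := HasDerivWithinAt.fun_sum (u := Finset.univ) fun i _ =>
      HasDerivWithinAt.fun_sum (u := Finset.univ) fun j _ =>
      HasDerivWithinAt.fun_sum (u := Finset.univ) fun k _ =>
        (((hA' X hX i).const_mul (U i j k)).mul (hA' Y hY j)).mul (hA' Z hZ k)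
    refine h1.congr_deriv ?_
    rw [← neg_zero, ← hinv A hA (σ (γ s) *ᵥ X s) (σ (γ s) *ᵥ Y s) (σ (γ s) *ᵥ Z s)]
    simp only [AmbientG2.tri, Pi.mul_apply, ← Finset.sum_add_distrib, ← Finset.sum_neg_distrib]
    exact Finset.sum_congr rfl fun _ _ => Finset.sum_congr rfl fun _ _ =>
      Finset.sum_congr rfl fun _ _ => by ring
  | concat a b c T T' h h' ih ih' =>
    simp only [LinearMap.comp_apply]
    rw [ih', ih]

end Transport

/-! ### The imaginary split octonions -/

/-- The imaginary split octonion with the components `w` in a coframe in which the metric is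
`etaG2`. -/
def octMap : (Fin 7 → ℝ) →ₗ[ℝ] SplitOct where
  toFun w := (!![√2 * w 3, -w 2; -2 * w 4, -(√2 * w 3)],
    !![2 * √2 * w 0, -w 5; 2 * w 1, √2 / 2 * w 6])
  map_add' x y := by
    ext i j <;> fin_cases i <;> fin_cases j <;> simp <;> ring
  map_smul' c x := by
    ext i j <;> fin_cases i <;> fin_cases j <;> simp <;> ring

/-- The vector product of imaginary split octonions: the imaginary part of the product. -/
def octCross (x y : Fin 7 → ℝ) : Fin 7 → ℝ :=
  √2 • ![-(x 0 * y 3 - x 3 * y 0) + 1 / 2 * (x 4 * y 5 - x 5 * y 4),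
    -(x 1 * y 3 - x 3 * y 1) - 1 / 2 * (x 4 * y 6 - x 6 * y 4),
    -(x 2 * y 3 - x 3 * y 2) + 1 / 2 * (x 5 * y 6 - x 6 * y 5),
    1 / 2 * ((x 0 * y 6 - x 6 * y 0) + (x 1 * y 5 - x 5 * y 1) + (x 2 * y 4 - x 4 * y 2)),
    2 * (x 0 * y 1 - x 1 * y 0) - (x 3 * y 4 - x 4 * y 3),
    -(2 * (x 0 * y 2 - x 2 * y 0)) - (x 3 * y 5 - x 5 * y 3),
    2 * (x 1 * y 2 - x 2 * y 1) - (x 3 * y 6 - x 6 * y 3)]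

lemma etaG2_form (x y : Fin 7 → ℝ) : x ⬝ᵥ (etaG2 *ᵥ y) =
    x 0 * y 6 + x 1 * y 5 + x 2 * y 4 + 2 * x 3 * y 3 + x 4 * y 2 + x 5 * y 1 + x 6 * y 0 := by
  simp [etaG2, mulVec, dotProduct, Fin.sum_univ_succ]
  ring

lemma octCross_form (x y z : Fin 7 → ℝ) :
    octCross x y ⬝ᵥ (etaG2 *ᵥ z) = √2 * tri upsG2 x y z := by
  rw [etaG2_form, tri_upsG2_expand]
  simp [octCross]
  ring

lemma omul_octMap (x y : Fin 7 → ℝ) :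
    omul (octMap x) (octMap y) = (x ⬝ᵥ (etaG2 *ᵥ y)) • oone + octMap (octCross x y) := by
  have h2 : √2 * √2 = 2 := Real.mul_self_sqrt (by norm_num)
  rw [etaG2_form]
  ext i j <;> fin_cases i <;> fin_cases j <;>
    simp [omul, octMap, oone, octCross, adjugate_fin_two] <;>
    grind

lemma etaG2_nondegenerate {x : Fin 7 → ℝ} (h : ∀ y, x ⬝ᵥ (etaG2 *ᵥ y) = 0) : x = 0 := by
  simp only [etaG2_form] at h
  ext i
  fin_cases i
  · simpa using h (Pi.single 6 1)
  · simpa using h (Pi.single 5 1)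
  · simpa using h (Pi.single 4 1)
  · simpa using h (Pi.single 3 1)
  · simpa using h (Pi.single 2 1)
  · simpa using h (Pi.single 1 1)
  · simpa using h (Pi.single 0 1)

/-- The split octonions as sums of real and imaginary ones. -/
def octSum : ℝ × (Fin 7 → ℝ) →ₗ[ℝ] SplitOct :=
  (LinearMap.toSpanSingleton ℝ SplitOct oone).coprod octMap

lemma octSum_injective : Function.Injective octSum := by
  rw [← LinearMap.ker_eq_bot, LinearMap.ker_eq_bot']
  rintro ⟨r, w⟩ h
  have h2 : √2 ≠ 0 := by positivity
  have e := fun i j => congrFun (congrFun (congrArg Prod.fst h) i) j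
  have e' := fun i j => congrFun (congrFun (congrArg Prod.snd h) i) j
  have e00 := e 0 0
  have e01 := e 0 1
  have e10 := e 1 0
  have e11 := e 1 1
  have f00 := e' 0 0
  have f01 := e' 0 1
  have f10 := e' 1 0
  have f11 := e' 1 1
  simp [octSum, octMap, oone] at e00 e01 e10 e11 f00 f01 f10 f11
  have hr : r = 0 := by linarith
  have h3 : w 3 = 0 := by
    have : √2 * w 3 = 0 := by linarith
    exact (mul_eq_zero.1 this).resolve_left h2
  refine Prod.ext hr (funext fun i => ?_)
  fin_cases i <;> simp <;> assumption

/-- The split octonions are the direct sum of the real and the imaginary ones. -/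
def octEquiv : (ℝ × (Fin 7 → ℝ)) ≃ₗ[ℝ] SplitOct :=
  octSum.linearEquivOfInjective octSum_injective
    (by simp [Module.finrank_matrix])

lemma octEquiv_apply (r : ℝ) (w : Fin 7 → ℝ) : octEquiv (r, w) = r • oone + octMap w := by
  simp [octEquiv, octSum]

lemma omul_oone (u : SplitOct) : omul u oone = u := by
  ext i j <;> simp [omul, oone]

lemma oone_omul (u : SplitOct) : omul oone u = u := by
  ext i j <;> simp [omul, oone]

lemma adjugate_two_add (A B : Matrix (Fin 2) (Fin 2) ℝ) :
    (A + B).adjugate = A.adjugate + B.adjugate := by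
  ext i j
  fin_cases i <;> fin_cases j <;> simp [adjugate_fin_two] <;> ring

lemma adjugate_two_smul (c : ℝ) (A : Matrix (Fin 2) (Fin 2) ℝ) :
    (c • A).adjugate = c • A.adjugate := by
  ext i j
  fin_cases i <;> fin_cases j <;> simp [adjugate_fin_two]

lemma omul_add (u v w : SplitOct) : omul u (v + w) = omul u v + omul u w := by
  ext1 <;> simp only [omul, Prod.fst_add, Prod.snd_add, adjugate_two_add] <;> noncomm_ring

lemma add_omul (u v w : SplitOct) : omul (u + v) w = omul u w + omul v w := by
  ext1 <;> simp only [omul, Prod.fst_add, Prod.snd_add] <;> noncomm_ring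

lemma omul_smul (c : ℝ) (u v : SplitOct) : omul u (c • v) = c • omul u v := by
  ext1 <;> simp [omul, adjugate_two_smul]

lemma smul_omul (c : ℝ) (u v : SplitOct) : omul (c • u) v = c • omul u v := by
  ext1 <;> simp [omul]

lemma omul_octEquiv (r r' : ℝ) (w w' : Fin 7 → ℝ) :
    omul (octEquiv (r, w)) (octEquiv (r', w')) =
      octEquiv (r * r' + w ⬝ᵥ (etaG2 *ᵥ w'), r • w' + r' • w + octCross w w') := by
  simp only [octEquiv_apply, add_omul, omul_add, omul_smul, smul_omul, omul_oone, oone_omul,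
    omul_octMap, map_add, map_smul, smul_add]
  module

lemma range_octMap : LinearMap.range octMap = imSplitOct := by
  ext X
  constructor
  · rintro ⟨w, rfl⟩
    change Matrix.trace _ = 0
    simp [octMap, trace_fin_two]
  · intro hX
    obtain ⟨⟨r, w⟩, rfl⟩ := octEquiv.surjective X
    rw [octEquiv_apply] at hX ⊢
    have h : Matrix.trace (r • oone + octMap w).1 = 0 := hX
    have hr : r = 0 := by
      simp [oone, octMap, trace_fin_two] at h
      linarith
    exact ⟨w, by simp [hr]⟩

/-- A linear map of the imaginary split octonions that preserves the scalar product and the 3-form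
extends to an automorphism of the split octonions. -/
lemma exists_splitG2 (N : (Fin 7 → ℝ) →ₗ[ℝ] (Fin 7 → ℝ))
    (hη : ∀ x y, N x ⬝ᵥ (etaG2 *ᵥ N y) = x ⬝ᵥ (etaG2 *ᵥ y))
    (hU : ∀ x y z, tri upsG2 (N x) (N y) (N z) = tri upsG2 x y z) :
    ∃ φ ∈ splitG2, ∀ w, φ (octMap w) = octMap (N w) := by
  have hinj : Function.Injective N := by
    rw [← LinearMap.ker_eq_bot, LinearMap.ker_eq_bot']
    intro x hx
    refine etaG2_nondegenerate fun y => ?_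
    rw [← hη, hx, zero_dotProduct]
  set N' : (Fin 7 → ℝ) ≃ₗ[ℝ] (Fin 7 → ℝ) := LinearEquiv.ofInjectiveEndo N hinj with hN'
  have hN : ∀ x, N' x = N x := fun x => rfl
  -- the vector product is determined by the scalar product and the 3-form
  have hcross : ∀ x y, N (octCross x y) = octCross (N x) (N y) := fun x y => by
    rw [← sub_eq_zero]
    refine etaG2_nondegenerate fun z => ?_
    obtain ⟨z, rfl⟩ := N'.surjective z
    rw [hN, sub_dotProduct, hη, octCross_form, octCross_form, hU, sub_self]
  set φ : SplitOct ≃ₗ[ℝ] SplitOct :=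
    (octEquiv.symm.trans ((LinearEquiv.refl ℝ ℝ).prodCongr N')).trans octEquiv with hφ
  have hφ' : ∀ r w, φ (octEquiv (r, w)) = octEquiv (r, N w) := fun r w => by
    simp [hφ, hN]
  refine ⟨φ, fun u v => ?_, fun w => ?_⟩
  · obtain ⟨⟨r, x⟩, rfl⟩ := octEquiv.surjective u
    obtain ⟨⟨r', y⟩, rfl⟩ := octEquiv.surjective v
    simp only [hφ', omul_octEquiv, map_add, map_smul, hη, hcross]
  · have := hφ' 0 w
    simpa only [octEquiv_apply, zero_smul, zero_add] using this

variable {S : Set (Fin 7 → ℝ)} {σ : (Fin 7 → ℝ) → Matrix (Fin 7) (Fin 7) ℝ}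
  {κ : Fin 7 → (Fin 7 → ℝ) → Matrix (Fin 7) (Fin 7) ℝ}

lemma IsConnectionForm.holonomyInSplitG2 (H : IsConnectionForm S etaG2 lieG2 σ κ) :
    HolonomyInSplitG2 S (frameMetric etaG2 σ) := by
  intro u hu
  have hinj : Function.Injective (σ u).mulVecLin := by
    rw [coe_mulVecLin, mulVec_injective_iff_isUnit, isUnit_iff_isUnit_det]
    exact isUnit_iff_ne_zero.2 (H.det_ne_zero u hu)
  have hoct : Function.Injective octMap := fun x y h => by
    have : octEquiv (0, x) = octEquiv (0, y) := by simp [octEquiv_apply, h]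
    exact (Prod.ext_iff.1 (octEquiv.injective this)).2
  have hsurj : Function.Surjective (σ u).mulVecLin := LinearMap.surjective_of_injective hinj
  refine ⟨octMap ∘ₗ (σ u).mulVecLin, hoct.comp hinj, ?_, fun v => ?_, fun T hT => ?_⟩
  · rw [LinearMap.range_comp_of_range_eq_top _ (LinearMap.range_eq_top.2 hsurj), range_octMap]
  · have hc : octCross (σ u *ᵥ v) (σ u *ᵥ v) = 0 := by
      ext i
      fin_cases i <;> simp [octCross] <;> ring
    rw [LinearMap.comp_apply, mulVecLin_apply, omul_octMap, hc, map_zero, add_zero]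
    congr 1
    rw [mulVec_mulVec, dotProduct_mulVec, ← vecMul_transpose, vecMul_vecMul, ← Matrix.mul_assoc,
      ← dotProduct_mulVec]
    simp only [frameMetric, mulVec, dotProduct, Finset.mul_sum]
    exact Finset.sum_congr rfl fun i _ => Finset.sum_congr rfl fun j _ => by ring
  -- `e T e⁻¹` is the matrix in the coframe of the transport `T` along a loop
  · set e : (Fin 7 → ℝ) ≃ₗ[ℝ] (Fin 7 → ℝ) := LinearEquiv.ofInjectiveEndo _ hinj with he
    have hev : ∀ v, e v = σ u *ᵥ v := fun v => rfl
    have hη : ∀ x y, e (T (e.symm x)) ⬝ᵥ (etaG2 *ᵥ e (T (e.symm y))) = x ⬝ᵥ (etaG2 *ᵥ y) := by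
      intro x y
      obtain ⟨x, rfl⟩ := e.surjective x
      obtain ⟨y, rfl⟩ := e.surjective y
      rw [LinearEquiv.symm_apply_apply, LinearEquiv.symm_apply_apply]
      exact IsTransport.metric H hT x y
    have hU : ∀ x y z, tri upsG2 (e (T (e.symm x))) (e (T (e.symm y))) (e (T (e.symm z))) =
        tri upsG2 x y z := by
      intro x y z
      obtain ⟨x, rfl⟩ := e.surjective x
      obtain ⟨y, rfl⟩ := e.surjective y
      obtain ⟨z, rfl⟩ := e.surjective z
      rw [LinearEquiv.symm_apply_apply, LinearEquiv.symm_apply_apply,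
        LinearEquiv.symm_apply_apply]
      exact IsTransport.tri H (fun X hX => hX.2) hT x y z
    obtain ⟨φ, hφ, hφ'⟩ := exists_splitG2 (e.toLinearMap ∘ₗ T ∘ₗ e.symm.toLinearMap) hη hU
    refine ⟨φ, hφ, fun v => ?_⟩
    have := hφ' (e v)
    simp only [LinearMap.comp_apply, LinearEquiv.coe_coe, LinearEquiv.symm_apply_apply] at this
    exact this

end AmbientG2

end

noncomputable section

namespace AmbientG2

open Matrix

/-! ### The connection form of the null coframe -/

/-- The coordinates of a point of the ambient space together with the derivatives, at that point, of
`f`, `h` and of a solution `A, B, C` of the first order system that occur in the first derivatives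
of the null coframe. The derivatives given by the system are omitted. -/
structure Jet where
  (t z p q r f fx fy fp fpx fpy fpp fppx fppy fppp h hx hy hxx hxy hyy
    A Ax Ay Ap Ar B Bx By C Cx Cy : ℝ)

namespace Jet

variable (J : Jet)

/-- `B_p`. -/
def Bp : ℝ := 5 / 9 * J.A - 2 / 9 * J.r * J.Ar

/-- `B_ϱ`. -/
def Br : ℝ := -(1 / 72) * J.Ap - 1 / 40 * J.fppp - 3 / 20 * J.hy

/-- `C_p`. -/
def Cp : ℝ := 1 / 324 * J.r * J.Ap + 2 / 3 * J.B + 1 / 180 * J.r * J.fppp + 1 / 30 * J.r * J.hy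

/-- `C_ϱ`. -/
def Cr : ℝ := 1 / 648 * J.A - 1 / 72 * J.Bp - 1 / 90 * J.fpp + 2 / 45 * J.h ^ 2
  - 1 / 15 * (J.p * J.hy + J.hx)

/-- The coefficient of `t² θ¹` in `ω⁶`. -/
def E : ℝ := (9 * J.fpp + 4 * J.h ^ 2 - 6 * (J.p * J.hy + J.hx)) / 10 + J.A / 2

/-- The coefficient of `t² dx` in `ω⁶`. -/
def G : ℝ := 4 * J.h * J.q + 3 * J.fp + 3 * J.B - J.p * J.E

/-- The coefficient of `t² dx` in `ω³`. -/
def Q : ℝ := J.f + J.h * J.z - J.q ^ 2 + 3 / 2 * J.C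

/-- The matrix of the null coframe `ω¹/√2, ω², ω³, ω⁴/√2, ω⁵, ω⁶, √2 ω⁷`; the factors make it
rational. -/
def sigma : Matrix (Fin 7) (Fin 7) ℝ :=
  !![9, 3 * J.t * J.h, 0, 0, 0, 0, 0;
    0, -J.p, 1, 0, 0, 0, 0;
    -(1 / 9) * J.t * J.h * J.r, J.t ^ 2 * J.Q, 0, -J.t ^ 2, 2 * J.t ^ 2 * J.q, 0,
      -(1 / 9) * J.t ^ 2 * J.h;
    0, -2 * J.t * J.q, 0, 0, 2 * J.t, 0, 0;
    0, 3, 0, 0, 0, 0, 0;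
    0, J.t ^ 2 * J.G, J.t ^ 2 * J.E, 0, 2 * J.t ^ 2 * J.h, -6 * J.t ^ 2, 0;
    1 / 9 * J.r, 0, 0, 0, 0, 0, 1 / 9 * J.t]

/-- The partial derivatives of `E`. -/
def dE : Fin 7 → ℝ :=
  ![0, (9 * J.fppx + 8 * J.h * J.hx - 6 * (J.p * J.hxy + J.hxx)) / 10 + J.Ax / 2,
    (9 * J.fppy + 8 * J.h * J.hy - 6 * (J.p * J.hyy + J.hxy)) / 10 + J.Ay / 2, 0,
    (9 * J.fppp - 6 * J.hy) / 10 + J.Ap / 2, 0, J.Ar / 2]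

/-- The partial derivatives of `G`. -/
def dG : Fin 7 → ℝ :=
  ![0, 4 * J.hx * J.q + 3 * J.fpx + 3 * J.Bx - J.p * J.dE 1,
    4 * J.hy * J.q + 3 * J.fpy + 3 * J.By - J.p * J.dE 2, 0,
    3 * J.fpp + 3 * J.Bp - J.E - J.p * J.dE 4, 4 * J.h, 3 * J.Br - J.p * J.dE 6]

/-- The partial derivatives of `Q`. -/
def dQ : Fin 7 → ℝ :=
  ![0, J.fx + J.hx * J.z + 3 / 2 * J.Cx, J.fy + J.hy * J.z + 3 / 2 * J.Cy, J.h,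
    J.fp + 3 / 2 * J.Cp, -2 * J.q, 3 / 2 * J.Cr]

/-- The partial derivatives of the entries of `sigma`: `dsigma a j i = ∂ᵢ ωᵃⱼ`. -/
def dsigma : Fin 7 → Fin 7 → Fin 7 → ℝ :=
  ![![0, ![3 * J.h, 3 * J.t * J.hx, 3 * J.t * J.hy, 0, 0, 0, 0], 0, 0, 0, 0, 0],
    ![0, ![0, 0, 0, 0, -1, 0, 0], 0, 0, 0, 0, 0],
    ![![-(1 / 9) * J.h * J.r, -(1 / 9) * J.t * J.hx * J.r, -(1 / 9) * J.t * J.hy * J.r, 0, 0, 0,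
        -(1 / 9) * J.t * J.h],
      ![2 * J.t * J.Q, J.t ^ 2 * J.dQ 1, J.t ^ 2 * J.dQ 2, J.t ^ 2 * J.dQ 3, J.t ^ 2 * J.dQ 4,
        J.t ^ 2 * J.dQ 5, J.t ^ 2 * J.dQ 6],
      0, ![-2 * J.t, 0, 0, 0, 0, 0, 0], ![4 * J.t * J.q, 0, 0, 0, 0, 2 * J.t ^ 2, 0], 0,
      ![-(2 / 9) * J.t * J.h, -(1 / 9) * J.t ^ 2 * J.hx, -(1 / 9) * J.t ^ 2 * J.hy, 0, 0, 0, 0]],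
    ![0, ![-2 * J.q, 0, 0, 0, 0, -2 * J.t, 0], 0, 0, ![2, 0, 0, 0, 0, 0, 0], 0, 0],
    ![0, 0, 0, 0, 0, 0, 0],
    ![0, ![2 * J.t * J.G, J.t ^ 2 * J.dG 1, J.t ^ 2 * J.dG 2, 0, J.t ^ 2 * J.dG 4,
        J.t ^ 2 * J.dG 5, J.t ^ 2 * J.dG 6],
      ![2 * J.t * J.E, J.t ^ 2 * J.dE 1, J.t ^ 2 * J.dE 2, 0, J.t ^ 2 * J.dE 4, 0,
        J.t ^ 2 * J.dE 6], 0,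
      ![4 * J.t * J.h, 2 * J.t ^ 2 * J.hx, 2 * J.t ^ 2 * J.hy, 0, 0, 0, 0],
      ![-12 * J.t, 0, 0, 0, 0, 0, 0], 0],
    ![![0, 0, 0, 0, 0, 0, 1 / 9], 0, 0, 0, 0, 0, ![1 / 9, 0, 0, 0, 0, 0, 0]]]

/-- The components of the connection form in the null coframe; they are determined by the
torsion-freeness. -/
def conn : Fin 7 → Matrix (Fin 7) (Fin 7) ℝ :=
  let m := -(J.Ap / 1296 + J.fppp / 720 + J.hy / 120) * J.r * J.t
  let s := 1 / (9 * J.t)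
  let b := (J.Ap / 16 + 9 / 80 * J.fppp + 27 / 40 * J.hy) * J.t
  ![g2mat 0 0 0 0 0 0 m (-s) 0 0 0 0 0 0,
    g2mat (J.Ar * J.r * J.t / 18) 0 m (-s) 0 0
      (J.t ^ 2 * (-(1 / 9) * J.A * J.h + 1 / 6 * J.Ap * J.q + 1 / 18 * J.Ar * J.h * J.r
        + 1 / 6 * (J.Ax + J.Ay * J.p) - J.By - 1 / 5 * J.fpp * J.h
        + 3 / 10 * (J.fppp * J.q + J.fppx + J.fppy * J.p) - J.fpy
        + 2 / 5 * J.h * (J.hx + J.hy * J.p) - 4 / 45 * J.h ^ 3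
        - 1 / 5 * (J.hxx + 2 * J.hxy * J.p + J.hyy * J.p ^ 2) - 11 / 5 * J.hy * J.q))
      0 (9 / 2 * J.Ar * J.t) 0 0 0
      ((-(J.Ap / 16) - 9 / 80 * J.fppp + 13 / 40 * J.hy) * J.t) 0,
    g2mat 0 0 (-s) 0 0 0 0 0 0 0 0 0 0 0,
    g2mat 0 0 0 0 0 0
      ((-(J.A / 12) + J.Ar * J.r / 18 - 3 / 20 * J.fpp - J.h ^ 2 / 15
        + (J.hx + J.hy * J.p) / 10) * J.t) 0 0 0 0 (-s / 2) 0 0,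
    g2mat m (-s)
      ((-(J.A / 2916) + J.Ar * J.r / 5832 - J.fpp / 1620 + J.h ^ 2 / 405
        - (J.hx + J.hy * J.p) / 270) * J.r * J.t)
      0 (-J.h / 9) 0 (-J.t ^ 2 * (J.Cy / 2 + J.fy / 3 + J.hy * J.z / 3)) 0 (-b) 0 0 0
      ((-(J.A / 36) + J.Ar * J.r / 72 - J.fpp / 20 - J.h ^ 2 / 45
        + (J.hx + J.hy * J.p) / 30) * J.t) 0,
    g2mat (-s) 0 0 0 0 0 0 0 0 0 0 0 0 0,
    g2mat 0 0 (-J.h / 9) 0 0 0 b 0 0 0 0 0 0 0]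

lemma conn_mem (c : Fin 7) : J.conn c ∈ lieG2 := by
  fin_cases c <;> exact g2mat_mem ..

/-- The torsion of the connection form, from the terms of the connection form that involve the rows
`c` and `b` of the coframe. -/
lemma torsion_aux (a i j : Fin 7) :
    ((∑ c, J.sigma c i • J.conn c) * J.sigma) a j - ((∑ c, J.sigma c j • J.conn c) * J.sigma) a i =
      ∑ c, ∑ b, J.conn c a b * (J.sigma c i * J.sigma b j - J.sigma c j * J.sigma b i) := by
  simp only [Matrix.mul_apply, Matrix.sum_apply, Matrix.smul_apply, smul_eq_mul, Finset.sum_mul,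
    ← Finset.sum_sub_distrib]
  rw [Finset.sum_comm]
  exact Finset.sum_congr rfl fun c _ => Finset.sum_congr rfl fun b _ => by ring

set_option linter.unusedSimpArgs false in
set_option maxHeartbeats 4000000 in
/-- The connection form is torsion-free, by the first order system. -/
lemma torsion_of_lt (ht : J.t ≠ 0) (a i j : Fin 7) (hij : i < j) :
    J.dsigma a j i - J.dsigma a i j
      + ∑ c, ∑ b, J.conn c a b * (J.sigma c i * J.sigma b j - J.sigma c j * J.sigma b i) = 0 := by
  fin_cases a <;> simp only [Fin.sum_univ_seven, conn, g2mat] <;>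
    simp only [dsigma, sigma, of_apply, cons_val, Fin.mk_one, Fin.zero_eta, Fin.reduceFinMk,
      zero_mul, neg_zero, add_zero, zero_add, mul_zero, zero_div] <;>
    fin_cases i <;> fin_cases j <;> (try exact absurd hij (by decide)) <;> clear hij <;>
    simp only [cons_val, Fin.mk_one, Fin.zero_eta, Fin.reduceFinMk, Pi.zero_apply, zero_mul,
      mul_zero, sub_zero, zero_sub, add_zero, zero_add, neg_zero, sub_self, dE, dG, dQ, E, G, Q,
      Bp, Br, Cp, Cr] <;>
    field_simp <;> ring

lemma torsion (ht : J.t ≠ 0) (a i j : Fin 7) :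
    J.dsigma a j i + ((∑ c, J.sigma c i • J.conn c) * J.sigma) a j =
      J.dsigma a i j + ((∑ c, J.sigma c j • J.conn c) * J.sigma) a i := by
  rcases lt_trichotomy i j with h | rfl | h
  · linear_combination J.torsion_of_lt ht a i j h + J.torsion_aux a i j
  · rfl
  · linear_combination -J.torsion_of_lt ht a j i h - J.torsion_aux a j i

end Jet

end AmbientG2

end

noncomputable section

namespace AmbientG2

open Matrix

/-! ### The null coframe on the ambient space -/

/-- The projection `u ↦ (x, y, p)`. -/
def projXYP : (Fin 7 → ℝ) →L[ℝ] ℝ × ℝ × ℝ :=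
  (ContinuousLinearMap.proj 1).prod
    ((ContinuousLinearMap.proj 2).prod (ContinuousLinearMap.proj 4))

/-- The projection `u ↦ ((x, y, p), ϱ)`. -/
def projXYPR : (Fin 7 → ℝ) →L[ℝ] (ℝ × ℝ × ℝ) × ℝ :=
  projXYP.prod (ContinuousLinearMap.proj 6)

lemma projXYP_apply (u : Fin 7 → ℝ) : projXYP u = (u 1, u 2, u 4) := rfl

lemma projXYPR_apply (u : Fin 7 → ℝ) : projXYPR u = ((u 1, u 2, u 4), u 6) := rfl

lemma hasGrad_unc₃ {S : Set (Fin 7 → ℝ)} {φ : ℝ → ℝ → ℝ → ℝ} {u : Fin 7 → ℝ}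
    (hφ : DifferentiableAt ℝ (unc₃ φ) (u 1, u 2, u 4)) :
    HasGrad S (fun v => φ (v 1) (v 2) (v 4))
      ![0, deriv (fun s => φ s (u 2) (u 4)) (u 1), deriv (fun s => φ (u 1) s (u 4)) (u 2), 0,
        deriv (fun s => φ (u 1) (u 2) s) (u 4), 0, 0] u := by
  set L := fderiv ℝ (unc₃ φ) (u 1, u 2, u 4) with hL
  have hd : HasFDerivAt (unc₃ φ) L (u 1, u 2, u 4) := hφ.hasFDerivAt
  have h1 : HasFDerivWithinAt (fun v => φ (v 1) (v 2) (v 4)) (L.comp projXYP) S u :=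
    (HasFDerivAt.comp (g := unc₃ φ) u hd projXYP.hasFDerivAt).hasFDerivWithinAt
  rw [← covec_eq (L.comp projXYP)] at h1
  have ex : deriv (fun s => φ s (u 2) (u 4)) (u 1) = L (1, 0, 0) :=
    (HasFDerivAt.comp_hasDerivAt (u 1) (l := unc₃ φ) (f := fun s => (s, u 2, u 4)) hd
      ((hasDerivAt_id _).prodMk (hasDerivAt_const _ _))).deriv
  have ey : deriv (fun s => φ (u 1) s (u 4)) (u 2) = L (0, 1, 0) :=
    (HasFDerivAt.comp_hasDerivAt (u 2) (l := unc₃ φ) (f := fun s => (u 1, s, u 4)) hd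
      ((hasDerivAt_const _ _).prodMk ((hasDerivAt_id _).prodMk (hasDerivAt_const _ _)))).deriv
  have ep : deriv (fun s => φ (u 1) (u 2) s) (u 4) = L (0, 0, 1) :=
    (HasFDerivAt.comp_hasDerivAt (u 4) (l := unc₃ φ) (f := fun s => (u 1, u 2, s)) hd
      ((hasDerivAt_const _ _).prodMk ((hasDerivAt_const _ _).prodMk (hasDerivAt_id _)))).deriv
  rw [ex, ey, ep]
  refine HasGrad.congr_grad h1 fun i => ?_
  fin_cases i <;> simp [projXYP_apply] <;> exact (map_zero L).symm

lemma hasGrad_unc₄ {S : Set (Fin 7 → ℝ)} {V : Set (ℝ × ℝ × ℝ)} (hV : IsOpen V) {I : Set ℝ}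
    {φ : ℝ → ℝ → ℝ → ℝ → ℝ} {u : Fin 7 → ℝ} (hI : UniqueDiffWithinAt ℝ I (u 6))
    (hS : Set.MapsTo projXYPR S (V ×ˢ I)) (hu : projXYPR u ∈ V ×ˢ I)
    (hφ : DifferentiableWithinAt ℝ (unc₄ φ) (V ×ˢ I) (projXYPR u)) :
    HasGrad S (fun v => φ (v 1) (v 2) (v 4) (v 6))
      ![0, deriv (fun s => φ s (u 2) (u 4) (u 6)) (u 1),
        deriv (fun s => φ (u 1) s (u 4) (u 6)) (u 2), 0,
        derP φ (u 1) (u 2) (u 4) (u 6), 0, derRho I φ (u 1) (u 2) (u 4) (u 6)] u := by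
  set L := fderivWithin ℝ (unc₄ φ) (V ×ˢ I) (projXYPR u) with hL
  have hd : HasFDerivWithinAt (unc₄ φ) L (V ×ˢ I) ((u 1, u 2, u 4), u 6) := hφ.hasFDerivWithinAt
  have h1 : HasFDerivWithinAt (fun v => φ (v 1) (v 2) (v 4) (v 6)) (L.comp projXYPR) S u :=
    HasFDerivWithinAt.comp (g := unc₄ φ) u hd projXYPR.hasFDerivWithinAt hS
  rw [← covec_eq (L.comp projXYPR)] at h1
  obtain ⟨huV, huI⟩ := hu
  have line : ∀ (c : ℝ → ℝ × ℝ × ℝ) (s : ℝ) (e : ℝ × ℝ × ℝ), c s = (u 1, u 2, u 4) →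
      HasDerivAt c e s → deriv (fun s => unc₄ φ (c s, u 6)) s = L (e, 0) := by
    intro c s e hc hce
    have hnh : c ⁻¹' V ∈ nhds s := hce.continuousAt.preimage_mem_nhds (by
      rw [hc]; exact hV.mem_nhds huV)
    have hd' : HasFDerivWithinAt (unc₄ φ) L (V ×ˢ I) (c s, u 6) := by rw [hc]; exact hd
    have := HasFDerivWithinAt.comp_hasDerivWithinAt s (t := V ×ˢ I) (s := c ⁻¹' V)
      (f := fun s => (c s, u 6)) hd' (hce.prodMk (hasDerivAt_const s (u 6))).hasDerivWithinAt
      fun s hs => ⟨hs, huI⟩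
    exact (this.hasDerivAt hnh).deriv
  have ex : deriv (fun s => φ s (u 2) (u 4) (u 6)) (u 1) = L ((1, 0, 0), 0) :=
    line (fun s => (s, u 2, u 4)) _ _ rfl ((hasDerivAt_id _).prodMk (hasDerivAt_const _ _))
  have ey : deriv (fun s => φ (u 1) s (u 4) (u 6)) (u 2) = L ((0, 1, 0), 0) :=
    line (fun s => (u 1, s, u 4)) _ _ rfl
      ((hasDerivAt_const _ _).prodMk ((hasDerivAt_id _).prodMk (hasDerivAt_const _ _)))
  have ep : derP φ (u 1) (u 2) (u 4) (u 6) = L ((0, 0, 1), 0) :=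
    line (fun s => (u 1, u 2, s)) _ _ rfl
      ((hasDerivAt_const _ _).prodMk ((hasDerivAt_const _ _).prodMk (hasDerivAt_id _)))
  have er : derRho I φ (u 1) (u 2) (u 4) (u 6) = L (0, 1) :=
    (HasFDerivWithinAt.comp_hasDerivWithinAt (u 6) (t := V ×ˢ I) (s := I) (l := unc₄ φ)
      (f := fun s => ((u 1, u 2, u 4), s)) hd
      ((hasDerivAt_const _ _).prodMk (hasDerivAt_id _)).hasDerivWithinAt
      fun s hs => ⟨huV, hs⟩).derivWithin hI
  rw [ex, ey, ep, er]
  refine HasGrad.congr_grad h1 fun i => ?_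
  fin_cases i <;> simp [projXYPR_apply] <;> first | rfl | exact (map_zero L).symm

/-! ### The derivatives of `f` and `h` -/

section Smooth

variable {V : Set (ℝ × ℝ × ℝ)} {φ : ℝ → ℝ → ℝ → ℝ}

lemma SmoothOn.fderiv_apply (hV : IsOpen V) {F : ℝ × ℝ × ℝ → ℝ} (hF : SmoothOn F V)
    (e : ℝ × ℝ × ℝ) : SmoothOn (fun v => fderiv ℝ F v e) V :=
  (hF.fderiv_of_isOpen hV (by exact le_rfl)).clm_apply contDiffOn_const

lemma SmoothOn.differentiableAt (hV : IsOpen V) {F : ℝ × ℝ × ℝ → ℝ} (hF : SmoothOn F V)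
    {v : ℝ × ℝ × ℝ} (hv : v ∈ V) : DifferentiableAt ℝ F v :=
  (hF.contDiffAt (hV.mem_nhds hv)).differentiableAt (by simp)

lemma dP_succ (k : ℕ) (φ : ℝ → ℝ → ℝ → ℝ) (x y p : ℝ) :
    dP (k + 1) φ x y p = deriv (fun s => dP k φ x y s) p := by
  simp only [dP, iteratedDeriv_succ]

lemma unc₃_dP_succ (hV : IsOpen V) {k : ℕ} (hφ : SmoothOn (unc₃ (dP k φ)) V) {v : ℝ × ℝ × ℝ}
    (hv : v ∈ V) : unc₃ (dP (k + 1) φ) v = fderiv ℝ (unc₃ (dP k φ)) v (0, 0, 1) :=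
  (dP_succ k φ v.1 v.2.1 v.2.2).trans
    (HasFDerivAt.comp_hasDerivAt v.2.2 (l := unc₃ (dP k φ)) (f := fun s => (v.1, v.2.1, s))
      (hφ.differentiableAt hV hv).hasFDerivAt
      ((hasDerivAt_const _ _).prodMk ((hasDerivAt_const _ _).prodMk (hasDerivAt_id _)))).deriv

lemma SmoothOn.dP (hV : IsOpen V) (hφ : SmoothOn (unc₃ φ) V) (k : ℕ) :
    SmoothOn (unc₃ (dP k φ)) V := by
  induction k with
  | zero =>
    rwa [show unc₃ (AmbientG2.dP 0 φ) = unc₃ φ by funext v; simp [unc₃, AmbientG2.dP]]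
  | succ k ih =>
    exact (ih.fderiv_apply hV (0, 0, 1)).congr fun v hv => unc₃_dP_succ hV ih hv

lemma SmoothOn.dX (hV : IsOpen V) {h : ℝ → ℝ → ℝ} (hh : SmoothOn (unc₃ fun x y _ => h x y) V) :
    SmoothOn (unc₃ fun x y _ => dX h x y) V := by
  refine (hh.fderiv_apply hV (1, 0, 0)).congr fun v hv => ?_
  have hd := (hh.differentiableAt hV hv).hasFDerivAt
  exact (HasFDerivAt.comp_hasDerivAt v.1 (l := unc₃ fun x y _ => h x y)
    (f := fun s => (s, v.2.1, v.2.2)) hd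
    ((hasDerivAt_id _).prodMk (hasDerivAt_const _ _))).deriv

lemma SmoothOn.dY (hV : IsOpen V) {h : ℝ → ℝ → ℝ} (hh : SmoothOn (unc₃ fun x y _ => h x y) V) :
    SmoothOn (unc₃ fun x y _ => dY h x y) V := by
  refine (hh.fderiv_apply hV (0, 1, 0)).congr fun v hv => ?_
  have hd := (hh.differentiableAt hV hv).hasFDerivAt
  exact (HasFDerivAt.comp_hasDerivAt v.2.1 (l := unc₃ fun x y _ => h x y)
    (f := fun s => (v.1, s, v.2.2)) hd
    ((hasDerivAt_const _ _).prodMk ((hasDerivAt_id _).prodMk (hasDerivAt_const _ _)))).deriv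

/-- The mixed derivatives of `h` agree. -/
lemma dX_dY (hV : IsOpen V) {h : ℝ → ℝ → ℝ} (hh : SmoothOn (unc₃ fun x y _ => h x y) V)
    {x y p : ℝ} (hv : (x, y, p) ∈ V) :
    AmbientG2.dX (AmbientG2.dY h) x y = AmbientG2.dY (AmbientG2.dX h) x y := by
  set F := unc₃ fun x y _ => h x y
  have hfd : DifferentiableAt ℝ (fderiv ℝ F) (x, y, p) :=
    ((hh.fderiv_of_isOpen hV (m := ∞) le_rfl).contDiffAt (hV.mem_nhds hv)).differentiableAt
      (by simp)
  have hd := hfd.hasFDerivAt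
  have hX : ∀ᶠ s in nhds y, AmbientG2.dX h x s = fderiv ℝ F (x, s, p) (1, 0, 0) := by
    have hc : ContinuousAt (fun s : ℝ => (x, s, p)) y := by fun_prop
    filter_upwards [hc.preimage_mem_nhds (hV.mem_nhds hv)] with s hs
    exact (HasFDerivAt.comp_hasDerivAt x (l := F) (f := fun s' => (s', s, p))
      (hh.differentiableAt hV hs).hasFDerivAt
      ((hasDerivAt_id _).prodMk (hasDerivAt_const _ _))).deriv
  have hY : ∀ᶠ s in nhds x, AmbientG2.dY h s y = fderiv ℝ F (s, y, p) (0, 1, 0) := by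
    have hc : ContinuousAt (fun s : ℝ => (s, y, p)) x := by fun_prop
    filter_upwards [hc.preimage_mem_nhds (hV.mem_nhds hv)] with s hs
    exact (HasFDerivAt.comp_hasDerivAt y (l := F) (f := fun s' => (s, s', p))
      (hh.differentiableAt hV hs).hasFDerivAt
      ((hasDerivAt_const _ _).prodMk ((hasDerivAt_id _).prodMk (hasDerivAt_const _ _)))).deriv
  have e1 : AmbientG2.dX (AmbientG2.dY h) x y =
      fderiv ℝ (fderiv ℝ F) (x, y, p) (1, 0, 0) (0, 1, 0) := by
    rw [AmbientG2.dX, Filter.EventuallyEq.deriv_eq hY]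
    have := (HasFDerivAt.comp_hasDerivAt x (f := fun s => (s, y, p)) hd
      ((hasDerivAt_id _).prodMk (hasDerivAt_const _ _))).clm_apply
        (hasDerivAt_const x ((0, 1, 0) : ℝ × ℝ × ℝ))
    refine this.deriv.trans ?_
    rw [map_zero, add_zero]
    rfl
  have e2 : AmbientG2.dY (AmbientG2.dX h) x y =
      fderiv ℝ (fderiv ℝ F) (x, y, p) (0, 1, 0) (1, 0, 0) := by
    rw [AmbientG2.dY, Filter.EventuallyEq.deriv_eq hX]
    have := (HasFDerivAt.comp_hasDerivAt y (f := fun s => (x, s, p)) hd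
      ((hasDerivAt_const _ _).prodMk ((hasDerivAt_id _).prodMk (hasDerivAt_const _ _)))).clm_apply
        (hasDerivAt_const y ((1, 0, 0) : ℝ × ℝ × ℝ))
    simpa using this.deriv
  rw [e1, e2]
  have hev : ∀ᶠ v in nhds (x, y, p), HasFDerivAt F (fderiv ℝ F v) v := by
    filter_upwards [hV.mem_nhds hv] with v hv
    exact (hh.differentiableAt hV hv).hasFDerivAt
  exact second_derivative_symmetric_of_eventually hev hd _ _

end Smooth

end AmbientG2

end

noncomputable section

namespace AmbientG2

open Matrix

/-! ### Regularity of the ambient space -/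

lemma continuous_base : Continuous base := by
  refine continuous_pi fun i => ?_
  fin_cases i <;> exact continuous_apply _

lemma regularDomain_ambientSpace {M : Set (Fin 5 → ℝ)} (hM : IsOpen M) {I : Set ℝ}
    (hI : Convex ℝ I) (hI' : I ⊆ closure (interior I)) : RegularDomain (ambientSpace M I) := by
  rintro u ⟨hu0, huM, huI⟩
  have hO : IsOpen {v : Fin 7 → ℝ | 0 < v 0 ∧ base v ∈ M} :=
    (isOpen_lt continuous_const (continuous_apply 0)).inter (hM.preimage continuous_base)
  obtain ⟨r, hr, hball⟩ := Metric.isOpen_iff.1 hO u ⟨hu0, huM⟩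
  refine ⟨Metric.ball u r ∩ {v | v 6 ∈ I}, fun v hv => ⟨(hball hv.1).1, (hball hv.1).2, hv.2⟩,
    ⟨Metric.mem_ball_self hr, huI⟩, (convex_ball u r).inter
      (hI.linear_preimage (LinearMap.proj (R := ℝ) (φ := fun _ : Fin 7 => ℝ) 6)), ?_⟩
  obtain ⟨s, hs, hsI⟩ := Metric.mem_closure_iff.1 (hI' huI) r hr
  have hop : IsOpen (Metric.ball u r ∩ {v : Fin 7 → ℝ | v 6 ∈ interior I}) :=
    Metric.isOpen_ball.inter (isOpen_interior.preimage (continuous_apply 6))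
  have hsub : Metric.ball u r ∩ {v : Fin 7 → ℝ | v 6 ∈ interior I} ⊆
      Metric.ball u r ∩ {v | v 6 ∈ I} := fun v hv => ⟨hv.1, (interior_subset hv.2 : v 6 ∈ I)⟩
  refine ⟨Function.update u 6 s, interior_maximal hsub hop ⟨?_, ?_⟩⟩
  · rw [Metric.mem_ball, dist_pi_lt_iff hr]
    intro i
    by_cases hi : i = 6
    · subst hi
      rwa [Function.update_self, dist_comm]
    · rwa [Function.update_of_ne hi, dist_self]
  · simpa using hs

/-- The two kinds of intervals over which ambient metrics are considered. -/
def IsRhoInterval (I : Set ℝ) : Prop := ∃ ε > 0, I = Set.Ioo (-ε) ε ∨ I = Set.Ico 0 ε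

namespace IsRhoInterval

variable {I : Set ℝ}

lemma convex (hI : IsRhoInterval I) : Convex ℝ I := by
  obtain ⟨ε, -, rfl | rfl⟩ := hI
  · exact convex_Ioo _ _
  · exact convex_Ico _ _

lemma subset_closure_interior (hI : IsRhoInterval I) : I ⊆ closure (interior I) := by
  obtain ⟨ε, hε, rfl | rfl⟩ := hI
  · rw [interior_Ioo]
    exact subset_closure
  · rw [interior_Ico, closure_Ioo hε.ne]
    exact Set.Ico_subset_Icc_self

lemma uniqueDiffOn (hI : IsRhoInterval I) : UniqueDiffOn ℝ I := fun _ hx =>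
  uniqueDiffWithinAt_convex hI.convex
    (closure_nonempty_iff.1 ⟨_, hI.subset_closure_interior hx⟩) (subset_closure hx)

end IsRhoInterval

/-! ### The jets of a solution -/

/-- The jet of `f`, `h` and the solution `A, B, C` at the point `u`. -/
def jet (f : ℝ → ℝ → ℝ → ℝ) (h : ℝ → ℝ → ℝ) (I : Set ℝ) (A B C : ℝ → ℝ → ℝ → ℝ → ℝ)
    (u : Fin 7 → ℝ) : Jet where
  t := u 0
  z := u 3
  p := u 4
  q := u 5
  r := u 6
  f := f (u 1) (u 2) (u 4)
  fx := deriv (fun s => f s (u 2) (u 4)) (u 1)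
  fy := deriv (fun s => f (u 1) s (u 4)) (u 2)
  fp := dP 1 f (u 1) (u 2) (u 4)
  fpx := deriv (fun s => dP 1 f s (u 2) (u 4)) (u 1)
  fpy := deriv (fun s => dP 1 f (u 1) s (u 4)) (u 2)
  fpp := dP 2 f (u 1) (u 2) (u 4)
  fppx := deriv (fun s => dP 2 f s (u 2) (u 4)) (u 1)
  fppy := deriv (fun s => dP 2 f (u 1) s (u 4)) (u 2)
  fppp := dP 3 f (u 1) (u 2) (u 4)
  h := h (u 1) (u 2)
  hx := dX h (u 1) (u 2)
  hy := dY h (u 1) (u 2)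
  hxx := dX (dX h) (u 1) (u 2)
  hxy := dY (dX h) (u 1) (u 2)
  hyy := dY (dY h) (u 1) (u 2)
  A := A (u 1) (u 2) (u 4) (u 6)
  Ax := deriv (fun s => A s (u 2) (u 4) (u 6)) (u 1)
  Ay := deriv (fun s => A (u 1) s (u 4) (u 6)) (u 2)
  Ap := derP A (u 1) (u 2) (u 4) (u 6)
  Ar := derRho I A (u 1) (u 2) (u 4) (u 6)
  B := B (u 1) (u 2) (u 4) (u 6)
  Bx := deriv (fun s => B s (u 2) (u 4) (u 6)) (u 1)
  By := deriv (fun s => B (u 1) s (u 4) (u 6)) (u 2)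
  C := C (u 1) (u 2) (u 4) (u 6)
  Cx := deriv (fun s => C s (u 2) (u 4) (u 6)) (u 1)
  Cy := deriv (fun s => C (u 1) s (u 4) (u 6)) (u 2)

/-- A twice differentiable solution `A, B, C` of the first order system, with smooth `f` and
`h`. -/
structure IsTwiceDiffSolution (V : Set (ℝ × ℝ × ℝ)) (I : Set ℝ) (f : ℝ → ℝ → ℝ → ℝ)
    (h : ℝ → ℝ → ℝ) (A B C : ℝ → ℝ → ℝ → ℝ → ℝ) : Prop where
  isOpen : IsOpen V
  smooth_f : SmoothOn (unc₃ f) V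
  smooth_h : SmoothOn (unc₃ fun x y _ => h x y) V
  interval : IsRhoInterval I
  twiceDiff_A : TwiceDiffOn (unc₄ A) (V ×ˢ I)
  twiceDiff_B : TwiceDiffOn (unc₄ B) (V ×ˢ I)
  twiceDiff_C : TwiceDiffOn (unc₄ C) (V ×ˢ I)
  system : SolvesSystem V I f h A B C

variable {V : Set (ℝ × ℝ × ℝ)} {I : Set ℝ} {f : ℝ → ℝ → ℝ → ℝ} {h : ℝ → ℝ → ℝ}
  {A B C : ℝ → ℝ → ℝ → ℝ → ℝ} {M : Set (Fin 5 → ℝ)} {u : Fin 7 → ℝ}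

lemma mapsTo_projXYPR (hMV : ∀ m ∈ M, (m 0, m 1, m 3) ∈ V) :
    Set.MapsTo projXYPR (ambientSpace M I) (V ×ˢ I) := fun _ hv => ⟨hMV _ hv.2.1, hv.2.2⟩

section Grad

variable {S : Set (Fin 7 → ℝ)}

lemma HasGrad.congr_fun {n : ℕ} {S : Set (Fin n → ℝ)} {F F' : (Fin n → ℝ) → ℝ}
    {G G' u : Fin n → ℝ} (hF : HasGrad S F G u)
    (h : ∀ v, F' v = F v) (hG : ∀ i, G' i = G i) : HasGrad S F' G' u := by
  rw [show F' = F from funext h]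
  exact hF.congr_grad hG

lemma IsTwiceDiffSolution.hasGrad_A (H : IsTwiceDiffSolution V I f h A B C)
    (hS : Set.MapsTo projXYPR S (V ×ˢ I)) (hu : u ∈ S) :
    HasGrad S (fun v => (jet f h I A B C v).A)
      ![0, (jet f h I A B C u).Ax, (jet f h I A B C u).Ay, 0, (jet f h I A B C u).Ap, 0,
        (jet f h I A B C u).Ar] u :=
  hasGrad_unc₄ (φ := A) H.isOpen (H.interval.uniqueDiffOn _ (hS hu).2) hS (hS hu)
    (H.twiceDiff_A.1 _ (hS hu))

lemma IsTwiceDiffSolution.hasGrad_B (H : IsTwiceDiffSolution V I f h A B C)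
    (hS : Set.MapsTo projXYPR S (V ×ˢ I)) (hu : u ∈ S) :
    HasGrad S (fun v => (jet f h I A B C v).B)
      ![0, (jet f h I A B C u).Bx, (jet f h I A B C u).By, 0, (jet f h I A B C u).Bp, 0,
        (jet f h I A B C u).Br] u := by
  have hs := H.system (u 1) (u 2) (u 4) (u 6) (hS hu).1 (hS hu).2
  refine (hasGrad_unc₄ (φ := B) H.isOpen (H.interval.uniqueDiffOn _ (hS hu).2) hS (hS hu)
    (H.twiceDiff_B.1 _ (hS hu))).congr_grad fun i => ?_
  fin_cases i <;>
    simp only [Jet.Bp, Jet.Br, jet, hs.1, hs.2.1, cons_val, Fin.mk_one, Fin.zero_eta,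
      Fin.reduceFinMk]

lemma IsTwiceDiffSolution.hasGrad_C (H : IsTwiceDiffSolution V I f h A B C)
    (hS : Set.MapsTo projXYPR S (V ×ˢ I)) (hu : u ∈ S) :
    HasGrad S (fun v => (jet f h I A B C v).C)
      ![0, (jet f h I A B C u).Cx, (jet f h I A B C u).Cy, 0, (jet f h I A B C u).Cp, 0,
        (jet f h I A B C u).Cr] u := by
  have hs := H.system (u 1) (u 2) (u 4) (u 6) (hS hu).1 (hS hu).2
  refine (hasGrad_unc₄ (φ := C) H.isOpen (H.interval.uniqueDiffOn _ (hS hu).2) hS (hS hu)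
    (H.twiceDiff_C.1 _ (hS hu))).congr_grad fun i => ?_
  fin_cases i <;>
    simp only [Jet.Bp, Jet.Cp, Jet.Cr, jet, hs.1, hs.2.2.1, hs.2.2.2, cons_val, Fin.mk_one,
      Fin.zero_eta, Fin.reduceFinMk]

lemma hasGrad_dP (hV : IsOpen V) (hf : SmoothOn (unc₃ f) V) (hu : (u 1, u 2, u 4) ∈ V) (k : ℕ) :
    HasGrad S (fun v => dP k f (v 1) (v 2) (v 4))
      ![0, deriv (fun s => dP k f s (u 2) (u 4)) (u 1), deriv (fun s => dP k f (u 1) s (u 4)) (u 2),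
        0, dP (k + 1) f (u 1) (u 2) (u 4), 0, 0] u := by
  rw [dP_succ]
  exact hasGrad_unc₃ (φ := dP k f) ((hf.dP hV k).differentiableAt hV hu)

lemma hasGrad_h (hV : IsOpen V) (hh : SmoothOn (unc₃ fun x y _ => h x y) V)
    (hu : (u 1, u 2, u 4) ∈ V) :
    HasGrad S (fun v => h (v 1) (v 2))
      ![0, dX h (u 1) (u 2), dY h (u 1) (u 2), 0, 0, 0, 0] u := by
  refine (hasGrad_unc₃ (φ := fun x y _ => h x y) (hh.differentiableAt hV hu)).congr_grad fun i => ?_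
  fin_cases i <;> simp [dX, dY]

end Grad

end AmbientG2

end

noncomputable section

namespace AmbientG2

open Matrix

/-! ### The derivatives of the null coframe -/

variable {V : Set (ℝ × ℝ × ℝ)} {I : Set ℝ} {f : ℝ → ℝ → ℝ → ℝ} {h : ℝ → ℝ → ℝ}
  {A B C : ℝ → ℝ → ℝ → ℝ → ℝ} {M : Set (Fin 5 → ℝ)} {u : Fin 7 → ℝ} {S : Set (Fin 7 → ℝ)}

namespace IsTwiceDiffSolution

lemma hasGrad_E (H : IsTwiceDiffSolution V I f h A B C)
    (hS : Set.MapsTo projXYPR S (V ×ˢ I)) (hu : u ∈ S) :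
    HasGrad S (fun v => (jet f h I A B C v).E) (jet f h I A B C u).dE u := by
  have huV : (u 1, u 2, u 4) ∈ V := (hS hu).1
  have hh := hasGrad_h (S := S) H.isOpen H.smooth_h huV
  have hp : HasGrad S (fun v => v 4) _ u := hasGrad_coord 4
  refine ((((hasGrad_dP (S := S) H.isOpen H.smooth_f huV 2).const_mul (9 / 10)).add
    ((hh.mul hh).const_mul (4 / 10))).sub
      (((hp.mul (hasGrad_h (S := S) (h := dY h) H.isOpen (H.smooth_h.dY H.isOpen) huV)).add
        (hasGrad_h (S := S) (h := dX h) H.isOpen (H.smooth_h.dX H.isOpen) huV)).const_mul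
          (6 / 10))).add ((H.hasGrad_A hS hu).const_mul (1 / 2)) |>.congr_fun
    (fun v => by simp only [Jet.E, jet]; ring) fun i => ?_
  have hxy := dX_dY H.isOpen H.smooth_h huV
  fin_cases i <;> simp only [Jet.dE, jet, cons_val, Fin.mk_one, Fin.zero_eta, Fin.reduceFinMk,
    Pi.single_apply, hxy, Fin.reduceEq, if_true, if_false] <;> ring

lemma hasGrad_G (H : IsTwiceDiffSolution V I f h A B C)
    (hS : Set.MapsTo projXYPR S (V ×ˢ I)) (hu : u ∈ S) :
    HasGrad S (fun v => (jet f h I A B C v).G) (jet f h I A B C u).dG u := by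
  have huV : (u 1, u 2, u 4) ∈ V := (hS hu).1
  have hp : HasGrad S (fun v => v 4) _ u := hasGrad_coord 4
  have hq : HasGrad S (fun v => v 5) _ u := hasGrad_coord 5
  refine (((((hasGrad_h (S := S) H.isOpen H.smooth_h huV).mul hq).const_mul 4).add
    ((hasGrad_dP (S := S) H.isOpen H.smooth_f huV 1).const_mul 3)).add
      ((H.hasGrad_B hS hu).const_mul 3)).sub (hp.mul (H.hasGrad_E hS hu)) |>.congr_fun
    (fun v => by simp only [Jet.G, jet]; ring) fun i => ?_
  fin_cases i <;> simp only [Jet.dG, Jet.dE, jet, cons_val, Fin.mk_one, Fin.zero_eta,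
    Fin.reduceFinMk, Pi.single_apply, Fin.reduceEq, if_true, if_false] <;> ring

lemma hasGrad_Q (H : IsTwiceDiffSolution V I f h A B C)
    (hS : Set.MapsTo projXYPR S (V ×ˢ I)) (hu : u ∈ S) :
    HasGrad S (fun v => (jet f h I A B C v).Q) (jet f h I A B C u).dQ u := by
  have huV : (u 1, u 2, u 4) ∈ V := (hS hu).1
  have hz : HasGrad S (fun v => v 3) _ u := hasGrad_coord 3
  have hq : HasGrad S (fun v => v 5) _ u := hasGrad_coord 5
  refine (((hasGrad_dP (S := S) H.isOpen H.smooth_f huV 0).add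
    ((hasGrad_h (S := S) H.isOpen H.smooth_h huV).mul hz)).sub (hq.mul hq)).add
      ((H.hasGrad_C hS hu).const_mul (3 / 2)) |>.congr_fun
    (fun v => by simp only [Jet.Q, jet, dP, iteratedDeriv_zero]; ring) fun i => ?_
  fin_cases i <;> simp only [Jet.dQ, jet, cons_val, Fin.mk_one, Fin.zero_eta,
    Fin.reduceFinMk, Pi.single_apply, Fin.reduceEq, if_true, if_false, dP, iteratedDeriv_zero,
    zero_add] <;> ring

lemma hasGrad_sigma (H : IsTwiceDiffSolution V I f h A B C)
    (hS : Set.MapsTo projXYPR S (V ×ˢ I)) (hu : u ∈ S) (a j : Fin 7) :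
    HasGrad S (fun v => (jet f h I A B C v).sigma a j) ((jet f h I A B C u).dsigma a j) u := by
  have hQ := H.hasGrad_Q hS hu
  have hE := H.hasGrad_E hS hu
  have hG := H.hasGrad_G hS hu
  have hh : HasGrad S (fun v => (jet f h I A B C v).h)
      ![0, (jet f h I A B C u).hx, (jet f h I A B C u).hy, 0, 0, 0, 0] u :=
    hasGrad_h (S := S) H.isOpen H.smooth_h (hS hu).1
  have ht : HasGrad S (fun v => (jet f h I A B C v).t) (Pi.single 0 1) u := hasGrad_coord 0
  have hp : HasGrad S (fun v => (jet f h I A B C v).p) (Pi.single 4 1) u := hasGrad_coord 4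
  have hq : HasGrad S (fun v => (jet f h I A B C v).q) (Pi.single 5 1) u := hasGrad_coord 5
  have hr : HasGrad S (fun v => (jet f h I A B C v).r) (Pi.single 6 1) u := hasGrad_coord 6
  have h0 : ∀ c, HasGrad S (fun _ => c) (0 : Fin 7 → ℝ) u := hasGrad_const
  have htt := ht.mul ht
  revert hQ hE hG hh ht hp hq hr htt
  generalize jet f h I A B C = J
  intro hQ hE hG hh ht hp hq hr htt
  have entry : ∀ {F F' : (Fin 7 → ℝ) → ℝ} {G G' : Fin 7 → ℝ}, HasGrad S F G u →
    (∀ v, F' v = F v) → (∀ i, G' i = G i) → HasGrad S F' G' u := HasGrad.congr_fun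
  fin_cases a <;> fin_cases j <;>
    simp only [Jet.sigma, Jet.dsigma, of_apply, cons_val, Fin.mk_one, Fin.zero_eta,
      Fin.reduceFinMk] <;>
    (try with_reducible exact h0 _) <;>
    [ refine entry ((ht.mul hh).const_mul 3) ?_ ?_;
      refine entry hp.neg ?_ ?_;
      refine entry (((ht.mul hh).mul hr).const_mul (-(1 / 9))) ?_ ?_;
      refine entry (htt.mul hQ) ?_ ?_;
      refine entry htt.neg ?_ ?_;
      refine entry ((htt.mul hq).const_mul 2) ?_ ?_;
      refine entry ((htt.mul hh).const_mul (-(1 / 9))) ?_ ?_;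
      refine entry ((ht.mul hq).const_mul (-2)) ?_ ?_;
      refine entry (ht.const_mul 2) ?_ ?_;
      refine entry (htt.mul hG) ?_ ?_;
      refine entry (htt.mul hE) ?_ ?_;
      refine entry ((htt.mul hh).const_mul 2) ?_ ?_;
      refine entry (htt.const_mul (-6)) ?_ ?_;
      refine entry (hr.const_mul (1 / 9)) ?_ ?_;
      refine entry (ht.const_mul (1 / 9)) ?_ ?_] <;>
    first
    | (intro v; ring1)
    | (intro i; fin_cases i <;>
        simp only [cons_val, Fin.mk_one, Fin.zero_eta, Fin.reduceFinMk, Pi.single_apply,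
          Fin.reduceEq, if_true, if_false, Jet.dE, Jet.dG, Jet.dQ] <;> ring)

end IsTwiceDiffSolution

end AmbientG2

end

noncomputable section

namespace AmbientG2

open Matrix

/-! ### The null coframe of a solution has a connection form in split `𝔤₂` -/

variable {V : Set (ℝ × ℝ × ℝ)} {I : Set ℝ} {f : ℝ → ℝ → ℝ → ℝ} {h : ℝ → ℝ → ℝ}
  {A B C : ℝ → ℝ → ℝ → ℝ → ℝ} {M : Set (Fin 5 → ℝ)} {u : Fin 7 → ℝ} {S : Set (Fin 7 → ℝ)}

/-- An algebra of functions on the ambient space that contains the coordinates and the functions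
which occur in the null coframe. -/
structure CoframeAlgebra (𝒜 : Subalgebra ℝ ((Fin 7 → ℝ) → ℝ)) (f : ℝ → ℝ → ℝ → ℝ) (h : ℝ → ℝ → ℝ)
    (A B C : ℝ → ℝ → ℝ → ℝ → ℝ) : Prop where
  coord : ∀ i, (fun v => v i) ∈ 𝒜
  mem_dP : ∀ k, (fun v => dP k f (v 1) (v 2) (v 4)) ∈ 𝒜
  mem_h : (fun v => h (v 1) (v 2)) ∈ 𝒜
  mem_dX : (fun v => dX h (v 1) (v 2)) ∈ 𝒜
  mem_dY : (fun v => dY h (v 1) (v 2)) ∈ 𝒜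
  mem_A : at₄ A ∈ 𝒜
  mem_B : at₄ B ∈ 𝒜
  mem_C : at₄ C ∈ 𝒜

lemma CoframeAlgebra.sigma_mem {𝒜 : Subalgebra ℝ ((Fin 7 → ℝ) → ℝ)}
    (H : CoframeAlgebra 𝒜 f h A B C) (a j : Fin 7) :
    (fun v => (jet f h I A B C v).sigma a j) ∈ 𝒜 := by
  have c : ∀ r : ℝ, (fun _ => r) ∈ 𝒜 := fun r => 𝒜.algebraMap_mem r
  have ht : (fun v => (jet f h I A B C v).t) ∈ 𝒜 := H.coord 0
  have hz : (fun v => (jet f h I A B C v).z) ∈ 𝒜 := H.coord 3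
  have hp : (fun v => (jet f h I A B C v).p) ∈ 𝒜 := H.coord 4
  have hq : (fun v => (jet f h I A B C v).q) ∈ 𝒜 := H.coord 5
  have hr : (fun v => (jet f h I A B C v).r) ∈ 𝒜 := H.coord 6
  have hf : (fun v => (jet f h I A B C v).f) ∈ 𝒜 := by
    have := H.mem_dP 0
    simp only [dP, iteratedDeriv_zero] at this
    exact this
  have hfp : (fun v => (jet f h I A B C v).fp) ∈ 𝒜 := H.mem_dP 1
  have hfpp : (fun v => (jet f h I A B C v).fpp) ∈ 𝒜 := H.mem_dP 2
  have hh : (fun v => (jet f h I A B C v).h) ∈ 𝒜 := H.mem_h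
  have hhx : (fun v => (jet f h I A B C v).hx) ∈ 𝒜 := H.mem_dX
  have hhy : (fun v => (jet f h I A B C v).hy) ∈ 𝒜 := H.mem_dY
  have hA : (fun v => (jet f h I A B C v).A) ∈ 𝒜 := H.mem_A
  have hB : (fun v => (jet f h I A B C v).B) ∈ 𝒜 := H.mem_B
  have hC : (fun v => (jet f h I A B C v).C) ∈ 𝒜 := H.mem_C
  generalize jet f h I A B C = J at *
  have htt := 𝒜.pow_mem ht 2
  have hE : (fun v => (J v).E) ∈ 𝒜 :=
    𝒜.add_mem (𝒜.mul_mem (𝒜.sub_mem (𝒜.add_mem (𝒜.mul_mem (c 9) hfpp)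
      (𝒜.mul_mem (c 4) (𝒜.pow_mem hh 2))) (𝒜.mul_mem (c 6) (𝒜.add_mem (𝒜.mul_mem hp hhy) hhx)))
      (c 10⁻¹)) (𝒜.mul_mem hA (c 2⁻¹))
  have hG : (fun v => (J v).G) ∈ 𝒜 :=
    𝒜.sub_mem (𝒜.add_mem (𝒜.add_mem (𝒜.mul_mem (𝒜.mul_mem (c 4) hh) hq) (𝒜.mul_mem (c 3) hfp))
      (𝒜.mul_mem (c 3) hB)) (𝒜.mul_mem hp hE)
  have hQ : (fun v => (J v).Q) ∈ 𝒜 :=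
    𝒜.add_mem (𝒜.sub_mem (𝒜.add_mem hf (𝒜.mul_mem hh hz)) (𝒜.pow_mem hq 2))
      (𝒜.mul_mem (c (3 / 2)) hC)
  fin_cases a <;> fin_cases j <;>
    simp only [Jet.sigma, of_apply, cons_val, Fin.mk_one, Fin.zero_eta, Fin.reduceFinMk] <;>
    (try with_reducible exact c _)
  · exact 𝒜.mul_mem (𝒜.mul_mem (c 3) ht) hh
  · exact 𝒜.neg_mem hp
  · exact 𝒜.mul_mem (𝒜.mul_mem (𝒜.mul_mem (c (-(1 / 9))) ht) hh) hr
  · exact 𝒜.mul_mem htt hQ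
  · exact 𝒜.neg_mem htt
  · exact 𝒜.mul_mem (𝒜.mul_mem (c 2) htt) hq
  · exact 𝒜.mul_mem (𝒜.mul_mem (c (-(1 / 9))) htt) hh
  · exact 𝒜.mul_mem (𝒜.mul_mem (c (-2)) ht) hq
  · exact 𝒜.mul_mem (c 2) ht
  · exact 𝒜.mul_mem htt hG
  · exact 𝒜.mul_mem htt hE
  · exact 𝒜.mul_mem (𝒜.mul_mem (c 2) htt) hh
  · exact 𝒜.mul_mem (c (-6)) htt
  · exact 𝒜.mul_mem (c (1 / 9)) hr
  · exact 𝒜.mul_mem (c (1 / 9)) ht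

lemma frameMetric_mem {𝒜 : Subalgebra ℝ ((Fin 7 → ℝ) → ℝ)} {η : Matrix (Fin 7) (Fin 7) ℝ}
    {σ : (Fin 7 → ℝ) → Matrix (Fin 7) (Fin 7) ℝ} (hσ : ∀ a j, (fun v => σ v a j) ∈ 𝒜)
    (i j : Fin 7) : (fun v => frameMetric η σ v i j) ∈ 𝒜 := by
  have : (fun v => frameMetric η σ v i j) =
      ∑ b, (∑ a, (fun v => σ v a i) * algebraMap ℝ _ (η a b)) * fun v => σ v b j := by
    ext v
    simp [frameMetric, Matrix.mul_apply, Finset.sum_apply]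
  rw [this]
  exact 𝒜.sum_mem fun b _ => 𝒜.mul_mem
    (𝒜.sum_mem fun a _ => 𝒜.mul_mem (hσ a i) (𝒜.algebraMap_mem _)) (hσ b j)

lemma Jet.sigma_det_ne_zero (J : Jet) (ht : J.t ≠ 0) : J.sigma.det ≠ 0 := by
  rw [Ne, ← exists_mulVec_eq_zero_iff]
  rintro ⟨v, hv0, hv⟩
  apply hv0
  have e := fun a => congrFun hv a
  simp only [Jet.sigma, mulVec, dotProduct, Fin.sum_univ_seven, Pi.zero_apply] at e
  have e4 := e 4
  have e0 := e 0
  have e1 := e 1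
  have e3 := e 3
  have e6 := e 6
  have e2 := e 2
  have e5 := e 5
  simp only [of_apply, cons_val, zero_mul, add_zero, zero_add] at e0 e1 e2 e3 e4 e5 e6
  have h1 : v 1 = 0 := by linarith
  rw [h1] at e0 e1 e2 e3 e5
  have h0 : v 0 = 0 := by linarith
  have h2 : v 2 = 0 := by linarith
  rw [h0] at e2 e6
  have h4 : v 4 = 0 := by
    have : 2 * J.t * v 4 = 0 := by linarith
    simpa [ht] using this
  have h6 : v 6 = 0 := by
    have : 1 / 9 * J.t * v 6 = 0 := by linarith
    simpa [ht] using this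
  rw [h4, h6] at e2
  rw [h2, h4] at e5
  have h3 : v 3 = 0 := by
    have : J.t ^ 2 * v 3 = 0 := by linarith
    simpa [ht] using this
  have h5 : v 5 = 0 := by
    have : J.t ^ 2 * v 5 = 0 := by linarith
    simpa [ht] using this
  funext i
  fin_cases i <;> assumption

lemma etaG2_transpose : etaG2ᵀ = etaG2 := by
  ext i j
  fin_cases i <;> fin_cases j <;> rfl

lemma etaG2_det : etaG2.det ≠ 0 := by
  rw [Ne, ← exists_mulVec_eq_zero_iff]
  rintro ⟨v, hv0, hv⟩
  apply hv0
  have e := fun a => congrFun hv a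
  simp only [etaG2, mulVec, dotProduct, Fin.sum_univ_seven, Pi.zero_apply] at e
  have e0 := e 0
  have e1 := e 1
  have e2 := e 2
  have e3 := e 3
  have e4 := e 4
  have e5 := e 5
  have e6 := e 6
  simp only [of_apply, cons_val, zero_mul, one_mul, add_zero, zero_add] at e0 e1 e2 e3 e4 e5 e6
  have h3 : v 3 = 0 := by linarith
  funext i
  fin_cases i <;> assumption

/-- The null coframe of a solution has a torsion-free connection form with values in `𝔤₂`. -/
lemma IsTwiceDiffSolution.isConnectionForm (H : IsTwiceDiffSolution V I f h A B C)
    (hM : IsOpen M) (hMV : ∀ m ∈ M, (m 0, m 1, m 3) ∈ V) :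
    IsConnectionForm (ambientSpace M I) etaG2 lieG2 (fun u => (jet f h I A B C u).sigma)
      fun i u => ∑ c, (jet f h I A B C u).sigma c i • (jet f h I A B C u).conn c := by
  have hreg := regularDomain_ambientSpace hM H.interval.convex H.interval.subset_closure_interior
  have hU := hreg.uniqueDiffOn
  have hS : Set.MapsTo projXYPR (ambientSpace M I) (V ×ˢ I) := mapsTo_projXYPR hMV
  have hS' : Set.MapsTo projXYP (ambientSpace M I) V := fun v hv => (hS hv).1
  have smooth : ∀ {φ : ℝ → ℝ → ℝ → ℝ}, SmoothOn (unc₃ φ) V →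
      TwiceDiffOn (fun v => φ (v 1) (v 2) (v 4)) (ambientSpace M I) := fun {φ} hφ =>
    (hφ.twiceDiffOn H.isOpen.uniqueDiffOn).comp_clm projXYP hS' hU
  have halg : CoframeAlgebra (twiceDiffAlg (ambientSpace M I) hU) f h A B C :=
    { coord := fun i => SmoothOn.twiceDiffOn hU (contDiff_apply ℝ ℝ i).contDiffOn
      mem_dP := fun k => smooth (H.smooth_f.dP H.isOpen k)
      mem_h := smooth (φ := fun x y _ => h x y) H.smooth_h
      mem_dX := smooth (φ := fun x y _ => dX h x y) (H.smooth_h.dX H.isOpen)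
      mem_dY := smooth (φ := fun x y _ => dY h x y) (H.smooth_h.dY H.isOpen)
      mem_A := H.twiceDiff_A.comp_clm projXYPR hS hU
      mem_B := H.twiceDiff_B.comp_clm projXYPR hS hU
      mem_C := H.twiceDiff_C.comp_clm projXYPR hS hU }
  exact
    { regular := hreg
      symm := etaG2_transpose
      η_det := etaG2_det
      skew := fun X hX => hX.1
      bracket := fun X hX Y hY => lieG2_bracket X hX Y hY
      twiceDiff := halg.sigma_mem
      det_ne_zero := fun u hu => Jet.sigma_det_ne_zero _ hu.1.ne'
      mem := fun u _ i => sum_mem fun c _ => lieG2.smul_mem _ (Jet.conn_mem _ c)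
      torsion := fun u hu i j a => by
        rw [(H.hasGrad_sigma hS hu a j).pd_eq (hU u hu),
          (H.hasGrad_sigma hS hu a i).pd_eq (hU u hu)]
        exact Jet.torsion _ hu.1.ne' a i j }

end AmbientG2

end

noncomputable section

namespace AmbientG2

open Matrix

variable {V : Set (ℝ × ℝ × ℝ)} {I : Set ℝ} {f : ℝ → ℝ → ℝ → ℝ} {h : ℝ → ℝ → ℝ}
  {A B C : ℝ → ℝ → ℝ → ℝ → ℝ} {M : Set (Fin 5 → ℝ)} {u : Fin 7 → ℝ} {S : Set (Fin 7 → ℝ)}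

/-! ### The metric and the 3-form in terms of the null coframe -/

lemma frameMetric_etaG2 (σ : (Fin 7 → ℝ) → Matrix (Fin 7) (Fin 7) ℝ) (u : Fin 7 → ℝ) :
    frameMetric etaG2 σ u = twoSym ((σ u).row 0) ((σ u).row 6) + twoSym ((σ u).row 1) ((σ u).row 5)
      + twoSym ((σ u).row 2) ((σ u).row 4) + (2 : ℝ) • symSq ((σ u).row 3) := by
  ext i j
  simp [frameMetric, etaG2, Matrix.mul_apply, Fin.sum_univ_seven, twoSym, symSq, vecMulVec_apply,
    Matrix.row]
  ring

lemma sqrt_two_mul_self : √2 * √2 = (2 : ℝ) := Real.mul_self_sqrt (by norm_num)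

variable (I f h A B C u)

lemma ω₁_eq : ω₁ h u = √2 • (jet f h I A B C u).sigma.row 0 := by
  funext i
  fin_cases i <;>
    simp only [ω₁, θ₄, Pi.add_apply, Pi.sub_apply, Pi.smul_apply,
      smul_eq_mul, pull, d₅, dϱt, dt, base, at₄, Pi.single_apply, Fin.reduceEq, if_true, if_false,
      Jet.sigma, jet,
      row_apply, of_apply, cons_val, Fin.mk_one, Fin.zero_eta, Fin.reduceFinMk] <;> ring

lemma ω₂_eq : ω₂ u = (jet f h I A B C u).sigma.row 1 := by
  funext i
  fin_cases i <;>
    simp only [ω₂, θ₁, Pi.add_apply, Pi.sub_apply, Pi.smul_apply,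
      smul_eq_mul, pull, d₅, dϱt, dt, base, at₄, Pi.single_apply, Fin.reduceEq, if_true, if_false,
      Jet.sigma, jet,
      row_apply, of_apply, cons_val, Fin.mk_one, Fin.zero_eta, Fin.reduceFinMk] <;> ring

lemma ω₃_eq : ω₃ f h C u = (jet f h I A B C u).sigma.row 2 := by
  funext i
  fin_cases i <;>
    simp only [ω₃, θ₂, θ₃, θ₄, Jet.Q, Pi.add_apply, Pi.sub_apply, Pi.smul_apply,
      smul_eq_mul, pull, d₅, dϱt, dt, base, at₄, Pi.single_apply, Fin.reduceEq, if_true, if_false,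
      Jet.sigma, jet,
      row_apply, of_apply, cons_val, Fin.mk_one, Fin.zero_eta, Fin.reduceFinMk]
  · ring
  · linear_combination (-(u 0 ^ 2 * u 5 ^ 2)) * sqrt_two_mul_self
  · ring
  · ring
  · linear_combination (u 0 ^ 2 * u 5) * sqrt_two_mul_self
  · ring
  · ring

lemma ω₄_eq : ω₄ u = √2 • (jet f h I A B C u).sigma.row 3 := by
  funext i
  fin_cases i <;>
    simp only [ω₄, θ₃, Pi.add_apply, Pi.sub_apply, Pi.smul_apply,
      smul_eq_mul, pull, d₅, dϱt, dt, base, at₄, Pi.single_apply, Fin.reduceEq, if_true, if_false,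
      Jet.sigma, jet,
      row_apply, of_apply, cons_val, Fin.mk_one, Fin.zero_eta, Fin.reduceFinMk] <;> ring

lemma ω₅_eq : ω₅ = (jet f h I A B C u).sigma.row 4 := by
  funext i
  fin_cases i <;>
    simp only [ω₅, θ₄, Pi.add_apply, Pi.sub_apply, Pi.smul_apply,
      smul_eq_mul, pull, d₅, dϱt, dt, base, at₄, Pi.single_apply, Fin.reduceEq, if_true, if_false,
      Jet.sigma, jet,
      row_apply, of_apply, cons_val, Fin.mk_one, Fin.zero_eta, Fin.reduceFinMk] <;> ring

lemma ω₆_eq : ω₆ f h A B u = (jet f h I A B C u).sigma.row 5 := by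
  funext i
  fin_cases i <;>
    simp only [ω₆, θ₅, θ₁, θ₃, θ₄, Jet.E, Jet.G, Pi.add_apply, Pi.sub_apply, Pi.smul_apply,
      smul_eq_mul, pull, d₅, dϱt, dt, base, at₄, Pi.single_apply, Fin.reduceEq, if_true, if_false,
      Jet.sigma, jet,
      row_apply, of_apply, cons_val, Fin.mk_one, Fin.zero_eta, Fin.reduceFinMk]
  · ring
  · linear_combination (-(u 0 ^ 2 * h (u 1) (u 2) * u 5)) * sqrt_two_mul_self
  · ring
  · ring
  · linear_combination (u 0 ^ 2 * h (u 1) (u 2)) * sqrt_two_mul_self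
  · ring
  · ring

lemma ω₇_eq : ω₇ u = (√2 / 2) • (jet f h I A B C u).sigma.row 6 := by
  funext i
  fin_cases i <;>
    simp only [ω₇, Pi.add_apply, Pi.sub_apply, Pi.smul_apply,
      smul_eq_mul, pull, d₅, dϱt, dt, base, at₄, Pi.single_apply, Fin.reduceEq, if_true, if_false,
      Jet.sigma, jet,
      row_apply, of_apply, cons_val, Fin.mk_one, Fin.zero_eta, Fin.reduceFinMk] <;> ring

lemma gTilde_eq :
    gTilde f h A B C u = frameMetric etaG2 (fun v => (jet f h I A B C v).sigma) u := by
  rw [frameMetric_etaG2, gTilde, ω₁_eq I f h A B C u, ω₂_eq I f h A B C u, ω₃_eq I f h A B C u,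
    ω₄_eq I f h A B C u, ω₅_eq I f h A B C u, ω₆_eq I f h A B C u, ω₇_eq I f h A B C u]
  have h2 := sqrt_two_mul_self
  ext i j
  simp only [twoSym, symSq, Matrix.add_apply, vecMulVec_apply, Pi.smul_apply, Matrix.smul_apply,
    smul_eq_mul]
  generalize (jet f h I A B C u).sigma = σ
  linear_combination ((σ.row 0 i * σ.row 6 j + σ.row 6 i * σ.row 0 j) / 2
    + σ.row 3 i * σ.row 3 j) * h2

lemma upsilon_eq (i j k : Fin 7) :
    upsilon f h A B C u i j k = √2 * upsForm (jet f h I A B C u).sigma i j k := by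
  rw [upsilon, ω₁_eq I f h A B C u, ω₂_eq I f h A B C u, ω₃_eq I f h A B C u,
    ω₄_eq I f h A B C u, ω₅_eq I f h A B C u, ω₆_eq I f h A B C u, ω₇_eq I f h A B C u]
  have h2 := sqrt_two_mul_self
  generalize (jet f h I A B C u).sigma = σ
  simp only [upsForm, wedge₃, det_fin_three, Pi.add_apply, Pi.sub_apply, Pi.smul_apply,
    smul_eq_mul, of_apply, cons_val]
  linear_combination (-√2 / 2) * (σ.row 0 i * σ.row 3 j * σ.row 6 k
    - σ.row 0 i * σ.row 3 k * σ.row 6 j - σ.row 0 j * σ.row 3 i * σ.row 6 k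
    + σ.row 0 j * σ.row 3 k * σ.row 6 i + σ.row 0 k * σ.row 3 i * σ.row 6 j
    - σ.row 0 k * σ.row 3 j * σ.row 6 i) * h2

variable {I f h A B C u}

/-! ### The form of an ambient metric -/

/-- The matrix of the pull-back of a bilinear form from `ℝ⁵` to the ambient space. -/
def pullForm (G : Matrix (Fin 5) (Fin 5) ℝ) : Matrix (Fin 7) (Fin 7) ℝ :=
  ∑ i, ∑ j, G i j • vecMulVec (pull (d₅ i)) (pull (d₅ j))

lemma pull_eq_sum (α : Fin 5 → ℝ) (a : Fin 7) : pull α a = ∑ i, α i * pull (d₅ i) a := by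
  fin_cases a <;> simp [pull, d₅, Fin.sum_univ_five, Pi.single_apply]

lemma pullForm_vecMulVec (α β : Fin 5 → ℝ) :
    pullForm (vecMulVec α β) = vecMulVec (pull α) (pull β) := by
  ext a b
  simp only [pullForm, Matrix.sum_apply, Matrix.smul_apply, vecMulVec_apply, smul_eq_mul]
  rw [pull_eq_sum α, pull_eq_sum β, Finset.sum_mul_sum]
  exact Finset.sum_congr rfl fun i _ => Finset.sum_congr rfl fun j _ => by ring

lemma pullForm_add (G G' : Matrix (Fin 5) (Fin 5) ℝ) :
    pullForm (G + G') = pullForm G + pullForm G' := by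
  simp [pullForm, add_smul, Finset.sum_add_distrib]

lemma pullForm_smul (c : ℝ) (G : Matrix (Fin 5) (Fin 5) ℝ) :
    pullForm (c • G) = c • pullForm G := by
  simp [pullForm, Finset.smul_sum, smul_smul]

lemma pullForm_sub (G G' : Matrix (Fin 5) (Fin 5) ℝ) :
    pullForm (G - G') = pullForm G - pullForm G' := by
  rw [sub_eq_add_neg, ← neg_one_smul ℝ, pullForm_add, pullForm_smul, neg_one_smul, sub_eq_add_neg]

lemma pullForm_twoSym (α β : Fin 5 → ℝ) :
    pullForm (twoSym α β) = twoSym (pull α) (pull β) := by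
  rw [twoSym, pullForm_add, pullForm_vecMulVec, pullForm_vecMulVec, twoSym]

lemma pullForm_symSq (α : Fin 5 → ℝ) : pullForm (symSq α) = symSq (pull α) :=
  pullForm_vecMulVec α α

lemma pullForm_mulVec_pull (G : Matrix (Fin 5) (Fin 5) ℝ) (v : Fin 5 → ℝ) :
    pullForm G *ᵥ pull v = pull (G *ᵥ v) := by
  have hp : ∀ j, v j = pull (d₅ j) ⬝ᵥ pull v := by
    intro j
    fin_cases j <;> simp [pull, d₅, dotProduct, Fin.sum_univ_seven]
  funext a
  rw [pull_eq_sum]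
  simp only [mulVec, dotProduct, pullForm, Matrix.sum_apply, Matrix.smul_apply, vecMulVec_apply,
    smul_eq_mul, Finset.sum_mul]
  rw [Finset.sum_comm]
  refine Finset.sum_congr rfl fun i _ => ?_
  rw [Finset.sum_comm]
  refine Finset.sum_congr rfl fun j _ => ?_
  rw [hp j, dotProduct, Finset.mul_sum, Finset.sum_mul]
  exact Finset.sum_congr rfl fun b _ => by ring

lemma ambientForm_eq (t r : ℝ) (G : Matrix (Fin 5) (Fin 5) ℝ) :
    ambientForm t r G = twoSym dt (dϱt t r) + t ^ 2 • pullForm G := rfl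

lemma det_ne_zero_of_ambientForm {t r : ℝ} {G : Matrix (Fin 5) (Fin 5) ℝ}
    (hG : (ambientForm t r G).det ≠ 0) : G.det ≠ 0 := by
  contrapose! hG
  obtain ⟨v, hv0, hv⟩ := exists_mulVec_eq_zero_iff.2 hG
  refine exists_mulVec_eq_zero_iff.1 ⟨pull v, fun h0 => hv0 ?_, ?_⟩
  · have e := fun a => congrFun h0 a
    funext i
    fin_cases i
    exacts [e 1, e 2, e 3, e 4, e 5]
  · have h1 : dt ⬝ᵥ pull v = 0 := by simp [dt, pull]
    have h2 : dϱt t r ⬝ᵥ pull v = 0 := by simp [dϱt, dt, pull, add_dotProduct]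
    have h3 : pull 0 = 0 := by
      funext a
      fin_cases a <;> rfl
    rw [ambientForm_eq, add_mulVec, smul_mulVec, pullForm_mulVec_pull, hv, twoSym, add_mulVec,
      vecMulVec_mulVec, vecMulVec_mulVec, h1, h2, h3]
    simp

/-- The family of metrics `g(·, ϱ)` for the metric `gTilde`. -/
def gRho (f : ℝ → ℝ → ℝ → ℝ) (h : ℝ → ℝ → ℝ) (A B C : ℝ → ℝ → ℝ → ℝ → ℝ) (m : Fin 5 → ℝ) (r : ℝ) :
    Matrix (Fin 5) (Fin 5) ℝ :=
  gD f h m + A (m 0) (m 1) (m 3) r • symSq (θ₁ m) + B (m 0) (m 1) (m 3) r • twoSym (θ₁ m) θ₄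
    + C (m 0) (m 1) (m 3) r • symSq θ₄

lemma base_pt (t : ℝ) (m : Fin 5 → ℝ) (r : ℝ) : base (pt t m r) = m := by
  funext i
  fin_cases i <;> rfl

lemma pt_base (u : Fin 7 → ℝ) : pt (u 0) (base u) (u 6) = u := by
  funext i
  fin_cases i <;> rfl

lemma gTilde_pt (t : ℝ) (m : Fin 5 → ℝ) (r : ℝ) :
    gTilde f h A B C (pt t m r) = ambientForm t r (gRho f h A B C m r) := by
  have e0 : pt t m r 0 = t := rfl
  have e1 : pt t m r 1 = m 0 := rfl
  have e2 : pt t m r 2 = m 1 := rfl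
  have e4 : pt t m r 4 = m 3 := rfl
  have e6 : pt t m r 6 = r := rfl
  simp only [ambientForm_eq, gRho, gD, pullForm_add, pullForm_sub, pullForm_smul, pullForm_twoSym,
    pullForm_symSq, gTilde, ω₁, ω₂, ω₃, ω₄, ω₅, ω₆, ω₇, base_pt, at₄, e0, e1, e2, e4, e6]
  generalize pull (θ₁ m) = α₁
  generalize pull (θ₂ f h m) = α₂
  generalize pull (θ₃ m) = α₃
  generalize pull θ₄ = α₄
  generalize pull (θ₅ f h m) = α₅
  generalize dϱt t r = δ
  ext a b
  simp only [twoSym, symSq, Matrix.add_apply, Matrix.sub_apply, Matrix.smul_apply, vecMulVec_apply,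
    Pi.add_apply, Pi.sub_apply, Pi.smul_apply, smul_eq_mul]
  linear_combination ((dt a * δ b + δ a * dt b) / 2
    + t * h (m 0) (m 1) / 18 * (α₄ a * δ b + δ a * α₄ b)) * sqrt_two_mul_self

lemma twoSym_isSymm {n : ℕ} (α β : Fin n → ℝ) : (twoSym α β).IsSymm := by
  ext i j
  simp [twoSym, vecMulVec_apply]
  ring

lemma symSq_isSymm {n : ℕ} (α : Fin n → ℝ) : (symSq α).IsSymm := by
  ext i j
  simp [symSq, vecMulVec_apply]
  ring

lemma gRho_isSymm (m : Fin 5 → ℝ) (r : ℝ) : (gRho f h A B C m r).IsSymm := by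
  have hD : (gD f h m).IsSymm :=
    ((twoSym_isSymm _ _).sub (twoSym_isSymm _ _)).add (symSq_isSymm _)
  exact ((hD.add ((symSq_isSymm _).smul _)).add ((twoSym_isSymm _ _).smul _)).add
    ((symSq_isSymm _).smul _)

lemma gTilde_eq_frameMetric :
    gTilde f h A B C = frameMetric etaG2 fun v => (jet f h I A B C v).sigma :=
  funext fun u => gTilde_eq I f h A B C u

lemma IsTwiceDiffSolution.hasAmbientForm (H : IsTwiceDiffSolution V I f h A B C)
    (h0 : VanishAtZero V A B C) (hM : IsOpen M) (hMV : ∀ m ∈ M, (m 0, m 1, m 3) ∈ V) :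
    HasAmbientForm M I (gD f h) (gTilde f h A B C) := by
  refine ⟨gRho f h A B C, fun m hm => ?_, fun m hm r hr => ⟨gRho_isSymm m r, ?_⟩,
    fun m hm r hr t ht => gTilde_pt t m r⟩
  · obtain ⟨hA, hB, hC⟩ := h0 _ _ _ (hMV m hm)
    simp [gRho, hA, hB, hC]
  · apply det_ne_zero_of_ambientForm (t := 1) (r := r)
    rw [← gTilde_pt, gTilde_eq I]
    exact (H.isConnectionForm hM hMV).frameMetric_det
      ⟨one_pos, by rwa [base_pt], hr⟩

lemma IsTwiceDiffSolution.isTwiceDiffAmbientMetric (H : IsTwiceDiffSolution V I f h A B C)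
    (h0 : VanishAtZero V A B C) (hM : IsOpen M) (hMV : ∀ m ∈ M, (m 0, m 1, m 3) ∈ V) :
    IsTwiceDiffAmbientMetric M I (gD f h) (gTilde f h A B C) := by
  refine ⟨H.hasAmbientForm h0 hM hMV, ?_, ?_⟩
  · rw [gTilde_eq_frameMetric (I := I)]
    exact (H.isConnectionForm hM hMV).twiceDiff_frameMetric
  · rw [gTilde_eq_frameMetric (I := I)]
    exact (H.isConnectionForm hM hMV).isRicciFlat

lemma IsTwiceDiffSolution.holonomyInSplitG2 (H : IsTwiceDiffSolution V I f h A B C)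
    (hM : IsOpen M) (hMV : ∀ m ∈ M, (m 0, m 1, m 3) ∈ V) :
    HolonomyInSplitG2 (ambientSpace M I) (gTilde f h A B C) := by
  rw [gTilde_eq_frameMetric (I := I)]
  exact (H.isConnectionForm hM hMV).holonomyInSplitG2

lemma IsTwiceDiffSolution.isParallelForm (H : IsTwiceDiffSolution V I f h A B C)
    (hM : IsOpen M) (hMV : ∀ m ∈ M, (m 0, m 1, m 3) ∈ V) :
    IsParallelForm (ambientSpace M I) (gTilde f h A B C) (upsilon f h A B C) := by
  have : upsilon f h A B C = fun v i j k => tri (√2 • upsG2) ((jet f h I A B C v).sigma.col i)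
      ((jet f h I A B C v).sigma.col j) ((jet f h I A B C v).sigma.col k) := by
    funext v i j k
    rw [upsilon_eq I, tri_smul_form, tri_upsG2_col]
  rw [gTilde_eq_frameMetric (I := I), this]
  refine IsConnectionForm.isParallelForm _ (H.isConnectionForm hM hMV) fun X hX x y z => ?_
  simp only [tri_smul_form, ← mul_add, hX.2 x y z, mul_zero]

lemma SmoothOn.gTilde_entry (hV : IsOpen V) (hf : SmoothOn (unc₃ f) V)
    (hh : SmoothOn (unc₃ fun x y _ => h x y) V) (hA : SmoothOn (unc₄ A) (V ×ˢ I))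
    (hB : SmoothOn (unc₄ B) (V ×ˢ I)) (hC : SmoothOn (unc₄ C) (V ×ˢ I))
    (hMV : ∀ m ∈ M, (m 0, m 1, m 3) ∈ V) (i j : Fin 7) :
    SmoothOn (fun u => gTilde f h A B C u i j) (ambientSpace M I) := by
  have hS : Set.MapsTo projXYPR (ambientSpace M I) (V ×ˢ I) := mapsTo_projXYPR hMV
  have hS' : Set.MapsTo projXYP (ambientSpace M I) V := fun v hv => (hS hv).1
  have smooth : ∀ {φ : ℝ → ℝ → ℝ → ℝ}, SmoothOn (unc₃ φ) V →
      SmoothOn (fun v => φ (v 1) (v 2) (v 4)) (ambientSpace M I) := fun {φ} hφ =>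
    ContDiffOn.comp hφ projXYP.contDiff.contDiffOn hS'
  have halg : CoframeAlgebra (smoothAlg (ambientSpace M I)) f h A B C :=
    { coord := fun i => (contDiff_apply ℝ ℝ i).contDiffOn
      mem_dP := fun k => smooth (hf.dP hV k)
      mem_h := smooth (φ := fun x y _ => h x y) hh
      mem_dX := smooth (φ := fun x y _ => AmbientG2.dX h x y) (hh.dX hV)
      mem_dY := smooth (φ := fun x y _ => AmbientG2.dY h x y) (hh.dY hV)
      mem_A := ContDiffOn.comp hA projXYPR.contDiff.contDiffOn hS
      mem_B := ContDiffOn.comp hB projXYPR.contDiff.contDiffOn hS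
      mem_C := ContDiffOn.comp hC projXYPR.contDiff.contDiffOn hS }
  rw [gTilde_eq_frameMetric (I := I)]
  exact frameMetric_mem halg.sigma_mem i j

lemma IsTwiceDiffSolution.isAmbientMetric {ε : ℝ}
    (H : IsTwiceDiffSolution V (Set.Ioo (-ε) ε) f h A B C)
    (h0 : VanishAtZero V A B C) (hM : IsOpen M) (hMV : ∀ m ∈ M, (m 0, m 1, m 3) ∈ V)
    (hA : SmoothOn (unc₄ A) (V ×ˢ Set.Ioo (-ε) ε)) (hB : SmoothOn (unc₄ B) (V ×ˢ Set.Ioo (-ε) ε))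
    (hC : SmoothOn (unc₄ C) (V ×ˢ Set.Ioo (-ε) ε)) :
    IsAmbientMetric M ε (gD f h) (gTilde f h A B C) :=
  ⟨H.hasAmbientForm h0 hM hMV,
    SmoothOn.gTilde_entry H.isOpen H.smooth_f H.smooth_h hA hB hC hMV,
    (H.isTwiceDiffAmbientMetric h0 hM hMV).2.2⟩

end AmbientG2

end

noncomputable section

namespace AmbientG2

open Matrix

/-! ### The conformal class of the distribution -/

namespace Jet

variable (J : Jet)

/-- The coefficient of `θ¹` in `θ⁵`. -/
def E₀ : ℝ := (9 * J.fpp + 4 * J.h ^ 2 - 6 * (J.p * J.hy + J.hx)) / 10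

/-- The partial derivatives of `E₀` with respect to `(x, y, z, p, q)`. -/
def dE₀ : Fin 5 → ℝ :=
  ![(9 * J.fppx + 8 * J.h * J.hx - 6 * (J.p * J.hxy + J.hxx)) / 10,
    (9 * J.fppy + 8 * J.h * J.hy - 6 * (J.p * J.hyy + J.hxy)) / 10, 0,
    (9 * J.fppp - 6 * J.hy) / 10, 0]

/-- The matrix of the coframe `-18 θ¹, 6 θ², (3/√2) θ³, θ⁴, -(1/3) θ⁵`, which satisfies Cartan's
structure equations. -/
def tau : Matrix (Fin 5) (Fin 5) ℝ :=
  !![18 * J.p, -18, 0, 0, 0;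
    6 * (J.q ^ 2 - J.f - J.h * J.z), 0, 6, -12 * J.q, 0;
    -6 * J.q, 0, 0, 6, 0;
    3, 0, 0, 0, 0;
    -(4 * J.h * J.q + 3 * J.fp - J.p * J.E₀) / 3, -J.E₀ / 3, 0, -2 / 3 * J.h, 2]

/-- The partial derivatives of the entries of `tau`: `dtau a j i = ∂ᵢ τᵃⱼ`. -/
def dtau : Fin 5 → Fin 5 → Fin 5 → ℝ :=
  ![![![0, 0, 0, 18, 0], 0, 0, 0, 0],
    ![![-6 * (J.fx + J.hx * J.z), -6 * (J.fy + J.hy * J.z), -6 * J.h, -6 * J.fp, 12 * J.q], 0, 0,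
      ![0, 0, 0, 0, -12], 0],
    ![![0, 0, 0, 0, -6], 0, 0, 0, 0],
    ![0, 0, 0, 0, 0],
    ![![-(4 * J.hx * J.q + 3 * J.fpx - J.p * J.dE₀ 0) / 3,
        -(4 * J.hy * J.q + 3 * J.fpy - J.p * J.dE₀ 1) / 3, 0,
        -(3 * J.fpp - J.E₀ - J.p * J.dE₀ 3) / 3, -4 / 3 * J.h],
      ![-J.dE₀ 0 / 3, -J.dE₀ 1 / 3, 0, -J.dE₀ 3 / 3, 0], 0,
      ![-2 / 3 * J.hx, -2 / 3 * J.hy, 0, 0, 0], 0]]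

/-- The components of the forms `Ω₁, …, Ω₇` in the coframe `tau`. -/
def cartan : Matrix (Fin 7) (Fin 5) ℝ :=
  let s := J.fpp / 60 + J.h ^ 2 / 135 - (J.hx + J.hy * J.p) / 90
  !![0, 0, 0, J.h / 9, 0;
    0, 0, 0, 0, 0;
    -J.fpp * J.h / 270 + (J.fppp * J.q + J.fppx + J.fppy * J.p) / 180 - J.fpy / 54
      + J.h * (J.hx + J.hy * J.p) / 135 - 2 / 1215 * J.h ^ 3
      - (J.hxx + 2 * J.hxy * J.p + J.hyy * J.p ^ 2) / 270 - 11 / 270 * J.hy * J.q,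
      0, s, (J.fy + J.hy * J.z) / 9, 0;
    0, 0, 0, -2 / 9 * J.h, 0;
    -J.fppp / 480 + 13 / 2160 * J.hy, 0, 0, s, 0;
    0, 0, 0, 0, 0;
    0, 0, 0, 0, 0]

/-- The form `Ωₛ`. -/
def Omega (s : Fin 7) : Fin 5 → ℝ := (J.cartan * J.tau).row s

/-- The exterior derivative of the `a`-th form of the coframe `tau`. -/
def extTau (a : Fin 5) : Fin 5 → Fin 5 → ℝ := fun i j => J.dtau a j i - J.dtau a i j

lemma Omega_apply (s : Fin 7) (i : Fin 5) : J.Omega s i = J.cartan s 0 * J.tau 0 i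
    + J.cartan s 1 * J.tau 1 i + J.cartan s 2 * J.tau 2 i + J.cartan s 3 * J.tau 3 i
    + J.cartan s 4 * J.tau 4 i := by
  rw [Omega, row_apply, Matrix.mul_apply, Fin.sum_univ_five]

set_option linter.unusedSimpArgs false in
set_option maxHeartbeats 1000000 in
/-- Cartan's structure equations for the coframe `tau`. -/
lemma structure_equations :
    J.extTau 0 = wedge (J.tau.row 0) ((2 : ℝ) • J.Omega 0 + J.Omega 3)
      + wedge (J.tau.row 1) (J.Omega 1) + wedge (J.tau.row 2) (J.tau.row 3) ∧
    J.extTau 1 = wedge (J.tau.row 0) (J.Omega 2)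
      + wedge (J.tau.row 1) (J.Omega 0 + (2 : ℝ) • J.Omega 3)
      + wedge (J.tau.row 2) (J.tau.row 4) ∧
    J.extTau 2 = wedge (J.tau.row 0) (J.Omega 4) + wedge (J.tau.row 1) (J.Omega 5)
      + wedge (J.tau.row 2) (J.Omega 0 + J.Omega 3) + wedge (J.tau.row 3) (J.tau.row 4) ∧
    J.extTau 3 = wedge (J.tau.row 0) (J.Omega 6)
      + (4 / 3 : ℝ) • wedge (J.tau.row 2) (J.Omega 5)
      + wedge (J.tau.row 3) (J.Omega 0) + wedge (J.tau.row 4) (J.Omega 1) ∧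
    J.extTau 4 = wedge (J.tau.row 1) (J.Omega 6)
      - (4 / 3 : ℝ) • wedge (J.tau.row 2) (J.Omega 4)
      + wedge (J.tau.row 3) (J.Omega 2) + wedge (J.tau.row 4) (J.Omega 3) := by
  refine ⟨?_, ?_, ?_, ?_, ?_⟩ <;> funext i j <;>
    simp only [wedge, extTau, Pi.add_apply, Pi.sub_apply, Pi.smul_apply, smul_eq_mul, row_apply,
      Omega_apply] <;>
    simp only [cartan, of_apply, cons_val, zero_mul, zero_add, add_zero, mul_zero, sub_zero,
      smul_zero] <;>
    fin_cases i <;> fin_cases j <;>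
    simp only [tau, dtau, of_apply, cons_val, Fin.mk_one, Fin.zero_eta, Fin.reduceFinMk,
      Pi.zero_apply, zero_mul, mul_zero, sub_zero, zero_sub, add_zero, zero_add, neg_zero, sub_self,
      dE₀, E₀] <;>
    ring

lemma tau_det_ne_zero : J.tau.det ≠ 0 := by
  rw [Ne, ← exists_mulVec_eq_zero_iff]
  rintro ⟨v, hv0, hv⟩
  apply hv0
  have e := fun a => congrFun hv a
  simp only [tau, mulVec, dotProduct, Fin.sum_univ_five, Pi.zero_apply] at e
  have e0 := e 0
  have e1 := e 1
  have e2 := e 2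
  have e3 := e 3
  have e4 := e 4
  simp only [of_apply, cons_val, zero_mul, add_zero, zero_add] at e0 e1 e2 e3 e4
  have h0 : v 0 = 0 := by linarith
  rw [h0] at e0 e1 e2 e4
  have h1 : v 1 = 0 := by linarith
  have h3 : v 3 = 0 := by linarith
  rw [h3] at e1 e4
  rw [h1] at e4
  have h2 : v 2 = 0 := by linarith
  have h4 : v 4 = 0 := by linarith
  funext i
  fin_cases i <;> assumption

end Jet

variable {V : Set (ℝ × ℝ × ℝ)} {f : ℝ → ℝ → ℝ → ℝ} {h : ℝ → ℝ → ℝ} {M : Set (Fin 5 → ℝ)}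
  {m : Fin 5 → ℝ}

/-- The jet of `f` and `h` at the point `m` of `ℝ⁵`. -/
def jet₅ (f : ℝ → ℝ → ℝ → ℝ) (h : ℝ → ℝ → ℝ) (m : Fin 5 → ℝ) : Jet :=
  jet f h Set.univ 0 0 0 (pt 1 m 0)

/-- The linear part of the map `m ↦ pt 1 m 0`. -/
def pullCLM : (Fin 5 → ℝ) →L[ℝ] (Fin 7 → ℝ) :=
  ContinuousLinearMap.pi ![0, ContinuousLinearMap.proj 0, ContinuousLinearMap.proj 1,
    ContinuousLinearMap.proj 2, ContinuousLinearMap.proj 3, ContinuousLinearMap.proj 4, 0]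

lemma hasFDerivAt_pt : HasFDerivAt (fun m => pt 1 m 0) pullCLM m := by
  have : (fun m => pt 1 m 0) = fun m => pullCLM m + pt 1 0 0 := by
    funext m a
    fin_cases a <;> simp [pt, pullCLM]
  rw [this]
  exact pullCLM.hasFDerivAt.add_const _

lemma HasGrad.comp_pt {F : (Fin 7 → ℝ) → ℝ} {G : Fin 7 → ℝ}
    (hF : HasGrad Set.univ F G (pt 1 m 0)) :
    HasGrad M (fun m => F (pt 1 m 0)) ![G 1, G 2, G 3, G 4, G 5] m := by
  have h1 := HasFDerivWithinAt.comp (g := F) (f := fun m => pt 1 m 0) m hF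
    hasFDerivAt_pt.hasFDerivWithinAt (Set.mapsTo_univ _ M)
  have : covec ![G 1, G 2, G 3, G 4, G 5] = (covec G).comp pullCLM := by
    ext v
    simp [Fin.sum_univ_five, Fin.sum_univ_seven, pullCLM]
  rw [HasGrad, this]
  exact h1

lemma hasGrad_tau (hV : IsOpen V) (hf : SmoothOn (unc₃ f) V)
    (hh : SmoothOn (unc₃ fun x y _ => h x y) V) (hm : (m 0, m 1, m 3) ∈ V) (a j : Fin 5) :
    HasGrad M (fun m => (jet₅ f h m).tau a j) ((jet₅ f h m).dtau a j) m := by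
  have hu : (pt 1 m 0 1, pt 1 m 0 2, pt 1 m 0 4) ∈ V := hm
  have hF : HasGrad M (fun m => (jet₅ f h m).f)
      ![(jet₅ f h m).fx, (jet₅ f h m).fy, 0, (jet₅ f h m).fp, 0] m := by
    have := (hasGrad_dP hV hf hu 0).comp_pt (M := M)
    simp only [dP, iteratedDeriv_zero] at this
    exact this
  have hFp : HasGrad M (fun m => (jet₅ f h m).fp)
      ![(jet₅ f h m).fpx, (jet₅ f h m).fpy, 0, (jet₅ f h m).fpp, 0] m :=
    (hasGrad_dP hV hf hu 1).comp_pt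
  have hFpp : HasGrad M (fun m => (jet₅ f h m).fpp)
      ![(jet₅ f h m).fppx, (jet₅ f h m).fppy, 0, (jet₅ f h m).fppp, 0] m :=
    (hasGrad_dP hV hf hu 2).comp_pt
  have hH : HasGrad M (fun m => (jet₅ f h m).h)
      ![(jet₅ f h m).hx, (jet₅ f h m).hy, 0, 0, 0] m := (hasGrad_h hV hh hu).comp_pt
  have hHx : HasGrad M (fun m => (jet₅ f h m).hx)
      ![(jet₅ f h m).hxx, (jet₅ f h m).hxy, 0, 0, 0] m :=
    (hasGrad_h (h := dX h) hV (hh.dX hV) hu).comp_pt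
  have hHy : HasGrad M (fun m => (jet₅ f h m).hy)
      ![(jet₅ f h m).hxy, (jet₅ f h m).hyy, 0, 0, 0] m := by
    have := (hasGrad_h (h := dY h) hV (hh.dY hV) hu).comp_pt (M := M)
    rw [dX_dY hV hh hu] at this
    exact this
  have hz : HasGrad M (fun m => (jet₅ f h m).z) (Pi.single 2 1) m := hasGrad_coord 2
  have hp : HasGrad M (fun m => (jet₅ f h m).p) (Pi.single 3 1) m := hasGrad_coord 3
  have hq : HasGrad M (fun m => (jet₅ f h m).q) (Pi.single 4 1) m := hasGrad_coord 4
  have h0 : ∀ c, HasGrad M (fun _ => c) (0 : Fin 5 → ℝ) m := hasGrad_const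
  generalize jet₅ f h = J at *
  have hE : HasGrad M (fun m => (J m).E₀) (J m).dE₀ m := by
    refine ((hFpp.const_mul (9 / 10)).add ((hH.mul hH).const_mul (4 / 10))).sub
      (((hp.mul hHy).add hHx).const_mul (6 / 10)) |>.congr_fun
      (fun v => by simp only [Jet.E₀]; ring) fun i => ?_
    fin_cases i <;> simp only [Jet.dE₀, cons_val, Fin.mk_one, Fin.zero_eta, Fin.reduceFinMk,
      Pi.single_apply, Fin.reduceEq, if_true, if_false] <;> ring
  have entry : ∀ {F F' : (Fin 5 → ℝ) → ℝ} {G G' : Fin 5 → ℝ}, HasGrad M F G m →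
    (∀ v, F' v = F v) → (∀ i, G' i = G i) → HasGrad M F' G' m := HasGrad.congr_fun
  fin_cases a <;> fin_cases j <;>
    simp only [Jet.tau, Jet.dtau, of_apply, cons_val, Fin.mk_one, Fin.zero_eta,
      Fin.reduceFinMk] <;>
    (try with_reducible exact h0 _) <;>
    [ refine entry (hp.const_mul 18) ?_ ?_;
      refine entry (((hq.mul hq).sub (hF.add (hH.mul hz))).const_mul 6) ?_ ?_;
      refine entry (hq.const_mul (-12)) ?_ ?_;
      refine entry (hq.const_mul (-6)) ?_ ?_;
      refine entry (((((hH.mul hq).const_mul 4).add (hFp.const_mul 3)).sub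
        (hp.mul hE)).const_mul (-(1 / 3))) ?_ ?_;
      refine entry (hE.const_mul (-(1 / 3))) ?_ ?_;
      refine entry (hH.const_mul (-2 / 3)) ?_ ?_] <;>
    first
    | (intro v; ring1)
    | (intro i; fin_cases i <;>
        simp only [cons_val, Fin.mk_one, Fin.zero_eta, Fin.reduceFinMk, Pi.single_apply,
          Fin.reduceEq, if_true, if_false, Jet.dE₀] <;> ring)

/-- The projection `m ↦ (x, y, p)`. -/
def projXYP₅ : (Fin 5 → ℝ) →L[ℝ] ℝ × ℝ × ℝ :=
  (ContinuousLinearMap.proj 0).prod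
    ((ContinuousLinearMap.proj 1).prod (ContinuousLinearMap.proj 3))

lemma SmoothOn.derivX {φ : ℝ → ℝ → ℝ → ℝ} (hV : IsOpen V) (hφ : SmoothOn (unc₃ φ) V) :
    SmoothOn (unc₃ fun x y p => deriv (fun s => φ s y p) x) V := by
  refine (hφ.fderiv_apply hV (1, 0, 0)).congr fun v hv => ?_
  have hd := (hφ.differentiableAt hV hv).hasFDerivAt
  exact (HasFDerivAt.comp_hasDerivAt v.1 (l := unc₃ φ) (f := fun s => (s, v.2.1, v.2.2)) hd
    ((hasDerivAt_id _).prodMk (hasDerivAt_const _ _))).deriv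

lemma SmoothOn.derivY {φ : ℝ → ℝ → ℝ → ℝ} (hV : IsOpen V) (hφ : SmoothOn (unc₃ φ) V) :
    SmoothOn (unc₃ fun x y p => deriv (fun s => φ x s p) y) V := by
  refine (hφ.fderiv_apply hV (0, 1, 0)).congr fun v hv => ?_
  have hd := (hφ.differentiableAt hV hv).hasFDerivAt
  exact (HasFDerivAt.comp_hasDerivAt v.2.1 (l := unc₃ φ) (f := fun s => (v.1, s, v.2.2)) hd
    ((hasDerivAt_const _ _).prodMk ((hasDerivAt_id _).prodMk (hasDerivAt_const _ _)))).deriv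

lemma smooth_tau_cartan (hV : IsOpen V) (hf : SmoothOn (unc₃ f) V)
    (hh : SmoothOn (unc₃ fun x y _ => h x y) V) (hMV : ∀ m ∈ M, (m 0, m 1, m 3) ∈ V) :
    (∀ a j, SmoothOn (fun m => (jet₅ f h m).tau a j) M) ∧
      ∀ s j, SmoothOn (fun m => (jet₅ f h m).cartan s j) M := by
  set 𝒜 := smoothAlg M
  have smooth : ∀ {φ : ℝ → ℝ → ℝ → ℝ}, SmoothOn (unc₃ φ) V →
      (fun m : Fin 5 → ℝ => φ (m 0) (m 1) (m 3)) ∈ 𝒜 := fun {φ} hφ =>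
    ContDiffOn.comp (g := unc₃ φ) (f := projXYP₅) hφ projXYP₅.contDiff.contDiffOn hMV
  have c : ∀ r : ℝ, (fun _ => r) ∈ 𝒜 := fun r => 𝒜.algebraMap_mem r
  have coord : ∀ i, (fun m : Fin 5 → ℝ => m i) ∈ 𝒜 := fun i => (contDiff_apply ℝ ℝ i).contDiffOn
  have hf1 := hf.dP hV 1
  have hf2 := hf.dP hV 2
  have hhx := hh.dX hV
  have hhy := hh.dY hV
  have mz : (fun m => (jet₅ f h m).z) ∈ 𝒜 := coord 2
  have mp : (fun m => (jet₅ f h m).p) ∈ 𝒜 := coord 3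
  have mq : (fun m => (jet₅ f h m).q) ∈ 𝒜 := coord 4
  have mf : (fun m => (jet₅ f h m).f) ∈ 𝒜 := smooth hf
  have mfy : (fun m => (jet₅ f h m).fy) ∈ 𝒜 := smooth (hf.derivY hV)
  have mfp : (fun m => (jet₅ f h m).fp) ∈ 𝒜 := smooth hf1
  have mfpy : (fun m => (jet₅ f h m).fpy) ∈ 𝒜 := smooth (hf1.derivY hV)
  have mfpp : (fun m => (jet₅ f h m).fpp) ∈ 𝒜 := smooth hf2
  have mfppx : (fun m => (jet₅ f h m).fppx) ∈ 𝒜 := smooth (hf2.derivX hV)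
  have mfppy : (fun m => (jet₅ f h m).fppy) ∈ 𝒜 := smooth (hf2.derivY hV)
  have mfppp : (fun m => (jet₅ f h m).fppp) ∈ 𝒜 := smooth (hf.dP hV 3)
  have mh : (fun m => (jet₅ f h m).h) ∈ 𝒜 := smooth (φ := fun x y _ => h x y) hh
  have mhx : (fun m => (jet₅ f h m).hx) ∈ 𝒜 := smooth (φ := fun x y _ => dX h x y) hhx
  have mhy : (fun m => (jet₅ f h m).hy) ∈ 𝒜 := smooth (φ := fun x y _ => dY h x y) hhy
  have mhxx : (fun m => (jet₅ f h m).hxx) ∈ 𝒜 :=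
    smooth (φ := fun x y _ => dX (dX h) x y) (hhx.dX hV)
  have mhxy : (fun m => (jet₅ f h m).hxy) ∈ 𝒜 :=
    smooth (φ := fun x y _ => dY (dX h) x y) (hhx.dY hV)
  have mhyy : (fun m => (jet₅ f h m).hyy) ∈ 𝒜 :=
    smooth (φ := fun x y _ => dY (dY h) x y) (hhy.dY hV)
  show (∀ a j, (fun m => (jet₅ f h m).tau a j) ∈ 𝒜) ∧
    ∀ s j, (fun m => (jet₅ f h m).cartan s j) ∈ 𝒜
  generalize jet₅ f h = J at *
  have mD : (fun m => (J m).hx + (J m).hy * (J m).p) ∈ 𝒜 := 𝒜.add_mem mhx (𝒜.mul_mem mhy mp)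
  have mE : (fun m => (J m).E₀) ∈ 𝒜 :=
    𝒜.mul_mem (𝒜.sub_mem (𝒜.add_mem (𝒜.mul_mem (c 9) mfpp) (𝒜.mul_mem (c 4) (𝒜.pow_mem mh 2)))
      (𝒜.mul_mem (c 6) (𝒜.add_mem (𝒜.mul_mem mp mhy) mhx))) (c 10⁻¹)
  constructor
  · intro a j
    fin_cases a <;> fin_cases j <;>
      simp only [Jet.tau, of_apply, cons_val, Fin.mk_one, Fin.zero_eta, Fin.reduceFinMk] <;>
      (try with_reducible exact c _)
    · exact 𝒜.mul_mem (c 18) mp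
    · exact 𝒜.mul_mem (c 6) (𝒜.sub_mem (𝒜.sub_mem (𝒜.pow_mem mq 2) mf) (𝒜.mul_mem mh mz))
    · exact 𝒜.mul_mem (c (-12)) mq
    · exact 𝒜.mul_mem (c (-6)) mq
    · exact 𝒜.mul_mem (𝒜.neg_mem (𝒜.sub_mem (𝒜.add_mem (𝒜.mul_mem (𝒜.mul_mem (c 4) mh) mq)
        (𝒜.mul_mem (c 3) mfp)) (𝒜.mul_mem mp mE))) (c 3⁻¹)
    · exact 𝒜.mul_mem (𝒜.neg_mem mE) (c 3⁻¹)
    · exact 𝒜.mul_mem (c (-2 / 3)) mh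
  · have ms : (fun m => (J m).fpp / 60 + (J m).h ^ 2 / 135 - ((J m).hx + (J m).hy * (J m).p) / 90)
        ∈ 𝒜 :=
      𝒜.sub_mem (𝒜.add_mem (𝒜.mul_mem mfpp (c 60⁻¹)) (𝒜.mul_mem (𝒜.pow_mem mh 2) (c 135⁻¹)))
        (𝒜.mul_mem mD (c 90⁻¹))
    intro s j
    fin_cases s <;> fin_cases j <;>
      simp only [Jet.cartan, of_apply, cons_val, Fin.mk_one, Fin.zero_eta, Fin.reduceFinMk] <;>
      (try with_reducible exact c _)
    · exact 𝒜.mul_mem mh (c 9⁻¹)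
    · exact 𝒜.sub_mem (𝒜.sub_mem (𝒜.sub_mem (𝒜.add_mem (𝒜.sub_mem (𝒜.add_mem
        (𝒜.mul_mem (𝒜.mul_mem (𝒜.neg_mem mfpp) mh) (c 270⁻¹))
        (𝒜.mul_mem (𝒜.add_mem (𝒜.add_mem (𝒜.mul_mem mfppp mq) mfppx) (𝒜.mul_mem mfppy mp))
          (c 180⁻¹))) (𝒜.mul_mem mfpy (c 54⁻¹))) (𝒜.mul_mem (𝒜.mul_mem mh mD) (c 135⁻¹)))
        (𝒜.mul_mem (c (2 / 1215)) (𝒜.pow_mem mh 3)))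
        (𝒜.mul_mem (𝒜.add_mem (𝒜.add_mem mhxx (𝒜.mul_mem (𝒜.mul_mem (c 2) mhxy) mp))
          (𝒜.mul_mem mhyy (𝒜.pow_mem mp 2))) (c 270⁻¹)))
        (𝒜.mul_mem (𝒜.mul_mem (c (11 / 270)) mhy) mq)
    · exact ms
    · exact 𝒜.mul_mem (𝒜.add_mem mfy (𝒜.mul_mem mhy mz)) (c 9⁻¹)
    · exact 𝒜.mul_mem (c (-2 / 9)) mh
    · exact 𝒜.add_mem (𝒜.mul_mem (𝒜.neg_mem mfppp) (c 480⁻¹)) (𝒜.mul_mem (c (13 / 2160)) mhy)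
    · exact ms

lemma mem_distr_iff (v : Fin 5 → ℝ) : v ∈ distr f h m ↔ (jet₅ f h m).tau.row 0 ⬝ᵥ v = 0 ∧
    (jet₅ f h m).tau.row 1 ⬝ᵥ v = 0 ∧ (jet₅ f h m).tau.row 2 ⬝ᵥ v = 0 := by
  have hp : (jet₅ f h m).p = m 3 := rfl
  have hq : (jet₅ f h m).q = m 4 := rfl
  have hz : (jet₅ f h m).z = m 2 := rfl
  have hf : (jet₅ f h m).f = f (m 0) (m 1) (m 3) := rfl
  have hh : (jet₅ f h m).h = h (m 0) (m 1) := rfl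
  rw [distr, Submodule.mem_span_pair]
  simp only [dotProduct, Fin.sum_univ_five, row_apply, Jet.tau, of_apply, cons_val, hp, hq, hz, hf,
    hh]
  constructor
  · rintro ⟨a, b, rfl⟩
    simp only [Pi.add_apply, Pi.smul_apply, cons_val, smul_eq_mul]
    refine ⟨?_, ?_, ?_⟩ <;> ring
  · rintro ⟨h0, h1, h2⟩
    refine ⟨v 4, v 0, ?_⟩
    funext i
    fin_cases i <;> simp only [Pi.add_apply, Pi.smul_apply, cons_val, smul_eq_mul, Fin.mk_one,
      Fin.zero_eta, Fin.reduceFinMk]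
    · ring
    · linarith
    · linear_combination -h1 / 6 - m 4 / 3 * h2
    · linarith
    · ring

lemma gD_eq : gD f h m = (1 / 6 : ℝ) • (twoSym ((jet₅ f h m).tau.row 0) ((jet₅ f h m).tau.row 4)
    - twoSym ((jet₅ f h m).tau.row 1) ((jet₅ f h m).tau.row 3)
    + (4 / 3 : ℝ) • symSq ((jet₅ f h m).tau.row 2)) := by
  have e0 : (jet₅ f h m).tau.row 0 = (-18 : ℝ) • θ₁ m := by
    funext i
    fin_cases i <;> simp [Jet.tau, θ₁, d₅, row_apply, jet₅, jet, pt]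
  have e1 : (jet₅ f h m).tau.row 1 = (6 : ℝ) • θ₂ f h m := by
    funext i
    fin_cases i <;> simp only [Jet.tau, θ₂, θ₃, Pi.add_apply, Pi.sub_apply, Pi.smul_apply,
      smul_eq_mul, d₅, Pi.single_apply, Fin.reduceEq, if_true, if_false, jet₅, jet, pt, row_apply,
      of_apply, cons_val, Fin.mk_one, Fin.zero_eta, Fin.reduceFinMk]
    · linear_combination (-6 * m 4 ^ 2) * sqrt_two_mul_self
    · ring
    · ring
    · linear_combination (6 * m 4) * sqrt_two_mul_self
    · ring
  have e2 : √2 • (jet₅ f h m).tau.row 2 = (3 : ℝ) • θ₃ m := by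
    funext i
    fin_cases i <;> simp [Jet.tau, θ₃, d₅, row_apply, jet₅, jet, pt] <;> ring
  have e3 : (jet₅ f h m).tau.row 3 = θ₄ := by
    funext i
    fin_cases i <;> simp [Jet.tau, θ₄, d₅, row_apply]
  have e4 : (jet₅ f h m).tau.row 4 = (-1 / 3 : ℝ) • θ₅ f h m := by
    funext i
    fin_cases i <;> simp only [Jet.tau, Jet.E₀, θ₅, θ₁, θ₃, Pi.add_apply, Pi.sub_apply,
      Pi.smul_apply, smul_eq_mul, d₅, Pi.single_apply, Fin.reduceEq, if_true, if_false, jet₅, jet,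
      pt, row_apply, of_apply, cons_val, Fin.mk_one, Fin.zero_eta, Fin.reduceFinMk]
    · linear_combination (-1 / 3 * h (m 0) (m 1) * m 4) * sqrt_two_mul_self
    · ring
    · ring
    · linear_combination (1 / 3 * h (m 0) (m 1)) * sqrt_two_mul_self
    · ring
  ext i j
  have h2 := fun i => congrFun e2 i
  simp only [gD, e0, e1, e3, e4, twoSym, symSq, Matrix.add_apply, Matrix.sub_apply,
    Matrix.smul_apply, vecMulVec_apply, Pi.smul_apply, smul_eq_mul] at h2 ⊢
  generalize (jet₅ f h m).tau.row 2 = τ at *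
  have h3 : 9 * (θ₃ m i * θ₃ m j) = 2 * (τ i * τ j) := by
    rw [← sqrt_two_mul_self]
    linear_combination (-(3 * θ₃ m j)) * h2 i - √2 * τ i * h2 j
  linear_combination h3 / 9

/-- The metric `gD` represents the conformal class of the distribution. -/
theorem inConformalClass (hV : IsOpen V) (hf : SmoothOn (unc₃ f) V)
    (hh : SmoothOn (unc₃ fun x y _ => h x y) V) (hM : IsOpen M)
    (hMV : ∀ m ∈ M, (m 0, m 1, m 3) ∈ V) : InConformalClass M (distr f h) (gD f h) := by
  obtain ⟨hs, hs'⟩ := smooth_tau_cartan hV hf hh hMV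
  refine ⟨fun a m => (jet₅ f h m).tau.row a, fun s m => (jet₅ f h m).Omega s,
    fun _ => -Real.log 6 / 2, hs, fun s i => ?_, contDiffOn_const, fun m hm => ?_⟩
  · simp only [Jet.Omega_apply]
    exact ((((((hs' s 0).mul (hs 0 i)).add ((hs' s 1).mul (hs 1 i))).add
      ((hs' s 2).mul (hs 2 i))).add ((hs' s 3).mul (hs 3 i))).add ((hs' s 4).mul (hs 4 i)))
  · have hext : ∀ a, extD M (fun m => (jet₅ f h m).tau.row a) m = (jet₅ f h m).extTau a := by
      intro a
      have hU : UniqueDiffWithinAt ℝ M m := hM.uniqueDiffOn m hm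
      funext i j
      exact congrArg₂ _ ((hasGrad_tau hV hf hh (hMV m hm) a j).pd_eq hU i)
        ((hasGrad_tau hV hf hh (hMV m hm) a i).pd_eq hU j)
    obtain ⟨t0, t1, t2, t3, t4⟩ := (jet₅ f h m).structure_equations
    refine ⟨?_, fun v => mem_distr_iff v, ?_, ?_, ?_, ?_, ?_, ?_⟩
    · exact linearIndependent_rows_of_det_ne_zero (jet₅ f h m).tau_det_ne_zero
    · rw [hext, t0]
    · rw [hext, t1]
    · rw [hext, t2]
    · rw [hext, t3]
    · rw [hext, t4]
    · rw [gD_eq, show 2 * (-Real.log 6 / 2) = -Real.log 6 by ring, Real.exp_neg,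
        Real.exp_log (by norm_num), one_div]

end AmbientG2

end

noncomputable section

namespace AmbientG2

open Matrix

/-! ### Functions that vanish to a given order at `ϱ = 0` -/

section Order

variable {S : Set (Fin 7 → ℝ)} {F G : (Fin 7 → ℝ) → ℝ} {u : Fin 7 → ℝ} {k : ℕ}

lemma SmoothOn.pd (hS : IsOpen S) (hF : SmoothOn F S) (i : Fin 7) : SmoothOn (pd S i F) S :=
  (hF.fderivWithin (m := ∞) hS.uniqueDiffOn le_rfl).clm_apply contDiffOn_const

lemma SmoothOn.hasGrad (hF : SmoothOn F S) (hu : u ∈ S) :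
    HasGrad S F (fun i => AmbientG2.pd S i F u) u :=
  hasGrad_pd (hF.differentiableOn (by simp) u hu)

lemma pd_mul (hS : IsOpen S) (hF : SmoothOn F S) (hG : SmoothOn G S) (hu : u ∈ S) (i : Fin 7) :
    pd S i (fun v => F v * G v) u = pd S i F u * G u + F u * pd S i G u :=
  ((hF.hasGrad hu).mul (hG.hasGrad hu)).pd_eq (hS.uniqueDiffOn u hu) i

lemma pd_sub (hS : IsOpen S) (hF : SmoothOn F S) (hG : SmoothOn G S) (hu : u ∈ S) (i : Fin 7) :
    pd S i (fun v => F v - G v) u = pd S i F u - pd S i G u :=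
  ((hF.hasGrad hu).sub (hG.hasGrad hu)).pd_eq (hS.uniqueDiffOn u hu) i

lemma pd_add (hS : IsOpen S) (hF : SmoothOn F S) (hG : SmoothOn G S) (hu : u ∈ S) (i : Fin 7) :
    pd S i (fun v => F v + G v) u = pd S i F u + pd S i G u :=
  ((hF.hasGrad hu).add (hG.hasGrad hu)).pd_eq (hS.uniqueDiffOn u hu) i

lemma pd_const_mul (hS : IsOpen S) (c : ℝ) (hF : SmoothOn F S) (hu : u ∈ S) (i : Fin 7) :
    pd S i (fun v => c * F v) u = c * pd S i F u :=
  ((hF.hasGrad hu).const_mul c).pd_eq (hS.uniqueDiffOn u hu) i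

lemma pd_const (hS : IsOpen S) (c : ℝ) (hu : u ∈ S) (i : Fin 7) :
    pd S i (fun _ => c) u = 0 :=
  (hasGrad_const c).pd_eq (hS.uniqueDiffOn u hu) i

lemma pd_coord (hS : IsOpen S) (j : Fin 7) (hu : u ∈ S) (i : Fin 7) :
    pd S i (fun v => v j) u = (Pi.single j 1 : Fin 7 → ℝ) i :=
  (hasGrad_coord j).pd_eq (hS.uniqueDiffOn u hu) i

lemma smoothOn_coord (j : Fin 7) : SmoothOn (fun v : Fin 7 → ℝ => v j) S :=
  (contDiff_apply ℝ ℝ j).contDiffOn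

lemma pd_comm (hS : IsOpen S) (hF : SmoothOn F S) (hu : u ∈ S) (i j : Fin 7) :
    pd S i (pd S j F) u = pd S j (pd S i F) u := by
  refine (hF.twiceDiffOn hS.uniqueDiffOn).pd_comm (fun v hv => ?_) hu i j
  obtain ⟨r, hr, hball⟩ := Metric.isOpen_iff.1 hS v hv
  exact ⟨Metric.ball v r, hball, Metric.mem_ball_self hr, convex_ball v r,
    ⟨v, by rw [Metric.isOpen_ball.interior_eq]; exact Metric.mem_ball_self hr⟩⟩

/-- `F` is smooth on `S` and is `O(ϱᵏ)`: its derivatives with respect to `ϱ` of order less than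
`k` vanish where `ϱ = 0`. -/
def VanishesToOrder (S : Set (Fin 7 → ℝ)) : ℕ → ((Fin 7 → ℝ) → ℝ) → Prop
  | 0, F => SmoothOn F S
  | k + 1, F => SmoothOn F S ∧ (∀ u ∈ S, u 6 = 0 → F u = 0) ∧ VanishesToOrder S k (pd S 6 F)

namespace VanishesToOrder

lemma congr (hF : VanishesToOrder S k F) (h : ∀ v ∈ S, G v = F v) : VanishesToOrder S k G := by
  induction k generalizing F G with
  | zero => exact ContDiffOn.congr hF h
  | succ k ih =>
    exact ⟨hF.1.congr h, fun u hu h6 => (h u hu).trans (hF.2.1 u hu h6),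
      ih hF.2.2 fun v hv => pd_congr hv h 6⟩

lemma of_succ (hF : VanishesToOrder S (k + 1) F) : VanishesToOrder S k F := by
  induction k generalizing F with
  | zero => exact hF.1
  | succ k ih => exact ⟨hF.1, hF.2.1, ih hF.2.2⟩

lemma mono {j : ℕ} (hF : VanishesToOrder S k F) (hjk : j ≤ k) :
    VanishesToOrder S j F := by
  induction k, hjk using Nat.le_induction with
  | base => exact hF
  | succ k _ ih => exact ih (hF.of_succ)

lemma zero (hS : IsOpen S) : VanishesToOrder S k fun _ => 0 := by
  induction k with
  | zero => exact contDiffOn_const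
  | succ k ih => exact ⟨contDiffOn_const, fun _ _ _ => rfl, ih.congr fun v hv => pd_const hS 0 hv 6⟩

lemma add (hS : IsOpen S) (hF : VanishesToOrder S k F) (hG : VanishesToOrder S k G) :
    VanishesToOrder S k fun u => F u + G u := by
  induction k generalizing F G with
  | zero => exact ContDiffOn.add hF hG
  | succ k ih =>
    exact ⟨hF.1.add hG.1, fun u hu h6 => by simp only [hF.2.1 u hu h6, hG.2.1 u hu h6, add_zero],
      (ih hF.2.2 hG.2.2).congr fun v hv => pd_add hS hF.1 hG.1 hv 6⟩

lemma mul_smooth (hS : IsOpen S) (hF : VanishesToOrder S k F) (hG : SmoothOn G S) :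
    VanishesToOrder S k fun u => F u * G u := by
  induction k generalizing F G with
  | zero => exact ContDiffOn.mul hF hG
  | succ k ih =>
    exact ⟨hF.1.mul hG, fun u hu h6 => by simp only [hF.2.1 u hu h6, zero_mul],
      ((ih hF.2.2 hG).add hS (ih (hF.of_succ) (hG.pd hS 6))).congr fun v hv =>
        pd_mul hS hF.1 hG hv 6⟩

lemma const_mul (hS : IsOpen S) (c : ℝ) (hF : VanishesToOrder S k F) :
    VanishesToOrder S k fun u => c * F u :=
  (hF.mul_smooth hS (contDiffOn_const (c := c))).congr fun _ _ => mul_comm _ _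

/-- Differentiation in a direction tangent to `ϱ = 0` does not lower the order. -/
lemma pd_of_ne (hS : IsOpen S) (hF : VanishesToOrder S k F) {i : Fin 7} (hi : i ≠ 6) :
    VanishesToOrder S k (AmbientG2.pd S i F) := by
  induction k generalizing F with
  | zero => exact SmoothOn.pd hS hF i
  | succ k ih =>
    refine ⟨hF.1.pd hS i, fun u hu h6 => ?_, (ih hF.2.2).congr fun v hv => pd_comm hS hF.1 hv 6 i⟩
    have hl : HasDerivAt (fun s : ℝ => u + s • (Pi.single i 1 : Fin 7 → ℝ)) (Pi.single i 1) 0 := by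
      simpa using ((hasDerivAt_id (0 : ℝ)).smul_const (Pi.single i (1 : ℝ) : Fin 7 → ℝ)).const_add u
    have hd : HasFDerivAt F (fderivWithin ℝ F S u) (u + (0 : ℝ) • (Pi.single i 1 : Fin 7 → ℝ)) := by
      rw [zero_smul, add_zero]
      exact (hF.1.differentiableOn (by simp) u hu).hasFDerivWithinAt.hasFDerivAt (hS.mem_nhds hu)
    have h1 := hd.comp_hasDerivAt (0 : ℝ) hl
    have h2 : (F ∘ fun s : ℝ => u + s • (Pi.single i 1 : Fin 7 → ℝ)) =ᶠ[nhds 0] fun _ => 0 := by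
      have hnh : (fun s : ℝ => u + s • (Pi.single i 1 : Fin 7 → ℝ)) ⁻¹' S ∈ nhds (0 : ℝ) :=
        hl.continuousAt.preimage_mem_nhds (by simpa using hS.mem_nhds hu)
      filter_upwards [hnh] with s hs
      exact hF.2.1 _ hs (by simp [h6, hi.symm])
    exact h1.unique ((hasDerivAt_const (0 : ℝ) (0 : ℝ)).congr_of_eventuallyEq h2)

lemma rho_mul (hS : IsOpen S) (hF : VanishesToOrder S k F) :
    VanishesToOrder S (k + 1) fun u => u 6 * F u := by
  have hd : ∀ {F : (Fin 7 → ℝ) → ℝ}, SmoothOn F S → ∀ v ∈ S,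
      pd S 6 (fun u => u 6 * F u) v = F v + v 6 * pd S 6 F v := fun {F} hF v hv => by
    rw [pd_mul hS (smoothOn_coord 6) hF hv, pd_coord hS 6 hv]
    simp
  induction k generalizing F with
  | zero =>
    have hF' : SmoothOn F S := hF
    exact ⟨(smoothOn_coord 6).mul hF', fun u _ h6 => by simp only [h6, zero_mul],
      SmoothOn.pd hS ((smoothOn_coord 6).mul hF') 6⟩
  | succ k ih =>
    exact ⟨(smoothOn_coord 6).mul hF.1, fun u _ h6 => by simp only [h6, zero_mul],
      (hF.add hS (ih hF.2.2)).congr fun v hv => hd hF.1 v hv⟩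

/-- The indicial argument: if `F = O(ϱᵏ)` and `ϱ F' - a F = O(ϱᵏ⁺¹)`, where `k ≠ a`, then
`F = O(ϱᵏ⁺¹)`. -/
lemma succ_of_indicial (hS : IsOpen S) {a : ℝ} (ha : (k : ℝ) ≠ a) (hF : VanishesToOrder S k F)
    (h : VanishesToOrder S (k + 1) fun u => u 6 * AmbientG2.pd S 6 F u - a * F u) :
    VanishesToOrder S (k + 1) F := by
  induction k generalizing F a with
  | zero =>
    have hF' : SmoothOn F S := hF
    refine ⟨hF', fun u hu h6 => ?_, hF'.pd hS 6⟩
    have := h.2.1 u hu h6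
    simp only [h6, zero_mul, zero_sub, neg_eq_zero, mul_eq_zero] at this
    exact this.resolve_left fun h0 => ha (by simp [h0])
  | succ k ih =>
    refine ⟨hF.1, hF.2.1, ih (a := a - 1) (fun h => ha ?_) hF.2.2 (h.2.2.congr fun v hv => ?_)⟩
    · push_cast
      linarith
    · have h1 := hF.1.pd hS 6
      rw [pd_sub hS ((smoothOn_coord 6).mul h1) ((contDiffOn_const (c := a)).mul hF.1) hv,
        pd_mul hS (smoothOn_coord 6) h1 hv, pd_const_mul hS a hF.1 hv, pd_coord hS 6 hv]
      simp only [Pi.single_eq_same]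
      ring

end VanishesToOrder

/-! ### Pairs of functions that agree to a given order at `ϱ = 0` -/

/-- The pairs of smooth functions, as functions on two copies of the ambient space, which agree
modulo `O(ϱᵏ)`. -/
def contactAlg (S : Set (Fin 7 → ℝ)) (hS : IsOpen S) (k : ℕ) :
    Subalgebra ℝ (Bool × (Fin 7 → ℝ) → ℝ) where
  carrier := {F | (∀ b, SmoothOn (fun u => F (b, u)) S) ∧
    VanishesToOrder S k fun u => F (true, u) - F (false, u)}
  mul_mem' {F G} hF hG := ⟨fun b => (hF.1 b).mul (hG.1 b),
    ((hF.2.mul_smooth hS (hG.1 true)).add hS (hG.2.mul_smooth hS (hF.1 false))).congr fun v _ => by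
      simp only [Pi.mul_apply]
      ring⟩
  add_mem' {F G} hF hG := ⟨fun b => (hF.1 b).add (hG.1 b), (hF.2.add hS hG.2).congr fun v _ => by
    simp only [Pi.add_apply]
    ring⟩
  algebraMap_mem' c := ⟨fun _ => contDiffOn_const (c := c),
    (VanishesToOrder.zero hS).congr fun v _ => sub_self _⟩

variable {hS : IsOpen S} {Φ Ψ : Bool × (Fin 7 → ℝ) → ℝ}

/-- The partial derivatives of a function on two copies of the ambient space. -/
def pd₂ (S : Set (Fin 7 → ℝ)) (i : Fin 7) (Φ : Bool × (Fin 7 → ℝ) → ℝ)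
    (y : Bool × (Fin 7 → ℝ)) : ℝ :=
  pd S i (fun v => Φ (y.1, v)) y.2

lemma contactAlg_congr (hΦ : Φ ∈ contactAlg S hS k) (h : ∀ b, ∀ v ∈ S, Ψ (b, v) = Φ (b, v)) :
    Ψ ∈ contactAlg S hS k :=
  ⟨fun b => (hΦ.1 b).congr (h b), hΦ.2.congr fun v hv => by rw [h true v hv, h false v hv]⟩

lemma contactAlg_mono {j : ℕ} (hjk : j ≤ k) (hΦ : Φ ∈ contactAlg S hS k) :
    Φ ∈ contactAlg S hS j :=
  ⟨hΦ.1, hΦ.2.mono hjk⟩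

lemma contactAlg_pd_of_ne (hΦ : Φ ∈ contactAlg S hS k) {i : Fin 7} (hi : i ≠ 6) :
    pd₂ S i Φ ∈ contactAlg S hS k :=
  ⟨fun b => (hΦ.1 b).pd hS i, (hΦ.2.pd_of_ne hS hi).congr fun _ hv =>
    (pd_sub hS (hΦ.1 true) (hΦ.1 false) hv i).symm⟩

lemma contactAlg_pd (hΦ : Φ ∈ contactAlg S hS (k + 1)) : pd₂ S 6 Φ ∈ contactAlg S hS k :=
  ⟨fun b => (hΦ.1 b).pd hS 6, hΦ.2.2.2.congr fun _ hv =>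
    (pd_sub hS (hΦ.1 true) (hΦ.1 false) hv 6).symm⟩

lemma mem_contactAlg_succ (hΦ : Φ ∈ contactAlg S hS 1) (h : pd₂ S 6 Φ ∈ contactAlg S hS k) :
    Φ ∈ contactAlg S hS (k + 1) :=
  ⟨hΦ.1, hΦ.2.1, hΦ.2.2.1, h.2.congr fun _ hv => pd_sub hS (hΦ.1 true) (hΦ.1 false) hv 6⟩

lemma contactAlg_coord (i : Fin 7) : (fun y => y.2 i) ∈ contactAlg S hS k :=
  ⟨fun _ => smoothOn_coord i, (VanishesToOrder.zero hS).congr fun _ _ => sub_self _⟩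

lemma contactAlg_rho_mul (hΦ : Φ ∈ contactAlg S hS k) :
    (fun y => y.2 6 * Φ y) ∈ contactAlg S hS (k + 1) :=
  ⟨fun b => (smoothOn_coord 6).mul (hΦ.1 b), (hΦ.2.rho_mul hS).congr fun _ _ => by ring⟩

lemma contactAlg_inv (hΦ : Φ ∈ contactAlg S hS k) (h0 : ∀ b, ∀ v ∈ S, Φ (b, v) ≠ 0) :
    (fun y => (Φ y)⁻¹) ∈ contactAlg S hS k := by
  have hinv : ∀ b, SmoothOn (fun v => (Φ (b, v))⁻¹) S := fun b =>
    ContDiffOn.inv (hΦ.1 b) (h0 b)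
  refine ⟨hinv, (((hΦ.2.mul_smooth hS (hinv true)).mul_smooth hS (hinv false)).const_mul hS
    (-1)).congr fun v hv => ?_⟩
  have := h0 true v hv
  have := h0 false v hv
  field_simp
  ring

lemma contactAlg_indicial {a : ℝ} (ha : (k : ℝ) ≠ a) (hΦ : Φ ∈ contactAlg S hS k)
    (h : (fun y => y.2 6 * pd₂ S 6 Φ y - a * Φ y) ∈ contactAlg S hS (k + 1)) :
    Φ ∈ contactAlg S hS (k + 1) :=
  ⟨hΦ.1, hΦ.2.succ_of_indicial hS ha (h.2.congr fun v hv => by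
    rw [pd_sub hS (hΦ.1 true) (hΦ.1 false) hv]
    simp only [pd₂]
    ring)⟩

end Order

end AmbientG2

end

noncomputable section

namespace AmbientG2

open Matrix

/-! ### The Ricci tensor of a metric of ambient form -/

section Block

/-- The position of the `i`-th coordinate of `ℝ⁵` among the coordinates of the ambient space. -/
def bidx (i : Fin 5) : Fin 7 := i.castSucc.succ

lemma bidx_cases (a : Fin 7) : a = 0 ∨ a = 6 ∨ ∃ i, a = bidx i := by
  revert a
  decide

@[simp] lemma bidx_ne_zero (i : Fin 5) : bidx i ≠ 0 := by
  revert i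
  decide

@[simp] lemma bidx_ne_six (i : Fin 5) : bidx i ≠ 6 := by
  revert i
  decide

@[simp] lemma zero_ne_bidx (i : Fin 5) : (0 : Fin 7) ≠ bidx i := (bidx_ne_zero i).symm

@[simp] lemma six_ne_bidx (i : Fin 5) : (6 : Fin 7) ≠ bidx i := (bidx_ne_six i).symm

@[simp] lemma bidx_inj {i j : Fin 5} : bidx i = bidx j ↔ i = j := by
  simp [bidx]

lemma sum_bidx (F : Fin 7 → ℝ) : ∑ a, F a = F 0 + ∑ i, F (bidx i) + F 6 := by
  rw [Fin.sum_univ_succ, Fin.sum_univ_castSucc, ← add_assoc]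
  rfl

lemma pull_d₅ (i : Fin 5) (a : Fin 7) : pull (d₅ i) a = if a = bidx i then 1 else 0 := by
  revert a
  fin_cases i <;> intro a <;> fin_cases a <;> simp [pull, d₅, bidx]

variable {G : Matrix (Fin 5) (Fin 5) ℝ}

lemma pullForm_apply (a b : Fin 7) : pullForm G a b =
    ∑ i, ∑ j, G i j * ((if a = bidx i then 1 else 0) * if b = bidx j then 1 else 0) := by
  simp only [pullForm, Matrix.sum_apply, Matrix.smul_apply, vecMulVec_apply, pull_d₅, smul_eq_mul]

@[simp] lemma pullForm_bidx (i j : Fin 5) : pullForm G (bidx i) (bidx j) = G i j := by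
  simp [pullForm_apply]

@[simp] lemma pullForm_zero_left (b : Fin 7) : pullForm G 0 b = 0 := by simp [pullForm_apply]

@[simp] lemma pullForm_six_left (b : Fin 7) : pullForm G 6 b = 0 := by simp [pullForm_apply]

@[simp] lemma pullForm_zero_right (a : Fin 7) : pullForm G a 0 = 0 := by simp [pullForm_apply]

@[simp] lemma pullForm_six_right (a : Fin 7) : pullForm G a 6 = 0 := by simp [pullForm_apply]

/-- `W` is on `S` the metric `2 dt d(ϱt) + P`, where `P` is a family of metrics in the coordinates
of `ℝ⁵` that is homogeneous of degree 2 in `t`. -/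
structure IsAmbientBlock (S : Set (Fin 7 → ℝ)) (W : (Fin 7 → ℝ) → Matrix (Fin 7) (Fin 7) ℝ)
    (P : (Fin 7 → ℝ) → Matrix (Fin 5) (Fin 5) ℝ) : Prop where
  isOpen : IsOpen S
  ne_zero : ∀ u ∈ S, u 0 ≠ 0
  smooth : ∀ i j, SmoothOn (fun u => P u i j) S
  symm : ∀ u ∈ S, ∀ i j, P u i j = P u j i
  det_ne_zero : ∀ u ∈ S, (P u).det ≠ 0
  homog : ∀ u ∈ S, ∀ i j, pd S 0 (fun v => P v i j) u = 2 / u 0 * P u i j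
  eq : ∀ u ∈ S, W u = twoSym dt (dϱt (u 0) (u 6)) + pullForm (P u)

/-- The Christoffel symbols `Γᵏᵢⱼ` of the metrics `P` in the coordinates of `ℝ⁵`. -/
def chrB (S : Set (Fin 7 → ℝ)) (P : (Fin 7 → ℝ) → Matrix (Fin 5) (Fin 5) ℝ) (k i j : Fin 5)
    (u : Fin 7 → ℝ) : ℝ :=
  1 / 2 * ∑ l, (P u)⁻¹ k l * (pd S (bidx i) (fun v => P v j l) u
    + pd S (bidx j) (fun v => P v i l) u - pd S (bidx l) (fun v => P v i j) u)

/-- The Christoffel symbols `Γᵏᵢϱ = (1/2) Pᵏˡ ∂Pᵢₗ/∂ϱ`. -/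
def chrR (S : Set (Fin 7 → ℝ)) (P : (Fin 7 → ℝ) → Matrix (Fin 5) (Fin 5) ℝ) (k i : Fin 5)
    (u : Fin 7 → ℝ) : ℝ :=
  1 / 2 * ∑ l, (P u)⁻¹ k l * pd S 6 (fun v => P v i l) u

/-- The Ricci tensor of the metrics `P` in the coordinates of `ℝ⁵`. -/
def ricB (S : Set (Fin 7 → ℝ)) (P : (Fin 7 → ℝ) → Matrix (Fin 5) (Fin 5) ℝ) (i j : Fin 5)
    (u : Fin 7 → ℝ) : ℝ :=
  ∑ k, (pd S (bidx k) (chrB S P k i j) u - pd S (bidx j) (chrB S P k i k) u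
    + ∑ l, (chrB S P k k l u * chrB S P l i j u - chrB S P k j l u * chrB S P l i k u))

namespace IsAmbientBlock

variable {S : Set (Fin 7 → ℝ)} {W : (Fin 7 → ℝ) → Matrix (Fin 7) (Fin 7) ℝ}
  {P : (Fin 7 → ℝ) → Matrix (Fin 5) (Fin 5) ℝ} {u : Fin 7 → ℝ}

section Entries

variable (H : IsAmbientBlock S W P) (hu : u ∈ S)
include H hu

lemma w00 : W u 0 0 = 2 * u 6 := by
  simp [H.eq u hu, twoSym, dt, dϱt, vecMulVec_apply]
  ring

lemma w06 : W u 0 6 = u 0 := by simp [H.eq u hu, twoSym, dt, dϱt, vecMulVec_apply]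

lemma w60 : W u 6 0 = u 0 := by simp [H.eq u hu, twoSym, dt, dϱt, vecMulVec_apply]

lemma w66 : W u 6 6 = 0 := by simp [H.eq u hu, twoSym, dt, dϱt, vecMulVec_apply]

lemma w0b (i : Fin 5) : W u 0 (bidx i) = 0 := by
  simp [H.eq u hu, twoSym, dt, dϱt, vecMulVec_apply, Pi.single_apply]

lemma wb0 (i : Fin 5) : W u (bidx i) 0 = 0 := by
  simp [H.eq u hu, twoSym, dt, dϱt, vecMulVec_apply, Pi.single_apply]

lemma w6b (i : Fin 5) : W u 6 (bidx i) = 0 := by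
  simp [H.eq u hu, twoSym, dt, dϱt, vecMulVec_apply, Pi.single_apply]

lemma wb6 (i : Fin 5) : W u (bidx i) 6 = 0 := by
  simp [H.eq u hu, twoSym, dt, dϱt, vecMulVec_apply, Pi.single_apply]

lemma wbb (i j : Fin 5) : W u (bidx i) (bidx j) = P u i j := by
  simp [H.eq u hu, twoSym, dt, dϱt, vecMulVec_apply, Pi.single_apply]

lemma mul_inv : P u * (P u)⁻¹ = 1 :=
  mul_nonsing_inv _ (isUnit_iff_ne_zero.2 (H.det_ne_zero u hu))

lemma inv_mul : (P u)⁻¹ * P u = 1 :=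
  nonsing_inv_mul _ (isUnit_iff_ne_zero.2 (H.det_ne_zero u hu))

lemma inv_eq : (W u)⁻¹ = (1 / u 0) • twoSym (Pi.single 0 1) (Pi.single 6 1)
    + (-2 * u 6 / u 0 ^ 2) • symSq (Pi.single 6 1) + pullForm (P u)⁻¹ := by
  have h0 := H.ne_zero u hu
  have hpi : ∀ i j, ∑ k, P u i k * (P u)⁻¹ k j = if i = j then 1 else 0 := fun i j => by
    rw [← Matrix.mul_apply, H.mul_inv hu, one_apply]
  refine inv_eq_right_inv ?_
  ext a b
  rw [Matrix.mul_apply, sum_bidx]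
  obtain rfl | rfl | ⟨i, rfl⟩ := bidx_cases a <;> obtain rfl | rfl | ⟨j, rfl⟩ := bidx_cases b <;>
    simp [H.w00 hu, H.w06 hu, H.w60 hu, H.w66 hu, H.w0b hu, H.wb0 hu, H.w6b hu, H.wb6 hu,
      H.wbb hu, twoSym, symSq, vecMulVec_apply, Pi.single_apply, hpi, one_apply, h0]
  field_simp
  ring

lemma christoffel_zero (i j : Fin 7) : christoffel S W 0 i j u = 1 / (2 * u 0) *
    (pd S i (fun v => W v j 6) u + pd S j (fun v => W v i 6) u - pd S 6 (fun v => W v i j) u) := by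
  rw [christoffel, sum_bidx]
  simp [H.inv_eq hu, twoSym, symSq, vecMulVec_apply, Pi.single_apply]
  ring

lemma christoffel_six (i j : Fin 7) : christoffel S W 6 i j u = 1 / (2 * u 0) *
    (pd S i (fun v => W v j 0) u + pd S j (fun v => W v i 0) u - pd S 0 (fun v => W v i j) u)
    - u 6 / u 0 ^ 2 *
    (pd S i (fun v => W v j 6) u + pd S j (fun v => W v i 6) u - pd S 6 (fun v => W v i j) u) := by
  rw [christoffel, sum_bidx]
  simp [H.inv_eq hu, twoSym, symSq, vecMulVec_apply, Pi.single_apply]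
  ring

lemma christoffel_bidx (k : Fin 5) (i j : Fin 7) : christoffel S W (bidx k) i j u =
    1 / 2 * ∑ l, (P u)⁻¹ k l * (pd S i (fun v => W v j (bidx l)) u
      + pd S j (fun v => W v i (bidx l)) u - pd S (bidx l) (fun v => W v i j) u) := by
  rw [christoffel, sum_bidx]
  simp [H.inv_eq hu, twoSym, symSq, vecMulVec_apply, Pi.single_apply]

lemma pd00 (c : Fin 7) : pd S c (fun v => W v 0 0) u = if c = 6 then 2 else 0 := by
  rw [pd_congr hu (fun v hv => H.w00 hv), pd_const_mul H.isOpen 2 (smoothOn_coord 6) hu,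
    pd_coord H.isOpen 6 hu, Pi.single_apply]
  simp

lemma pd06 (c : Fin 7) : pd S c (fun v => W v 0 6) u = if c = 0 then 1 else 0 := by
  rw [pd_congr hu (fun v hv => H.w06 hv), pd_coord H.isOpen 0 hu, Pi.single_apply]

lemma pd60 (c : Fin 7) : pd S c (fun v => W v 6 0) u = if c = 0 then 1 else 0 := by
  rw [pd_congr hu (fun v hv => H.w60 hv), pd_coord H.isOpen 0 hu, Pi.single_apply]

lemma pd66 (c : Fin 7) : pd S c (fun v => W v 6 6) u = 0 := by
  rw [pd_congr hu (fun _ hv => H.w66 hv), pd_const H.isOpen 0 hu]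

lemma pd0b (i : Fin 5) (c : Fin 7) : pd S c (fun v => W v 0 (bidx i)) u = 0 := by
  rw [pd_congr hu (fun v hv => H.w0b hv i), pd_const H.isOpen 0 hu]

lemma pdb0 (i : Fin 5) (c : Fin 7) : pd S c (fun v => W v (bidx i) 0) u = 0 := by
  rw [pd_congr hu (fun v hv => H.wb0 hv i), pd_const H.isOpen 0 hu]

lemma pd6b (i : Fin 5) (c : Fin 7) : pd S c (fun v => W v 6 (bidx i)) u = 0 := by
  rw [pd_congr hu (fun v hv => H.w6b hv i), pd_const H.isOpen 0 hu]

lemma pdb6 (i : Fin 5) (c : Fin 7) : pd S c (fun v => W v (bidx i) 6) u = 0 := by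
  rw [pd_congr hu (fun v hv => H.wb6 hv i), pd_const H.isOpen 0 hu]

lemma pdbb (i j : Fin 5) (c : Fin 7) :
    pd S c (fun v => W v (bidx i) (bidx j)) u = pd S c (fun v => P v i j) u :=
  pd_congr hu (fun _ hv => H.wbb hv i j) c

lemma chr_0_bb (i j : Fin 5) : christoffel S W 0 (bidx i) (bidx j) u =
    -1 / (2 * u 0) * pd S 6 (fun v => P v i j) u := by
  rw [H.christoffel_zero hu, H.pdb6 hu, H.pdb6 hu, H.pdbb hu]
  ring

lemma chr_6_bb (i j : Fin 5) : christoffel S W 6 (bidx i) (bidx j) u =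
    (-P u i j + u 6 * pd S 6 (fun v => P v i j) u) / u 0 ^ 2 := by
  have h0 := H.ne_zero u hu
  rw [H.christoffel_six hu, H.pdb6 hu, H.pdb6 hu, H.pdb0 hu, H.pdb0 hu, H.pdbb hu, H.pdbb hu,
    H.homog u hu]
  field_simp
  ring

lemma chr_b_bb (k i j : Fin 5) :
    christoffel S W (bidx k) (bidx i) (bidx j) u = chrB S P k i j u := by
  rw [H.christoffel_bidx hu, chrB]
  simp only [H.pdbb hu]

lemma chr_b_b6 (k i : Fin 5) : christoffel S W (bidx k) (bidx i) 6 u = chrR S P k i u := by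
  rw [H.christoffel_bidx hu, chrR]
  simp only [H.pdbb hu, H.pd6b hu, H.pdb6 hu, zero_add, sub_zero]

lemma chr_b_6b (k i : Fin 5) : christoffel S W (bidx k) 6 (bidx i) u = chrR S P k i u := by
  rw [H.christoffel_bidx hu, chrR]
  simp only [H.pdbb hu, H.pd6b hu, add_zero, sub_zero]

lemma chr_b_b0 (k i : Fin 5) :
    christoffel S W (bidx k) (bidx i) 0 u = if k = i then 1 / u 0 else 0 := by
  have hpi : ∀ i j, ∑ k, (P u)⁻¹ i k * P u k j = if i = j then 1 else 0 := fun i j => by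
    rw [← Matrix.mul_apply, H.inv_mul hu, one_apply]
  have h0 := H.ne_zero u hu
  have : ∀ l, (P u)⁻¹ k l * (2 / u 0 * P u i l) = 2 / u 0 * ((P u)⁻¹ k l * P u l i) := fun l => by
    rw [H.symm u hu i l]
    ring
  rw [H.christoffel_bidx hu]
  simp only [H.pdbb hu, H.pd0b hu, H.pdb0 hu, H.homog u hu, zero_add, sub_zero, this,
    ← Finset.mul_sum, hpi]
  split_ifs
  · field_simp
  · simp

lemma chr_b_60 (k : Fin 5) : christoffel S W (bidx k) 6 0 u = 0 := by
  rw [H.christoffel_bidx hu]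
  simp [H.pd0b hu, H.pd6b hu, H.pd60 hu]

lemma chr_b_66 (k : Fin 5) : christoffel S W (bidx k) 6 6 u = 0 := by
  rw [H.christoffel_bidx hu]
  simp [H.pd66 hu, H.pd6b hu]

lemma chr_0_b0 (i : Fin 5) : christoffel S W 0 (bidx i) 0 u = 0 := by
  simp [H.christoffel_zero hu, H.pdb6 hu, H.pdb0 hu, H.pd06 hu]

lemma chr_0_0b (i : Fin 5) : christoffel S W 0 0 (bidx i) u = 0 := by
  simp [H.christoffel_zero hu, H.pdb6 hu, H.pd0b hu, H.pd06 hu]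

lemma chr_0_b6 (i : Fin 5) : christoffel S W 0 (bidx i) 6 u = 0 := by
  simp [H.christoffel_zero hu, H.pdb6 hu, H.pd66 hu]

lemma chr_0_6b (i : Fin 5) : christoffel S W 0 6 (bidx i) u = 0 := by
  simp [H.christoffel_zero hu, H.pdb6 hu, H.pd66 hu, H.pd6b hu]

lemma chr_0_00 : christoffel S W 0 0 0 u = 0 := by
  simp [H.christoffel_zero hu, H.pd06 hu, H.pd00 hu]
  norm_num

lemma chr_0_06 : christoffel S W 0 0 6 u = 0 := by
  simp [H.christoffel_zero hu, H.pd06 hu, H.pd66 hu]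

lemma chr_0_60 : christoffel S W 0 6 0 u = 0 := by
  simp [H.christoffel_zero hu, H.pd06 hu, H.pd66 hu, H.pd60 hu]

lemma chr_0_66 : christoffel S W 0 6 6 u = 0 := by
  simp [H.christoffel_zero hu, H.pd66 hu]

lemma chr_6_b6 (i : Fin 5) : christoffel S W 6 (bidx i) 6 u = 0 := by
  simp [H.christoffel_six hu, H.pdb6 hu, H.pd66 hu, H.pd60 hu, H.pdb0 hu]

lemma chr_6_6b (i : Fin 5) : christoffel S W 6 6 (bidx i) u = 0 := by
  simp [H.christoffel_six hu, H.pdb6 hu, H.pd66 hu, H.pd60 hu, H.pdb0 hu, H.pd6b hu]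

lemma chr_6_b0 (i : Fin 5) : christoffel S W 6 (bidx i) 0 u = 0 := by
  simp [H.christoffel_six hu, H.pdb6 hu, H.pd06 hu, H.pd00 hu, H.pdb0 hu]

lemma chr_6_60 : christoffel S W 6 6 0 u = 1 / u 0 := by
  simp [H.christoffel_six hu, H.pd66 hu, H.pd06 hu, H.pd00 hu, H.pd60 hu]

lemma chr_6_66 : christoffel S W 6 6 6 u = 0 := by
  simp [H.christoffel_six hu, H.pd66 hu, H.pd60 hu]

end Entries

end IsAmbientBlock

end Block

end AmbientG2

end

noncomputable section

namespace AmbientG2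

open Matrix

namespace IsAmbientBlock

variable {S : Set (Fin 7 → ℝ)} {W : (Fin 7 → ℝ) → Matrix (Fin 7) (Fin 7) ℝ}
  {P : (Fin 7 → ℝ) → Matrix (Fin 5) (Fin 5) ℝ} {u : Fin 7 → ℝ}

lemma smooth_inv_t (H : IsAmbientBlock S W P) : SmoothOn (fun v => (v 0)⁻¹) S :=
  ContDiffOn.inv (smoothOn_coord 0) H.ne_zero

lemma pd_inv_t (H : IsAmbientBlock S W P) (hu : u ∈ S) (c : Fin 7) :
    pd S c (fun v => (v 0)⁻¹) u = if c = 0 then -1 / u 0 ^ 2 else 0 := by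
  have h0 := H.ne_zero u hu
  have h1 := pd_mul H.isOpen (smoothOn_coord 0) H.smooth_inv_t hu c
  rw [pd_congr hu (fun v hv => mul_inv_cancel₀ (H.ne_zero v hv)), pd_const H.isOpen 1 hu,
    pd_coord H.isOpen 0 hu, Pi.single_apply] at h1
  have h2 : u 0 * pd S c (fun v => (v 0)⁻¹) u = -(if c = 0 then 1 else 0) * (u 0)⁻¹ := by linarith
  rw [← mul_right_inj' h0, h2]
  split_ifs <;> field_simp
  simp

lemma smooth_pd (H : IsAmbientBlock S W P) (c : Fin 7) (i j : Fin 5) :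
    SmoothOn (pd S c fun v => P v i j) S := SmoothOn.pd H.isOpen (H.smooth i j) c

lemma pd_zero_pd_six (H : IsAmbientBlock S W P) (hu : u ∈ S) (i j : Fin 5) :
    pd S 0 (pd S 6 fun v => P v i j) u = 2 / u 0 * pd S 6 (fun v => P v i j) u := by
  rw [pd_comm H.isOpen (H.smooth i j) hu,
    pd_congr hu (F' := fun v => 2 * ((v 0)⁻¹ * P v i j)) (fun v hv => by
      rw [H.homog v hv i j]
      ring),
    pd_const_mul H.isOpen 2 (H.smooth_inv_t.mul (H.smooth i j)) hu,
    pd_mul H.isOpen H.smooth_inv_t (H.smooth i j) hu, H.pd_inv_t hu]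
  simp
  ring

lemma pd_zero_chr_0_bb (H : IsAmbientBlock S W P) (hu : u ∈ S) (i j : Fin 5) :
    pd S 0 (christoffel S W 0 (bidx i) (bidx j)) u
      = -1 / (2 * u 0 ^ 2) * pd S 6 (fun v => P v i j) u := by
  have h0 := H.ne_zero u hu
  rw [pd_congr hu (F' := fun v => -1 / 2 * ((v 0)⁻¹ * pd S 6 (fun v => P v i j) v)) (fun v hv => by
      rw [H.chr_0_bb hv i j]
      field_simp [H.ne_zero v hv]),
    pd_const_mul H.isOpen _ (H.smooth_inv_t.mul (H.smooth_pd 6 i j)) hu,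
    pd_mul H.isOpen H.smooth_inv_t (H.smooth_pd 6 i j) hu, H.pd_inv_t hu, H.pd_zero_pd_six hu]
  simp
  field_simp
  ring

lemma pd_six_chr_6_bb (H : IsAmbientBlock S W P) (hu : u ∈ S) (i j : Fin 5) :
    pd S 6 (christoffel S W 6 (bidx i) (bidx j)) u
      = u 6 / u 0 ^ 2 * pd S 6 (pd S 6 fun v => P v i j) u := by
  have h0 := H.ne_zero u hu
  have h1 := (smoothOn_coord 6).mul (H.smooth_pd 6 i j)
  have h2 : SmoothOn (fun v => (v 0)⁻¹ * (v 0)⁻¹) S := H.smooth_inv_t.mul H.smooth_inv_t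
  rw [pd_congr hu (F' := fun v => (v 0)⁻¹ * (v 0)⁻¹ *
      (v 6 * pd S 6 (fun v => P v i j) v - P v i j)) (fun v hv => by
      rw [H.chr_6_bb hv i j]
      field_simp [H.ne_zero v hv]
      ring),
    pd_mul H.isOpen h2 (h1.sub (H.smooth i j)) hu, pd_mul H.isOpen H.smooth_inv_t H.smooth_inv_t hu,
    pd_sub H.isOpen h1 (H.smooth i j) hu, pd_mul H.isOpen (smoothOn_coord 6) (H.smooth_pd 6 i j) hu,
    pd_coord H.isOpen 6 hu, H.pd_inv_t hu]
  simp
  field_simp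

lemma sum_chrR (H : IsAmbientBlock S W P) (hu : u ∈ S) (i j : Fin 5) :
    ∑ l, P u j l * chrR S P l i u = 1 / 2 * pd S 6 (fun v => P v i j) u := by
  have hpi : ∀ i j, ∑ k, P u i k * (P u)⁻¹ k j = if i = j then 1 else 0 := fun i j => by
    rw [← Matrix.mul_apply, H.mul_inv hu, one_apply]
  simp only [chrR, Finset.mul_sum]
  rw [Finset.sum_comm]
  have : ∀ m, ∑ l, P u j l * (1 / 2 * ((P u)⁻¹ l m * pd S 6 (fun v => P v i m) u)) =
      1 / 2 * pd S 6 (fun v => P v i m) u * ∑ l, P u j l * (P u)⁻¹ l m := fun m => by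
    rw [Finset.mul_sum]
    exact Finset.sum_congr rfl fun l _ => by ring
  simp only [this, hpi]
  simp

/-- The components of the Ricci tensor along `ℝ⁵`. -/
lemma ricci_bidx (H : IsAmbientBlock S W P) (hu : u ∈ S) (i j : Fin 5) :
    u 0 ^ 2 * ricci S W (bidx i) (bidx j) u =
      u 6 * pd S 6 (pd S 6 fun v => P v i j) u - 3 / 2 * pd S 6 (fun v => P v i j) u
      - (∑ k, chrR S P k k u) * (P u i j - u 6 * pd S 6 (fun v => P v i j) u)
      - u 6 * ∑ l, (pd S 6 (fun v => P v j l) u * chrR S P l i u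
        + pd S 6 (fun v => P v i l) u * chrR S P l j u)
      + u 0 ^ 2 * ricB S P i j u := by
  have h0 := H.ne_zero u hu
  have z1 : pd S (bidx j) (christoffel S W 0 (bidx i) 0) u = 0 := by
    rw [pd_congr hu (fun v hv => H.chr_0_b0 hv i), pd_const H.isOpen 0 hu]
  have z2 : pd S (bidx j) (christoffel S W 6 (bidx i) 6) u = 0 := by
    rw [pd_congr hu (fun v hv => H.chr_6_b6 hv i), pd_const H.isOpen 0 hu]
  have b1 : ∀ k c a b, pd S c (christoffel S W (bidx k) (bidx a) (bidx b)) u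
      = pd S c (chrB S P k a b) u := fun k c a b => pd_congr hu (fun v hv => H.chr_b_bb hv k a b) c
  have s1 : ∀ i j, ∑ l, (-P u j l + u 6 * pd S 6 (fun v => P v j l) u) / u 0 ^ 2 * chrR S P l i u =
      (-(1 / 2 * pd S 6 (fun v => P v i j) u)
        + u 6 * ∑ l, pd S 6 (fun v => P v j l) u * chrR S P l i u) / u 0 ^ 2 := fun i j => by
    rw [← H.sum_chrR hu, Finset.mul_sum, ← Finset.sum_neg_distrib, ← Finset.sum_add_distrib,
      Finset.sum_div]
    exact Finset.sum_congr rfl fun l _ => by ring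
  have hsym : pd S 6 (fun v => P v j i) u = pd S 6 (fun v => P v i j) u :=
    pd_congr hu (fun v hv => H.symm v hv j i) 6
  have t1 : ∑ x, christoffel S W 6 (bidx j) (bidx x) u * chrR S P x i u = _ :=
    (Finset.sum_congr rfl fun x _ => by rw [H.chr_6_bb hu]).trans (s1 i j)
  have t2 : ∑ x, chrR S P x j u * christoffel S W 6 (bidx i) (bidx x) u = _ :=
    (Finset.sum_congr rfl fun x _ => by rw [H.chr_6_bb hu, mul_comm]).trans (s1 j i)
  rw [ricci]
  simp only [sum_bidx, Finset.sum_add_distrib, Finset.sum_sub_distrib, H.chr_0_00 hu,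
    H.chr_0_06 hu, H.chr_0_0b hu, H.chr_0_b0 hu, H.chr_0_b6 hu, H.chr_6_60 hu, H.chr_6_66 hu,
    H.chr_6_6b hu, H.chr_6_b0 hu, H.chr_6_b6 hu, H.chr_b_b0 hu, H.chr_b_b6 hu, H.chr_b_bb hu,
    z1, z2, b1, H.pd_zero_chr_0_bb hu, H.pd_six_chr_6_bb hu, ricB]
  rw [t1, t2]
  simp only [← Finset.sum_mul, ite_mul, mul_ite, zero_mul, mul_zero, Finset.sum_ite_eq',
    Finset.mem_univ, if_true, Finset.sum_const, Finset.card_univ, Fintype.card_fin, H.chr_0_bb hu,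
    H.chr_6_bb hu, nsmul_eq_mul, hsym]
  field_simp
  push_cast
  ring

/-- The component of the Ricci tensor along `∂_ϱ`. -/
lemma ricci_six (H : IsAmbientBlock S W P) (hu : u ∈ S) :
    ricci S W 6 6 u = -∑ k, pd S 6 (chrR S P k k) u
      - ∑ k, ∑ l, chrR S P k l u * chrR S P l k u := by
  have z : ∀ {k a b : Fin 7} (c : Fin 7), (∀ v ∈ S, christoffel S W k a b v = 0) →
      pd S c (christoffel S W k a b) u = 0 := fun c h => by
    rw [pd_congr hu h, pd_const H.isOpen 0 hu]
  have b : ∀ k, pd S 6 (christoffel S W (bidx k) 6 (bidx k)) u = pd S 6 (chrR S P k k) u := fun k =>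
    pd_congr hu (fun v hv => H.chr_b_6b hv k k) 6
  rw [ricci]
  simp only [sum_bidx, Finset.sum_add_distrib, Finset.sum_sub_distrib, H.chr_0_06 hu, H.chr_0_60 hu,
    H.chr_0_66 hu, H.chr_0_6b hu, H.chr_6_66 hu, H.chr_6_6b hu, H.chr_b_60 hu, H.chr_b_66 hu,
    H.chr_b_6b hu, b, z 0 fun v hv => H.chr_0_66 hv, z 6 fun v hv => H.chr_6_66 hv,
    z 6 fun v hv => H.chr_0_60 hv, fun k => z (bidx k) fun v hv => H.chr_b_66 hv k]
  simp [sub_eq_add_neg]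

/-- The Ricci equations along `ℝ⁵`, as singular ordinary differential equations in `ϱ` with the
indicial roots `0` and `5/2`. -/
lemma pd_six_pd_six (H : IsAmbientBlock S W P) (hu : u ∈ S) {i j : Fin 5}
    (h : ricci S W (bidx i) (bidx j) u = 0) :
    u 6 * pd S 6 (pd S 6 fun v => P v i j) u - 3 / 2 * pd S 6 (fun v => P v i j) u =
      (∑ k, chrR S P k k u) * P u i j - u 0 ^ 2 * ricB S P i j u
      + u 6 * (∑ l, (pd S 6 (fun v => P v j l) u * chrR S P l i u
        + pd S 6 (fun v => P v i l) u * chrR S P l j u)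
        - (∑ k, chrR S P k k u) * pd S 6 (fun v => P v i j) u) := by
  have := H.ricci_bidx hu i j
  rw [h] at this
  linear_combination -this

/-- The trace of the Ricci equations along `ℝ⁵`, solved for `Γᵏₖϱ`; at `ϱ = 0` it is determined by
the metric there. -/
lemma sum_chrR_eq (H : IsAmbientBlock S W P) (hu : u ∈ S)
    (h : ∀ i j, ricci S W (bidx i) (bidx j) u = 0) :
    ∑ k, chrR S P k k u = 1 / 8 * (u 0 ^ 2 * (∑ i, ∑ j, (P u)⁻¹ i j * ricB S P i j u)
      + u 6 * ∑ i, ∑ j, (P u)⁻¹ i j * (pd S 6 (pd S 6 fun v => P v i j) u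
        - (∑ l, (pd S 6 (fun v => P v j l) u * chrR S P l i u
        + pd S 6 (fun v => P v i l) u * chrR S P l j u)
        - (∑ k, chrR S P k k u) * pd S 6 (fun v => P v i j) u))) := by
  set s := ∑ k, chrR S P k k u with hs
  have h5 : ∑ i, ∑ j, (P u)⁻¹ i j * P u i j = 5 := by
    have : ∀ i, ∑ j, (P u)⁻¹ i j * P u i j = 1 := fun i => by
      rw [← one_apply_eq (α := ℝ) i, ← H.inv_mul hu, Matrix.mul_apply]
      exact Finset.sum_congr rfl fun j _ => by rw [H.symm u hu i j]
    simp [this]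
  have h2 : ∑ i, ∑ j, (P u)⁻¹ i j * pd S 6 (fun v => P v i j) u = 2 * s := by
    simp only [hs, chrR, ← Finset.mul_sum]
    ring
  have e : ∑ i, ∑ j, (P u)⁻¹ i j * (u 6 * (pd S 6 (pd S 6 fun v => P v i j) u
        - (∑ l, (pd S 6 (fun v => P v j l) u * chrR S P l i u
        + pd S 6 (fun v => P v i l) u * chrR S P l j u)
        - s * pd S 6 (fun v => P v i j) u)) + u 0 ^ 2 * ricB S P i j u) =
      ∑ i, ∑ j, (P u)⁻¹ i j * (3 / 2 * pd S 6 (fun v => P v i j) u + s * P u i j) :=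
    Finset.sum_congr rfl fun i _ => Finset.sum_congr rfl fun j _ => by
      congr 1
      linear_combination H.pd_six_pd_six hu (h i j)
  have e1 : ∑ i, ∑ j, (P u)⁻¹ i j * (3 / 2 * pd S 6 (fun v => P v i j) u + s * P u i j) =
      3 / 2 * (2 * s) + s * 5 := by
    rw [← h2, ← h5]
    simp only [Finset.mul_sum, ← Finset.sum_add_distrib]
    exact Finset.sum_congr rfl fun i _ => Finset.sum_congr rfl fun j _ => by ring
  rw [e1] at e
  have e2 : ∀ (X Y : Fin 5 → Fin 5 → ℝ), ∑ i, ∑ j, (P u)⁻¹ i j * (u 6 * X i j + u 0 ^ 2 * Y i j) =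
      u 6 * (∑ i, ∑ j, (P u)⁻¹ i j * X i j) + u 0 ^ 2 * ∑ i, ∑ j, (P u)⁻¹ i j * Y i j := by
    intro X Y
    simp only [Finset.mul_sum, ← Finset.sum_add_distrib]
    exact Finset.sum_congr rfl fun i _ => Finset.sum_congr rfl fun j _ => by ring
  rw [e2] at e
  linarith

end IsAmbientBlock

end AmbientG2

end

noncomputable section

namespace AmbientG2

open Matrix

/-! ### Ricci-flatness determines the metric to infinite order at `ϱ = 0` -/

lemma fun_sum_mem {X ι : Type*} [Fintype ι] {𝒜 : Subalgebra ℝ (X → ℝ)} {F : ι → X → ℝ}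
    (hF : ∀ i, F i ∈ 𝒜) : (fun x => ∑ i, F i x) ∈ 𝒜 := by
  have := 𝒜.sum_mem fun i (_ : i ∈ Finset.univ) => hF i
  rwa [Finset.sum_fn] at this

section Contact

variable {S : Set (Fin 7 → ℝ)} {hS : IsOpen S} {W : Bool → (Fin 7 → ℝ) → Matrix (Fin 7) (Fin 7) ℝ}
  {P : Bool → (Fin 7 → ℝ) → Matrix (Fin 5) (Fin 5) ℝ} {k : ℕ}

lemma inv_mem_contactAlg (H : ∀ b, IsAmbientBlock S (W b) (P b))
    (hP : ∀ i j, (fun y => P y.1 y.2 i j) ∈ contactAlg S hS k) (i j : Fin 5) :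
    (fun y => (P y.1 y.2)⁻¹ i j) ∈ contactAlg S hS k :=
  inv_mem_subalgebra (W := fun y : Bool × (Fin 7 → ℝ) => P y.1 y.2) (contactAlg S hS k) hP
    (contactAlg_inv (det_mem_subalgebra (W := fun y : Bool × (Fin 7 → ℝ) => P y.1 y.2) _ hP)
      fun b v hv => (H b).det_ne_zero v hv) i j

lemma chrB_mem_contactAlg (H : ∀ b, IsAmbientBlock S (W b) (P b))
    (hP : ∀ i j, (fun y => P y.1 y.2 i j) ∈ contactAlg S hS k) (a i j : Fin 5) :
    (fun y => chrB S (P y.1) a i j y.2) ∈ contactAlg S hS k := by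
  have hp : ∀ c i j, (fun y => pd S (bidx c) (fun v => P y.1 v i j) y.2) ∈ contactAlg S hS k :=
    fun c i j => contactAlg_pd_of_ne (hP i j) (bidx_ne_six c)
  exact (contactAlg S hS k).mul_mem ((contactAlg S hS k).algebraMap_mem (1 / 2))
    (fun_sum_mem fun l => (contactAlg S hS k).mul_mem (inv_mem_contactAlg H hP a l)
      ((contactAlg S hS k).sub_mem ((contactAlg S hS k).add_mem (hp i j l) (hp j i l)) (hp l i j)))

lemma ricB_mem_contactAlg (H : ∀ b, IsAmbientBlock S (W b) (P b))
    (hP : ∀ i j, (fun y => P y.1 y.2 i j) ∈ contactAlg S hS k) (i j : Fin 5) :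
    (fun y => ricB S (P y.1) i j y.2) ∈ contactAlg S hS k := by
  have hc := chrB_mem_contactAlg H hP
  have hp : ∀ c a i j, (fun y => pd S (bidx c) (chrB S (P y.1) a i j) y.2) ∈ contactAlg S hS k :=
    fun c a i j => contactAlg_pd_of_ne (hc a i j) (bidx_ne_six c)
  set 𝒜 := contactAlg S hS k
  exact fun_sum_mem fun a => 𝒜.add_mem (𝒜.sub_mem (hp a a i j) (hp j a i a))
    (fun_sum_mem fun l => 𝒜.sub_mem (𝒜.mul_mem (hc a a l) (hc l i j))
      (𝒜.mul_mem (hc a j l) (hc l i a)))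

lemma chrR_mem_contactAlg (H : ∀ b, IsAmbientBlock S (W b) (P b))
    (hP : ∀ i j, (fun y => P y.1 y.2 i j) ∈ contactAlg S hS (k + 1)) (i j : Fin 5) :
    (fun y => chrR S (P y.1) i j y.2) ∈ contactAlg S hS k :=
  (contactAlg S hS k).mul_mem ((contactAlg S hS k).algebraMap_mem (1 / 2))
    (fun_sum_mem fun l => (contactAlg S hS k).mul_mem
      (contactAlg_mono k.le_succ (inv_mem_contactAlg H hP i l)) (contactAlg_pd (hP j l)))

variable (H : ∀ b, IsAmbientBlock S (W b) (P b)) (hR : ∀ b, ∀ u ∈ S, ∀ i j, ricci S (W b) i j u = 0)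
include H hR

/-- The trace `Γᵏₖϱ` is determined to one order more than the first derivatives of the metric: by
the trace of the Ricci equations along `ℝ⁵` at `ϱ = 0`, and by the Ricci equation along `∂_ϱ` its
derivative is determined to the order of the first derivatives of the metric. -/
lemma trace_mem_contactAlg (hP : ∀ i j, (fun y => P y.1 y.2 i j) ∈ contactAlg S hS (k + 1)) :
    (fun y => ∑ a, chrR S (P y.1) a a y.2) ∈ contactAlg S hS (k + 1) := by
  refine mem_contactAlg_succ ?_ ?_
  · have hP1 : ∀ i j, (fun y => P y.1 y.2 i j) ∈ contactAlg S hS 1 := fun i j =>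
      contactAlg_mono (by omega) (hP i j)
    have hQ := inv_mem_contactAlg H hP1
    have hB := ricB_mem_contactAlg H hP1
    have hQ0 := fun i j => contactAlg_mono (zero_le_one (α := ℕ)) (hQ i j)
    have hC := chrR_mem_contactAlg (k := 0) H hP1
    have hP' : ∀ i j, (fun y => pd S 6 (fun v => P y.1 v i j) y.2) ∈ contactAlg S hS 0 :=
      fun i j => contactAlg_pd (hP1 i j)
    have hP'' : ∀ i j, (fun y => pd S 6 (pd S 6 fun v => P y.1 v i j) y.2) ∈ contactAlg S hS 0 :=
      fun i j => ⟨fun b => ((hP' i j).1 b).pd hS 6, ContDiffOn.sub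
        (((hP' i j).1 true).pd hS 6) (((hP' i j).1 false).pd hS 6)⟩
    have hs : (fun y => ∑ a, chrR S (P y.1) a a y.2) ∈ contactAlg S hS 0 :=
      fun_sum_mem fun a => hC a a
    refine contactAlg_congr (Φ := fun y => 1 / 8 * (y.2 0 ^ 2 *
        (∑ i, ∑ j, (P y.1 y.2)⁻¹ i j * ricB S (P y.1) i j y.2) + y.2 6 * ∑ i, ∑ j,
        (P y.1 y.2)⁻¹ i j * (pd S 6 (pd S 6 fun v => P y.1 v i j) y.2
        - (∑ l, (pd S 6 (fun v => P y.1 v j l) y.2 * chrR S (P y.1) l i y.2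
        + pd S 6 (fun v => P y.1 v i l) y.2 * chrR S (P y.1) l j y.2)
        - (∑ k, chrR S (P y.1) k k y.2) * pd S 6 (fun v => P y.1 v i j) y.2))))
      ?_ fun b v hv => (H b).sum_chrR_eq hv fun i j => hR b v hv _ _
    set 𝒜 := contactAlg S hS 1
    set 𝒜₀ := contactAlg S hS 0
    refine 𝒜.mul_mem (𝒜.algebraMap_mem (1 / 8)) (𝒜.add_mem
      (𝒜.mul_mem (𝒜.pow_mem (contactAlg_coord 0) 2)
        (fun_sum_mem fun i => fun_sum_mem fun j => 𝒜.mul_mem (hQ i j) (hB i j)))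
      (contactAlg_rho_mul ?_))
    exact fun_sum_mem fun i => fun_sum_mem fun j => 𝒜₀.mul_mem (hQ0 i j)
      (𝒜₀.sub_mem (hP'' i j) (𝒜₀.sub_mem (fun_sum_mem fun l => 𝒜₀.add_mem
        (𝒜₀.mul_mem (hP' j l) (hC l i)) (𝒜₀.mul_mem (hP' i l) (hC l j)))
        (𝒜₀.mul_mem hs (hP' i j))))
  · have hC := chrR_mem_contactAlg H hP
    set 𝒜 := contactAlg S hS k
    have hD : (fun y => -∑ a, ∑ l, chrR S (P y.1) a l y.2 * chrR S (P y.1) l a y.2) ∈ 𝒜 :=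
      𝒜.neg_mem (fun_sum_mem fun a => fun_sum_mem fun l => 𝒜.mul_mem (hC a l) (hC l a))
    refine contactAlg_congr hD fun b v hv => ?_
    have h6 := (H b).ricci_six hv
    rw [hR b v hv] at h6
    have : pd₂ S 6 (fun y => ∑ a, chrR S (P y.1) a a y.2) (b, v) =
        ∑ a, pd S 6 (chrR S (P b) a a) v :=
      (HasGrad.sum Finset.univ fun a _ => ((hC a a).1 b).hasGrad hv).pd_eq (hS.uniqueDiffOn v hv) 6
    rw [this]
    linarith

/-- Two Ricci-flat metrics of ambient form that agree at `ϱ = 0` agree to all orders there: the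
indicial root `3/2` of the Ricci equations, for the derivative of the metric, is not an integer. -/
theorem mem_contactAlg (h0 : ∀ u ∈ S, u 6 = 0 → P true u = P false u) (k : ℕ) (i j : Fin 5) :
    (fun y => P y.1 y.2 i j) ∈ contactAlg S hS (k + 1) := by
  have hsm : ∀ i j b, SmoothOn (fun u => P b u i j) S := fun i j b => (H b).smooth i j
  induction k generalizing i j with
  | zero =>
    have hd : SmoothOn (fun u => P true u i j - P false u i j) S :=
      ContDiffOn.sub (hsm i j true) (hsm i j false)
    exact ⟨hsm i j, hd, fun u hu h6 => by simp only [h0 u hu h6, sub_self], hd.pd hS 6⟩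
  | succ k ih =>
    have hs := trace_mem_contactAlg H hR ih
    have hs' := contactAlg_mono k.le_succ hs
    have hB := ricB_mem_contactAlg H ih
    have hC := chrR_mem_contactAlg H ih
    have hP' : ∀ i j, (fun y => pd S 6 (fun v => P y.1 v i j) y.2) ∈ contactAlg S hS k :=
      fun i j => contactAlg_pd (ih i j)
    refine mem_contactAlg_succ (contactAlg_mono (by omega) (ih i j)) ?_
    -- the indicial root
    have h32 : (k : ℝ) ≠ 3 / 2 := fun h => by
      have : 2 * k = 3 := by
        have : (2 * k : ℝ) = 3 := by linarith
        exact_mod_cast this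
      omega
    refine contactAlg_indicial h32 (hP' i j) ?_
    refine contactAlg_congr (Φ := fun y => (∑ k, chrR S (P y.1) k k y.2) * P y.1 y.2 i j
        - y.2 0 ^ 2 * ricB S (P y.1) i j y.2
        + y.2 6 * (∑ l, (pd S 6 (fun v => P y.1 v j l) y.2 * chrR S (P y.1) l i y.2
        + pd S 6 (fun v => P y.1 v i l) y.2 * chrR S (P y.1) l j y.2)
        - (∑ k, chrR S (P y.1) k k y.2) * pd S 6 (fun v => P y.1 v i j) y.2))
      ?_ fun b v hv => (H b).pd_six_pd_six hv (hR b v hv (bidx i) (bidx j))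
    set 𝒜 := contactAlg S hS (k + 1)
    set 𝒜₀ := contactAlg S hS k
    refine 𝒜.add_mem (𝒜.sub_mem (𝒜.mul_mem hs (ih i j))
      (𝒜.mul_mem (𝒜.pow_mem (contactAlg_coord 0) 2) (hB i j))) (contactAlg_rho_mul ?_)
    exact 𝒜₀.sub_mem (fun_sum_mem fun l => 𝒜₀.add_mem (𝒜₀.mul_mem (hP' j l) (hC l i))
      (𝒜₀.mul_mem (hP' i l) (hC l j))) (𝒜₀.mul_mem hs' (hP' i j))

end Contact

end AmbientG2

end

noncomputable section

namespace AmbientG2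

open Matrix

/-! ### Uniqueness of the ambient metric that is analytic in `ϱ` -/

section Uniqueness

variable {S S' : Set (Fin 7 → ℝ)} {F : (Fin 7 → ℝ) → ℝ} {u : Fin 7 → ℝ} {k : ℕ}

lemma pd_of_subset (hS : IsOpen S) (hS' : IsOpen S') (h : S' ⊆ S) (hu : u ∈ S') (i : Fin 7) :
    pd S i F u = pd S' i F u := by
  rw [pd, pd, fderivWithin_of_isOpen hS (h hu), fderivWithin_of_isOpen hS' hu]

lemma ricci_of_subset (hS : IsOpen S) (hS' : IsOpen S') (h : S' ⊆ S) (hu : u ∈ S')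
    (g : (Fin 7 → ℝ) → Matrix (Fin 7) (Fin 7) ℝ) (i j : Fin 7) :
    ricci S g i j u = ricci S' g i j u := by
  have hc : ∀ v ∈ S', ∀ k i j, christoffel S g k i j v = christoffel S' g k i j v :=
    fun v hv k i j => by simp only [christoffel, pd_of_subset hS hS' h hv]
  simp only [ricci, hc u hu, pd_of_subset hS hS' h hu]
  simp only [pd_congr hu fun v hv => hc v hv _ _ _]

variable {M : Set (Fin 5 → ℝ)} {I : Set ℝ} {m : Fin 5 → ℝ} {t r : ℝ}

lemma isOpen_ambientSpace (hM : IsOpen M) (hI : IsOpen I) : IsOpen (ambientSpace M I) :=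
  (isOpen_lt continuous_const (continuous_apply 0)).inter
    ((hM.preimage continuous_base).inter (hI.preimage (continuous_apply 6)))

lemma pt_mem_ambientSpace (ht : 0 < t) (hm : m ∈ M) (hr : r ∈ I) : pt t m r ∈ ambientSpace M I :=
  ⟨ht, by rwa [base_pt], hr⟩

lemma hasDerivAt_add_smul_single (hS : IsOpen S) (hF : SmoothOn F S) (hu : u ∈ S) (i : Fin 7) :
    HasDerivAt (fun s : ℝ => F (u + s • (Pi.single i 1 : Fin 7 → ℝ))) (pd S i F u) 0 := by
  have hl : HasDerivAt (fun s : ℝ => u + s • (Pi.single i 1 : Fin 7 → ℝ)) (Pi.single i 1) 0 := by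
    simpa using ((hasDerivAt_id (0 : ℝ)).smul_const (Pi.single i (1 : ℝ) : Fin 7 → ℝ)).const_add u
  have hd : HasFDerivAt F (fderivWithin ℝ F S u) (u + (0 : ℝ) • (Pi.single i 1 : Fin 7 → ℝ)) := by
    rw [zero_smul, add_zero]
    exact (hF.differentiableOn (by simp) u hu).hasFDerivWithinAt.hasFDerivAt (hS.mem_nhds hu)
  exact hd.comp_hasDerivAt (0 : ℝ) hl

lemma hasDerivAt_pt (hM : IsOpen M) (hI : IsOpen I) (hF : SmoothOn F (ambientSpace M I))
    (ht : 0 < t) (hm : m ∈ M) (hr : r ∈ I) :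
    HasDerivAt (fun r => F (pt t m r)) (pd (ambientSpace M I) 6 F (pt t m r)) r := by
  have h := hasDerivAt_add_smul_single (isOpen_ambientSpace hM hI) hF
    (pt_mem_ambientSpace ht hm hr) 6
  have h' : HasDerivAt (fun s : ℝ => F (pt t m r + (s - r) • (Pi.single 6 1 : Fin 7 → ℝ)))
      (pd (ambientSpace M I) 6 F (pt t m r)) r := by
    rw [← sub_self r] at h
    exact h.comp_sub_const r r
  refine h'.congr_of_eventuallyEq (Filter.Eventually.of_forall fun s => ?_)
  have e : pt t m s = pt t m r + (s - r) • (Pi.single 6 1 : Fin 7 → ℝ) := by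
    funext a
    fin_cases a <;> simp [pt, Pi.single_apply]
  simp only [e]

lemma VanishesToOrder.iteratedDeriv_eq_zero (hM : IsOpen M) (hI : IsOpen I) (h0 : 0 ∈ I)
    (hF : VanishesToOrder (ambientSpace M I) k F) (ht : 0 < t) (hm : m ∈ M) {n : ℕ} (hn : n < k) :
    iteratedDeriv n (fun r => F (pt t m r)) 0 = 0 := by
  induction k generalizing F n with
  | zero => omega
  | succ k ih =>
    cases n with
    | zero => exact hF.2.1 _ (pt_mem_ambientSpace ht hm h0) rfl
    | succ n =>
      rw [iteratedDeriv_succ']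
      refine Eq.trans ?_ (ih hF.2.2 (Nat.lt_of_succ_lt_succ hn))
      refine Filter.EventuallyEq.iteratedDeriv_eq n ?_
      filter_upwards [hI.mem_nhds h0] with r hr
      exact (hasDerivAt_pt hM hI hF.1 ht hm hr).deriv

/-- A function that is analytic in `ϱ` and vanishes to infinite order at `ϱ = 0` is zero. -/
lemma VanishesToOrder.eq_zero_of_analytic (hM : IsOpen M) (hI : IsOpen I) (hI' : IsPreconnected I)
    (h0 : 0 ∈ I) (hF : ∀ k, VanishesToOrder (ambientSpace M I) k F) (ht : 0 < t) (hm : m ∈ M)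
    (ha : AnalyticOnNhd ℝ (fun r => F (pt t m r)) I) (hr : r ∈ I) : F (pt t m r) = 0 := by
  refine ha.eqOn_zero_of_preconnected_of_eventuallyEq_zero hI' h0 ?_ hr
  have htop : analyticOrderAt (fun r => F (pt t m r)) 0 = ⊤ :=
    ENat.eq_top_iff_forall_ge.2 fun n =>
      (natCast_le_analyticOrderAt_iff_iteratedDeriv_eq_zero (ha 0 h0)).2 fun i hi =>
        (hF n).iteratedDeriv_eq_zero hM hI h0 ht hm hi
  exact analyticOrderAt_eq_top.1 htop

variable {g₀ : (Fin 5 → ℝ) → Matrix (Fin 5) (Fin 5) ℝ} {ε δ : ℝ}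
  {gt gt' : (Fin 7 → ℝ) → Matrix (Fin 7) (Fin 7) ℝ}

lemma ambientSpace_mono {I' : Set ℝ} (h : I' ⊆ I) : ambientSpace M I' ⊆ ambientSpace M I :=
  fun _ hu => ⟨hu.1, hu.2.1, h hu.2.2⟩

lemma Ioo_neg_subset (h : δ ≤ ε) : Set.Ioo (-δ) δ ⊆ Set.Ioo (-ε) ε :=
  Set.Ioo_subset_Ioo (neg_le_neg h) h

lemma IsAmbientMetric.mono (hM : IsOpen M) (h : δ ≤ ε) (H : IsAmbientMetric M ε g₀ gt) :
    IsAmbientMetric M δ g₀ gt := by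
  obtain ⟨⟨g, hg0, hg, hgt⟩, hs, hR⟩ := H
  have hI := Ioo_neg_subset h
  refine ⟨⟨g, hg0, fun m hm r hr => hg m hm r (hI hr), fun m hm r hr => hgt m hm r (hI hr)⟩,
    fun i j => (hs i j).mono (ambientSpace_mono hI), fun u hu i j => ?_⟩
  rw [← ricci_of_subset (isOpen_ambientSpace hM isOpen_Ioo) (isOpen_ambientSpace hM isOpen_Ioo)
    (ambientSpace_mono hI) hu]
  exact hR u (ambientSpace_mono hI hu) i j

lemma IsAnalyticInRho.mono (h : δ ≤ ε) (H : IsAnalyticInRho M ε gt) : IsAnalyticInRho M δ gt :=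
  fun m hm t ht i j => (H m hm t ht i j).mono (Ioo_neg_subset h)

lemma ambientForm_bidx (t r : ℝ) (G : Matrix (Fin 5) (Fin 5) ℝ) (i j : Fin 5) :
    ambientForm t r G (bidx i) (bidx j) = t ^ 2 * G i j := by
  rw [ambientForm_eq, Matrix.add_apply, Matrix.smul_apply, pullForm_bidx]
  simp [twoSym, vecMulVec_apply, dt]

/-- An ambient metric is `2 dt d(ϱt) + P`, where `P` consists of its components along `ℝ⁵`. -/
lemma IsAmbientMetric.isAmbientBlock (hM : IsOpen M) (H : IsAmbientMetric M ε g₀ gt) :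
    IsAmbientBlock (ambientSpace M (Set.Ioo (-ε) ε)) gt
      fun u => of fun i j => gt u (bidx i) (bidx j) := by
  obtain ⟨⟨g, hg0, hg, hgt⟩, hs, -⟩ := H
  set S := ambientSpace M (Set.Ioo (-ε) ε) with hSdef
  have hS : IsOpen S := isOpen_ambientSpace hM isOpen_Ioo
  have hform : ∀ u ∈ S, gt u = ambientForm (u 0) (u 6) (g (base u) (u 6)) := fun u hu => by
    conv_lhs => rw [← pt_base u]
    exact hgt _ hu.2.1 _ hu.2.2 _ hu.1
  have hP : ∀ u ∈ S, (of fun i j => gt u (bidx i) (bidx j)) = u 0 ^ 2 • g (base u) (u 6) :=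
    fun u hu => by
      ext i j
      rw [of_apply, hform u hu, ambientForm_bidx, Matrix.smul_apply, smul_eq_mul]
  refine ⟨hS, fun u hu => hu.1.ne', fun i j => hs _ _, fun u hu i j => ?_, fun u hu => ?_,
    fun u hu i j => ?_, fun u hu => ?_⟩
  · rw [hP u hu, Matrix.smul_apply, Matrix.smul_apply, (hg _ hu.2.1 _ hu.2.2).1.apply]
  · rw [hP u hu, det_smul]
    exact mul_ne_zero (pow_ne_zero _ (pow_ne_zero _ hu.1.ne')) (hg _ hu.2.1 _ hu.2.2).2
  · have h1 := hasDerivAt_add_smul_single hS (hs (bidx i) (bidx j)) hu 0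
    have h2 : HasDerivAt (fun s : ℝ => (u 0 + s) ^ 2 * g (base u) (u 6) i j)
        (2 * u 0 * g (base u) (u 6) i j) 0 := by
      have := (((hasDerivAt_id (0 : ℝ)).const_add (u 0)).pow 2).mul_const (g (base u) (u 6) i j)
      simpa using this
    have h3 : (fun s : ℝ => gt (u + s • (Pi.single 0 1 : Fin 7 → ℝ)) (bidx i) (bidx j))
        =ᶠ[nhds 0] fun s => (u 0 + s) ^ 2 * g (base u) (u 6) i j := by
      filter_upwards [lt_mem_nhds (neg_lt_zero.2 hu.1)] with s hs0
      have e : u + s • (Pi.single 0 1 : Fin 7 → ℝ) = pt (u 0 + s) (base u) (u 6) := by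
        funext a
        fin_cases a <;> simp [pt, base, Pi.single_apply]
      rw [e, hgt _ hu.2.1 _ hu.2.2 _ (by linarith), ambientForm_bidx]
    have h4 := h1.unique (h2.congr_of_eventuallyEq h3)
    simp only [of_apply]
    rw [h4, hform u hu, ambientForm_bidx]
    have := hu.1.ne'
    field_simp
  · rw [hP u hu, hform u hu, ambientForm_eq, pullForm_smul]

/-- Ambient metrics for the same metric, analytic in `ϱ`, coincide. -/
theorem IsAmbientMetric.eq_of_isAnalyticInRho (hM : IsOpen M) (hε : 0 < ε) (hδ : 0 < δ)
    (H : IsAmbientMetric M ε g₀ gt) (Ha : IsAnalyticInRho M ε gt)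
    (H' : IsAmbientMetric M δ g₀ gt') (Ha' : IsAnalyticInRho M δ gt')
    (hu : u ∈ ambientSpace M (Set.Ioo (-ε) ε)) (hu' : u ∈ ambientSpace M (Set.Ioo (-δ) δ)) :
    gt' u = gt u := by
  -- both metrics are restricted to the smaller interval
  have hη : 0 < min ε δ := lt_min hε hδ
  replace H := H.mono hM (min_le_left ε δ)
  replace Ha := Ha.mono (min_le_left ε δ)
  replace H' := H'.mono hM (min_le_right ε δ)
  replace Ha' := Ha'.mono (min_le_right ε δ)
  replace hu : u ∈ ambientSpace M (Set.Ioo (-min ε δ) (min ε δ)) := by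
    refine ⟨hu.1, hu.2.1, ?_, lt_min hu.2.2.2 hu'.2.2.2⟩
    rw [neg_lt]
    exact lt_min (neg_lt.1 hu.2.2.1) (neg_lt.1 hu'.2.2.1)
  generalize min ε δ = η at *
  have h0 : (0 : ℝ) ∈ Set.Ioo (-η) η := ⟨neg_lt_zero.2 hη, hη⟩
  let W : Bool → (Fin 7 → ℝ) → Matrix (Fin 7) (Fin 7) ℝ := fun b => bif b then gt' else gt
  let P : Bool → (Fin 7 → ℝ) → Matrix (Fin 5) (Fin 5) ℝ := fun b u =>
    of fun i j => W b u (bidx i) (bidx j)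
  have hW : ∀ b, IsAmbientMetric M η g₀ (W b) := fun b => by cases b <;> assumption
  have hB : ∀ b, IsAmbientBlock (ambientSpace M (Set.Ioo (-η) η)) (W b) (P b) := fun b =>
    (hW b).isAmbientBlock hM
  have hat0 : ∀ b, ∀ v ∈ ambientSpace M (Set.Ioo (-η) η), v 6 = 0 → ∀ i j,
      P b v i j = v 0 ^ 2 * g₀ (base v) i j := fun b v hv h6 i j => by
    obtain ⟨g, hg0, -, hgt⟩ := (hW b).1
    have e := hgt _ hv.2.1 _ hv.2.2 _ hv.1
    rw [pt_base, h6, hg0 _ hv.2.1] at e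
    simp only [P, of_apply, e, ambientForm_bidx]
  have hmem := fun k i j => mem_contactAlg (hS := isOpen_ambientSpace hM isOpen_Ioo) hB
    (fun b => (hW b).2.2) (fun v hv h6 => by
      ext i j
      rw [hat0 true v hv h6, hat0 false v hv h6]) k i j
  have hP : P true u = P false u := by
    ext i j
    rw [← sub_eq_zero, ← pt_base u]
    exact VanishesToOrder.eq_zero_of_analytic (F := fun v => P true v i j - P false v i j) hM
      isOpen_Ioo isPreconnected_Ioo h0 (fun k => (hmem k i j).2.of_succ) hu.1 hu.2.1
      ((Ha' _ hu.2.1 _ hu.1 _ _).sub (Ha _ hu.2.1 _ hu.1 _ _)) hu.2.2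
  have e1 := (hB true).eq u hu
  have e2 := (hB false).eq u hu
  rw [hP, ← e2] at e1
  exact e1

end Uniqueness

end AmbientG2

end

noncomputable section

namespace AmbientG2

open Matrix

/-! ### Smoothness of power series in `ϱ` with smooth coefficients -/

section PowerSeries

variable {E F G : Type} [NormedAddCommGroup E] [NormedSpace ℝ E] [NormedAddCommGroup F]
  [NormedSpace ℝ F] [NormedAddCommGroup G] [NormedSpace ℝ G]

/-- The derivatives of the smooth functions `aₖ`, of each order, are on `W` of size at most `Kᵏ`,
up to a factor that grows polynomially in `k`. -/
structure GeomBounded (W : Set E) (K : ℝ) (a : ℕ → E → F) : Prop where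
  contDiffOn : ∀ k, ContDiffOn ℝ ∞ (a k) W
  bound : ∀ m : ℕ, ∃ (C : ℝ) (d : ℕ), 0 ≤ C ∧
    ∀ k, ∀ v ∈ W, ‖iteratedFDeriv ℝ m (a k) v‖ ≤ C * ((k : ℝ) + 1) ^ d * K ^ k

namespace GeomBounded

variable {W : Set E} {K : ℝ} {a b : ℕ → E → F}

lemma contDiffAt (hW : IsOpen W) (ha : GeomBounded W K a) (k : ℕ) {v : E} (hv : v ∈ W) :
    ContDiffAt ℝ ∞ (a k) v :=
  (ha.contDiffOn k).contDiffAt (hW.mem_nhds hv)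

lemma add (hW : IsOpen W) (hK : 0 ≤ K) (ha : GeomBounded W K a) (hb : GeomBounded W K b) :
    GeomBounded W K fun k v => a k v + b k v := by
  refine ⟨fun k => (ha.contDiffOn k).add (hb.contDiffOn k), fun m => ?_⟩
  obtain ⟨C, d, hC, h⟩ := ha.bound m
  obtain ⟨C', d', hC', h'⟩ := hb.bound m
  refine ⟨C + C', max d d', by positivity, fun k v hv => ?_⟩
  have hle : ∀ i ≤ max d d', ((k : ℝ) + 1) ^ i ≤ ((k : ℝ) + 1) ^ max d d' := fun i hi =>
    pow_le_pow_right₀ (by linarith [k.cast_nonneg (α := ℝ)]) hi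
  rw [fun_iteratedFDeriv_add_apply ((ha.contDiffAt hW k hv).of_le (by exact_mod_cast le_top))
    ((hb.contDiffAt hW k hv).of_le (by exact_mod_cast le_top)), add_mul, add_mul]
  refine (norm_add_le _ _).trans (add_le_add ((h k v hv).trans ?_) ((h' k v hv).trans ?_))
  · exact mul_le_mul_of_nonneg_right (mul_le_mul_of_nonneg_left (hle d (le_max_left _ _)) hC)
      (pow_nonneg hK k)
  · exact mul_le_mul_of_nonneg_right (mul_le_mul_of_nonneg_left (hle d' (le_max_right _ _)) hC')
      (pow_nonneg hK k)

lemma clm_comp (hW : IsOpen W) (ha : GeomBounded W K a) (L : F →L[ℝ] G) :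
    GeomBounded W K fun k v => L (a k v) := by
  refine ⟨fun k => L.contDiff.comp_contDiffOn (ha.contDiffOn k), fun m => ?_⟩
  obtain ⟨C, d, hC, h⟩ := ha.bound m
  refine ⟨‖L‖ * C, d, by positivity, fun k v hv => ?_⟩
  refine (L.norm_iteratedFDeriv_comp_left (ha.contDiffAt hW k hv)
    (by exact_mod_cast le_top)).trans ?_
  rw [mul_assoc, mul_assoc, ← mul_assoc C]
  exact mul_le_mul_of_nonneg_left (h k v hv) (norm_nonneg _)

lemma fderiv (hW : IsOpen W) (ha : GeomBounded W K a) :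
    GeomBounded W K fun k => fderiv ℝ (a k) := by
  refine ⟨fun k => (ha.contDiffOn k).fderiv_of_isOpen hW le_rfl, fun m => ?_⟩
  simpa only [norm_iteratedFDeriv_fderiv] using ha.bound (m + 1)

lemma shift (hK : 0 ≤ K) (ha : GeomBounded W K a) : GeomBounded W K fun k => a (k + 1) := by
  refine ⟨fun k => ha.contDiffOn _, fun m => ?_⟩
  obtain ⟨C, d, hC, h⟩ := ha.bound m
  refine ⟨C * 2 ^ d * K, d, by positivity, fun k v hv => (h _ v hv).trans ?_⟩
  have h2 : ((k + 1 : ℕ) : ℝ) + 1 ≤ 2 * ((k : ℝ) + 1) := by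
    push_cast
    linarith [k.cast_nonneg (α := ℝ)]
  calc C * (((k + 1 : ℕ) : ℝ) + 1) ^ d * K ^ (k + 1)
      ≤ C * (2 * ((k : ℝ) + 1)) ^ d * K ^ (k + 1) := by gcongr
    _ = C * 2 ^ d * K * ((k : ℝ) + 1) ^ d * K ^ k := by rw [mul_pow, pow_succ]; ring

lemma succ_smul (hW : IsOpen W) (ha : GeomBounded W K a) :
    GeomBounded W K fun k v => ((k : ℝ) + 1) • a k v := by
  refine ⟨fun k => (ha.contDiffOn k).const_smul _, fun m => ?_⟩
  obtain ⟨C, d, hC, h⟩ := ha.bound m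
  refine ⟨C, d + 1, hC, fun k v hv => ?_⟩
  have := iteratedFDeriv_const_smul_apply (a := (k : ℝ) + 1) (i := m)
    ((ha.contDiffAt hW k hv).of_le (by exact_mod_cast le_top))
  rw [show (fun v => ((k : ℝ) + 1) • a k v) = ((k : ℝ) + 1) • a k from rfl, this, norm_smul,
    Real.norm_of_nonneg (by positivity)]
  calc ((k : ℝ) + 1) * ‖iteratedFDeriv ℝ m (a k) v‖
      ≤ ((k : ℝ) + 1) * (C * ((k : ℝ) + 1) ^ d * K ^ k) := by gcongr; exact h k v hv
    _ = C * ((k : ℝ) + 1) ^ (d + 1) * K ^ k := by ring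

/-- The coefficients of the derivative of `(v, ϱ) ↦ ∑ ϱᵏ aₖ(v)`. -/
def derivCoeff (a : ℕ → E → F) (k : ℕ) (v : E) : E × ℝ →L[ℝ] F :=
  (ContinuousLinearMap.compL ℝ (E × ℝ) E F).flip (ContinuousLinearMap.fst ℝ E ℝ)
      (_root_.fderiv ℝ (a k) v)
    + ContinuousLinearMap.smulRightL ℝ (E × ℝ) F (ContinuousLinearMap.snd ℝ E ℝ)
      (((k : ℝ) + 1) • a (k + 1) v)

lemma succ_smul_shift (hW : IsOpen W) (hK : 0 ≤ K) (ha : GeomBounded W K a) :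
    GeomBounded W K fun k v => ((k : ℝ) + 1) • a (k + 1) v :=
  (ha.shift hK).succ_smul hW

lemma geomBounded_derivCoeff (hW : IsOpen W) (hK : 0 ≤ K) (ha : GeomBounded W K a) :
    GeomBounded W K (derivCoeff a) :=
  ((ha.fderiv hW).clm_comp hW _).add hW hK ((ha.succ_smul_shift hW hK).clm_comp hW _)

lemma exists_summable_bound (hK : 0 ≤ K) (ha : GeomBounded W K a) {R : ℝ} (hR : 0 ≤ R)
    (hKR : K * R < 1) :
    ∃ u : ℕ → ℝ, Summable u ∧ ∀ k, ∀ v ∈ W, R ^ k * ‖a k v‖ ≤ u k := by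
  obtain ⟨C, d, hC, h⟩ := ha.bound 0
  have h1 : ‖K * R‖ < 1 := by rwa [Real.norm_of_nonneg (by positivity)]
  have hs : Summable fun k : ℕ => C * (2 ^ d * ((k : ℝ) ^ d * (K * R) ^ k + (K * R) ^ k)) :=
    (((summable_pow_mul_geometric_of_norm_lt_one d h1).add
      (summable_geometric_of_norm_lt_one h1)).mul_left _).mul_left _
  refine ⟨_, hs, fun k v hv => ?_⟩
  have h2 : ((k : ℝ) + 1) ^ d ≤ 2 ^ d * ((k : ℝ) ^ d + 1) := by
    rcases Nat.eq_zero_or_pos k with rfl | hk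
    · have : (1 : ℝ) ≤ 2 ^ d := one_le_pow₀ (by norm_num)
      simp only [Nat.cast_zero, zero_add, one_pow]
      nlinarith [pow_nonneg (le_refl (0 : ℝ)) d]
    · have hk1 : (1 : ℝ) ≤ k := by exact_mod_cast hk
      calc ((k : ℝ) + 1) ^ d ≤ (2 * k) ^ d := by gcongr; linarith
        _ = 2 ^ d * (k : ℝ) ^ d := mul_pow _ _ _
        _ ≤ _ := by gcongr; linarith
  have h3 := h k v hv
  rw [norm_iteratedFDeriv_zero] at h3
  calc R ^ k * ‖a k v‖ ≤ R ^ k * (C * (2 ^ d * ((k : ℝ) ^ d + 1)) * K ^ k) := by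
        gcongr
        exact h3.trans (by gcongr)
    _ = _ := by rw [mul_pow]; ring

lemma summable (hK : 0 ≤ K) (ha : GeomBounded W K a) [CompleteSpace F] {v : E} (hv : v ∈ W) {r : ℝ}
    (hr : K * |r| < 1) : Summable fun k => r ^ k • a k v := by
  obtain ⟨u, hu, h⟩ := ha.exists_summable_bound hK (abs_nonneg r) hr
  refine Summable.of_norm_bounded hu fun k => ?_
  rw [norm_smul, norm_pow, Real.norm_eq_abs]
  exact h k v hv

lemma hasFDerivAt_tsum (hW : IsOpen W) (hK : 0 ≤ K) (ha : GeomBounded W K a) [CompleteSpace F]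
    {v : E} (hv : v ∈ W) {r : ℝ} (hr : K * |r| < 1) :
    HasFDerivAt (fun w : E × ℝ => ∑' k, w.2 ^ k • a k w.1)
      (∑' k, r ^ k • derivCoeff a k v) (v, r) := by
  obtain ⟨R, hrR, hKR⟩ : ∃ R, |r| < R ∧ K * R < 1 := by
    have hc : ContinuousAt (fun R : ℝ => K * R) |r| := by fun_prop
    obtain ⟨R, hR⟩ := ((hc.eventually_lt_const hr).filter_mono nhdsWithin_le_nhds |>.and
      (self_mem_nhdsWithin (s := Set.Ioi |r|))).exists
    exact ⟨R, hR.2, hR.1⟩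
  have hR0 : 0 ≤ R := (abs_nonneg r).trans hrR.le
  obtain ⟨ρ, hρ, hball⟩ := Metric.isOpen_iff.1 hW v hv
  set a₁ : ℕ → E → E × ℝ →L[ℝ] F := fun k v =>
    (ContinuousLinearMap.compL ℝ (E × ℝ) E F).flip (ContinuousLinearMap.fst ℝ E ℝ)
      (_root_.fderiv ℝ (a k) v) with ha₁
  set a₂ : ℕ → E → E × ℝ →L[ℝ] F := fun k v =>
    ContinuousLinearMap.smulRightL ℝ (E × ℝ) F (ContinuousLinearMap.snd ℝ E ℝ)
      (((k : ℝ) + 1) • a (k + 1) v) with ha₂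
  have hG₁ : GeomBounded W K a₁ := (ha.fderiv hW).clm_comp hW _
  have hG₂ : GeomBounded W K a₂ := (ha.succ_smul_shift hW hK).clm_comp hW _
  obtain ⟨u₁, hu₁, hb₁⟩ := hG₁.exists_summable_bound hK hR0 hKR
  obtain ⟨u₂, hu₂, hb₂⟩ := hG₂.exists_summable_bound hK hR0 hKR
  -- the derivative of the `k`-th term
  set T : ℕ → E × ℝ → E × ℝ →L[ℝ] F := fun k w =>
    w.2 ^ k • a₁ k w.1 + (match k with | 0 => 0 | k + 1 => w.2 ^ k • a₂ k w.1) with hT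
  set u : ℕ → ℝ := fun k => u₁ k + (match k with | 0 => 0 | k + 1 => u₂ k) with hu
  have hsu : Summable u := hu₁.add ((summable_nat_add_iff 1).1 hu₂)
  have hopen : IsOpen (Metric.ball v ρ ×ˢ Set.Ioo (-R) R) := Metric.isOpen_ball.prod isOpen_Ioo
  have hpre : IsPreconnected (Metric.ball v ρ ×ˢ Set.Ioo (-R) R) :=
    (convex_ball v ρ).isPreconnected.prod isPreconnected_Ioo
  have hmem : (v, r) ∈ Metric.ball v ρ ×ˢ Set.Ioo (-R) R :=
    ⟨Metric.mem_ball_self hρ, abs_lt.1 hrR⟩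
  have hder : ∀ k, ∀ w ∈ Metric.ball v ρ ×ˢ Set.Ioo (-R) R,
      HasFDerivAt (fun w : E × ℝ => w.2 ^ k • a k w.1) (T k w) w := by
    intro k w hw
    have h1 : HasFDerivAt (fun w : E × ℝ => a k w.1)
        ((_root_.fderiv ℝ (a k) w.1).comp (ContinuousLinearMap.fst ℝ E ℝ)) w :=
      (((ha.contDiffAt hW k (hball hw.1)).differentiableAt (by simp)).hasFDerivAt).comp w
        hasFDerivAt_fst
    have h2 : HasFDerivAt (fun w : E × ℝ => w.2 ^ k)
        ((k * w.2 ^ (k - 1)) • ContinuousLinearMap.snd ℝ E ℝ) w :=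
      (hasDerivAt_pow k w.2).comp_hasFDerivAt w hasFDerivAt_snd
    refine (h2.smul h1).congr_fderiv ?_
    cases k with
    | zero =>
      ext e <;> simp [hT, ha₁]
    | succ k =>
      ext e <;> simp [hT, ha₁, ha₂, smul_smul, mul_comm]
  have hbd : ∀ k, ∀ w ∈ Metric.ball v ρ ×ˢ Set.Ioo (-R) R, ‖T k w‖ ≤ u k := by
    intro k w hw
    have hwR : |w.2| ≤ R := (abs_lt.2 hw.2).le
    have hn : ∀ (j : ℕ) (z : E × ℝ →L[ℝ] F), ‖w.2 ^ j • z‖ ≤ R ^ j * ‖z‖ := fun j z => by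
      rw [norm_smul, norm_pow, Real.norm_eq_abs]
      gcongr
    refine (norm_add_le _ _).trans (add_le_add ((hn _ _).trans (hb₁ k _ (hball hw.1))) ?_)
    cases k with
    | zero => simp
    | succ k => exact (hn _ _).trans (hb₂ k _ (hball hw.1))
  have key := hasFDerivAt_tsum_of_isPreconnected hsu hopen hpre hder hbd hmem
    (ha.summable hK hv hr) hmem
  refine key.congr_fderiv ?_
  have s₁ := hG₁.summable hK hv hr
  have s₂ := hG₂.summable hK hv hr
  have s₂' : Summable fun k : ℕ =>
      (match k with | 0 => 0 | k + 1 => r ^ k • a₂ k v : E × ℝ →L[ℝ] F) :=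
    (summable_nat_add_iff 1).1 s₂
  simp only [hT, derivCoeff, smul_add]
  rw [s₁.tsum_add s₂', s₁.tsum_add s₂, s₂'.tsum_eq_zero_add, zero_add]

/-- A power series in `ϱ` whose coefficients and their derivatives are bounded geometrically is
smooth. -/
theorem contDiffOn_tsum (hW : IsOpen W) (hK : 0 ≤ K) (ha : GeomBounded W K a) [CompleteSpace F]
    {ε : ℝ} (hε : K * ε ≤ 1) :
    ContDiffOn ℝ ∞ (fun w : E × ℝ => ∑' k, w.2 ^ k • a k w.1) (W ×ˢ Set.Ioo (-ε) ε) := by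
  have hopen : IsOpen (W ×ˢ Set.Ioo (-ε) ε) := hW.prod isOpen_Ioo
  have hr : ∀ r ∈ Set.Ioo (-ε) ε, K * |r| < 1 := fun r hr => by
    have hr' := abs_lt.2 hr
    rcases hK.eq_or_lt with rfl | hK
    · simp
    · exact (mul_lt_mul_of_pos_left hr' hK).trans_le hε
  refine contDiffOn_infty.2 fun n => ?_
  induction n generalizing F with
  | zero =>
    exact contDiffOn_zero.2 fun w hw =>
      (ha.hasFDerivAt_tsum hW hK hw.1 (hr _ hw.2)).continuousAt.continuousWithinAt
  | succ n ih =>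
    rw [Nat.cast_succ, contDiffOn_succ_iff_fderiv_of_isOpen hopen]
    refine ⟨fun w hw => (ha.hasFDerivAt_tsum hW hK hw.1
      (hr _ hw.2)).differentiableAt.differentiableWithinAt, fun h => by simp at h, ?_⟩
    exact (ih (ha.geomBounded_derivCoeff hW hK)).congr fun w hw =>
      (ha.hasFDerivAt_tsum hW hK hw.1 (hr _ hw.2)).fderiv

end GeomBounded

end PowerSeries

end AmbientG2

end

noncomputable section

namespace AmbientG2

open Matrix

/-! ### Local convergence of the series for analytic `f` -/

section Analytic

variable {E F : Type} [NormedAddCommGroup E] [NormedSpace ℝ E] [NormedAddCommGroup F]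
  [NormedSpace ℝ F]

/-- Cauchy estimates near a point where `f` is analytic. -/
lemma AnalyticAt.exists_norm_iteratedFDeriv_le [CompleteSpace F] {f : E → F} {v₀ : E}
    (hf : AnalyticAt ℝ f v₀) : ∃ ρ > 0, ∃ C ≥ 0, ∃ K ≥ 0, ∀ v ∈ Metric.ball v₀ ρ, ∀ n : ℕ,
      ‖iteratedFDeriv ℝ n f v‖ ≤ C * K ^ n * n.factorial := by
  obtain ⟨p, R, hp⟩ := hf
  -- the power series at the points of the ball of half the radius are bounded uniformly, because
  -- their coefficients are sums of parts of one convergent multiple series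
  obtain ⟨r₀, hr₀, hr₀R⟩ := ENNReal.lt_iff_exists_nnreal_btwn.1 hp.r_pos
  set r : NNReal := r₀ / 2 with hr
  have hrpos : 0 < r := half_pos (by exact_mod_cast hr₀)
  have hrr : ((r : ENNReal) + r) < p.radius := by
    rw [← ENNReal.coe_add, hr, add_halves]
    exact hr₀R.trans_le hp.r_le
  have hrR : (r : ENNReal) < R := by
    refine lt_of_le_of_lt ?_ hr₀R
    exact_mod_cast half_le_self zero_le
  have hs := NNReal.summable_sigma.1 (p.changeOriginSeries_summable_aux₁ hrr)
  set T : NNReal := ∑' k : ℕ, ∑' s : Σ l : ℕ, { s : Finset (Fin (k + l)) // s.card = l },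
    ‖p (k + s.1)‖₊ * r ^ s.1 * r ^ k with hT
  refine ⟨r, hrpos, T, T.2, (r : ℝ)⁻¹, by positivity, fun v hv n => ?_⟩
  set x := v - v₀ with hx
  have hxr : ‖x‖₊ ≤ r := by
    rw [Metric.mem_ball, dist_eq_norm] at hv
    exact hv.le
  have hxr' : (‖x‖₊ : ENNReal) ≤ r := by exact_mod_cast hxr
  have hxrad : (‖x‖₊ : ENNReal) < p.radius := (hxr'.trans_lt hrR).trans_le hp.r_le
  have hc : ‖p.changeOrigin x n‖₊ * r ^ n ≤ T := by
    refine le_trans ?_ (hs.2.le_tsum n fun _ _ => zero_le)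
    change _ ≤ ∑' s : Σ l : ℕ, { s : Finset (Fin (n + l)) // s.card = l },
      ‖p (n + s.1)‖₊ * r ^ s.1 * r ^ n
    rw [NNReal.tsum_mul_right]
    gcongr
    refine (p.nnnorm_changeOrigin_le n hxrad).trans ?_
    refine Summable.tsum_le_tsum (fun s => by gcongr)
      (p.changeOriginSeries_summable_aux₂ hxrad n)
      (p.changeOriginSeries_summable_aux₂ (hrR.trans_le hp.r_le) n)
  have hc' : ‖p.changeOrigin x n‖ ≤ T * (r : ℝ)⁻¹ ^ n := by
    have : ‖p.changeOrigin x n‖ * (r : ℝ) ^ n ≤ T := by exact_mod_cast hc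
    rw [inv_pow, ← div_eq_mul_inv]
    exact (le_div_iff₀ (by positivity)).2 this
  have hps : HasFPowerSeriesOnBall f (p.changeOrigin x) v (R - ‖x‖₊) := by
    have := hp.changeOrigin (hxr'.trans_lt hrR)
    rwa [hx, add_sub_cancel] at this
  refine ContinuousMultilinearMap.opNorm_le_bound (by positivity) fun w => ?_
  rw [hps.iteratedFDeriv_eq_sum_of_completeSpace]
  calc ‖∑ σ : Equiv.Perm (Fin n), p.changeOrigin x n fun i => w (σ i)‖
      ≤ ∑ σ : Equiv.Perm (Fin n), (T * (r : ℝ)⁻¹ ^ n) * ∏ i, ‖w i‖ := by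
        refine norm_sum_le_of_le _ fun σ _ => ?_
        rw [← Equiv.prod_comp σ fun i => ‖w i‖]
        exact ((p.changeOrigin x n).le_opNorm _).trans (by gcongr)
    _ = _ := by
        rw [Finset.sum_const, Finset.card_univ, Fintype.card_perm, Fintype.card_fin, nsmul_eq_mul]
        ring

lemma factorial_add_le (m n : ℕ) :
    ((m + n).factorial : ℝ) ≤ 2 ^ (m + n) * (m.factorial * n.factorial) := by
  have h1 := Nat.add_choose_mul_factorial_mul_factorial m n
  have h2 : ((m + n).choose n : ℝ) ≤ 2 ^ (m + n) := by exact_mod_cast Nat.choose_le_two_pow _ _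
  rw [← h1]
  push_cast
  rw [mul_assoc]
  gcongr

end Analytic

section Series

variable {V W : Set (ℝ × ℝ × ℝ)} {f : ℝ → ℝ → ℝ → ℝ} {h : ℝ → ℝ → ℝ}

lemma norm_iteratedFDeriv_dP_le (hV : IsOpen V) (hf : SmoothOn (unc₃ f) V) {v : ℝ × ℝ × ℝ}
    (hv : v ∈ V) (n m : ℕ) :
    ‖iteratedFDeriv ℝ m (unc₃ (dP n f)) v‖ ≤ ‖iteratedFDeriv ℝ (m + n) (unc₃ f) v‖ := by
  induction n generalizing m with
  | zero => rw [show unc₃ (dP 0 f) = unc₃ f by funext v; simp [unc₃, dP], add_zero]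
  | succ n ih =>
    have hn := hf.dP hV n
    have he : unc₃ (dP (n + 1) f) =ᶠ[nhds v] fun v => fderiv ℝ (unc₃ (dP n f)) v (0, 0, 1) := by
      filter_upwards [hV.mem_nhds hv] with v hv
      exact unc₃_dP_succ hV hn hv
    have hs : ContDiffAt ℝ ∞ (fderiv ℝ (unc₃ (dP n f))) v :=
      (hn.fderiv_of_isOpen hV (m := ∞) le_rfl).contDiffAt (hV.mem_nhds hv)
    have h1 : ‖((0, 0, 1) : ℝ × ℝ × ℝ)‖ = 1 := by simp [Prod.norm_def]
    rw [(he.iteratedFDeriv ℝ m).eq_of_nhds, show m + (n + 1) = m + 1 + n by ring]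
    refine (norm_iteratedFDeriv_clm_apply_const hs (by exact_mod_cast le_top)).trans ?_
    rw [h1, one_mul, norm_iteratedFDeriv_fderiv]
    exact ih (m + 1)

/-- By the Cauchy estimates the derivatives `∂_p^{2k+j} f` are of size `(2k+j)! Lᵏ`, together with
their derivatives of any fixed order; the coefficients `cₖ` compensate for the factorial. -/
lemma geomBounded_dP (hV : IsOpen V) (hf : SmoothOn (unc₃ f) V) (hWV : W ⊆ V) {C₁ K : ℝ}
    (hC₁ : 0 ≤ C₁) (hK : 0 ≤ K) (hb : ∀ v ∈ W, ∀ n : ℕ,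
      ‖iteratedFDeriv ℝ n (unc₃ f) v‖ ≤ C₁ * K ^ n * n.factorial)
    {c : ℕ → ℝ} {j : ℕ} {C : ℝ} {d : ℕ} (hC : 0 ≤ C)
    (hc : ∀ k : ℕ, |c k| * (2 * k + j).factorial ≤ C * ((k : ℝ) + 1) ^ d) :
    GeomBounded W ((2 * K) ^ 2) fun k v => c k • unc₃ (dP (2 * k + j) f) v := by
  refine ⟨fun k => ((hf.dP hV _).mono hWV).const_smul _, fun m =>
    ⟨C₁ * (2 * K) ^ (m + j) * m.factorial * C, d, by positivity, fun k v hv => ?_⟩⟩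
  have hs : ContDiffAt ℝ m (unc₃ (dP (2 * k + j) f)) v :=
    ((hf.dP hV _).contDiffAt (hV.mem_nhds (hWV hv))).of_le (by exact_mod_cast le_top)
  have e := iteratedFDeriv_const_smul_apply (a := c k) (i := m) hs
  rw [show (fun v => c k • unc₃ (dP (2 * k + j) f) v) = c k • unc₃ (dP (2 * k + j) f) from rfl, e,
    norm_smul, Real.norm_eq_abs]
  calc |c k| * ‖iteratedFDeriv ℝ m (unc₃ (dP (2 * k + j) f)) v‖
      ≤ |c k| * (C₁ * K ^ (m + (2 * k + j)) *
          (2 ^ (m + (2 * k + j)) * (m.factorial * (2 * k + j).factorial))) := by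
        gcongr
        refine (norm_iteratedFDeriv_dP_le hV hf (hWV hv) _ m).trans ((hb v hv _).trans ?_)
        gcongr
        exact factorial_add_le _ _
    _ = C₁ * (2 * K) ^ (m + j) * m.factorial * (|c k| * (2 * k + j).factorial) *
          ((2 * K) ^ 2) ^ k := by
        rw [← pow_mul]
        simp only [mul_pow, pow_add]
        ring
    _ ≤ C₁ * (2 * K) ^ (m + j) * m.factorial * (C * ((k : ℝ) + 1) ^ d) * ((2 * K) ^ 2) ^ k := by
        exact mul_le_mul_of_nonneg_right (mul_le_mul_of_nonneg_left (hc k) (by positivity))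
          (by positivity)
    _ = _ := by ring

lemma abs_cf_succ_mul_le (k : ℕ) :
    |cf (k + 1)| * (2 * k + 2).factorial ≤ 4 * ((k : ℝ) + 1) ^ 2 := by
  have hk : (0 : ℝ) ≤ k := k.cast_nonneg
  have hfac : (0 : ℝ) < (2 * k + 2).factorial := by exact_mod_cast Nat.factorial_pos _
  have e : |cf (k + 1)| * (2 * k + 2).factorial =
      |2 * (k : ℝ) + 1| * |2 * (k : ℝ) - 1| / 2 ^ (2 * (k + 1)) := by
    rw [cf, show 2 * (k + 1) = 2 * k + 2 by ring, abs_div, abs_mul, abs_mul, abs_of_pos hfac,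
      abs_of_pos (by positivity : (0 : ℝ) < 2 ^ (2 * k + 2))]
    push_cast
    rw [show 2 * ((k : ℝ) + 1) - 1 = 2 * k + 1 by ring,
      show 2 * ((k : ℝ) + 1) - 3 = 2 * k - 1 by ring]
    field_simp
  rw [e]
  have h1 : |2 * (k : ℝ) + 1| ≤ 2 * (k + 1) := by rw [abs_le]; constructor <;> linarith
  have h2 : |2 * (k : ℝ) - 1| ≤ 2 * (k + 1) := by rw [abs_le]; constructor <;> linarith
  calc |2 * (k : ℝ) + 1| * |2 * (k : ℝ) - 1| / 2 ^ (2 * (k + 1))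
      ≤ |2 * (k : ℝ) + 1| * |2 * (k : ℝ) - 1| := div_le_self (by positivity)
        (one_le_pow₀ (by norm_num))
    _ ≤ (2 * (k + 1)) * (2 * (k + 1)) := by gcongr
    _ = _ := by ring

lemma coeffA_le (k : ℕ) :
    |cf (k + 1)| * (2 * k + 4).factorial ≤ 48 * ((k : ℝ) + 1) ^ 4 := by
  have hk : (0 : ℝ) ≤ k := k.cast_nonneg
  rw [show (2 * k + 4).factorial = (2 * k + 4) * ((2 * k + 3) * (2 * k + 2).factorial) from rfl]
  push_cast
  calc |cf (k + 1)| * ((2 * k + 4) * ((2 * k + 3) * (2 * k + 2).factorial))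
      = (2 * k + 4) * (2 * k + 3) * (|cf (k + 1)| * (2 * k + 2).factorial) := by ring
    _ ≤ (4 * (k + 1)) * (3 * (k + 1)) * (4 * ((k : ℝ) + 1) ^ 2) := by
        gcongr ?_ * ?_ * ?_
        · linarith
        · linarith
        · exact abs_cf_succ_mul_le k
    _ = _ := by ring

lemma coeffB_le (k : ℕ) : |cf (k + 1) * (2 * ((k : ℝ) + 1) - 5)| * (2 * k + 3).factorial ≤
    36 * ((k : ℝ) + 1) ^ 4 := by
  have hk : (0 : ℝ) ≤ k := k.cast_nonneg
  have h1 : |2 * ((k : ℝ) + 1) - 5| ≤ 3 * (k + 1) := by rw [abs_le]; constructor <;> linarith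
  rw [show (2 * k + 3).factorial = (2 * k + 3) * (2 * k + 2).factorial from rfl, abs_mul]
  push_cast
  calc |cf (k + 1)| * |2 * ((k : ℝ) + 1) - 5| * ((2 * k + 3) * (2 * k + 2).factorial)
      = |2 * ((k : ℝ) + 1) - 5| * (2 * k + 3) * (|cf (k + 1)| * (2 * k + 2).factorial) := by ring
    _ ≤ (3 * (k + 1)) * (3 * (k + 1)) * (4 * ((k : ℝ) + 1) ^ 2) := by
        gcongr ?_ * ?_ * ?_
        · linarith
        · exact abs_cf_succ_mul_le k
    _ = _ := by ring

lemma coeffC_le (k : ℕ) : |(((k : ℝ) + 1) - 3) * cf (k + 1) * (2 * ((k : ℝ) + 1) - 5)| *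
    (2 * k + 2).factorial ≤ 24 * ((k : ℝ) + 1) ^ 4 := by
  have hk : (0 : ℝ) ≤ k := k.cast_nonneg
  have h1 : |2 * ((k : ℝ) + 1) - 5| ≤ 3 * (k + 1) := by rw [abs_le]; constructor <;> linarith
  have h2 : |((k : ℝ) + 1) - 3| ≤ 2 * (k + 1) := by rw [abs_le]; constructor <;> linarith
  rw [abs_mul, abs_mul]
  calc |((k : ℝ) + 1) - 3| * |cf (k + 1)| * |2 * ((k : ℝ) + 1) - 5| * (2 * k + 2).factorial
      = |((k : ℝ) + 1) - 3| * |2 * ((k : ℝ) + 1) - 5| * (|cf (k + 1)| * (2 * k + 2).factorial) := by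
        ring
    _ ≤ (2 * (k + 1)) * (3 * (k + 1)) * (4 * ((k : ℝ) + 1) ^ 2) := by
        gcongr ?_ * ?_ * ?_
        exact abs_cf_succ_mul_le k
    _ = _ := by ring

/-- The series converge to smooth functions near every point where `f` is analytic. -/
theorem exists_isSeriesSolution (hV : IsOpen V) (hf : SmoothOn (unc₃ f) V)
    (hh : SmoothOn (unc₃ fun x y _ => h x y) V) (ha : AnalyticOnNhd ℝ (unc₃ f) V)
    {v : ℝ × ℝ × ℝ} (hv : v ∈ V) :
    ∃ V₀ : Set (ℝ × ℝ × ℝ), IsOpen V₀ ∧ v ∈ V₀ ∧ V₀ ⊆ V ∧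
      ∃ (ε : ℝ) (A B C : ℝ → ℝ → ℝ → ℝ → ℝ), 0 < ε ∧
        SmoothOn (unc₄ A) (V₀ ×ˢ Set.Ioo (-ε) ε) ∧ SmoothOn (unc₄ B) (V₀ ×ˢ Set.Ioo (-ε) ε) ∧
        SmoothOn (unc₄ C) (V₀ ×ˢ Set.Ioo (-ε) ε) ∧ IsSeriesSolution V₀ ε f h A B C := by
  obtain ⟨ρ, hρ, C₁, hC₁, K, hK, hb⟩ := (ha v hv).exists_norm_iteratedFDeriv_le
  set W := Metric.ball v ρ ∩ V with hWdef
  have hW : IsOpen W := Metric.isOpen_ball.inter hV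
  have hWV : W ⊆ V := Set.inter_subset_right
  have hbW := fun w (hw : w ∈ W) => hb w hw.1
  set L := (2 * K) ^ 2 with hL
  have hL0 : 0 ≤ L := by positivity
  set ε := 1 / (L + 1) with hε
  have hε0 : 0 < ε := by positivity
  have hLε : L * ε ≤ 1 := by
    rw [hε, mul_one_div]
    exact (div_le_one (by positivity)).2 (by linarith)
  have gA := geomBounded_dP hV hf hWV hC₁ hK hbW (by norm_num) coeffA_le
  have gB := geomBounded_dP hV hf hWV hC₁ hK hbW (by norm_num) coeffB_le
  have gC := geomBounded_dP hV hf hWV hC₁ hK hbW (by norm_num) coeffC_le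
  have sum : ∀ {c : ℕ → ℝ} {j : ℕ}, GeomBounded W L (fun k v => c k • unc₃ (dP (2 * k + j) f) v) →
      ∀ x y p r, (x, y, p) ∈ W → r ∈ Set.Ioo (-ε) ε →
      HasSum (fun k => c k * dP (2 * k + j) f x y p * r ^ (k + 1))
        (r * ∑' k, r ^ k • c k • unc₃ (dP (2 * k + j) f) (x, y, p)) := by
    intro c j g x y p r hw hr
    have hr' : L * |r| < 1 := by
      rcases hL0.eq_or_lt with h0 | hL0
      · rw [← h0, zero_mul]
        exact one_pos
      · exact (mul_lt_mul_of_pos_left (abs_lt.2 hr) hL0).trans_le hLε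
    have e : (fun k => c k * dP (2 * k + j) f x y p * r ^ (k + 1)) =
        fun k => r * (r ^ k • c k • unc₃ (dP (2 * k + j) f) (x, y, p)) := by
      funext k
      simp only [smul_eq_mul, unc₃, pow_succ]
      ring
    rw [e]
    exact (g.summable hL0 hw hr').hasSum.mul_left r
  -- the sum of a series in `ϱ`, which begins with the term of order one
  set serSum : (ℕ → ℝ) → ℕ → ℝ → ℝ → ℝ → ℝ → ℝ := fun c j x y p r =>
    r * ∑' k, r ^ k • c k • unc₃ (dP (2 * k + j) f) (x, y, p) with hser
  have smooth : ∀ {c : ℕ → ℝ} {j : ℕ},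
      GeomBounded W L (fun k v => c k • unc₃ (dP (2 * k + j) f) v) →
      SmoothOn (unc₄ (serSum c j)) (W ×ˢ Set.Ioo (-ε) ε) := fun g =>
    ContDiffOn.mul contDiff_snd.contDiffOn (g.contDiffOn_tsum hW hL0 hLε)
  have hfst : Set.MapsTo Prod.fst (W ×ˢ Set.Ioo (-ε) ε) V := fun w hw => hWV hw.1
  have comp : ∀ {φ : ℝ × ℝ × ℝ → ℝ}, SmoothOn φ V →
      SmoothOn (fun w : (ℝ × ℝ × ℝ) × ℝ => φ w.1) (W ×ˢ Set.Ioo (-ε) ε) := fun hφ =>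
    ContDiffOn.comp hφ contDiff_fst.contDiffOn hfst
  have hr : SmoothOn (fun w : (ℝ × ℝ × ℝ) × ℝ => w.2) (W ×ˢ Set.Ioo (-ε) ε) :=
    contDiff_snd.contDiffOn
  have hp : SmoothOn (fun w : (ℝ × ℝ × ℝ) × ℝ => w.1.2.2) (W ×ˢ Set.Ioo (-ε) ε) :=
    (contDiff_snd.comp (contDiff_snd.comp contDiff_fst)).contDiffOn
  have cst : ∀ c : ℝ, SmoothOn (fun _ : (ℝ × ℝ × ℝ) × ℝ => c) (W ×ˢ Set.Ioo (-ε) ε) := fun c =>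
    contDiffOn_const
  refine ⟨W, hW, ⟨Metric.mem_ball_self hρ, hv⟩, hWV, ε,
    fun x y p r => 3 / 5 * serSum (fun k => cf (k + 1)) 4 x y p r,
    fun x y p r => -(3 / 20) * r * dY h x y
      - 1 / 15 * serSum (fun k => cf (k + 1) * (2 * ((k : ℝ) + 1) - 5)) 3 x y p r,
    fun x y p r => 2 / 45 * r * h x y ^ 2 - 1 / 15 * r * (p * dY h x y + dX h x y)
      + 2 / 135 * serSum (fun k => (((k : ℝ) + 1) - 3) * cf (k + 1) * (2 * ((k : ℝ) + 1) - 5)) 2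
        x y p r,
    hε0, ?_, ?_, ?_, ?_⟩
  · exact ContDiffOn.mul (cst _) (smooth gA)
  · exact ContDiffOn.sub (ContDiffOn.mul (ContDiffOn.mul (cst _) hr) (comp (hh.dY hV)))
      (ContDiffOn.mul (cst _) (smooth gB))
  · exact ContDiffOn.add (ContDiffOn.sub (ContDiffOn.mul (ContDiffOn.mul (cst _) hr)
      (ContDiffOn.pow (comp hh) 2)) (ContDiffOn.mul (ContDiffOn.mul (cst _) hr)
      (ContDiffOn.add (ContDiffOn.mul hp (comp (hh.dY hV))) (comp (hh.dX hV)))))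
      (ContDiffOn.mul (cst _) (smooth gC))
  · intro x y p r hw hr
    exact ⟨_, _, _, sum gA x y p r hw hr, sum gB x y p r hw hr, sum gC x y p r hw hr, rfl, rfl, rfl⟩

end Series

end AmbientG2

end

noncomputable section

namespace AmbientG2

open Matrix

/-! ### Power series in one variable -/

section OneVariable

variable {c : ℕ → ℝ} {Φ : ℝ → ℝ} {ε r : ℝ}

lemma exists_abs_lt_lt (hr : r ∈ Set.Ioo (-ε) ε) : ∃ R, |r| < R ∧ R ∈ Set.Ioo (-ε) ε := by
  obtain ⟨R, h1, h2⟩ := exists_between (abs_lt.2 hr)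
  exact ⟨R, h1, by linarith [abs_nonneg r], h2⟩

lemma Summable.exists_abs_le {u : ℕ → ℝ} (hu : Summable u) : ∃ N : ℕ, ∀ j, |u j| ≤ N := by
  obtain ⟨C, hC⟩ := hu.tendsto_atTop_zero.abs.bddAbove_range
  obtain ⟨N, hN⟩ := exists_nat_ge C
  exact ⟨N, fun j => (hC ⟨j, rfl⟩).trans hN⟩

lemma analyticOnNhd_of_hasSum
    (hΦ : ∀ r ∈ Set.Ioo (-ε) ε, HasSum (fun j : ℕ => c j * r ^ (j + 1)) (Φ r)) :
    AnalyticOnNhd ℝ Φ (Set.Ioo (-ε) ε) := by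
  rcases le_or_gt ε 0 with hε | hε
  · rw [Set.Ioo_eq_empty (by linarith)]
    exact fun _ h => h.elim
  set d : ℕ → ℝ := fun n => n.casesOn 0 c with hd
  have hsum : ∀ r ∈ Set.Ioo (-ε) ε, HasSum (fun n => d n * r ^ n) (Φ r) := fun r hr => by
    rw [← hasSum_nat_add_iff' 1]
    simpa [hd] using hΦ r hr
  have hp : HasFPowerSeriesOnBall Φ (FormalMultilinearSeries.ofScalars ℝ d) 0 (ENNReal.ofReal ε) :=
    { r_le := by
        refine ENNReal.le_of_forall_nnreal_lt fun R hR => ?_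
        have hR' : (R : ℝ) ∈ Set.Ioo (-ε) ε := by
          have : (R : ℝ) < ε := by
            rw [← ENNReal.ofReal_coe_nnreal] at hR
            exact (ENNReal.ofReal_lt_ofReal_iff hε).1 hR
          exact ⟨by linarith [R.2], this⟩
        refine FormalMultilinearSeries.le_radius_of_tendsto _ (l := 0) ?_
        have := (hsum R hR').summable.tendsto_atTop_zero.norm
        simpa [FormalMultilinearSeries.ofScalars_norm, norm_mul] using this
      r_pos := ENNReal.ofReal_pos.2 hε
      hasSum := fun {y} hy => by
        rw [Metric.eball_ofReal, Metric.mem_ball, dist_zero_right, Real.norm_eq_abs] at hy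
        simpa [FormalMultilinearSeries.ofScalars_apply_eq, mul_comm] using hsum y (abs_lt.1 hy) }
  have := hp.analyticOnNhd
  rwa [Metric.eball_ofReal, Real.ball_eq_Ioo, zero_sub, zero_add] at this

/-- A power series can be differentiated term by term. -/
lemma hasSum_deriv_of_hasSum
    (hΦ : ∀ r ∈ Set.Ioo (-ε) ε, HasSum (fun j : ℕ => c j * r ^ (j + 1)) (Φ r))
    (hr : r ∈ Set.Ioo (-ε) ε) : HasSum (fun j : ℕ => ((j : ℝ) + 1) * c j * r ^ j) (deriv Φ r) := by
  obtain ⟨R₁, hrR₁, hR₁⟩ := exists_abs_lt_lt hr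
  obtain ⟨R, hR₁R, hR⟩ := exists_abs_lt_lt hR₁
  have hR₁0 : 0 ≤ R₁ := (abs_nonneg r).trans hrR₁.le
  rw [abs_of_nonneg hR₁0] at hR₁R
  have hR0 : 0 < R := hR₁0.trans_lt hR₁R
  obtain ⟨N, hN⟩ := (hΦ R hR).summable.exists_abs_le
  -- the terms are dominated by a geometric series on `(-R₁, R₁)`, as the series converges at `R`
  set q := R₁ / R with hq
  have hq0 : 0 ≤ q := by positivity
  have hq1 : ‖q‖ < 1 := by
    rw [Real.norm_of_nonneg hq0, hq]
    exact (div_lt_one hR0).2 hR₁R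
  have hu : Summable fun j : ℕ => (N / R : ℝ) * ((j : ℝ) ^ 1 * q ^ j + q ^ j) :=
    ((summable_pow_mul_geometric_of_norm_lt_one 1 hq1).add
      (summable_geometric_of_norm_lt_one hq1)).mul_left _
  have hbd : ∀ (j : ℕ), ∀ y ∈ Set.Ioo (-R₁) R₁,
      ‖((j : ℝ) + 1) * c j * y ^ j‖ ≤ (N / R : ℝ) * ((j : ℝ) ^ 1 * q ^ j + q ^ j) := by
    intro j y hy
    have hc : |c j| * R ^ j ≤ N / R := by
      rw [le_div_iff₀ hR0, mul_assoc, ← pow_succ]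
      have := hN j
      rwa [abs_mul, abs_of_pos (pow_pos hR0 _)] at this
    have hyR : |y| ^ j ≤ R ^ j * q ^ j := by
      rw [← mul_pow, hq, mul_div_cancel₀ _ hR0.ne']
      exact pow_le_pow_left₀ (abs_nonneg y) (abs_lt.2 hy).le j
    rw [norm_mul, norm_mul, norm_pow, Real.norm_eq_abs, Real.norm_eq_abs, Real.norm_eq_abs,
      abs_of_pos (by positivity : (0 : ℝ) < j + 1)]
    calc ((j : ℝ) + 1) * |c j| * |y| ^ j ≤ ((j : ℝ) + 1) * |c j| * (R ^ j * q ^ j) := by gcongr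
      _ = ((j : ℝ) + 1) * q ^ j * (|c j| * R ^ j) := by ring
      _ ≤ ((j : ℝ) + 1) * q ^ j * (N / R) := by gcongr
      _ = _ := by ring
  have hrm : r ∈ Set.Ioo (-R₁) R₁ := abs_lt.1 hrR₁
  have hder : ∀ (j : ℕ), ∀ y ∈ Set.Ioo (-R₁) R₁,
      HasDerivAt (fun y => c j * y ^ (j + 1)) (((j : ℝ) + 1) * c j * y ^ j) y := fun j y _ => by
    have := (hasDerivAt_pow (j + 1) y).const_mul (c j)
    refine this.congr_deriv ?_
    rw [Nat.add_sub_cancel]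
    push_cast
    ring
  have key := hasDerivAt_tsum_of_isPreconnected hu isOpen_Ioo isPreconnected_Ioo hder hbd hrm
    (hΦ r hr).summable hrm
  have he : Φ =ᶠ[nhds r] fun y => ∑' j, c j * y ^ (j + 1) := by
    filter_upwards [isOpen_Ioo.mem_nhds hr] with y hy
    exact (hΦ y hy).tsum_eq.symm
  rw [(key.congr_of_eventuallyEq he).deriv]
  exact (Summable.of_norm_bounded hu fun j => hbd j r hrm).hasSum

/-- By Baire's theorem, a sequence of continuous functions that is bounded at every point is
uniformly bounded on some ball. -/
lemma exists_ball_bounded {a b : ℝ} (hab : a < b) {w : ℕ → ℝ → ℝ}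
    (hw : ∀ j, ContinuousOn (w j) (Set.Icc a b))
    (hN : ∀ s ∈ Set.Icc a b, ∃ N : ℕ, ∀ j, |w j s| ≤ N) :
    ∃ (s η : ℝ) (N : ℕ), 0 < η ∧
      ∀ y ∈ Metric.ball s η, y ∈ Set.Icc a b ∧ ∀ j, |w j y| ≤ N := by
  set T : ℕ → Set ℝ := fun N =>
    Set.Iic a ∪ Set.Ici b ∪ ⋂ j, Set.Icc a b ∩ (fun s => |w j s|) ⁻¹' Set.Iic N with hT
  have hTc : ∀ N, IsClosed (T N) := fun N =>
    (isClosed_Iic.union isClosed_Ici).union (isClosed_iInter fun j =>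
      (hw j).abs.preimage_isClosed_of_isClosed isClosed_Icc isClosed_Iic)
  have hTU : ⋃ N, T N = Set.univ := by
    refine Set.eq_univ_of_forall fun s => ?_
    by_cases hs : s ∈ Set.Icc a b
    · obtain ⟨N, hN⟩ := hN s hs
      exact Set.mem_iUnion.2 ⟨N, Or.inr (Set.mem_iInter.2 fun j => ⟨hs, hN j⟩)⟩
    · refine Set.mem_iUnion.2 ⟨0, Or.inl ?_⟩
      rw [Set.mem_Icc, not_and_or, not_le, not_le] at hs
      exact hs.imp (fun h => h.le) fun h => h.le
  -- a closed set of points where the bound `N` holds contains an interval inside `(a, b)`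
  obtain ⟨s, hsab, hsT⟩ := (dense_iUnion_interior_of_closed hTc hTU).inter_open_nonempty
    (Set.Ioo a b) isOpen_Ioo (Set.nonempty_Ioo.2 hab)
  obtain ⟨N, hsN⟩ := Set.mem_iUnion.1 hsT
  obtain ⟨η, hη, hηsub⟩ := Metric.isOpen_iff.1 (isOpen_Ioo.inter isOpen_interior) s ⟨hsab, hsN⟩
  refine ⟨s, η, N, hη, fun y hy => ?_⟩
  obtain ⟨hy1, hy2⟩ := hηsub hy
  refine ⟨Set.Ioo_subset_Icc_self hy1, fun j => ?_⟩
  rcases interior_subset hy2 with (h | h) | h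
  · exact absurd hy1.1 (not_lt.2 h)
  · exact absurd hy1.2 (not_lt.2 h)
  · exact (Set.mem_iInter.1 h j).2

lemma deriv_eq_of_hasSum_of_bounded {c c' : ℕ → ℝ → ℝ} {G : ℝ → ℝ} {r R s η N D : ℝ} (hη : 0 < η)
    (hc : ∀ j, ∀ y ∈ Metric.ball s η, HasDerivAt (c j) (c' j y) y) (hrR : |r| < R)
    (hG : ∀ y ∈ Metric.ball s η, HasSum (fun j => c j y * r ^ (j + 1)) (G y))
    (hN : ∀ y ∈ Metric.ball s η, ∀ j, |c' j y * R ^ (j + 1)| ≤ N)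
    (hD : HasSum (fun j => c' j s * r ^ (j + 1)) D) : deriv G s = D := by
  have hR0 : 0 < R := (abs_nonneg r).trans_lt hrR
  set q := |r| / R with hq
  have hq1 : ‖q‖ < 1 := by
    rw [Real.norm_of_nonneg (by positivity), hq]
    exact (div_lt_one hR0).2 hrR
  have hu : Summable fun j : ℕ => N * q ^ (j + 1) :=
    ((summable_nat_add_iff (f := fun j : ℕ => q ^ j) 1).2
      (summable_geometric_of_norm_lt_one hq1)).mul_left N
  have hbd : ∀ j, ∀ y ∈ Metric.ball s η, ‖c' j y * r ^ (j + 1)‖ ≤ N * q ^ (j + 1) := by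
    intro j y hy
    have h1 := hN y hy j
    rw [abs_mul, abs_of_pos (pow_pos hR0 _)] at h1
    rw [norm_mul, norm_pow, Real.norm_eq_abs, Real.norm_eq_abs]
    calc |c' j y| * |r| ^ (j + 1) = (|c' j y| * R ^ (j + 1)) * q ^ (j + 1) := by
          rw [mul_assoc, ← mul_pow, hq, mul_div_cancel₀ _ hR0.ne']
      _ ≤ _ := by gcongr
  have hs := Metric.mem_ball_self (x := s) hη
  have hder : ∀ j, ∀ y ∈ Metric.ball s η,
      HasDerivAt (fun y => c j y * r ^ (j + 1)) (c' j y * r ^ (j + 1)) y := fun j y hy =>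
    (hc j y hy).mul_const _
  have key := hasDerivAt_tsum_of_isPreconnected hu Metric.isOpen_ball
    (convex_ball s η).isPreconnected hder hbd hs (hG s hs).summable hs
  have he : G =ᶠ[nhds s] fun y => ∑' j, c j y * r ^ (j + 1) := by
    filter_upwards [Metric.isOpen_ball.mem_nhds hs] with y hy
    exact (hG y hy).tsum_eq.symm
  rw [(key.congr_of_eventuallyEq he).deriv, hD.tsum_eq]

/-- A series of functions of `s`, the terms of which are the powers of `r` with coefficients
depending on `s`, can be differentiated term by term with respect to `s` if the sum is continuously
differentiable, and if the series of derivatives has a continuous sum and converges pointwise also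
for some larger value of `r`: by Baire's theorem the latter convergence is dominated near points of
a dense set. -/
lemma deriv_eq_of_hasSum {J : Set ℝ} (hJ : IsOpen J) {c c' : ℕ → ℝ → ℝ} {G D : ℝ → ℝ} {r R : ℝ}
    (hc : ∀ j, ∀ s ∈ J, HasDerivAt (c j) (c' j s) s) (hc' : ∀ j, ContinuousOn (c' j) J)
    (hrR : |r| < R) (hG : ∀ s ∈ J, HasSum (fun j => c j s * r ^ (j + 1)) (G s))
    (hR : ∀ s ∈ J, Summable fun j => c' j s * R ^ (j + 1))
    (hD : ∀ s ∈ J, HasSum (fun j => c' j s * r ^ (j + 1)) (D s))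
    (hGc : ContinuousOn (deriv G) J) (hDc : ContinuousOn D J) {p : ℝ} (hp : p ∈ J) :
    deriv G p = D p := by
  by_contra hne
  have hU : IsOpen (J ∩ (fun s => deriv G s - D s) ⁻¹' {0}ᶜ) :=
    (hGc.sub hDc).isOpen_inter_preimage hJ isOpen_compl_singleton
  obtain ⟨ρ, hρ, hball⟩ := Metric.isOpen_iff.1 hU p ⟨hp, sub_ne_zero.2 hne⟩
  rw [Real.ball_eq_Ioo] at hball
  have hIcc : ∀ s ∈ Set.Icc (p - ρ / 2) (p + ρ / 2), s ∈ J ∧ deriv G s - D s ≠ 0 := fun s hs =>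
    hball ⟨by linarith [hs.1], by linarith [hs.2]⟩
  obtain ⟨s, η, N, hη, hmem⟩ := exists_ball_bounded (w := fun j s => c' j s * R ^ (j + 1))
    (by linarith : p - ρ / 2 < p + ρ / 2)
    (fun j => ((hc' j).mono fun s hs => (hIcc s hs).1).mul continuousOn_const)
    fun s hs => (hR s (hIcc s hs).1).exists_abs_le
  have hJ' := fun y hy => (hIcc y (hmem y hy).1).1
  have hs := Metric.mem_ball_self (x := s) hη
  exact (hIcc s (hmem s hs).1).2 (sub_eq_zero.2 (deriv_eq_of_hasSum_of_bounded hη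
    (fun j y hy => hc j y (hJ' y hy)) hrR (fun y hy => hG y (hJ' y hy)) (fun y hy => (hmem y hy).2)
    (hD s (hJ' s hs))))

end OneVariable

end AmbientG2

end

noncomputable section

namespace AmbientG2

open Matrix

/-! ### The sums of the series solve the first order system -/

section Partial

variable {V : Set (ℝ × ℝ × ℝ)} {I : Set ℝ} {φ : ℝ → ℝ → ℝ → ℝ → ℝ} {x y p r : ℝ}

lemma SmoothOn.hasFDerivAt_unc₄ (hV : IsOpen V) (hI : IsOpen I)
    (hφ : SmoothOn (unc₄ φ) (V ×ˢ I)) (hw : (x, y, p) ∈ V) (hr : r ∈ I) :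
    HasFDerivAt (unc₄ φ) (fderiv ℝ (unc₄ φ) ((x, y, p), r)) ((x, y, p), r) :=
  ((hφ.contDiffAt ((hV.prod hI).mem_nhds ⟨hw, hr⟩)).differentiableAt (by simp)).hasFDerivAt

lemma SmoothOn.hasDerivAt_p (hV : IsOpen V) (hI : IsOpen I) (hφ : SmoothOn (unc₄ φ) (V ×ˢ I))
    (hw : (x, y, p) ∈ V) (hr : r ∈ I) :
    HasDerivAt (fun s => φ x y s r) (derP φ x y p r) p := by
  have := HasFDerivAt.comp_hasDerivAt p (l := unc₄ φ) (f := fun s => ((x, y, s), r))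
    (hφ.hasFDerivAt_unc₄ hV hI hw hr) (((hasDerivAt_const p x).prodMk
      ((hasDerivAt_const p y).prodMk (hasDerivAt_id p))).prodMk (hasDerivAt_const p r))
  exact this.differentiableAt.hasDerivAt

lemma SmoothOn.derP_eq (hV : IsOpen V) (hI : IsOpen I) (hφ : SmoothOn (unc₄ φ) (V ×ˢ I))
    (hw : (x, y, p) ∈ V) (hr : r ∈ I) :
    derP φ x y p r = fderiv ℝ (unc₄ φ) ((x, y, p), r) ((0, 0, 1), 0) :=
  (HasFDerivAt.comp_hasDerivAt p (l := unc₄ φ) (f := fun s => ((x, y, s), r))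
    (hφ.hasFDerivAt_unc₄ hV hI hw hr) (((hasDerivAt_const p x).prodMk
      ((hasDerivAt_const p y).prodMk (hasDerivAt_id p))).prodMk (hasDerivAt_const p r))).deriv

lemma SmoothOn.derRho_eq (hV : IsOpen V) (hI : IsOpen I) (hφ : SmoothOn (unc₄ φ) (V ×ˢ I))
    (hw : (x, y, p) ∈ V) (hr : r ∈ I) :
    derRho I φ x y p r = fderiv ℝ (unc₄ φ) ((x, y, p), r) (0, 1) :=
  (derivWithin_of_isOpen hI hr).trans
    (HasFDerivAt.comp_hasDerivAt r (l := unc₄ φ) (f := fun s => ((x, y, p), s))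
      (hφ.hasFDerivAt_unc₄ hV hI hw hr) ((hasDerivAt_const r (x, y, p)).prodMk
      (hasDerivAt_id r))).deriv

lemma SmoothOn.hasDerivAt_rho (hV : IsOpen V) (hI : IsOpen I) (hφ : SmoothOn (unc₄ φ) (V ×ˢ I))
    (hw : (x, y, p) ∈ V) (hr : r ∈ I) :
    HasDerivAt (fun s => φ x y p s) (derRho I φ x y p r) r := by
  rw [hφ.derRho_eq hV hI hw hr]
  exact HasFDerivAt.comp_hasDerivAt r (l := unc₄ φ) (f := fun s => ((x, y, p), s))
    (hφ.hasFDerivAt_unc₄ hV hI hw hr) ((hasDerivAt_const r (x, y, p)).prodMk (hasDerivAt_id r))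

variable (x y) in
lemma isOpen_slice (hV : IsOpen V) : IsOpen {s : ℝ | (x, y, s) ∈ V} :=
  hV.preimage (by fun_prop)

lemma SmoothOn.continuousOn_slice (hφ : SmoothOn (unc₄ φ) (V ×ˢ I)) (hr : r ∈ I) :
    ContinuousOn (fun s => φ x y s r) {s | (x, y, s) ∈ V} :=
  ContinuousOn.comp (g := unc₄ φ) (f := fun s => ((x, y, s), r)) hφ.continuousOn
    (by fun_prop) fun _ hs => ⟨hs, hr⟩

lemma SmoothOn.continuousOn_fderiv_slice (hV : IsOpen V) (hI : IsOpen I)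
    (hφ : SmoothOn (unc₄ φ) (V ×ˢ I)) (hr : r ∈ I) (e : (ℝ × ℝ × ℝ) × ℝ) :
    ContinuousOn (fun s => fderiv ℝ (unc₄ φ) ((x, y, s), r) e) {s | (x, y, s) ∈ V} :=
  (ContinuousOn.comp (f := fun s => ((x, y, s), r))
    (hφ.fderiv_of_isOpen (m := ∞) (hV.prod hI) le_rfl).continuousOn
    (by fun_prop) fun _ hs => ⟨hs, hr⟩).clm_apply continuousOn_const

lemma SmoothOn.continuousOn_derP (hV : IsOpen V) (hI : IsOpen I)
    (hφ : SmoothOn (unc₄ φ) (V ×ˢ I)) (hr : r ∈ I) :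
    ContinuousOn (fun s => derP φ x y s r) {s | (x, y, s) ∈ V} :=
  (hφ.continuousOn_fderiv_slice hV hI hr _).congr fun _ hs => hφ.derP_eq hV hI hs hr

lemma SmoothOn.continuousOn_derRho (hV : IsOpen V) (hI : IsOpen I)
    (hφ : SmoothOn (unc₄ φ) (V ×ˢ I)) (hr : r ∈ I) :
    ContinuousOn (fun s => derRho I φ x y s r) {s | (x, y, s) ∈ V} :=
  (hφ.continuousOn_fderiv_slice hV hI hr _).congr fun _ hs => hφ.derRho_eq hV hI hs hr

end Partial

section Solution

variable {V : Set (ℝ × ℝ × ℝ)} {f : ℝ → ℝ → ℝ → ℝ} {h : ℝ → ℝ → ℝ} {x y p r ε : ℝ}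

lemma SmoothOn.hasDerivAt_dP (hV : IsOpen V) (hf : SmoothOn (unc₃ f) V) (hw : (x, y, p) ∈ V)
    (k : ℕ) : HasDerivAt (fun s => AmbientG2.dP k f x y s) (AmbientG2.dP (k + 1) f x y p) p := by
  have := HasFDerivAt.comp_hasDerivAt p (l := unc₃ (AmbientG2.dP k f)) (f := fun s => (x, y, s))
    ((hf.dP hV k).differentiableAt hV hw).hasFDerivAt
    ((hasDerivAt_const p x).prodMk ((hasDerivAt_const p y).prodMk (hasDerivAt_id p)))
  rw [dP_succ]
  exact this.differentiableAt.hasDerivAt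

lemma SmoothOn.continuousOn_dP_slice (hV : IsOpen V) (hf : SmoothOn (unc₃ f) V) (k : ℕ) :
    ContinuousOn (fun s => AmbientG2.dP k f x y s) {s | (x, y, s) ∈ V} := fun _ hs =>
  (hf.hasDerivAt_dP hV hs k).continuousAt.continuousWithinAt

lemma cf_one : cf 1 = -(1 / 8) := by
  norm_num [cf, Nat.factorial]

/-- The recursion for the coefficients, which makes the series solve the system. -/
lemma cf_succ (j : ℕ) :
    ((j : ℝ) + 2) * (2 * (j : ℝ) - 1) * cf (j + 2) = 1 / 8 * cf (j + 1) := by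
  have hfac : ((2 * (j + 1)).factorial : ℝ) ≠ 0 := by exact_mod_cast (Nat.factorial_pos _).ne'
  have e : (2 * (j + 2)).factorial = (2 * j + 4) * ((2 * j + 3) * (2 * (j + 1)).factorial) := rfl
  rw [cf, cf, e, show 2 * (j + 2) = 2 * (j + 1) + 2 by ring, pow_add]
  push_cast
  have h3 : (2 * (j : ℝ) + 3) ≠ 0 := by positivity
  have h4 : (2 * (j : ℝ) + 4) ≠ 0 := by positivity
  field_simp
  ring

lemma hasSum_congr_fun {u v : ℕ → ℝ} {s t : ℝ} (h : ∀ j, v j = u j) (hst : t = s)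
    (hu : HasSum u s) : HasSum v t := by
  rwa [hst, show v = u from funext h]

/-- A sum of a power series that begins with the term of order one, multiplied by `ϱ`. -/
lemma hasSum_mul_rho {c : ℕ → ℝ} {s : ℝ}
    (hs : HasSum (fun j : ℕ => ((j : ℝ) + 1) * c j * r ^ j) s) :
    HasSum (fun j : ℕ => ((j : ℝ) + 1) * c j * r ^ (j + 1)) (r * s) := by
  have e : (fun j : ℕ => ((j : ℝ) + 1) * c j * r ^ (j + 1)) =
      fun j : ℕ => r * (((j : ℝ) + 1) * c j * r ^ j) := by
    funext j
    ring
  rw [e]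
  exact hs.mul_left r

variable {A B C : ℝ → ℝ → ℝ → ℝ → ℝ}

/-- The term-by-term derivatives of the three series: those with respect to `ϱ` are sums of power
series, and those with respect to `p` are combinations of the former, which follows from the
recursion for the coefficients. -/
lemma hasSum_series {a b c : ℝ → ℝ} {a' b' c' : ℝ}
    (ha : ∀ r ∈ Set.Ioo (-ε) ε,
      HasSum (fun j : ℕ => cf (j + 1) * dP (2 * (j + 1) + 2) f x y p * r ^ (j + 1)) (a r))
    (hb : ∀ r ∈ Set.Ioo (-ε) ε, HasSum (fun j : ℕ => cf (j + 1) * (2 * ((j : ℝ) + 1) - 5)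
        * dP (2 * (j + 1) + 1) f x y p * r ^ (j + 1)) (b r))
    (hc : ∀ r ∈ Set.Ioo (-ε) ε, HasSum (fun j : ℕ => (((j : ℝ) + 1) - 3) * cf (j + 1)
      * (2 * ((j : ℝ) + 1) - 5) * dP (2 * (j + 1)) f x y p * r ^ (j + 1)) (c r))
    (hr : r ∈ Set.Ioo (-ε) ε) (ha' : HasDerivAt a a' r) (hb' : HasDerivAt b b' r)
    (hc' : HasDerivAt c c' r) :
    HasSum (fun j : ℕ => cf (j + 1) * dP (2 * (j + 1) + 3) f x y p * r ^ (j + 1))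
      (8 * b' - 3 * dP 3 f x y p) ∧
    HasSum (fun j : ℕ => cf (j + 1) * (2 * ((j : ℝ) + 1) - 5)
        * dP (2 * (j + 1) + 2) f x y p * r ^ (j + 1)) (2 * (r * a') - 5 * a r) ∧
    HasSum (fun j : ℕ => (((j : ℝ) + 1) - 3) * cf (j + 1) * (2 * ((j : ℝ) + 1) - 5)
        * dP (2 * (j + 1) + 1) f x y p * r ^ (j + 1)) (r * b' - 3 * b r) ∧
    c' = 1 / 8 * (r * a' - 2 * a r) - 3 / 4 * dP 2 f x y p := by
  have sa := hasSum_deriv_of_hasSum ha hr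
  have sb := hasSum_deriv_of_hasSum hb hr
  have sc := hasSum_deriv_of_hasSum hc hr
  rw [ha'.deriv] at sa
  rw [hb'.deriv] at sb
  rw [hc'.deriv] at sc
  have ra := hasSum_mul_rho sa
  have rb := hasSum_mul_rho sb
  refine ⟨?_, ?_, ?_, ?_⟩
  · have h1 := (hasSum_nat_add_iff' 1).2 sb
    have h2 := h1.mul_left 8
    simp only [Finset.sum_range_one, Nat.cast_zero, zero_add, cf_one, pow_zero, mul_one] at h2
    refine (hasSum_congr_fun ?_ ?_ h2)
    · intro j
      have := cf_succ j
      push_cast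
      linear_combination (-8 * dP (2 * (j + 1 + 1) + 1) f x y p * r ^ (j + 1)) * this
    · norm_num
      ring
  · refine hasSum_congr_fun (fun j => ?_) rfl ((ra.mul_left 2).sub ((ha r hr).mul_left 5))
    ring
  · refine hasSum_congr_fun (fun j => ?_) rfl (rb.sub ((hb r hr).mul_left 3))
    ring
  · have h1 := (hasSum_nat_add_iff' 1).2 sc
    simp only [Finset.sum_range_one, Nat.cast_zero, zero_add, cf_one, pow_zero, mul_one] at h1
    have h2 := (ra.sub ((ha r hr).mul_left 2)).mul_left (1 / 8)
    have h3 := (hasSum_congr_fun (fun j => ?_) rfl h2).unique h1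
    · linear_combination -h3
    · have := cf_succ j
      push_cast
      linear_combination ((j - 1) * dP (2 * (j + 1) + 2) f x y p * r ^ (j + 1)) * this

/-- The sums of the series, if they are smooth, solve the first order system. -/
theorem IsSeriesSolution.solvesSystem (H : IsSeriesSolution V ε f h A B C) (hV : IsOpen V)
    (hf : SmoothOn (unc₃ f) V) (hA : SmoothOn (unc₄ A) (V ×ˢ Set.Ioo (-ε) ε))
    (hB : SmoothOn (unc₄ B) (V ×ˢ Set.Ioo (-ε) ε)) (hC : SmoothOn (unc₄ C) (V ×ˢ Set.Ioo (-ε) ε)) :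
    SolvesSystem V (Set.Ioo (-ε) ε) f h A B C := by
  intro x y p r hp hr
  have hI : IsOpen (Set.Ioo (-ε) ε) := isOpen_Ioo
  set I := Set.Ioo (-ε) ε with hIdef
  have hJ := isOpen_slice x y hV
  set J := {s : ℝ | (x, y, s) ∈ V} with hJdef
  -- the sums of the three series
  let a : ℝ → ℝ → ℝ := fun s r => 5 / 3 * A x y s r
  let b : ℝ → ℝ → ℝ := fun s r => -15 * (B x y s r + 3 / 20 * r * dY h x y)
  let c : ℝ → ℝ → ℝ := fun s r => 135 / 2 * (C x y s r - 2 / 45 * r * h x y ^ 2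
    + 1 / 15 * r * (s * dY h x y + dX h x y))
  have key : ∀ s ∈ J, ∀ r ∈ I, _ := fun s hs r hr => hasSum_series (ε := ε) (r := r) (f := f)
    (x := x) (y := y) (p := s) (a := a s) (b := b s) (c := c s)
    (a' := 5 / 3 * derRho I A x y s r) (b' := -15 * (derRho I B x y s r + 3 / 20 * dY h x y))
    (c' := 135 / 2 * (derRho I C x y s r - 2 / 45 * h x y ^ 2
      + 1 / 15 * (s * dY h x y + dX h x y)))
    (fun r hr => by
      obtain ⟨a₀, b₀, c₀, h1, -, -, e, -, -⟩ := H x y s r hs hr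
      exact hasSum_congr_fun (fun _ => rfl) (by simp only [a]; linarith) h1)
    (fun r hr => by
      obtain ⟨a₀, b₀, c₀, -, h1, -, -, e, -⟩ := H x y s r hs hr
      exact hasSum_congr_fun (fun _ => rfl) (by simp only [b]; linarith) h1)
    (fun r hr => by
      obtain ⟨a₀, b₀, c₀, -, -, h1, -, -, e⟩ := H x y s r hs hr
      exact hasSum_congr_fun (fun _ => rfl) (by simp only [c]; linarith) h1)
    hr ((hA.hasDerivAt_rho hV hI hs hr).const_mul _)
    (((hB.hasDerivAt_rho hV hI hs hr).add
      (((hasDerivAt_id r).const_mul (3 / 20)).mul_const (dY h x y))).const_mul (-15)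
      |>.congr_deriv (by ring))
    ((((hC.hasDerivAt_rho hV hI hs hr).sub
      (((hasDerivAt_id r).const_mul (2 / 45)).mul_const (h x y ^ 2))).add
      (((hasDerivAt_id r).const_mul (1 / 15)).mul_const (s * dY h x y + dX h x y))).const_mul
      (135 / 2) |>.congr_deriv (by ring))
  -- a larger value of `ϱ`, at which the series of derivatives also converge
  obtain ⟨R, hrR, hR⟩ := exists_abs_lt_lt hr
  have hdP : ∀ (k j : ℕ) (d : ℝ), ∀ s ∈ J,
      HasDerivAt (fun s => d * dP k f x y s) (d * dP (k + 1) f x y s) s := fun k j d s hs =>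
    (hf.hasDerivAt_dP hV hs k).const_mul d
  have hcP : ∀ (k : ℕ) (d : ℝ), ContinuousOn (fun s => d * dP k f x y s) J := fun k d =>
    continuousOn_const.mul (hf.continuousOn_dP_slice hV k)
  have cA := hA.continuousOn_slice (x := x) (y := y) hr
  have cB := hB.continuousOn_slice (x := x) (y := y) hr
  have cAr := hA.continuousOn_derRho (x := x) (y := y) hV hI hr
  have cBr := hB.continuousOn_derRho (x := x) (y := y) hV hI hr
  have da : ∀ s ∈ J, HasDerivAt (fun s => a s r) (5 / 3 * derP A x y s r) s := fun s hs =>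
    (hA.hasDerivAt_p hV hI hs hr).const_mul _
  have db : ∀ s ∈ J, HasDerivAt (fun s => b s r) (-15 * derP B x y s r) s := fun s hs =>
    ((hB.hasDerivAt_p hV hI hs hr).add_const _).const_mul _
  have dc : ∀ s ∈ J, HasDerivAt (fun s => c s r)
      (135 / 2 * (derP C x y s r + 1 / 15 * r * dY h x y)) s := fun s hs =>
    (((hC.hasDerivAt_p hV hI hs hr).sub_const _).add
      ((((hasDerivAt_id s).mul_const (dY h x y)).add_const _).const_mul (1 / 15 * r))).const_mul
      (135 / 2) |>.congr_deriv (by ring)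
  -- the derivatives with respect to `p`, term by term
  have ea := deriv_eq_of_hasSum hJ (fun j s hs => hdP _ j (cf (j + 1)) s hs) (fun j => hcP _ _) hrR
    (G := fun s => a s r) (D := fun s => 8 * (-15 * (derRho I B x y s r + 3 / 20 * dY h x y))
      - 3 * dP 3 f x y s)
    (fun s hs => by
      obtain ⟨a₀, b₀, c₀, h1, -, -, e, -, -⟩ := H x y s r hs hr
      exact hasSum_congr_fun (fun _ => rfl) (by simp only [a]; linarith) h1)
    (fun s hs => (key s hs R hR).1.summable) (fun s hs => (key s hs r hr).1)
    ((continuousOn_const.mul (hA.continuousOn_derP hV hI hr)).congr fun s hs => (da s hs).deriv)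
    ((continuousOn_const.mul (continuousOn_const.mul (cBr.add continuousOn_const))).sub
      (continuousOn_const.mul (hf.continuousOn_dP_slice hV 3))) hp
  have eb := deriv_eq_of_hasSum hJ
    (fun j s hs => hdP _ j (cf (j + 1) * (2 * ((j : ℝ) + 1) - 5)) s hs) (fun j => hcP _ _) hrR
    (G := fun s => b s r) (D := fun s => 2 * (r * (5 / 3 * derRho I A x y s r)) - 5 * a s r)
    (fun s hs => by
      obtain ⟨a₀, b₀, c₀, -, h1, -, -, e, -⟩ := H x y s r hs hr
      exact hasSum_congr_fun (fun _ => rfl) (by simp only [b]; linarith) h1)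
    (fun s hs => (key s hs R hR).2.1.summable) (fun s hs => (key s hs r hr).2.1)
    ((continuousOn_const.mul (hB.continuousOn_derP hV hI hr)).congr fun s hs => (db s hs).deriv)
    ((continuousOn_const.mul (continuousOn_const.mul (continuousOn_const.mul cAr))).sub
      (continuousOn_const.mul (continuousOn_const.mul cA))) hp
  have ec := deriv_eq_of_hasSum hJ
    (fun j s hs => hdP _ j ((((j : ℝ) + 1) - 3) * cf (j + 1) * (2 * ((j : ℝ) + 1) - 5)) s hs)
    (fun j => hcP _ _) hrR
    (G := fun s => c s r)
    (D := fun s => r * (-15 * (derRho I B x y s r + 3 / 20 * dY h x y)) - 3 * b s r)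
    (fun s hs => by
      obtain ⟨a₀, b₀, c₀, -, -, h1, -, -, e⟩ := H x y s r hs hr
      exact hasSum_congr_fun (fun _ => rfl) (by simp only [c]; linarith) h1)
    (fun s hs => (key s hs R hR).2.2.1.summable) (fun s hs => (key s hs r hr).2.2.1)
    ((continuousOn_const.mul ((hC.continuousOn_derP hV hI hr).add continuousOn_const)).congr
      fun s hs => (dc s hs).deriv)
    ((continuousOn_const.mul (continuousOn_const.mul (cBr.add continuousOn_const))).sub
      (continuousOn_const.mul (continuousOn_const.mul (cB.add continuousOn_const)))) hp
  rw [(da p hp).deriv] at ea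
  rw [(db p hp).deriv] at eb
  rw [(dc p hp).deriv] at ec
  have er := (key p hp r hr).2.2.2
  simp only [a, b] at ea eb ec er
  refine ⟨by linarith, by linarith, by linarith, ?_⟩
  linear_combination 2 / 135 * ec - 1 / 540 * r * ea

lemma IsSeriesSolution.vanishAtZero (H : IsSeriesSolution V ε f h A B C) (hε : 0 < ε) :
    VanishAtZero V A B C := by
  intro x y p hp
  obtain ⟨a, b, c, ha, hb, hc, eA, eB, eC⟩ := H x y p 0 hp ⟨neg_lt_zero.2 hε, hε⟩
  have h0 : ∀ {u : ℕ → ℝ} {s : ℝ}, HasSum (fun j => u j * (0 : ℝ) ^ (j + 1)) s → s = 0 :=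
    fun hs => hs.unique (by simp)
  rw [eA, eB, eC, h0 ha, h0 hb, h0 hc]
  simp

end Solution

end AmbientG2

end

noncomputable section

namespace AmbientG2

open Matrix

/-! ### Analyticity in `ϱ` -/

section Solution

variable {V : Set (ℝ × ℝ × ℝ)} {f : ℝ → ℝ → ℝ → ℝ} {h : ℝ → ℝ → ℝ} {ε : ℝ}
  {A B C : ℝ → ℝ → ℝ → ℝ → ℝ}

/-- The functions on the ambient space over `M` that are analytic in `ϱ`. -/
def analyticRhoAlg (M : Set (Fin 5 → ℝ)) (ε : ℝ) : Subalgebra ℝ ((Fin 7 → ℝ) → ℝ) where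
  carrier := {F | ∀ m ∈ M, ∀ t, 0 < t → AnalyticOnNhd ℝ (fun r => F (pt t m r)) (Set.Ioo (-ε) ε)}
  mul_mem' hF hG m hm t ht r hr := (hF m hm t ht r hr).fun_mul (hG m hm t ht r hr)
  add_mem' hF hG m hm t ht r hr := (hF m hm t ht r hr).fun_add (hG m hm t ht r hr)
  algebraMap_mem' _ _ _ _ _ := analyticOnNhd_const

lemma mem_analyticRhoAlg_of_unc₃ (M : Set (Fin 5 → ℝ)) (ε : ℝ) (φ : ℝ → ℝ → ℝ → ℝ) :
    (fun v => φ (v 1) (v 2) (v 4)) ∈ analyticRhoAlg M ε := fun m _ _ _ =>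
  analyticOnNhd_const (v := φ (m 0) (m 1) (m 3))

lemma mem_analyticRhoAlg_coord (M : Set (Fin 5 → ℝ)) (ε : ℝ) (i : Fin 7) :
    (fun v => v i) ∈ analyticRhoAlg M ε := by
  intro m _ t _
  fin_cases i
  exacts [analyticOnNhd_const (v := t), analyticOnNhd_const (v := m 0),
    analyticOnNhd_const (v := m 1), analyticOnNhd_const (v := m 2), analyticOnNhd_const (v := m 3),
    analyticOnNhd_const (v := m 4), analyticOnNhd_id]

lemma mem_analyticRhoAlg_at₄ {M : Set (Fin 5 → ℝ)} {ε : ℝ} {φ : ℝ → ℝ → ℝ → ℝ → ℝ}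
    (hφ : ∀ m ∈ M, AnalyticOnNhd ℝ (φ (m 0) (m 1) (m 3)) (Set.Ioo (-ε) ε)) :
    at₄ φ ∈ analyticRhoAlg M ε := fun m hm _ _ => hφ m hm

/-- The solutions given by the series are, as functions of `ϱ`, of the form `l ϱ + k s`, where `s`
is the sum of a power series. -/
lemma analyticOnNhd_of_hasSum_linear {c : ℕ → ℝ} {Φ : ℝ → ℝ} {ε k l : ℝ} (hk : k ≠ 0)
    (hΦ : ∀ r ∈ Set.Ioo (-ε) ε, ∃ s, HasSum (fun j : ℕ => c j * r ^ (j + 1)) s ∧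
      Φ r = l * r + k * s) : AnalyticOnNhd ℝ Φ (Set.Ioo (-ε) ε) := by
  have h1 : AnalyticOnNhd ℝ (fun r => (Φ r - l * r) / k) (Set.Ioo (-ε) ε) :=
    analyticOnNhd_of_hasSum fun r hr => by
      obtain ⟨s, hs, e⟩ := hΦ r hr
      rwa [e, add_sub_cancel_left, mul_div_cancel_left₀ _ hk]
  have h2 : AnalyticOnNhd ℝ (fun r => l * r + k * ((Φ r - l * r) / k)) (Set.Ioo (-ε) ε) :=
    fun r hr => (analyticAt_const.fun_mul analyticAt_id).fun_add
      (analyticAt_const.fun_mul (h1 r hr))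
  have e : Φ = fun r => l * r + k * ((Φ r - l * r) / k) := by
    funext r
    field_simp
    ring
  rw [e]
  exact h2

/-- The components of the metric given by the series are analytic in `ϱ`, as polynomials in
functions which are. -/
theorem IsSeriesSolution.isAnalyticInRho (H : IsSeriesSolution V ε f h A B C)
    {M : Set (Fin 5 → ℝ)} (hMV : ∀ m ∈ M, (m 0, m 1, m 3) ∈ V) :
    IsAnalyticInRho M ε (gTilde f h A B C) := by
  have halg : CoframeAlgebra (analyticRhoAlg M ε) f h A B C :=
    { coord := mem_analyticRhoAlg_coord M ε
      mem_dP := fun k => mem_analyticRhoAlg_of_unc₃ M ε (dP k f)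
      mem_h := mem_analyticRhoAlg_of_unc₃ M ε fun x y _ => h x y
      mem_dX := mem_analyticRhoAlg_of_unc₃ M ε fun x y _ => dX h x y
      mem_dY := mem_analyticRhoAlg_of_unc₃ M ε fun x y _ => dY h x y
      mem_A := mem_analyticRhoAlg_at₄ fun m hm =>
        analyticOnNhd_of_hasSum_linear (k := 3 / 5) (l := 0) (by norm_num) fun r hr => by
          obtain ⟨a₀, b₀, c₀, h1, -, -, e, -, -⟩ := H _ _ _ r (hMV m hm) hr
          exact ⟨a₀, h1, by linarith⟩
      mem_B := mem_analyticRhoAlg_at₄ fun m hm =>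
        analyticOnNhd_of_hasSum_linear (k := -(1 / 15)) (l := -(3 / 20) * dY h (m 0) (m 1))
          (by norm_num) fun r hr => by
          obtain ⟨a₀, b₀, c₀, -, h1, -, -, e, -⟩ := H _ _ _ r (hMV m hm) hr
          exact ⟨b₀, h1, by linarith⟩
      mem_C := mem_analyticRhoAlg_at₄ fun m hm =>
        analyticOnNhd_of_hasSum_linear (k := 2 / 135) (l := 2 / 45 * h (m 0) (m 1) ^ 2
          - 1 / 15 * (m 3 * dY h (m 0) (m 1) + dX h (m 0) (m 1))) (by norm_num) fun r hr => by
          obtain ⟨a₀, b₀, c₀, -, -, h1, -, -, e⟩ := H _ _ _ r (hMV m hm) hr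
          exact ⟨c₀, h1, by linarith⟩ }
  intro m hm t ht i j
  rw [gTilde_eq_frameMetric (I := Set.Ioo (-ε) ε)]
  exact frameMetric_mem halg.sigma_mem i j m hm t ht

end Solution

end AmbientG2

end

theorem mainTheorem2
    (V : Set (ℝ × ℝ × ℝ)) (hV : IsOpen V)
    (f : ℝ → ℝ → ℝ → ℝ) (h : ℝ → ℝ → ℝ)
    (hf : SmoothOn (unc₃ f) V)
    (hh : SmoothOn (unc₃ (fun x y _ => h x y)) V)
    (M : Set (Fin 5 → ℝ)) (hM : IsOpen M)
    (hMV : ∀ m ∈ M, (m 0, m 1, m 3) ∈ V) :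
    -- `g_{D_{f,h}}` represents the conformal class of the distribution
    InConformalClass M (distr f h) (gD f h) ∧
    -- twice differentiable solutions
    (∀ (ε : ℝ) (I : Set ℝ) (A B C : ℝ → ℝ → ℝ → ℝ → ℝ), 0 < ε →
      (I = Set.Ioo (-ε) ε ∨ I = Set.Ico 0 ε) →
      TwiceDiffOn (unc₄ A) (V ×ˢ I) → TwiceDiffOn (unc₄ B) (V ×ˢ I) →
      TwiceDiffOn (unc₄ C) (V ×ˢ I) →
      SolvesSystem V I f h A B C → VanishAtZero V A B C →
        IsTwiceDiffAmbientMetric M I (gD f h) (gTilde f h A B C) ∧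
        (I = Set.Ioo (-ε) ε → SmoothOn (unc₄ A) (V ×ˢ I) → SmoothOn (unc₄ B) (V ×ˢ I) →
          SmoothOn (unc₄ C) (V ×ˢ I) → IsAmbientMetric M ε (gD f h) (gTilde f h A B C)) ∧
        IsParallelForm (ambientSpace M I) (gTilde f h A B C) (upsilon f h A B C) ∧
        HolonomyInSplitG2 (ambientSpace M I) (gTilde f h A B C)) ∧
    -- the series solutions for analytic `f`
    (AnalyticOnNhd ℝ (unc₃ f) V →
      (∀ v ∈ V, ∃ V₀ : Set (ℝ × ℝ × ℝ), IsOpen V₀ ∧ v ∈ V₀ ∧ V₀ ⊆ V ∧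
        ∃ (ε : ℝ) (A B C : ℝ → ℝ → ℝ → ℝ → ℝ), 0 < ε ∧
          SmoothOn (unc₄ A) (V₀ ×ˢ Set.Ioo (-ε) ε) ∧
          SmoothOn (unc₄ B) (V₀ ×ˢ Set.Ioo (-ε) ε) ∧
          SmoothOn (unc₄ C) (V₀ ×ˢ Set.Ioo (-ε) ε) ∧
          IsSeriesSolution V₀ ε f h A B C) ∧
      (∀ (ε : ℝ) (A B C : ℝ → ℝ → ℝ → ℝ → ℝ), 0 < ε →
        SmoothOn (unc₄ A) (V ×ˢ Set.Ioo (-ε) ε) →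
        SmoothOn (unc₄ B) (V ×ˢ Set.Ioo (-ε) ε) →
        SmoothOn (unc₄ C) (V ×ˢ Set.Ioo (-ε) ε) →
        IsSeriesSolution V ε f h A B C →
          SolvesSystem V (Set.Ioo (-ε) ε) f h A B C ∧ VanishAtZero V A B C ∧
          IsAmbientMetric M ε (gD f h) (gTilde f h A B C) ∧
          IsAnalyticInRho M ε (gTilde f h A B C) ∧
          ∀ (δ : ℝ) (gt : (Fin 7 → ℝ) → Matrix (Fin 7) (Fin 7) ℝ), 0 < δ →
            IsAmbientMetric M δ (gD f h) gt → IsAnalyticInRho M δ gt →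
            ∀ u ∈ ambientSpace M (Set.Ioo (-ε) ε) ∩ ambientSpace M (Set.Ioo (-δ) δ),
              gt u = gTilde f h A B C u)) := by
  refine ⟨inConformalClass hV hf hh hM hMV, ?_, ?_⟩
  · intro ε I A B C hε hI hA hB hC hs h0
    have H : IsTwiceDiffSolution V I f h A B C :=
      ⟨hV, hf, hh, ⟨ε, hε, hI⟩, hA, hB, hC, hs⟩
    refine ⟨H.isTwiceDiffAmbientMetric h0 hM hMV, ?_, H.isParallelForm hM hMV,
      H.holonomyInSplitG2 hM hMV⟩
    rintro rfl hA' hB' hC'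
    exact H.isAmbientMetric h0 hM hMV hA' hB' hC'
  · intro ha
    refine ⟨fun v hv => exists_isSeriesSolution hV hf hh ha hv, ?_⟩
    intro ε A B C hε hA hB hC H
    have hs := H.solvesSystem hV hf hA hB hC
    have h0 := H.vanishAtZero hε
    have hU : UniqueDiffOn ℝ (V ×ˢ Set.Ioo (-ε) ε) := (hV.prod isOpen_Ioo).uniqueDiffOn
    have HT : IsTwiceDiffSolution V (Set.Ioo (-ε) ε) f h A B C :=
      ⟨hV, hf, hh, ⟨ε, hε, Or.inl rfl⟩, hA.twiceDiffOn hU, hB.twiceDiffOn hU, hC.twiceDiffOn hU, hs⟩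
    have HA := HT.isAmbientMetric h0 hM hMV hA hB hC
    have Han := H.isAnalyticInRho hMV
    exact ⟨hs, h0, HA, Han, fun δ gt hδ Hg Hga u hu =>
      HA.eq_of_isAnalyticInRho hM hε hδ Han Hg Hga hu.1 hu.2⟩
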